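/- For $W\in\mathbb{R}^{d\times k}$ and $b\in\mathbb{R}^d$ let $\mathcal{D}(W,b)$ be the law of $\mathrm{ReLU}(Wz+b)$, $z\sim\mathcal{N}(0,I_k)$ (ReLU is applied coordinatewise). Given $n$ i.i.d. samples $x_1,\dots,x_n\in\mathbb{R}^d$, consider the following algorithm with hyper-parameters $r,\lambda>0$ and $B\in\mathbb{N}$. (1) For each $i\in[d]$, let $S_i$ be the list of the positive values among $x_1(i),\dots,x_n(i)$, with empirical mean $\mu_0$ and empirical variance $\sigma_0^2$. Replace each $x\in S_i$ by $(x-\mu_0)/\sigma_0$ and split the result into $B$ batches of $T=\lfloor |S_i|/B\rfloor$ points. On each batch run projected SGD: $v^{(0)}=(1,0)$; for $t=1,\dots,T$, with $x$ the $t$-th point of the batch and $z$ drawn, by rejection from $\mathcal{N}(\mu,\sigma^2)$, from $\mathcal{N}(\mu,\sigma^2)$ truncated to $(-\mu_0/\sigma_0,\infty)$, where $(1/\sigma^2,\mu/\sigma^2)=v^{(t-1)}$, put $g=\big((x^2-z^2)/2,\ z-x\big)$ and let $v^{(t)}$ be the projection of $v^{(t-1)}-g/(\lambda t)$ to $\{v: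 1/r\le v(1)\le r,\ |v(2)|\le r\}$; output $\frac1T\sum_{t=1}^T v^{(t)}$. Among the $B$ outputs select the first one that minimizes the sum of the Euclidean distances to all of them, transform it back to a parameter $v=(1/\sigma^2,\mu/\sigma^2)$ of the original space, and set $\widehat b(i)=\max(0,v(2)/v(1))$, $\widehat\Sigma(i,i)=1/v(1)$. (2) For $i<j$ let $\widehat\theta_{ij}=\pi-\frac{2\pi}{n}\sum_{m=1}^n \mathbf{1}(x_m(i)>\widehat b(i))\,\mathbf{1}(x_m(j)>\widehat b(j))$ and $\widehat\Sigma(i,j)=\widehat\Sigma(j,i)=\sqrt{\widehat\Sigma(i,i)\widehat\Sigma(j,j)}\,\cos\widehat\theta_{ij}$. Output $(\widehat\Sigma,\widehat b)$. Corollary 1. There are universal constants $r,\lambda,c,C,C'>0$ and $k\in\mathbb{N}$ such that the following holds for all $d\ge 1$, all full-rank $W^*\in\mathbb{R}^{d\times d}$, all $b^*\in\mathbb{R}^d$ with non-negative entries, all $\epsilon\in(0,1/2]$ and all $\delta\in(0,1)$. Let $\kappa$ be the condition number (in the spectral norm) of $W^*W^{*T}$, $L=1+\ln(\kappa d/\epsilon)$,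 $B=\lceil c\ln(2d/\delta)\rceil$ and $$n=\left\lceil C\,\frac{\kappa^2d^2}{\epsilon^2}\,\ln\!\Big(\frac{2d}{\delta}\Big)\,L^k\right\rceil .$$ When the algorithm is run on $n$ i.i.d. samples from $\mathcal{D}(W^*,b^*)$, then with probability at least $1-\delta$ (over the samples and the internal randomness) its output has $\widehat\Sigma$ positive semidefinite and satisfies $$\mathrm{TV}\big(\mathcal{D}(\widehat\Sigma^{1/2},\widehat b),\ \mathcal{D}(W^*,b^*)\big)\le\epsilon ,$$ and, on a machine with exact real arithmetic and unit-cost elementary operations and Gaussian draws, it runs in time at most $$C'\left(\frac{\kappa^2d^4}{\epsilon^2}\ln\!\Big(\frac{2d}{\delta}\Big)L^k+d\,\ln^2\!\Big(\frac{2d}{\delta}\Big)\right)$$ and in space at most $C'\,\frac{\kappa^2d^3}{\epsilon^2}\ln(\frac{2d}{\delta})L^k$ memory words. That is, $n=\widetilde O(\frac{\kappa^2d^2}{\epsilon^2}\ln\frac d\delta)$ samples suffice, in time $\widetilde O(\frac{\kappa^2d^4}{\epsilon^2}\ln\frac d\delta)$ and space $\widetilde O(\frac{\kappa^2d^3}{\epsilon^2}\ln\frac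 d\delta)$. -/

import Mathlib

open MeasureTheory ProbabilityTheory
open scoped Matrix

noncomputable section

/-! ## Rectified Gaussian distributions, total variation, condition number -/

/-- `D(W, b)`: the law on `ℝ^d` of `ReLU(W z + b)`, where `z ~ N(0, I_k)`. -/
def reluDist {d k : ℕ} (W : Matrix (Fin d) (Fin k) ℝ) (b : Fin d → ℝ) : Measure (Fin d → ℝ) :=
  (Measure.pi (fun _ : Fin k => gaussianReal 0 1)).map (fun z i => max 0 ((W *ᵥ z) i + b i))

/-- Total variation distance `sup_A |P(A) - Q(A)|`, over measurable sets `A`. -/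
def tvDistance {α : Type*} [MeasurableSpace α] (P Q : Measure α) : ℝ :=
  ⨆ A : {A : Set α // MeasurableSet A}, |P.real A - Q.real A|

/-- Condition number `‖A‖ ‖A⁻¹‖` of an invertible matrix, in the spectral norm. -/
def condNumber {d : ℕ} (A : Matrix (Fin d) (Fin d) ℝ) : ℝ :=
  ‖Matrix.toEuclideanCLM (𝕜 := ℝ) A‖ * ‖Matrix.toEuclideanCLM (𝕜 := ℝ) A⁻¹‖

open scoped MatrixOrder in
/-- The positive semidefinite square root of a positive semidefinite matrix. -/
def matrixSqrt {d : ℕ} (A : Matrix (Fin d) (Fin d) ℝ) : Matrix (Fin d) (Fin d) ℝ :=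
  CFC.sqrt A

/-! ## A real-number machine with a step count and a word count

A value of type `Metered α` is a computation with a result, the number of elementary instructions
executed (infinite if the computation does not halt) and the number of memory words in use at peak.
Every memory word stores one real number or one integer. Exact arithmetic, minimum and maximum, `√`,
`cos` and comparisons on operands held in memory, reading an array entry, writing a value and
drawing one standard Gaussian are elementary instructions of unit cost; every pass through a loop
costs at least one further instruction. -/

/-- A computation: its result, its number of instructions, its peak number of memory words. -/
structure Metered (α : Type) where
  val : α
  time : ℕ∞
  space : ℕ

namespace Metered

variable {α σ ι : Type}

/-- Sequential composition: times add up, memory is reused. -/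
instance : Monad Metered where
  pure a := ⟨a, 0, 0⟩
  bind p f := ⟨(f p.val).val, p.time + (f p.val).time, max p.space (f p.val).space⟩

/-- One elementary instruction, with its result. -/
def step (a : α) : Metered α := ⟨a, 1, 0⟩

def add (x y : ℝ) : Metered ℝ := step (x + y)
def sub (x y : ℝ) : Metered ℝ := step (x - y)
def mul (x y : ℝ) : Metered ℝ := step (x * y)
def div (x y : ℝ) : Metered ℝ := step (x / y)
def sqrt (x : ℝ) : Metered ℝ := step (Real.sqrt x)
def cos (x : ℝ) : Metered ℝ := step (Real.cos x)
def max' (x y : ℝ) : Metered ℝ := step (max x y)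
def min' (x y : ℝ) : Metered ℝ := step (min x y)
/-- Test `x < y`. -/
def less (x y : ℝ) : Metered Bool := step (decide (x < y))
/-- Read a stored or an input value, or (for a value of the random tape) draw a fresh one. -/
def read (x : ℝ) : Metered ℝ := step x

/-- Run `p` with `w` further words of memory reserved. -/
def hold (w : ℕ) (p : Metered α) : Metered α := ⟨p.val, p.time, w + p.space⟩

/-- A loop over `l` that stores the result of each pass (one write per pass). -/
def forEach (l : List ι) (f : ι → Metered α) : Metered (List α) :=
  ⟨l.map fun i => (f i).val, (l.map fun i => (f i).time + 1).sum,
    (l.map fun i => (f i).space).foldr max 0⟩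

/-- The same, over the index range `1, …, m`. -/
def forEachFin {m : ℕ} (f : Fin m → Metered α) : Metered (Fin m → α) :=
  ⟨fun i => (f i).val, ∑ i, ((f i).time + 1), Finset.univ.sup fun i => (f i).space⟩

/-- A loop over `l` that sums up the results of its passes (one addition, one write per pass). -/
def sumEach (l : List ι) (f : ι → Metered ℝ) : Metered ℝ :=
  ⟨(l.map fun i => (f i).val).sum, (l.map fun i => (f i).time + 2).sum,
    (l.map fun i => (f i).space).foldr max 0⟩

/-- A loop over `l` that updates a state. -/
def loop (body : σ → ι → Metered σ) : List ι → σ → Metered σ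
  | [], s => pure s
  | i :: l, s => do
      let s' ← body s i
      let s'' ← step s'
      loop body l s''

open Classical in
/-- Repeat `attempt 0`, `attempt 1`, … until an attempt returns a value; if none ever does,
the computation does not halt. -/
def repeatUntil [Inhabited α] (attempt : ℕ → Metered (Option α)) : Metered α :=
  if h : ∃ k, (attempt k).val.isSome then
    ⟨(attempt (Nat.find h)).val.getD default,
      ∑ k ∈ Finset.range (Nat.find h + 1), ((attempt k).time + 1),
      (Finset.range (Nat.find h + 1)).sup fun k => (attempt k).space⟩
  else ⟨default, ⊤, 0⟩

end Metered

open Metered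

/-! ## The learning algorithm

The hyper-parameters are the size `r` of the projection domain, the step size parameter `lam`
and the number `B` of batches. Internal randomness is a tape of independent
standard Gaussians, each of which is used at most once. -/

/-- A sample of `N(μ, σ²)` truncated to `(a, ∞)`, by rejection from `μ + σ w 0`, `μ + σ w 1`, … -/
def truncNormal (a μ σ : ℝ) (w : ℕ → ℝ) : Metered ℝ :=
  repeatUntil fun k => do
    let g ← read (w k)
    let s ← mul σ g
    let z ← add μ s
    let ok ← less a z
    if ok then pure (some z) else pure none

/-- Projection of `v` to the box `{v : 1/r ≤ v(1) ≤ r, |v(2)| ≤ r}`. -/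
def projBox (r : ℝ) (v : ℝ × ℝ) : Metered (ℝ × ℝ) := do
  let ri ← div 1 r
  let rn ← sub 0 r
  let p ← min' r v.1
  let p ← max' ri p
  let q ← min' r v.2
  let q ← max' rn q
  pure (p, q)

/-- The stochastic gradient `-(-x²/2, x) + (-z²/2, z)` at `v = (1/σ², μ/σ²)`, where `x` is a data
point and `z` is sampled from `N(μ, σ²)` truncated to `(a, ∞)`. -/
def stochGrad (a : ℝ) (v : ℝ × ℝ) (x : ℝ) (w : ℕ → ℝ) : Metered (ℝ × ℝ) := do
  let μ ← div v.2 v.1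
  let σ2 ← div 1 v.1
  let σ ← sqrt σ2
  let z ← truncNormal a μ σ w
  let xx ← mul x x
  let zz ← mul z z
  let g ← sub xx zz
  let g₁ ← div g 2
  let g₂ ← sub z x
  pure (g₁, g₂)

/-- Projected SGD for data truncated to `(a, ∞)`. Iteration `t = 1, …, T` uses
the `t`-th point of the list; the output is the average of the `T` iterates. -/
def projSGD (r lam a : ℝ) (xs : List ℝ) (w : ℕ → ℕ → ℝ) : Metered (ℝ × ℝ) :=
  hold 32 do
    let out ← loop (fun (s : (ℝ × ℝ) × (ℝ × ℝ)) (xt : ℝ × ℕ) => do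
        let x ← read xt.1
        let g ← stochGrad a s.1 x (w xt.2)
        let t ← add (xt.2 : ℝ) 1
        let c ← mul lam t
        let h₁ ← div g.1 c
        let h₂ ← div g.2 c
        let u₁ ← sub s.1.1 h₁
        let u₂ ← sub s.1.2 h₂
        let v ← projBox r (u₁, u₂)
        let s₁ ← add s.2.1 v.1
        let s₂ ← add s.2.2 v.2
        pure (v, (s₁, s₂)))
      xs.zipIdx ((1, 0), (0, 0))
    let m₁ ← div out.2.1 (xs.length : ℝ)
    let m₂ ← div out.2.2 (xs.length : ℝ)
    pure (m₁, m₂)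

/-- Euclidean distance in the plane. -/
def planeDist (p q : ℝ × ℝ) : Metered ℝ := do
  let a ← sub p.1 q.1
  let b ← sub p.2 q.2
  let aa ← mul a a
  let bb ← mul b b
  let s ← add aa bb
  sqrt s

/-- The first point `p` of the list at which `∑ q, ‖p - q‖₂` (over the list) is minimal. -/
def selectPoint (vs : List (ℝ × ℝ)) : Metered (ℝ × ℝ) :=
  hold (3 * vs.length + 16) do
    let scored ← forEach vs fun p => do
      let c ← sumEach vs fun q => planeDist p q
      pure (p, c)
    match scored with
    | [] => pure (0, 0)
    | s₀ :: rest => do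
        let best ← loop (fun (best s : (ℝ × ℝ) × ℝ) => do
            let lt ← less s.2 best.2
            if lt then pure s else pure best) rest s₀
        pure best.1

/-- Estimate `(μ, σ²)` from samples of `N(μ, σ²)` truncated to `(0, ∞)`. The samples are shifted and
rescaled by their empirical mean `μ₀` and standard deviation `σ₀` and split into `B` batches, each of
length `T = ⌊N / B⌋`; projected SGD is run on each batch; one of the `B` results is selected
and transformed back to the original space. -/
def normBiasEst (r lam : ℝ) (B : ℕ) (S : List ℝ) (w : ℕ → ℕ → ℕ → ℝ) : Metered (ℝ × ℝ) :=
  hold (S.length + 2 * B + 32) do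
    let N : ℝ := S.length
    let sum ← sumEach S fun x => read x
    let μ₀ ← div sum N
    let sumSq ← sumEach S fun x => do
      let x ← read x
      let c ← sub x μ₀
      mul c c
    let var ← div sumSq N
    let σ₀ ← sqrt var
    let y ← forEach S fun x => do
      let x ← read x
      let c ← sub x μ₀
      div c σ₀
    let q ← div μ₀ σ₀
    let a ← sub 0 q
    let T ← step (S.length / B)
    let vs ← forEach (List.range B) fun j => projSGD r lam a ((y.drop (j * T)).take T) (w j)
    let v ← selectPoint vs
    -- `v̂ = (1/σ², μ/σ²)` in the original space
    let v₁ ← div v.1 var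
    let p ← mul σ₀ v.2
    let q ← mul μ₀ v.1
    let s ← add p q
    let v₂ ← div s var
    let μ ← div v₂ v₁
    let σ2 ← div 1 v₁
    pure (μ, σ2)

/-- The positive values among the `i`-th coordinates of the samples. -/
def positivePart {n d : ℕ} (x : Fin n → Fin d → ℝ) (i : Fin d) : Metered (List ℝ) :=
  loop (fun (S : List ℝ) (m : Fin n) => do
    let y ← read (x m i)
    let pos ← less 0 y
    if pos then step (S ++ [y]) else pure S) (List.finRange n) []

/-- The estimate `π - (2π/n) ∑ₘ 1(xₘ(i) > b(i)) 1(xₘ(j) > b(j))` of the angle between rows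
`i` and `j`. -/
def angleEst {n d : ℕ} (x : Fin n → Fin d → ℝ) (b : Fin d → ℝ) (i j : Fin d) : Metered ℝ := do
  let bi ← read (b i)
  let bj ← read (b j)
  let count ← sumEach (List.finRange n) fun m => do
    let xi ← read (x m i)
    let xj ← read (x m j)
    let hi ← less bi xi
    let hj ← less bj xj
    step (if hi && hj then 1 else 0)
  let c ← mul 2 Real.pi
  let c ← div c (n : ℝ)
  let c ← mul c count
  sub Real.pi c

/-- The whole algorithm: the estimates `(Σ̂, b̂)` from `n` samples in `ℝ^d`. -/
def learnReLU (r lam : ℝ) (B : ℕ) {n d : ℕ} (x : Fin n → Fin d → ℝ)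
    (w : Fin d → ℕ → ℕ → ℕ → ℝ) : Metered (Matrix (Fin d) (Fin d) ℝ × (Fin d → ℝ)) :=
  hold (n * d + 2 * (d * d) + 2 * d + 32) do
    let est ← forEachFin fun i => hold n do
      let S ← positivePart x i
      let e ← normBiasEst r lam B S (w i)
      let bi ← max' 0 e.1
      let si ← step e.2
      pure (bi, si)
    let b : Fin d → ℝ := fun i => (est i).1
    let off ← forEachFin fun i => forEachFin fun j =>
      if i < j then do
        let θ ← angleEst x b i j
        let s ← mul (est i).2 (est j).2
        let s ← sqrt s
        let c ← cos θ
        mul s c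
      else step 0
    let Sig ← forEachFin fun i => forEachFin fun j =>
      step (if i = j then (est i).2 else if i < j then off i j else off j i)
    pure (Sig, b)

/-- The law of the `n` independent samples from `D(W, b)` together with the independent random tape
of the algorithm (independent standard Gaussians, indexed by coordinate, batch, iteration of
SGD and attempt of the rejection sampler). -/
def samplesAndTape {d : ℕ} (n : ℕ) (W : Matrix (Fin d) (Fin d) ℝ) (b : Fin d → ℝ) :
    Measure ((Fin n → Fin d → ℝ) × (Fin d × ℕ × ℕ × ℕ → ℝ)) :=
  (Measure.pi fun _ : Fin n => reluDist W b).prod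
    (Measure.infinitePi fun _ : Fin d × ℕ × ℕ × ℕ => gaussianReal 0 1)

end

section MeteredMachine

open Metered

/-! ## Results, times and sizes of the computations -/

namespace Metered

variable {α β σ ι : Type}

/-! Coordinate `i` of a sample is `max 0 (b i + σ g)` with `g` standard Gaussian and `σ` the norm of
row `i` of `W`. Put `m = b i / σ ≥ 0`. The positive values are `m σ + σ Y`, where `Y` is a standard
Gaussian truncated to `(-m, ∞)`. This truncation keeps at least half of the mass, so all moment
bounds are uniform in `m`. In the natural parameter `v` the truncated Gaussians form an exponential
family: the gradient of the negative log-likelihood is the difference of the expectations of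
`(-x²/2, x)` under `v` and under the truth. On the box it is strongly monotone and Lipschitz
(`truncExp_strongMono`, `truncExp_lipschitz`), with constants that depend on the box only.

The normalization uses all data, so the points of a batch are not independent of the optimization
problem that SGD solves on them. The analysis therefore fixes the data and averages over the
rejection sampler alone. Let `S t` be the accumulated deviation of the statistics of the first `t`
points from their true mean, and take the potential `|lam t (v t - v*) - S t|²`. The new data point
cancels from one step of it (`integral_sgdPotential_le`), and the price of a step involves only
`S²/t` and `S⁴/t²`. Deviations of normalized data are linear combinations, with bounded
coefficients, of deviations of the raw i.i.d. data (`devSum_stat1_normData`). Hence the price is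
bounded by a functional of the raw data whose mean is `O(log T)` (`integral_batchCost_le`), and the
mean squared error on a typical batch is `O(log T / T)`. Markov's and Hoeffding's inequalities leave
less than a quarter of the batches far from the target, and a minimizer of the sum of distances is
then near it (`dist_le_of_distSum_le`). The number of positive samples is random; this is handled by
drawing signs and truncated values independently (`map_signCase`) and conditioning on the signs.

For a pair of coordinates, the probability that both exceed their biases is that of a planar wedge,
`(π - θ) / (2π)`. The estimated thresholds depend on the same samples, but counts are monotone in
the thresholds, so they lie between counts for two fixed quadrants, which differ by strips of small
probability (`jointCount_close`).

All this gives relative accuracy `η` for the biases and the entries of the covariance. In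
coordinates where `W⁻¹ (S - W Wᵀ) W⁻ᵀ` is diagonal, both laws are images under one map of products
of Gaussians. The Frobenius norm of that matrix is at most `κ d η`, and a chi-square computation
bounds the total variation distance by a multiple of `κ d η` (`posSemidef_and_tvDistance_le`). So
`η` of order `ε / (κ d)` suffices, whence batches of length about `κ² d² / ε²` up to a logarithm,
and about `log (2 d / δ)` of them.

For the running time, every rejection sampler accepts all draws above one fixed constant, whatever
the iterate. The total number of draws is thus dominated by a sum of independent geometric
variables, which is linear in `d n` up to exponentially small probability
(`exists_measure_trials_le`). -/

theorem val_pure (a : α) : (pure a : Metered α).val = a := rfl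
theorem time_pure (a : α) : (pure a : Metered α).time = 0 := rfl
theorem space_pure (a : α) : (pure a : Metered α).space = 0 := rfl
theorem val_bind (p : Metered α) (f : α → Metered β) : (p >>= f).val = (f p.val).val := rfl
theorem time_bind (p : Metered α) (f : α → Metered β) :
    (p >>= f).time = p.time + (f p.val).time := rfl
theorem space_bind (p : Metered α) (f : α → Metered β) :
    (p >>= f).space = max p.space (f p.val).space := rfl
theorem val_step (a : α) : (step a).val = a := rfl
theorem time_step (a : α) : (step a).time = 1 := rfl
theorem space_step (a : α) : (step a).space = 0 := rfl
theorem time_hold (w : ℕ) (p : Metered α) : (hold w p).time = p.time := rfl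
theorem space_hold (w : ℕ) (p : Metered α) : (hold w p).space = w + p.space := rfl

/-! ### Time and space of loops -/

theorem foldr_max_le {l : List ℕ} {c : ℕ} (h : ∀ x ∈ l, x ≤ c) : l.foldr max 0 ≤ c := by
  induction l with
  | nil => simp
  | cons a l ih =>
    simp only [List.foldr_cons]
    exact max_le (h a (by simp)) (ih fun x hx => h x (by simp [hx]))

theorem list_sum_le {l : List ι} {f : ι → ℕ∞} {c : ℕ} (h : ∀ x ∈ l, f x ≤ c) :
    (l.map f).sum ≤ ((l.length * c : ℕ) : ℕ∞) := by
  induction l with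
  | nil => simp
  | cons a l ih =>
    have h1 := h a (by simp)
    have h2 := ih fun x hx => h x (by simp [hx])
    simp only [List.map_cons, List.sum_cons, List.length_cons]
    calc f a + (l.map f).sum ≤ (c : ℕ∞) + ((l.length * c : ℕ) : ℕ∞) := add_le_add h1 h2
      _ = (((l.length + 1) * c : ℕ) : ℕ∞) := by push_cast; ring

theorem space_forEach_le {l : List ι} {f : ι → Metered α} {c : ℕ} (h : ∀ i ∈ l, (f i).space ≤ c) :
    (forEach l f).space ≤ c := by
  refine foldr_max_le fun x hx => ?_
  obtain ⟨i, hi, rfl⟩ := List.mem_map.1 hx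
  exact h i hi

theorem space_sumEach_le {l : List ι} {f : ι → Metered ℝ} {c : ℕ} (h : ∀ i ∈ l, (f i).space ≤ c) :
    (sumEach l f).space ≤ c := by
  refine foldr_max_le fun x hx => ?_
  obtain ⟨i, hi, rfl⟩ := List.mem_map.1 hx
  exact h i hi

theorem space_loop_le {body : σ → ι → Metered σ} {c : ℕ} (h : ∀ s i, (body s i).space ≤ c)
    (l : List ι) (s : σ) : (loop body l s).space ≤ c := by
  induction l generalizing s with
  | nil => exact Nat.zero_le _
  | cons i l ih =>
    simp only [loop, space_bind, space_step]
    exact max_le (h _ _) (max_le (Nat.zero_le _) (ih _))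

theorem time_loop_le {body : σ → ι → Metered σ} {c : ℕ} (h : ∀ s i, (body s i).time ≤ c)
    (l : List ι) (s : σ) : (loop body l s).time ≤ ((l.length * (c + 1) : ℕ) : ℕ∞) := by
  induction l generalizing s with
  | nil => simp [loop, time_pure]
  | cons i l ih =>
    simp only [loop, time_bind, time_step, val_step, List.length_cons]
    calc (body s i).time + (1 + (loop body l (body s i).val).time)
        ≤ (c : ℕ∞) + (1 + ((l.length * (c + 1) : ℕ) : ℕ∞)) := by
          gcongr
          · exact h _ _
          · exact ih _
      _ = (((l.length + 1) * (c + 1) : ℕ) : ℕ∞) := by push_cast; ring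

end Metered


/-! ### Rejection sampling -/

open Classical in
/-- The number of draws until the first one that exceeds `c`. -/
noncomputable def trials (c : ℝ) (w : ℕ → ℝ) : ℕ :=
  if h : ∃ k, c < w k then Nat.find h + 1 else 0

/-- One attempt of the rejection sampler. -/
noncomputable def attempt (a μ σ : ℝ) (w : ℕ → ℝ) (k : ℕ) : Metered (Option ℝ) := do
  let g ← read (w k)
  let s ← mul σ g
  let z ← Metered.add μ s
  let ok ← less a z
  if ok then pure (some z) else pure none

open Classical in
theorem attempt_eq (a μ σ : ℝ) (w : ℕ → ℝ) (k : ℕ) :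
    attempt a μ σ w k =
      ⟨if a < μ + σ * w k then some (μ + σ * w k) else none, 4, 0⟩ := by
  change Metered.mk _ _ _ = _
  by_cases h : a < μ + σ * w k <;>
  · simp only [val_bind, Metered.read, Metered.mul, Metered.add, val_step, h, time_bind,
      space_bind, time_step, space_step, less]
    norm_num [val_pure, time_pure, space_pure]

theorem isSome_attempt_iff (a μ σ : ℝ) (w : ℕ → ℝ) (k : ℕ) :
    (attempt a μ σ w k).val.isSome ↔ a < μ + σ * w k := by
  rw [attempt_eq]
  by_cases h : a < μ + σ * w k <;> simp [h]

theorem truncNormal_eq (a μ σ : ℝ) (w : ℕ → ℝ) :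
    truncNormal a μ σ w = repeatUntil (attempt a μ σ w) := rfl

open Classical in
theorem truncNormal_val (a μ σ : ℝ) (w : ℕ → ℝ) :
    (truncNormal a μ σ w).val =
      if h : ∃ k, a < μ + σ * w k then μ + σ * w (Nat.find h) else 0 := by
  rw [truncNormal_eq]
  unfold repeatUntil
  simp only [isSome_attempt_iff]
  split_ifs with h
  · have h1 := Nat.find_spec h
    simp only [attempt_eq]
    rw [if_pos h1]
    rfl
  · rfl

open Classical in
theorem truncNormal_time {a μ σ : ℝ} {w : ℕ → ℝ} (h : ∃ k, a < μ + σ * w k) :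
    (truncNormal a μ σ w).time = ((5 * (Nat.find h + 1) : ℕ) : ℕ∞) := by
  rw [truncNormal_eq]
  unfold repeatUntil
  simp only [isSome_attempt_iff]
  rw [dif_pos h]
  simp only [attempt_eq]
  simp only [Finset.sum_const, Finset.card_range]
  norm_num
  ring

theorem truncNormal_space (a μ σ : ℝ) (w : ℕ → ℝ) : (truncNormal a μ σ w).space = 0 := by
  rw [truncNormal_eq]
  unfold repeatUntil
  split_ifs with h
  · simp only [attempt_eq]
    exact Nat.le_zero.1 (Finset.sup_le fun k _ => le_rfl)
  · rfl

/-- Every draw above `c` is accepted, so the first acceptance comes no later than the first draw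
above `c`. The bound no longer involves the iterate, which makes the bounds for different iterations
independent although the iterates are not. -/
theorem truncNormal_time_le {a μ σ c : ℝ} {w : ℕ → ℝ} (hw : ∃ k, c < w k)
    (hc : ∀ g, c < g → a < μ + σ * g) :
    (truncNormal a μ σ w).time ≤ ((5 * trials c w : ℕ) : ℕ∞) := by
  classical
  have h : ∃ k, a < μ + σ * w k := hw.imp fun k hk => hc _ hk
  rw [truncNormal_time h, trials, dif_pos hw]
  have := Nat.find_mono (p := fun k => a < μ + σ * w k) (q := fun k => c < w k)
    (fun k hk => hc _ hk) (hp := h) (hq := hw)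
  exact_mod_cast (by omega : 5 * (Nat.find h + 1) ≤ 5 * (Nat.find hw + 1))

/-! ### Projected SGD -/

/-- The projection to the box, as a function. -/
noncomputable def clampBox (r : ℝ) (u : ℝ × ℝ) : ℝ × ℝ :=
  (max (1 / r) (min r u.1), max (0 - r) (min r u.2))

/-- One iteration of projected SGD (number `t + 1`), as a function. -/
noncomputable def sgdNext (r lam a : ℝ) (v : ℝ × ℝ) (x : ℝ) (t : ℕ) (w : ℕ → ℝ) : ℝ × ℝ :=
  let z := (truncNormal a (v.2 / v.1) (√(1 / v.1)) w).val
  clampBox r (v.1 - (x * x - z * z) / 2 / (lam * (t + 1)), v.2 - (z - x) / (lam * (t + 1)))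

/-- The iterates of projected SGD. -/
noncomputable def sgdIter (r lam a : ℝ) (x : ℕ → ℝ) (w : ℕ → ℕ → ℝ) : ℕ → ℝ × ℝ
  | 0 => (1, 0)
  | t + 1 => sgdNext r lam a (sgdIter r lam a x w t) (x t) t (w t)

/-- The box to which the iterates are projected. -/
def paramBox (r : ℝ) : Set (ℝ × ℝ) := {v | 1 / r ≤ v.1 ∧ v.1 ≤ r ∧ |v.2| ≤ r}

theorem clampBox_mem {r : ℝ} (hr : 1 ≤ r) (u : ℝ × ℝ) : clampBox r u ∈ paramBox r := by
  have h1 : 1 / r ≤ r := by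
    rw [div_le_iff₀ (by linarith)]; nlinarith
  refine ⟨le_max_left _ _, max_le h1 (min_le_left _ _), abs_le.2 ⟨?_, ?_⟩⟩
  · simp [clampBox]
  · exact max_le (by linarith) (min_le_left _ _)

theorem sgdIter_mem {r : ℝ} (hr : 1 ≤ r) (lam a : ℝ) (x : ℕ → ℝ) (w : ℕ → ℕ → ℝ) (t : ℕ) :
    sgdIter r lam a x w t ∈ paramBox r := by
  cases t with
  | zero =>
    refine ⟨?_, hr, ?_⟩
    · rw [sgdIter, div_le_iff₀ (by linarith)]; linarith
    · simp [sgdIter]; linarith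
  | succ t => exact clampBox_mem hr _

/-- The body of the loop of projected SGD. -/
noncomputable def sgdBody (r lam a : ℝ) (w : ℕ → ℕ → ℝ) (s : (ℝ × ℝ) × (ℝ × ℝ)) (xt : ℝ × ℕ) :
    Metered ((ℝ × ℝ) × (ℝ × ℝ)) := do
  let x ← read xt.1
  let g ← stochGrad a s.1 x (w xt.2)
  let t ← Metered.add (xt.2 : ℝ) 1
  let c ← mul lam t
  let h₁ ← div g.1 c
  let h₂ ← div g.2 c
  let u₁ ← sub s.1.1 h₁
  let u₂ ← sub s.1.2 h₂
  let v ← projBox r (u₁, u₂)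
  let s₁ ← Metered.add s.2.1 v.1
  let s₂ ← Metered.add s.2.2 v.2
  pure (v, (s₁, s₂))

theorem sgdBody_val (r lam a : ℝ) (w : ℕ → ℕ → ℝ) (s : (ℝ × ℝ) × (ℝ × ℝ)) (xt : ℝ × ℕ) :
    (sgdBody r lam a w s xt).val = (sgdNext r lam a s.1 xt.1 xt.2 (w xt.2),
      s.2 + sgdNext r lam a s.1 xt.1 xt.2 (w xt.2)) := rfl

theorem sgdBody_time (r lam a : ℝ) (w : ℕ → ℕ → ℝ) (s : (ℝ × ℝ) × (ℝ × ℝ)) (xt : ℝ × ℕ) :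
    (sgdBody r lam a w s xt).time =
      23 + (truncNormal a (s.1.2 / s.1.1) (√(1 / s.1.1)) (w xt.2)).time := by
  simp only [sgdBody, stochGrad, projBox, time_bind, Metered.read, Metered.mul, Metered.add, sub,
    div, Metered.sqrt, max', min', val_step, val_bind, val_pure, time_step, time_pure]
  ring

theorem sgdBody_space (r lam a : ℝ) (w : ℕ → ℕ → ℝ) (s : (ℝ × ℝ) × (ℝ × ℝ)) (xt : ℝ × ℕ) :
    (sgdBody r lam a w s xt).space = 0 := by
  simp only [sgdBody, stochGrad, projBox, space_bind, Metered.read, Metered.mul, Metered.add, sub,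
    div, Metered.sqrt, max', min', val_step, val_bind, val_pure, space_step, space_pure,
    truncNormal_space]
  rfl

/-- The starting index and the accumulator are general for the sake of the induction. The
accumulator collects iterates after their update, so the starting point `(1, 0)` never enters the
average. -/
theorem loop_sgdBody_val (r lam a : ℝ) (x : ℕ → ℝ) (w : ℕ → ℕ → ℝ) (xs : List ℝ) (k : ℕ)
    (hx : ∀ i (h : i < xs.length), x (k + i) = xs[i]) (acc : ℝ × ℝ) :
    (loop (sgdBody r lam a w) (xs.zipIdx k) (sgdIter r lam a x w k, acc)).val =
      (sgdIter r lam a x w (k + xs.length),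
        acc + ∑ i ∈ Finset.range xs.length, sgdIter r lam a x w (k + i + 1)) := by
  induction xs generalizing k acc with
  | nil => simp [loop, val_pure]
  | cons y xs ih =>
    have h0 : x k = y := hx 0 (by simp)
    have h1 : sgdNext r lam a (sgdIter r lam a x w k) y k (w k) = sgdIter r lam a x w (k + 1) := by
      rw [sgdIter, h0]
    simp only [List.zipIdx_cons, loop, val_bind, val_step, sgdBody_val, h1]
    rw [ih (k + 1) (fun i h => by
      have := hx (i + 1) (by simpa using h)
      simpa [add_assoc, add_comm 1 i] using this)]
    rw [List.length_cons, Finset.sum_range_succ', ← add_assoc]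
    congr 1
    · congr 1; omega
    · have : ∀ i, k + 1 + i + 1 = k + (i + 1) + 1 := fun i => by omega
      simp only [this, add_zero]
      abel

theorem projSGD_val (r lam a : ℝ) (x : ℕ → ℝ) (w : ℕ → ℕ → ℝ) (xs : List ℝ)
    (hx : ∀ i (h : i < xs.length), x i = xs[i]) :
    (projSGD r lam a xs w).val =
      ((∑ i ∈ Finset.range xs.length, (sgdIter r lam a x w (i + 1)).1) / xs.length,
        (∑ i ∈ Finset.range xs.length, (sgdIter r lam a x w (i + 1)).2) / xs.length) := by
  have h := loop_sgdBody_val r lam a x w xs 0 (fun i h => by simpa using hx i h) (0, 0)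
  change ((loop (sgdBody r lam a w) (xs.zipIdx) ((1, 0), (0, 0))).val.2.1 / (xs.length : ℝ),
    (loop (sgdBody r lam a w) (xs.zipIdx) ((1, 0), (0, 0))).val.2.2 / (xs.length : ℝ)) = _
  have h0 : sgdIter r lam a x w 0 = (1, 0) := rfl
  rw [h0] at h
  rw [h]
  simp [Prod.fst_sum, Prod.snd_sum]

theorem projSGD_space (r lam a : ℝ) (xs : List ℝ) (w : ℕ → ℕ → ℝ) :
    (projSGD r lam a xs w).space ≤ 32 := by
  change 32 + max (loop (sgdBody r lam a w) (xs.zipIdx) ((1, 0), (0, 0))).space 0 ≤ 32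
  have := space_loop_le (body := sgdBody r lam a w) (c := 0)
    (fun s i => (sgdBody_space r lam a w s i).le) xs.zipIdx ((1, 0), (0, 0))
  simp only [Nat.le_zero.1 this]
  rfl

/-- The only fact needed about an iterate is that it lies in the box, and `clampBox_mem` restores
this after every update; so the induction runs over arbitrary states. -/
theorem loop_sgdBody_time {r : ℝ} (hr : 1 ≤ r) (lam a c : ℝ) (w : ℕ → ℕ → ℝ)
    (hc : ∀ v ∈ paramBox r, ∀ g, c < g → a < v.2 / v.1 + √(1 / v.1) * g)
    (hw : ∀ t, ∃ k, c < w t k) (xs : List ℝ) (k : ℕ) (v acc : ℝ × ℝ) (hv : v ∈ paramBox r) :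
    (loop (sgdBody r lam a w) (xs.zipIdx k) (v, acc)).time ≤
      ((∑ i ∈ Finset.range xs.length, (24 + 5 * trials c (w (k + i))) : ℕ) : ℕ∞) := by
  induction xs generalizing k v acc with
  | nil => simp [loop, time_pure]
  | cons y xs ih =>
    simp only [List.zipIdx_cons, loop, time_bind, val_step, sgdBody_val, time_step, sgdBody_time,
      List.length_cons]
    have h1 := truncNormal_time_le (hw k) (hc v hv)
    have h2 := ih (k + 1) (sgdNext r lam a v y k (w k)) (acc + sgdNext r lam a v y k (w k))
      (clampBox_mem hr _)
    rw [Finset.sum_range_succ']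
    calc _ ≤ 23 + ((5 * trials c (w k) : ℕ) : ℕ∞) + (1 +
          ((∑ i ∈ Finset.range xs.length, (24 + 5 * trials c (w (k + 1 + i))) : ℕ) : ℕ∞)) := by
          gcongr
      _ = _ := by
        have : ∀ i, k + 1 + i = k + (i + 1) := fun i => by omega
        simp only [this, add_zero]
        push_cast
        ring

theorem projSGD_time {r : ℝ} (hr : 1 ≤ r) (lam a c : ℝ) (w : ℕ → ℕ → ℝ)
    (hc : ∀ v ∈ paramBox r, ∀ g, c < g → a < v.2 / v.1 + √(1 / v.1) * g)
    (hw : ∀ t, ∃ k, c < w t k) (xs : List ℝ) :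
    (projSGD r lam a xs w).time ≤
      ((∑ i ∈ Finset.range xs.length, (24 + 5 * trials c (w i)) + 2 : ℕ) : ℕ∞) := by
  have h := loop_sgdBody_time hr lam a c w hc hw xs 0 (1, 0) (0, 0) (sgdIter_mem hr lam a 0 w 0)
  change (loop (sgdBody r lam a w) (xs.zipIdx) ((1, 0), (0, 0))).time + (1 + (1 + 0)) ≤ _
  simp only [zero_add] at h
  push_cast at h ⊢
  calc _ ≤ _ := add_le_add_left h _
    _ = _ := by norm_num [add_assoc]

/-! ### Selection of a central point -/

/-- The sum of the distances of `p` to the points of the list. -/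
noncomputable def distSum (vs : List (ℝ × ℝ)) (p : ℝ × ℝ) : ℝ :=
  (vs.map fun q => √((p.1 - q.1) * (p.1 - q.1) + (p.2 - q.2) * (p.2 - q.2))).sum

/-- The loop of `selectPoint`. -/
noncomputable def argminBody (best s : (ℝ × ℝ) × ℝ) : Metered ((ℝ × ℝ) × ℝ) := do
  let lt ← less s.2 best.2
  if lt then pure s else pure best

theorem loop_argminBody (l : List ((ℝ × ℝ) × ℝ)) (s₀ : (ℝ × ℝ) × ℝ) :
    (loop argminBody l s₀).val ∈ s₀ :: l ∧
      ∀ s ∈ s₀ :: l, (loop argminBody l s₀).val.2 ≤ s.2 := by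
  induction l generalizing s₀ with
  | nil => simp [loop, val_pure]
  | cons a l ih =>
    simp only [loop, val_bind, val_step]
    have hb : (argminBody s₀ a).val = if a.2 < s₀.2 then a else s₀ := by
      simp only [argminBody, val_bind, less, val_step, decide_eq_true_eq]
      split_ifs <;> rfl
    obtain ⟨h1, h2⟩ := ih (argminBody s₀ a).val
    have h3 : (argminBody s₀ a).val ∈ s₀ :: a :: l := by rw [hb]; split_ifs <;> simp
    have h4 : (argminBody s₀ a).val.2 ≤ s₀.2 ∧ (argminBody s₀ a).val.2 ≤ a.2 := by
      rw [hb]; split_ifs with h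
      · exact ⟨h.le, le_rfl⟩
      · exact ⟨le_rfl, not_lt.1 h⟩
    refine ⟨?_, fun s hs => ?_⟩
    · rcases List.mem_cons.1 h1 with h | h
      · rw [h]; exact h3
      · simp [h]
    · have h5 := h2 _ List.mem_cons_self
      rcases List.mem_cons.1 hs with rfl | hs
      · exact h5.trans h4.1
      · rcases List.mem_cons.1 hs with rfl | hs
        · exact h5.trans h4.2
        · exact h2 _ (List.mem_cons_of_mem _ hs)

theorem selectPoint_spec {vs : List (ℝ × ℝ)} (h : vs ≠ []) :
    (selectPoint vs).val ∈ vs ∧ ∀ q ∈ vs, distSum vs (selectPoint vs).val ≤ distSum vs q := by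
  obtain ⟨p, l, rfl⟩ := List.exists_cons_of_ne_nil h
  set vs := p :: l with hvs
  have hv : (selectPoint vs).val =
      (loop argminBody (l.map fun p => (p, distSum vs p)) (p, distSum vs p)).val.1 := rfl
  obtain ⟨h1, h2⟩ := loop_argminBody (l.map fun p => (p, distSum vs p)) (p, distSum vs p)
  have h3 : (p, distSum vs p) :: (l.map fun p => (p, distSum vs p)) =
    vs.map fun p => (p, distSum vs p) := rfl
  rw [h3] at h1 h2
  obtain ⟨q, hq, hq'⟩ := List.mem_map.1 h1
  rw [hv, ← hq']
  refine ⟨hq, fun u hu => ?_⟩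
  have := h2 _ (List.mem_map.2 ⟨u, hu, rfl⟩)
  rw [← hq'] at this
  exact this

theorem selectPoint_time (vs : List (ℝ × ℝ)) :
    (selectPoint vs).time ≤ ((8 * vs.length ^ 2 + 3 * vs.length : ℕ) : ℕ∞) := by
  rcases vs with _ | ⟨p, l⟩
  · simp [selectPoint, time_hold, time_bind, forEach, time_pure]
  set vs := p :: l with hvs
  set f : ℝ × ℝ → Metered ((ℝ × ℝ) × ℝ) := fun p => do
    let c ← sumEach vs fun q => planeDist p q
    pure (p, c) with hf
  have hv : (selectPoint vs).time = (forEach vs f).time +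
      ((loop argminBody (l.map fun p => (p, distSum vs p)) (p, distSum vs p)).time + 0) := rfl
  have h1 : (forEach vs f).time ≤ ((vs.length * (8 * vs.length + 1) : ℕ) : ℕ∞) := by
    refine list_sum_le fun q _ => ?_
    have : (sumEach vs fun u => planeDist q u).time ≤ ((vs.length * 8 : ℕ) : ℕ∞) := by
      refine list_sum_le fun u _ => ?_
      simp only [planeDist, time_bind, sub, Metered.mul, Metered.add, Metered.sqrt, time_step]
      norm_num
    simp only [hf, time_bind, time_pure]
    calc _ ≤ ((vs.length * 8 : ℕ) : ℕ∞) + 0 + 1 := by gcongr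
      _ = _ := by push_cast; ring
  have h2 := time_loop_le (body := argminBody) (c := 1) (fun s i => by
    simp only [argminBody, time_bind, less, time_step]
    split_ifs <;> simp [time_pure]) (l.map fun p => (p, distSum vs p)) (p, distSum vs p)
  rw [hv]
  calc _ ≤ _ := add_le_add h1 (add_le_add_left h2 0)
    _ ≤ _ := by
      rw [add_zero, ← Nat.cast_add]
      have : vs.length = l.length + 1 := rfl
      rw [List.length_map]
      norm_cast
      rw [this]
      nlinarith

theorem selectPoint_space (vs : List (ℝ × ℝ)) :
    (selectPoint vs).space ≤ 3 * vs.length + 16 := by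
  rcases vs with _ | ⟨p, l⟩
  · simp [selectPoint, space_hold, space_bind, forEach, space_pure]
  set vs := p :: l with hvs
  set f : ℝ × ℝ → Metered ((ℝ × ℝ) × ℝ) := fun p => do
    let c ← sumEach vs fun q => planeDist p q
    pure (p, c) with hf
  have hv : (selectPoint vs).space = (3 * vs.length + 16) + max (forEach vs f).space
      (max (loop argminBody (l.map fun p => (p, distSum vs p)) (p, distSum vs p)).space 0) := rfl
  have h1 : (forEach vs f).space ≤ 0 := by
    refine space_forEach_le fun q _ => ?_
    have : (sumEach vs fun u => planeDist q u).space ≤ 0 := by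
      refine space_sumEach_le fun u _ => ?_
      simp only [planeDist, space_bind, sub, Metered.mul, Metered.add, Metered.sqrt, space_step]
      norm_num
    simp only [hf, space_bind, space_pure]
    exact max_le this le_rfl
  have h2 := space_loop_le (body := argminBody) (c := 0) (fun s i => by
    simp only [argminBody, space_bind, less, space_step]
    split_ifs <;> simp [space_pure]) (l.map fun p => (p, distSum vs p)) (p, distSum vs p)
  rw [hv, Nat.le_zero.1 h1, Nat.le_zero.1 h2]
  simp

/-! ### The estimate for one coordinate -/

/-- The empirical mean. -/
noncomputable def listMean (S : List ℝ) : ℝ := (S.map fun x => x).sum / S.length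

/-- The empirical variance. -/
noncomputable def listVar (S : List ℝ) : ℝ :=
  (S.map fun x => (x - listMean S) * (x - listMean S)).sum / S.length

/-- The data after shifting and rescaling. -/
noncomputable def listNormalized (S : List ℝ) : List ℝ :=
  S.map fun x => (x - listMean S) / √(listVar S)

/-- The results of projected SGD on the batches. -/
noncomputable def batchResults (r lam : ℝ) (B : ℕ) (S : List ℝ) (w : ℕ → ℕ → ℕ → ℝ) :
    List (ℝ × ℝ) :=
  (List.range B).map fun j =>
    (projSGD r lam (0 - listMean S / √(listVar S))
      (((listNormalized S).drop (j * (S.length / B))).take (S.length / B)) (w j)).val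

/-- Transformation of a parameter `(1/σ², μ/σ²)` of the normalized data to `(μ, σ²)` for data with
mean `m` and variance `s`. -/
noncomputable def denormalize (m s : ℝ) (v : ℝ × ℝ) : ℝ × ℝ :=
  ((√s * v.2 + m * v.1) / s / (v.1 / s), 1 / (v.1 / s))

theorem normBiasEst_val (r lam : ℝ) (B : ℕ) (S : List ℝ) (w : ℕ → ℕ → ℕ → ℝ) :
    (normBiasEst r lam B S w).val =
      denormalize (listMean S) (listVar S) (selectPoint (batchResults r lam B S w)).val := rfl

theorem length_batchResults (r lam : ℝ) (B : ℕ) (S : List ℝ) (w : ℕ → ℕ → ℕ → ℝ) :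
    (batchResults r lam B S w).length = B := by simp [batchResults]

theorem length_batch_le (S : List ℝ) (B j : ℕ) :
    (((listNormalized S).drop (j * (S.length / B))).take (S.length / B)).length ≤ S.length / B := by
  simp

theorem normBiasEst_space (r lam : ℝ) (B : ℕ) (S : List ℝ) (w : ℕ → ℕ → ℕ → ℝ) :
    (normBiasEst r lam B S w).space ≤ S.length + 5 * B + 80 := by
  have h : (normBiasEst r lam B S w).space = (S.length + 2 * B + 32) +
      max (sumEach S fun x => read x).space (max 0 (max
        (sumEach S fun x => do
          let x ← read x
          let c ← sub x (listMean S)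
          mul c c).space (max 0 (max 0 (max (forEach S fun x => do
          let x ← read x
          let c ← sub x (listMean S)
          div c (√(listVar S))).space (max 0 (max 0 (max 0 (max
          (forEach (List.range B) fun j =>
            projSGD r lam (0 - listMean S / √(listVar S))
              (((listNormalized S).drop (j * (S.length / B))).take (S.length / B)) (w j)).space
          (max (selectPoint (batchResults r lam B S w)).space 0)))))))))) := rfl
  have h1 : (sumEach S fun x => read x).space ≤ 0 := space_sumEach_le fun _ _ => le_rfl
  have h2 : (sumEach S fun x => do
          let x ← read x
          let c ← sub x (listMean S)
          mul c c).space ≤ 0 := space_sumEach_le fun _ _ => le_rfl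
  have h3 : (forEach S fun x => do
          let x ← read x
          let c ← sub x (listMean S)
          div c (√(listVar S))).space ≤ 0 := space_forEach_le fun _ _ => le_rfl
  have h4 : (forEach (List.range B) fun j =>
            projSGD r lam (0 - listMean S / √(listVar S))
              (((listNormalized S).drop (j * (S.length / B))).take (S.length / B)) (w j)).space
      ≤ 32 := space_forEach_le fun _ _ => projSGD_space _ _ _ _ _
  have h5 := selectPoint_space (batchResults r lam B S w)
  rw [length_batchResults] at h5
  rw [h]
  omega

theorem listMean_nonneg {S : List ℝ} (hS : ∀ x ∈ S, 0 ≤ x) : 0 ≤ listMean S := by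
  refine div_nonneg (List.sum_nonneg ?_) (Nat.cast_nonneg _)
  simpa using hS

/-- The data are nonnegative, so the truncation point of the normalized data is at most `0` and a
proposal above `0` is always accepted. Hence one threshold `c` serves for all data. -/
theorem normBiasEst_time {r : ℝ} (hr : 1 ≤ r) (lam c : ℝ) (B : ℕ) {S : List ℝ}
    (hS : ∀ x ∈ S, 0 ≤ x) (w : ℕ → ℕ → ℕ → ℝ)
    (hc : ∀ v ∈ paramBox r, ∀ g, c < g → 0 < v.2 / v.1 + √(1 / v.1) * g)
    (hw : ∀ j t, ∃ k, c < w j t k) :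
    (normBiasEst r lam B S w).time ≤
      ((12 * S.length + 8 * B ^ 2 + 6 * B + 20 + ∑ j ∈ Finset.range B,
        ∑ t ∈ Finset.range (S.length / B), (24 + 5 * trials c (w j t)) : ℕ) : ℕ∞) := by
  set T := S.length / B with hT
  set a := 0 - listMean S / √(listVar S) with ha
  have ha0 : a ≤ 0 := by
    have := div_nonneg (listMean_nonneg hS) (Real.sqrt_nonneg (listVar S))
    linarith
  have h : (normBiasEst r lam B S w).time =
      (sumEach S fun x => read x).time + (1 +
        ((sumEach S fun x => do
          let x ← read x
          let c ← sub x (listMean S)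
          mul c c).time + (1 + (1 + ((forEach S fun x => do
          let x ← read x
          let c ← sub x (listMean S)
          div c (√(listVar S))).time + (1 + (1 + (1 + (
          (forEach (List.range B) fun j =>
            projSGD r lam a (((listNormalized S).drop (j * T)).take T) (w j)).time +
          ((selectPoint (batchResults r lam B S w)).time + 
            (1 + (1 + (1 + (1 + (1 + (1 + (1 + 0))))))))))))))))) := rfl
  have h1 : (sumEach S fun x => read x).time ≤ ((S.length * 3 : ℕ) : ℕ∞) :=
    list_sum_le fun _ _ => by simp only [Metered.read, time_step]; norm_num
  have h2 : (sumEach S fun x => do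
          let x ← read x
          let c ← sub x (listMean S)
          mul c c).time ≤ ((S.length * 5 : ℕ) : ℕ∞) :=
    list_sum_le fun _ _ => by
      simp only [Metered.read, sub, mul, time_bind, time_step]; norm_num
  have h3 : (forEach S fun x => do
          let x ← read x
          let c ← sub x (listMean S)
          div c (√(listVar S))).time ≤ ((S.length * 4 : ℕ) : ℕ∞) := 
    list_sum_le fun _ _ => by
      simp only [Metered.read, sub, div, time_bind, time_step]; norm_num
  have h4 : (forEach (List.range B) fun j =>
            projSGD r lam a (((listNormalized S).drop (j * T)).take T) (w j)).time
      ≤ ((∑ j ∈ Finset.range B, (∑ t ∈ Finset.range T, (24 + 5 * trials c (w j t)) + 3) : ℕ)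
          : ℕ∞) := by
    have e : (forEach (List.range B) fun j =>
            projSGD r lam a (((listNormalized S).drop (j * T)).take T) (w j)).time =
        ∑ j ∈ Finset.range B,
          ((projSGD r lam a (((listNormalized S).drop (j * T)).take T) (w j)).time + 1) := by
      -- The multiset underlying `Finset.range B` is the coercion of `List.range B`.
      exact (Multiset.sum_coe _).symm
    rw [e, Nat.cast_sum]
    refine Finset.sum_le_sum fun j _ => ?_
    have h6 := projSGD_time hr lam a c (w j)
      (fun v hv g hg => ha0.trans_lt (hc v hv g hg)) (hw j)
      (((listNormalized S).drop (j * T)).take T)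
    calc _ ≤ _ := add_le_add_left h6 1
      _ ≤ _ := by
        norm_cast
        have : ∑ i ∈ Finset.range (((listNormalized S).drop (j * T)).take T).length,
            (24 + 5 * trials c (w j i)) ≤ ∑ t ∈ Finset.range T, (24 + 5 * trials c (w j t)) :=
          Finset.sum_le_sum_of_subset (Finset.range_mono (length_batch_le S B j))
        omega
  have h5 := selectPoint_time (batchResults r lam B S w)
  rw [length_batchResults] at h5
  rw [h]
  calc _ ≤ ((S.length * 3 : ℕ) : ℕ∞) + (1 + (((S.length * 5 : ℕ) : ℕ∞) + (1 + (1 + (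
        ((S.length * 4 : ℕ) : ℕ∞) + (1 + (1 + (1 + (
        ((∑ j ∈ Finset.range B, (∑ t ∈ Finset.range T, (24 + 5 * trials c (w j t)) + 3) : ℕ) : ℕ∞)
        + (((8 * B ^ 2 + 3 * B : ℕ) : ℕ∞) + 
          (1 + (1 + (1 + (1 + (1 + (1 + (1 + 0))))))))))))))))) := by gcongr
    _ ≤ _ := by
      norm_cast
      rw [Finset.sum_add_distrib]
      simp only [Finset.sum_const, Finset.card_range, smul_eq_mul]
      omega

/-! ### The whole algorithm -/

/-- The body of the loop of `positivePart`. -/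
noncomputable def positiveBody {n d : ℕ} (x : Fin n → Fin d → ℝ) (i : Fin d) (S : List ℝ)
    (m : Fin n) : Metered (List ℝ) := do
  let y ← read (x m i)
  let pos ← less 0 y
  if pos then step (S ++ [y]) else pure S

theorem positiveBody_val {n d : ℕ} (x : Fin n → Fin d → ℝ) (i : Fin d) (S : List ℝ) (m : Fin n) :
    (positiveBody x i S m).val = if 0 < x m i then S ++ [x m i] else S := by
  change (if decide (0 < x m i) = true then step (S ++ [x m i]) else pure S : Metered _).val = _
  by_cases h : 0 < x m i <;> simp [h, val_step, val_pure]

theorem loop_positiveBody {n d : ℕ} (x : Fin n → Fin d → ℝ) (i : Fin d) (l : List (Fin n))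
    (S : List ℝ) :
    (loop (positiveBody x i) l S).val =
      S ++ (l.map fun m => x m i).filter (fun y => decide (0 < y)) := by
  induction l generalizing S with
  | nil => simp [loop, val_pure]
  | cons m l ih =>
    simp only [loop, val_bind, val_step, List.map_cons, List.filter_cons]
    rw [ih, positiveBody_val]
    by_cases h : 0 < x m i <;> simp [h]

theorem positivePart_val {n d : ℕ} (x : Fin n → Fin d → ℝ) (i : Fin d) :
    (positivePart x i).val =
      (List.ofFn fun m => x m i).filter (fun y => decide (0 < y)) := by
  rw [List.ofFn_eq_map, ← List.nil_append (List.filter _ _), ← loop_positiveBody]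
  rfl

theorem positivePart_time {n d : ℕ} (x : Fin n → Fin d → ℝ) (i : Fin d) :
    (positivePart x i).time ≤ ((n * 4 : ℕ) : ℕ∞) := by
  have := time_loop_le (body := fun (S : List ℝ) (m : Fin n) => do
      let y ← read (x m i)
      let pos ← less 0 y
      if pos then step (S ++ [y]) else pure S) (c := 3) (fun s m => by
    simp only [time_bind, Metered.read, less, time_step]
    split_ifs <;> simp only [time_pure, time_step] <;> norm_num) (List.finRange n) []
  rw [List.length_finRange] at this
  exact this

theorem positivePart_space {n d : ℕ} (x : Fin n → Fin d → ℝ) (i : Fin d) :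
    (positivePart x i).space = 0 := by
  have := space_loop_le (body := fun (S : List ℝ) (m : Fin n) => do
      let y ← read (x m i)
      let pos ← less 0 y
      if pos then step (S ++ [y]) else pure S) (c := 0) (fun s m => by
    simp only [space_bind, Metered.read, less, space_step]
    split_ifs <;> simp [space_pure, space_step]) (List.finRange n) []
  exact Nat.le_zero.1 this

theorem length_positivePart_le {n d : ℕ} (x : Fin n → Fin d → ℝ) (i : Fin d) :
    (positivePart x i).val.length ≤ n := by
  rw [positivePart_val]
  exact (List.length_filter_le _ _).trans (by simp)

theorem positivePart_nonneg {n d : ℕ} (x : Fin n → Fin d → ℝ) (i : Fin d) :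
    ∀ y ∈ (positivePart x i).val, 0 ≤ y := by
  rw [positivePart_val]
  intro y hy
  have := (List.mem_filter.1 hy).2
  simp only [decide_eq_true_eq] at this
  exact this.le

/-- The estimates `(b̂(i), Σ̂(i,i))` of the bias and the variance of a coordinate, from the values
of this coordinate. -/
noncomputable def coordEst (r lam : ℝ) (B : ℕ) {n : ℕ} (x : Fin n → ℝ) (w : ℕ → ℕ → ℕ → ℝ) : ℝ × ℝ :=
  let e := (normBiasEst r lam B ((List.ofFn x).filter fun y => decide (0 < y)) w).val
  (max 0 e.1, e.2)

/-- The number of samples for which both coordinates exceed the threshold. -/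
noncomputable def jointCount {n d : ℕ} (x : Fin n → Fin d → ℝ) (b : Fin d → ℝ) (i j : Fin d) : ℝ :=
  ∑ m, if b i < x m i ∧ b j < x m j then 1 else 0

theorem angleEst_val {n d : ℕ} (x : Fin n → Fin d → ℝ) (b : Fin d → ℝ) (i j : Fin d) :
    (angleEst x b i j).val = Real.pi - 2 * Real.pi / n * jointCount x b i j := by
  change Real.pi - 2 * Real.pi / n * ((List.finRange n).map fun m =>
    if (decide (b i < x m i) && decide (b j < x m j)) = true then (1 : ℝ) else 0).sum = _
  rw [jointCount, ← List.sum_ofFn, List.ofFn_eq_map]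
  simp only [Bool.and_eq_true, decide_eq_true_eq]

theorem angleEst_time {n d : ℕ} (x : Fin n → Fin d → ℝ) (b : Fin d → ℝ) (i j : Fin d) :
    (angleEst x b i j).time ≤ ((7 * n + 6 : ℕ) : ℕ∞) := by
  have h : ((sumEach (List.finRange n) fun m => do
    let xi ← read (x m i)
    let xj ← read (x m j)
    let hi ← less (b i) xi
    let hj ← less (b j) xj
    step (if hi && hj then (1 : ℝ) else 0)) : Metered ℝ).time ≤
      (((List.finRange n).length * 7 : ℕ) : ℕ∞) := list_sum_le fun m _ => by
    simp only [time_bind, Metered.read, less, time_step]; norm_num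
  rw [List.length_finRange] at h
  simp only [angleEst, time_bind, Metered.read, val_step, time_step, mul, div, sub]
  calc _ ≤ _ := add_le_add_right (add_le_add_right (add_le_add_left h _) _) _
    _ = _ := by push_cast; ring

theorem angleEst_space {n d : ℕ} (x : Fin n → Fin d → ℝ) (b : Fin d → ℝ) (i j : Fin d) :
    (angleEst x b i j).space = 0 := by
  have h : ((sumEach (List.finRange n) fun m => do
    let xi ← read (x m i)
    let xj ← read (x m j)
    let hi ← less (b i) xi
    let hj ← less (b j) xj
    step (if hi && hj then (1 : ℝ) else 0)) : Metered ℝ).space ≤ 0 := space_sumEach_le fun m _ => by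
    simp only [space_bind, Metered.read, less, space_step]; norm_num
  exact Nat.le_zero.1 (max_le le_rfl (max_le le_rfl (max_le h (by simp [space_bind, mul, div, sub, space_step]))))

/-- The entries of the covariance estimate, from the variances `s` and the thresholds `b`. -/
noncomputable def covEst {n d : ℕ} (x : Fin n → Fin d → ℝ) (s b : Fin d → ℝ) (i j : Fin d) : ℝ :=
  √(s i * s j) * Real.cos (Real.pi - 2 * Real.pi / n * jointCount x b i j)

/-- The loop pass of `learnReLU` that treats one coordinate. -/
noncomputable def coordPass (r lam : ℝ) (B : ℕ) {n d : ℕ} (x : Fin n → Fin d → ℝ)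
    (w : Fin d → ℕ → ℕ → ℕ → ℝ) (i : Fin d) : Metered (ℝ × ℝ) := hold n do
  let S ← positivePart x i
  let e ← normBiasEst r lam B S (w i)
  let bi ← max' 0 e.1
  let si ← step e.2
  pure (bi, si)

theorem coordPass_val (r lam : ℝ) (B : ℕ) {n d : ℕ} (x : Fin n → Fin d → ℝ)
    (w : Fin d → ℕ → ℕ → ℕ → ℝ) (i : Fin d) :
    (coordPass r lam B x w i).val = coordEst r lam B (fun m => x m i) (w i) := by
  rw [coordEst, ← positivePart_val x i]
  rfl

theorem coordPass_space (r lam : ℝ) (B : ℕ) {n d : ℕ} (x : Fin n → Fin d → ℝ)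
    (w : Fin d → ℕ → ℕ → ℕ → ℝ) (i : Fin d) :
    (coordPass r lam B x w i).space ≤ 2 * n + 5 * B + 80 := by
  have h : (coordPass r lam B x w i).space = n + max (positivePart x i).space
      (max (normBiasEst r lam B (positivePart x i).val (w i)).space (max 0 (max 0 0))) := rfl
  have h1 := normBiasEst_space r lam B (positivePart x i).val (w i)
  have h2 := length_positivePart_le x i
  rw [h, positivePart_space]
  omega

theorem coordPass_time {r : ℝ} (hr : 1 ≤ r) (lam c : ℝ) (B : ℕ) {n d : ℕ} (x : Fin n → Fin d → ℝ)
    (w : Fin d → ℕ → ℕ → ℕ → ℝ) (i : Fin d)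
    (hc : ∀ v ∈ paramBox r, ∀ g, c < g → 0 < v.2 / v.1 + √(1 / v.1) * g)
    (hw : ∀ i j t, ∃ k, c < w i j t k) :
    (coordPass r lam B x w i).time ≤ ((16 * n + 8 * B ^ 2 + 6 * B + 22 + ∑ j ∈ Finset.range B,
        ∑ t ∈ Finset.range (n / B), (24 + 5 * trials c (w i j t)) : ℕ) : ℕ∞) := by
  have h : (coordPass r lam B x w i).time = (positivePart x i).time +
      ((normBiasEst r lam B (positivePart x i).val (w i)).time + (1 + (1 + 0))) := rfl
  have h1 := normBiasEst_time hr lam c B (positivePart_nonneg x i) (w i) hc (hw i)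
  have h2 := length_positivePart_le x i
  rw [h]
  calc _ ≤ _ := add_le_add (positivePart_time x i) (add_le_add_left h1 _)
    _ ≤ _ := by
      norm_cast
      have : ∑ j ∈ Finset.range B, ∑ t ∈ Finset.range ((positivePart x i).val.length / B),
          (24 + 5 * trials c (w i j t)) ≤ ∑ j ∈ Finset.range B, ∑ t ∈ Finset.range (n / B),
          (24 + 5 * trials c (w i j t)) :=
        Finset.sum_le_sum fun j _ => Finset.sum_le_sum_of_subset
          (Finset.range_mono (Nat.div_le_div_right h2))
      omega

/-- The loop pass of `learnReLU` that computes an entry above the diagonal. -/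
noncomputable def offDiagPass {n d : ℕ} (x : Fin n → Fin d → ℝ) (s b : Fin d → ℝ) (i j : Fin d) :
    Metered ℝ :=
  if i < j then do
    let θ ← angleEst x b i j
    let s ← mul (s i) (s j)
    let s ← Metered.sqrt s
    let c ← Metered.cos θ
    mul s c
  else step 0

theorem offDiagPass_val {n d : ℕ} (x : Fin n → Fin d → ℝ) (s b : Fin d → ℝ) {i j : Fin d}
    (h : i < j) : (offDiagPass x s b i j).val = covEst x s b i j := by
  rw [offDiagPass, if_pos h, covEst, ← angleEst_val]
  rfl

theorem offDiagPass_time {n d : ℕ} (x : Fin n → Fin d → ℝ) (s b : Fin d → ℝ) (i j : Fin d) :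
    (offDiagPass x s b i j).time ≤ ((7 * n + 10 : ℕ) : ℕ∞) := by
  rw [offDiagPass]
  split_ifs
  · simp only [time_bind, mul, Metered.sqrt, Metered.cos, time_step]
    calc _ ≤ _ := add_le_add_left (angleEst_time x b i j) _
      _ = _ := by norm_cast
  · rw [time_step]; norm_cast; omega

theorem offDiagPass_space {n d : ℕ} (x : Fin n → Fin d → ℝ) (s b : Fin d → ℝ) (i j : Fin d) :
    (offDiagPass x s b i j).space = 0 := by
  rw [offDiagPass]
  split_ifs
  · simp [space_bind, mul, Metered.sqrt, Metered.cos, space_step, angleEst_space]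
  · rfl

section learnReLU

variable (r lam : ℝ) (B : ℕ) {n d : ℕ} (x : Fin n → Fin d → ℝ) (w : Fin d → ℕ → ℕ → ℕ → ℝ)

/-- The bias estimates of `learnReLU`. -/
noncomputable def biasOut (i : Fin d) : ℝ := (coordEst r lam B (fun m => x m i) (w i)).1

/-- The variance estimates of `learnReLU`. -/
noncomputable def varOut (i : Fin d) : ℝ := (coordEst r lam B (fun m => x m i) (w i)).2

theorem learnReLU_snd : (learnReLU r lam B x w).val.2 = biasOut r lam B x w := by
  funext i
  change ((coordPass r lam B x w i).val).1 = _
  rw [coordPass_val, biasOut]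

theorem learnReLU_fst (i j : Fin d) : (learnReLU r lam B x w).val.1 i j =
    if i = j then varOut r lam B x w i
    else if i < j then covEst x (varOut r lam B x w) (biasOut r lam B x w) i j
    else covEst x (varOut r lam B x w) (biasOut r lam B x w) j i := by
  have h1 : (fun i => ((coordPass r lam B x w i).val).1) = biasOut r lam B x w := by
    funext i; rw [coordPass_val, biasOut]
  have h2 : (fun i => ((coordPass r lam B x w i).val).2) = varOut r lam B x w := by
    funext i; rw [coordPass_val, varOut]
  have h : (learnReLU r lam B x w).val.1 i j =
    if i = j then ((coordPass r lam B x w i).val).2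
    else if i < j then (offDiagPass x (fun i => ((coordPass r lam B x w i).val).2)
      (fun i => ((coordPass r lam B x w i).val).1) i j).val
    else (offDiagPass x (fun i => ((coordPass r lam B x w i).val).2)
      (fun i => ((coordPass r lam B x w i).val).1) j i).val := rfl
  rw [h, h1, h2, coordPass_val, varOut]
  split_ifs with h3 h4
  · rfl
  · exact offDiagPass_val _ _ _ h4
  · exact offDiagPass_val _ _ _ (lt_of_le_of_ne (not_lt.1 h4) (Ne.symm h3))

theorem learnReLU_space :
    (learnReLU r lam B x w).space ≤ n * d + 2 * (d * d) + 2 * d + 2 * n + 5 * B + 112 := by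
  have h : (learnReLU r lam B x w).space = (n * d + 2 * (d * d) + 2 * d + 32) +
    max (Finset.univ.sup fun i => (coordPass r lam B x w i).space)
      (max (Finset.univ.sup fun i => Finset.univ.sup fun j =>
        (offDiagPass x (fun i => ((coordPass r lam B x w i).val).2)
        (fun i => ((coordPass r lam B x w i).val).1) i j).space)
        (max (Finset.univ.sup fun _ : Fin d => Finset.univ.sup fun _ : Fin d => 0) 0)) := rfl
  have h1 : (Finset.univ.sup fun i => (coordPass r lam B x w i).space) ≤ 2 * n + 5 * B + 80 :=
    Finset.sup_le fun i _ => coordPass_space r lam B x w i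
  have h2 : (Finset.univ.sup fun i => Finset.univ.sup fun j =>
      (offDiagPass x (fun i => ((coordPass r lam B x w i).val).2)
        (fun i => ((coordPass r lam B x w i).val).1) i j).space) ≤ 0 :=
    Finset.sup_le fun i _ => Finset.sup_le fun j _ => (offDiagPass_space _ _ _ _ _).le
  have h3 : (Finset.univ.sup fun _ : Fin d => Finset.univ.sup fun _ : Fin d => 0) ≤ 0 :=
    Finset.sup_le fun i _ => Finset.sup_le fun j _ => le_rfl
  rw [h]
  omega

theorem learnReLU_time {r : ℝ} (hr : 1 ≤ r) (c : ℝ)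
    (hc : ∀ v ∈ paramBox r, ∀ g, c < g → 0 < v.2 / v.1 + √(1 / v.1) * g)
    (hw : ∀ i j t, ∃ k, c < w i j t k) :
    (learnReLU r lam B x w).time ≤
      ((d * (16 * n + 8 * B ^ 2 + 6 * B + 25) + d * d * (7 * n + 13) +
        ∑ i : Fin d, ∑ j ∈ Finset.range B, ∑ t ∈ Finset.range (n / B),
          (24 + 5 * trials c (w i j t)) : ℕ) : ℕ∞) := by
  have h : (learnReLU r lam B x w).time = ∑ i, ((coordPass r lam B x w i).time + 1) +
      (∑ i, (∑ j, ((offDiagPass x (fun i => ((coordPass r lam B x w i).val).2)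
        (fun i => ((coordPass r lam B x w i).val).1) i j).time + 1) + 1) +
      (∑ _i : Fin d, (∑ _j : Fin d, (1 + 1) + 1) + 0)) := rfl
  rw [h]
  calc _ ≤ ∑ i : Fin d, (((16 * n + 8 * B ^ 2 + 6 * B + 22 + ∑ j ∈ Finset.range B,
        ∑ t ∈ Finset.range (n / B), (24 + 5 * trials c (w i j t)) : ℕ) : ℕ∞) + 1) +
        (∑ _i : Fin d, (∑ _j : Fin d, (((7 * n + 10 : ℕ) : ℕ∞) + 1) + 1) +
        (∑ _i : Fin d, (∑ _j : Fin d, (1 + 1) + 1) + 0)) := by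
        gcongr with i _ i _ j _
        · exact coordPass_time hr lam c B x w i hc hw
        · exact offDiagPass_time _ _ _ _ _
    _ ≤ _ := by
      norm_cast
      simp only [Finset.sum_add_distrib, Finset.sum_const, Finset.card_univ, Fintype.card_fin,
        smul_eq_mul]
      nlinarith

end learnReLU

end MeteredMachine

/-! ## Truncated Gaussians as an exponential family -/

/-- Half of the Gaussian decay absorbs the polynomial, by `u ^ k / k! ≤ exp u` at `u = (b / 2) (1 +
x²)`. -/
theorem integrable_poly_mul_exp (k : ℕ) {b : ℝ} (hb : 0 < b) :
    Integrable fun x : ℝ => (1 + x ^ 2) ^ k * Real.exp (-b * x ^ 2) := by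
  have h1 : Integrable fun x : ℝ =>
      (k.factorial / (b / 2) ^ k * Real.exp (b / 2)) * Real.exp (-(b / 2) * x ^ 2) :=
    (integrable_exp_neg_mul_sq (by positivity)).const_mul _
  refine h1.mono' (by fun_prop) (Filter.Eventually.of_forall fun x => ?_)
  have h2 := Real.pow_div_factorial_le_exp ((b / 2) * (1 + x ^ 2)) (by positivity) k
  rw [div_le_iff₀ (by positivity), mul_pow] at h2
  have h3 : (1 + x ^ 2) ^ k ≤ k.factorial / (b / 2) ^ k * Real.exp (b / 2 * (1 + x ^ 2)) := by
    rw [div_mul_eq_mul_div, le_div_iff₀ (by positivity)]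
    linarith
  rw [Real.norm_of_nonneg (by positivity)]
  calc _ ≤ k.factorial / (b / 2) ^ k * Real.exp (b / 2 * (1 + x ^ 2)) * Real.exp (-b * x ^ 2) := by
        gcongr
    _ = _ := by
      rw [mul_assoc, mul_assoc, ← Real.exp_add, ← Real.exp_add]
      congr 2; ring

/-- The unnormalized Gaussian density with natural parameter `v = (1/σ², μ/σ²)`. -/
noncomputable def gaussWeight (v : ℝ × ℝ) (x : ℝ) : ℝ := Real.exp (-v.1 * x ^ 2 / 2 + v.2 * x)

/-- A bound for all weights with parameter in the box. -/
noncomputable def weightEnv (r x : ℝ) : ℝ := Real.exp (r ^ 3) * Real.exp (-(1 / (4 * r)) * x ^ 2)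

/-- A moment of `weightEnv`. -/
noncomputable def envMoment (r : ℝ) : ℝ := ∫ x, (1 + x ^ 2) ^ 4 * weightEnv r x

theorem gaussWeight_pos (v : ℝ × ℝ) (x : ℝ) : 0 < gaussWeight v x := Real.exp_pos _

theorem weightEnv_pos (r x : ℝ) : 0 < weightEnv r x := by unfold weightEnv; positivity

@[fun_prop] theorem continuous_gaussWeight (v : ℝ × ℝ) : Continuous (gaussWeight v) := by
  unfold gaussWeight; fun_prop

/-- The decay is at least `x² / (2 r)`. One half of it is kept, the other half absorbs the linear
term through `r |x| ≤ x² / (4 r) + r³`. -/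
theorem gaussWeight_le {r : ℝ} (hr : 1 ≤ r) {v : ℝ × ℝ} (hv : v ∈ paramBox r) (x : ℝ) :
    gaussWeight v x ≤ weightEnv r x := by
  obtain ⟨h1, -, h3⟩ := hv
  have hr0 : 0 < r := by linarith
  rw [gaussWeight, weightEnv, ← Real.exp_add, Real.exp_le_exp]
  have h4 : v.2 * x ≤ r * |x| := (le_abs_self _).trans (by rw [abs_mul]; gcongr)
  have h5 : (1 / r) * x ^ 2 ≤ v.1 * x ^ 2 := by gcongr
  have h6 : 0 ≤ (|x| - 2 * r ^ 2) ^ 2 / (4 * r) := by positivity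
  have h7 : (|x| - 2 * r ^ 2) ^ 2 / (4 * r) =
      1 / (4 * r) * x ^ 2 - r * |x| + r ^ 3 := by
    have : x ^ 2 = |x| ^ 2 := (sq_abs x).symm
    rw [this]; field_simp; ring
  have h8 : 1 / r * x ^ 2 = 4 * (1 / (4 * r) * x ^ 2) := by field_simp
  linarith

theorem exp_le_gaussWeight {r : ℝ} {v : ℝ × ℝ} (hv : v ∈ paramBox r) {x : ℝ} (h0 : 0 ≤ x)
    (h1 : x ≤ 1) : Real.exp (-(3 * r / 2)) ≤ gaussWeight v x := by
  obtain ⟨h3, h4, h5⟩ := hv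
  rw [gaussWeight, Real.exp_le_exp]
  have h6 := (abs_le.1 h5).1
  have h7 : 0 ≤ r := (abs_nonneg _).trans h5
  have h8 : x ^ 2 ≤ 1 := by nlinarith
  have h9 : v.1 * x ^ 2 ≤ r := by nlinarith [sq_nonneg x]
  nlinarith

theorem integrable_poly_mul_env (k : ℕ) {r : ℝ} (hr : 1 ≤ r) :
    Integrable fun x : ℝ => (1 + x ^ 2) ^ k * weightEnv r x := by
  have h := (integrable_poly_mul_exp k (b := 1 / (4 * r)) (by positivity)).const_mul
    (Real.exp (r ^ 3))
  refine h.congr (Filter.Eventually.of_forall fun x => ?_)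
  simp only [weightEnv]; ring

theorem integrable_mul_gaussWeight {r : ℝ} (hr : 1 ≤ r) {v : ℝ × ℝ} (hv : v ∈ paramBox r)
    {f : ℝ → ℝ} (hf : Measurable f) {C : ℝ} {k : ℕ} (hC : ∀ x, |f x| ≤ C * (1 + x ^ 2) ^ k) :
    Integrable fun x => f x * gaussWeight v x := by
  refine ((integrable_poly_mul_env k hr).const_mul C).mono' (by fun_prop)
    (Filter.Eventually.of_forall fun x => ?_)
  have h0 := gaussWeight_pos v x
  have h1 := gaussWeight_le hr hv x
  rw [Real.norm_eq_abs, abs_mul, abs_of_pos h0, ← mul_assoc]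
  have h2 := hC x
  have h3 := (abs_nonneg _).trans h2
  gcongr

theorem integrable_gaussWeight {r : ℝ} (hr : 1 ≤ r) {v : ℝ × ℝ} (hv : v ∈ paramBox r) :
    Integrable (gaussWeight v) := by
  have := integrable_mul_gaussWeight hr hv (f := fun _ => 1) measurable_const (C := 1) (k := 0)
    (by simp)
  simpa using this

theorem integral_poly_le_envMoment {r : ℝ} (hr : 1 ≤ r) {k : ℕ} (hk : k ≤ 4) (s : Set ℝ) :
    ∫ x in s, (1 + x ^ 2) ^ k * weightEnv r x ≤ envMoment r := by
  calc _ ≤ ∫ x, (1 + x ^ 2) ^ k * weightEnv r x :=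
        setIntegral_le_integral (integrable_poly_mul_env k hr)
          (Filter.Eventually.of_forall fun x => mul_nonneg (by positivity) (weightEnv_pos r x).le)
    _ ≤ _ := by
      refine integral_mono (integrable_poly_mul_env k hr) (integrable_poly_mul_env 4 hr) fun x => ?_
      have := weightEnv_pos r x
      have h1 : (1 : ℝ) ≤ 1 + x ^ 2 := by nlinarith [sq_nonneg x]
      dsimp only
      gcongr

/-- The normalizing constant of the weight, truncated to `(a, ∞)`. -/
noncomputable def truncMass (a : ℝ) (v : ℝ × ℝ) : ℝ := ∫ x in Set.Ioi a, gaussWeight v x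

/-- The expectation of `f` for the Gaussian with parameter `v`, truncated to `(a, ∞)`. -/
noncomputable def truncExp (a : ℝ) (v : ℝ × ℝ) (f : ℝ → ℝ) : ℝ :=
  (∫ x in Set.Ioi a, f x * gaussWeight v x) / truncMass a v

theorem truncMass_le {r : ℝ} (hr : 1 ≤ r) {v : ℝ × ℝ} (hv : v ∈ paramBox r) (a : ℝ) :
    truncMass a v ≤ envMoment r := by
  refine le_trans ?_ (integral_poly_le_envMoment hr (Nat.zero_le 4) (Set.Ioi a))
  simp only [pow_zero, one_mul]
  refine integral_mono (integrable_gaussWeight hr hv).integrableOn ?_ (gaussWeight_le hr hv)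
  have := (integrable_poly_mul_env 0 hr).integrableOn (s := Set.Ioi a)
  simpa [IntegrableOn] using this

/-- A truncation point `a ≤ 0` never cuts into `(0, 1]`. This is why no constant below depends on
`a`. -/
theorem le_truncMass {r : ℝ} (hr : 1 ≤ r) {v : ℝ × ℝ} (hv : v ∈ paramBox r) {a : ℝ} (ha : a ≤ 0) :
    Real.exp (-(3 * r / 2)) ≤ truncMass a v := by
  have hsub : Set.Ioc (0 : ℝ) 1 ⊆ Set.Ioi a := fun x hx => ha.trans_lt hx.1
  calc Real.exp (-(3 * r / 2)) = ∫ x in Set.Ioc (0 : ℝ) 1, Real.exp (-(3 * r / 2)) := by simp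
    _ ≤ ∫ x in Set.Ioc (0 : ℝ) 1, gaussWeight v x :=
      setIntegral_mono_on (by simp) (integrable_gaussWeight hr hv).integrableOn measurableSet_Ioc
        fun x hx => exp_le_gaussWeight hv hx.1.le hx.2
    _ ≤ _ := setIntegral_mono_set (integrable_gaussWeight hr hv).integrableOn
        (Filter.Eventually.of_forall fun x => (gaussWeight_pos v x).le) hsub.eventuallyLE

/-! ### Symmetrization; strong monotonicity and Lipschitz continuity of the mean statistics -/

theorem integral_antisymm (ρ : Measure ℝ) [SFinite ρ] {f u w : ℝ → ℝ} (hu : Integrable u ρ)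
    (hw : Integrable w ρ) (hfu : Integrable (fun x => f x * u x) ρ)
    (hfw : Integrable (fun x => f x * w x) ρ) :
    ∫ p, (f p.1 - f p.2) * (u p.1 * w p.2 - w p.1 * u p.2) ∂(ρ.prod ρ) =
      2 * ((∫ x, f x * u x ∂ρ) * (∫ x, w x ∂ρ) - (∫ x, f x * w x ∂ρ) * ∫ x, u x ∂ρ) := by
  have e : ∀ p : ℝ × ℝ, (f p.1 - f p.2) * (u p.1 * w p.2 - w p.1 * u p.2) =
      (f p.1 * u p.1 * w p.2 - f p.1 * w p.1 * u p.2) +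
        (w p.1 * (f p.2 * u p.2) - u p.1 * (f p.2 * w p.2)) := fun p => by ring
  simp_rw [e]
  have i1 : Integrable (fun p : ℝ × ℝ => f p.1 * u p.1 * w p.2 - f p.1 * w p.1 * u p.2)
      (ρ.prod ρ) := (hfu.mul_prod hw).sub (hfw.mul_prod hu)
  have i2 : Integrable (fun p : ℝ × ℝ => w p.1 * (f p.2 * u p.2) - u p.1 * (f p.2 * w p.2))
      (ρ.prod ρ) := (hw.mul_prod hfu).sub (hu.mul_prod hfw)
  rw [integral_add i1 i2, integral_sub (hfu.mul_prod hw) (hfw.mul_prod hu),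
    integral_sub (hw.mul_prod hfu) (hu.mul_prod hfw), integral_prod_mul (fun x => f x * u x) w,
    integral_prod_mul (fun x => f x * w x) u, integral_prod_mul w (fun x => f x * u x),
    integral_prod_mul u (fun x => f x * w x)]
  ring

/-- Over a common denominator the numerator is antisymmetric in the two parameters; symmetrizing it
over pairs of points leaves only increments of `f` and of the swapped weights, whose signs and sizes
can be compared. -/
theorem truncExp_sub {r : ℝ} (hr : 1 ≤ r) {v v' : ℝ × ℝ} (hv : v ∈ paramBox r)
    (hv' : v' ∈ paramBox r) {a : ℝ} (ha : a ≤ 0) {f : ℝ → ℝ} (hf : Measurable f) {C : ℝ} {k : ℕ}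
    (hC : ∀ x, |f x| ≤ C * (1 + x ^ 2) ^ k) :
    truncExp a v f - truncExp a v' f =
      (∫ p, (f p.1 - f p.2) * (gaussWeight v p.1 * gaussWeight v' p.2 -
        gaussWeight v' p.1 * gaussWeight v p.2)
        ∂((volume.restrict (Set.Ioi a)).prod (volume.restrict (Set.Ioi a)))) /
        (2 * truncMass a v * truncMass a v') := by
  rw [integral_antisymm _ (integrable_gaussWeight hr hv).integrableOn
    (integrable_gaussWeight hr hv').integrableOn
    (integrable_mul_gaussWeight hr hv hf hC).integrableOn
    (integrable_mul_gaussWeight hr hv' hf hC).integrableOn]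
  have h1 := (Real.exp_pos _).trans_le (le_truncMass hr hv ha)
  have h2 := (Real.exp_pos _).trans_le (le_truncMass hr hv' ha)
  rw [truncExp, truncExp, div_sub_div _ _ h1.ne' h2.ne', mul_assoc 2, mul_div_mul_left _ _ two_ne_zero]
  simp only [truncMass]
  ring

/-- The exponents of the swapped products differ by the increment of the statistic in direction `v -
v'`. If `f` is that statistic, the integrand of `truncExp_sub` becomes `(P - Q) (exp P - exp Q) ≥
0`. -/
theorem weight_prod_sub (v v' : ℝ × ℝ) (x y : ℝ) :
    ∃ P Q : ℝ, gaussWeight v x * gaussWeight v' y = Real.exp P ∧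
      gaussWeight v' x * gaussWeight v y = Real.exp Q ∧
      P - Q = (-(v.1 - v'.1) * x ^ 2 / 2 + (v.2 - v'.2) * x) -
        (-(v.1 - v'.1) * y ^ 2 / 2 + (v.2 - v'.2) * y) :=
  ⟨_, _, (Real.exp_add _ _).symm, (Real.exp_add _ _).symm, by ring⟩

theorem sq_mul_min_le (P Q : ℝ) :
    (P - Q) ^ 2 * min (Real.exp P) (Real.exp Q) ≤ (P - Q) * (Real.exp P - Real.exp Q) := by
  have key : ∀ s t : ℝ, s ≤ t → (t - s) * Real.exp s ≤ Real.exp t - Real.exp s := fun s t _ => by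
    have h1 := Real.add_one_le_exp (t - s)
    have h2 : Real.exp t = Real.exp (t - s) * Real.exp s := by rw [← Real.exp_add]; simp
    rw [h2]; nlinarith [Real.exp_pos s]
  rcases le_total P Q with h | h
  · rw [min_eq_left (Real.exp_le_exp.2 h)]
    nlinarith [key P Q h]
  · rw [min_eq_right (Real.exp_le_exp.2 h)]
    nlinarith [key Q P h]

theorem abs_exp_sub_le (P Q : ℝ) :
    |Real.exp P - Real.exp Q| ≤ |P - Q| * max (Real.exp P) (Real.exp Q) := by
  have key : ∀ s t : ℝ, s ≤ t → Real.exp t - Real.exp s ≤ (t - s) * Real.exp t := fun s t _ => by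
    have h1 := Real.add_one_le_exp (s - t)
    have h2 : Real.exp s = Real.exp (s - t) * Real.exp t := by rw [← Real.exp_add]; simp
    rw [h2]; nlinarith [Real.exp_pos t]
  rcases le_total P Q with h | h
  · rw [max_eq_right (Real.exp_le_exp.2 h), abs_of_nonpos (by linarith [Real.exp_le_exp.2 h]),
      abs_of_nonpos (by linarith)]
    linarith [key P Q h]
  · rw [max_eq_left (Real.exp_le_exp.2 h), abs_of_nonneg (by linarith [Real.exp_le_exp.2 h]),
      abs_of_nonneg (by linarith)]
    exact key Q P h

/-- The mean of a squared increment is twice the variance, here under the uniform law on `(0, 1]`.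
This is `integral_antisymm` with `u = f` and `w = 1`. -/
theorem integral_unit_square (p q : ℝ) :
    ∫ z, ((-p * z.1 ^ 2 / 2 + q * z.1) - (-p * z.2 ^ 2 / 2 + q * z.2)) ^ 2
      ∂((volume.restrict (Set.Ioc (0 : ℝ) 1)).prod (volume.restrict (Set.Ioc (0 : ℝ) 1))) =
      2 * (p ^ 2 / 45 - p * q / 12 + q ^ 2 / 12) := by
  have hc : ∀ g : ℝ → ℝ, Continuous g → Integrable g (volume.restrict (Set.Ioc (0 : ℝ) 1)) :=
    fun g hg => (hg.integrableOn_Icc (a := 0) (b := 1)).mono_set Set.Ioc_subset_Icc_self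
  have h := integral_antisymm (volume.restrict (Set.Ioc (0 : ℝ) 1))
    (f := fun x => -p * x ^ 2 / 2 + q * x) (u := fun x => -p * x ^ 2 / 2 + q * x) (w := fun _ => 1)
    (hc _ (by fun_prop)) (hc _ (by fun_prop)) (hc _ (by fun_prop)) (hc _ (by fun_prop))
  simp only [mul_one, one_mul] at h
  simp only [sq ((-p * _ ^ 2 / 2 + q * _) - _)]
  rw [h]
  simp only [← intervalIntegral.integral_of_le zero_le_one]
  have e1 : ∀ x : ℝ, (-p * x ^ 2 / 2 + q * x) * (-p * x ^ 2 / 2 + q * x) =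
      p ^ 2 / 4 * x ^ 4 + (-p * q) * x ^ 3 + q ^ 2 * x ^ 2 := fun x => by ring
  have e2 : ∀ x : ℝ, -p * x ^ 2 / 2 + q * x = (-p / 2) * x ^ 2 + q * x ^ 1 := fun x => by ring
  have i1 : ∫ x in (0 : ℝ)..1, (-p * x ^ 2 / 2 + q * x) * (-p * x ^ 2 / 2 + q * x) =
      p ^ 2 / 20 - p * q / 4 + q ^ 2 / 3 := by
    simp_rw [e1]
    rw [intervalIntegral.integral_add (by apply Continuous.intervalIntegrable; fun_prop)
      (by apply Continuous.intervalIntegrable; fun_prop),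
      intervalIntegral.integral_add (by apply Continuous.intervalIntegrable; fun_prop)
      (by apply Continuous.intervalIntegrable; fun_prop)]
    simp only [intervalIntegral.integral_const_mul, integral_pow]
    norm_num; ring
  have i2 : ∫ x in (0 : ℝ)..1, (-p * x ^ 2 / 2 + q * x) = -p / 6 + q / 2 := by
    simp_rw [e2]
    rw [intervalIntegral.integral_add (by apply Continuous.intervalIntegrable; fun_prop)
      (by apply Continuous.intervalIntegrable; fun_prop)]
    simp only [intervalIntegral.integral_const_mul, integral_pow]
    norm_num; ring
  rw [i1, i2]
  simp
  ring

/-- The form is definite because `x` and `x²` are not affinely dependent on an interval. Its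
discriminant is only slightly negative (`1/144 < 4/540`), hence the small constant. -/
theorem unit_square_form_ge (p q : ℝ) :
    (p ^ 2 + q ^ 2) / 1000 ≤ p ^ 2 / 45 - p * q / 12 + q ^ 2 / 12 := by
  nlinarith [sq_nonneg (p - 2 * q), sq_nonneg (p - 1.95 * q), sq_nonneg q, sq_nonneg p]

theorem abs_statistic_le (p q x : ℝ) :
    |-p * x ^ 2 / 2 + q * x| ≤ (|p| + |q|) * (1 + x ^ 2) ^ 1 := by
  have h1 : |x| ≤ 1 + x ^ 2 := by nlinarith [sq_nonneg (|x| - 1), sq_abs x]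
  calc |-p * x ^ 2 / 2 + q * x| ≤ |-p * x ^ 2 / 2| + |q * x| := abs_add_le _ _
    _ = |p| * x ^ 2 / 2 + |q| * |x| := by
      rw [abs_div, abs_mul, abs_mul, abs_neg, abs_of_nonneg (sq_nonneg x)]; norm_num
    _ ≤ _ := by nlinarith [abs_nonneg p, abs_nonneg q, sq_nonneg x]

/-- The constant of strong monotonicity. -/
noncomputable def monoConst (r : ℝ) : ℝ := Real.exp (-(3 * r)) / (1000 * envMoment r ^ 2)

/-- The Lipschitz constant. -/
noncomputable def lipConst (r : ℝ) : ℝ := 2 * envMoment r ^ 2 * Real.exp (3 * r)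

theorem envMoment_pos {r : ℝ} (hr : 1 ≤ r) : 0 < envMoment r := by
  have hv : ((1 : ℝ), (0 : ℝ)) ∈ paramBox r := sgdIter_mem hr 0 0 0 0 0
  exact ((Real.exp_pos _).trans_le (le_truncMass hr hv le_rfl)).trans_le (truncMass_le hr hv 0)

theorem monoConst_pos {r : ℝ} (hr : 1 ≤ r) : 0 < monoConst r := by
  have := envMoment_pos hr
  unfold monoConst; positivity

/-- The symmetrized integrand is nonnegative, so it may be restricted to the unit square, where
products of weights are at least `exp (-3 r)`. There it dominates a multiple of the squared
increment of the statistic, which `integral_unit_square` evaluates. -/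
theorem truncExp_strongMono {r : ℝ} (hr : 1 ≤ r) {v v' : ℝ × ℝ} (hv : v ∈ paramBox r)
    (hv' : v' ∈ paramBox r) {a : ℝ} (ha : a ≤ 0) :
    monoConst r * ((v.1 - v'.1) ^ 2 + (v.2 - v'.2) ^ 2) ≤
      truncExp a v (fun x => -(v.1 - v'.1) * x ^ 2 / 2 + (v.2 - v'.2) * x) -
      truncExp a v' (fun x => -(v.1 - v'.1) * x ^ 2 / 2 + (v.2 - v'.2) * x) := by
  set p := v.1 - v'.1 with hp
  set q := v.2 - v'.2 with hq
  set τ : ℝ → ℝ := fun x => -p * x ^ 2 / 2 + q * x with hτ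
  have hτm : Measurable τ := by fun_prop
  rw [truncExp_sub hr hv hv' ha hτm (abs_statistic_le p q)]
  have m1 := (Real.exp_pos _).trans_le (le_truncMass hr hv ha)
  have m2 := (Real.exp_pos _).trans_le (le_truncMass hr hv' ha)
  have m3 := truncMass_le hr hv a
  have m4 := truncMass_le hr hv' a
  set G : ℝ × ℝ → ℝ := fun z => (τ z.1 - τ z.2) * (gaussWeight v z.1 * gaussWeight v' z.2 -
        gaussWeight v' z.1 * gaussWeight v z.2) with hG
  have hint : Integrable G ((volume.restrict (Set.Ioi a)).prod (volume.restrict (Set.Ioi a))) := by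
    have i1 := (integrable_mul_gaussWeight hr hv hτm (abs_statistic_le p q)).integrableOn
      (s := Set.Ioi a)
    have i2 := (integrable_mul_gaussWeight hr hv' hτm (abs_statistic_le p q)).integrableOn
      (s := Set.Ioi a)
    have j1 := (integrable_gaussWeight hr hv).integrableOn (s := Set.Ioi a)
    have j2 := (integrable_gaussWeight hr hv').integrableOn (s := Set.Ioi a)
    have := ((i1.mul_prod j2).sub (i2.mul_prod j1)).add ((j2.mul_prod i1).sub (j1.mul_prod i2))
    refine this.congr (Filter.Eventually.of_forall fun z => ?_)
    simp only [hG, Pi.add_apply, Pi.sub_apply]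
    ring
  have hnn : ∀ z, (τ z.1 - τ z.2) ^ 2 * min (gaussWeight v z.1 * gaussWeight v' z.2)
      (gaussWeight v' z.1 * gaussWeight v z.2) ≤ G z := fun z => by
    obtain ⟨P, Q, h1, h2, h3⟩ := weight_prod_sub v v' z.1 z.2
    simp only [hG]
    rw [h1, h2, ← h3]
    exact sq_mul_min_le P Q
  have hnn0 : ∀ z, 0 ≤ G z := fun z => le_trans (mul_nonneg (sq_nonneg _) (le_min
    (mul_pos (gaussWeight_pos _ _) (gaussWeight_pos _ _)).le
    (mul_pos (gaussWeight_pos _ _) (gaussWeight_pos _ _)).le)) (hnn z)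
  have hsub : Set.Ioc (0 : ℝ) 1 ⊆ Set.Ioi a := fun x hx => ha.trans_lt hx.1
  have hmain : Real.exp (-(3 * r)) * (2 * ((p ^ 2 + q ^ 2) / 1000)) ≤
      ∫ z, G z ∂((volume.restrict (Set.Ioi a)).prod (volume.restrict (Set.Ioi a))) := by
    calc _ ≤ Real.exp (-(3 * r)) * (2 * (p ^ 2 / 45 - p * q / 12 + q ^ 2 / 12)) := by
          gcongr; exact unit_square_form_ge p q
      _ = ∫ z in Set.Ioc (0 : ℝ) 1 ×ˢ Set.Ioc (0 : ℝ) 1,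
          Real.exp (-(3 * r)) * (τ z.1 - τ z.2) ^ 2 := by
          rw [integral_const_mul, Measure.volume_eq_prod, ← Measure.prod_restrict]
          rw [integral_unit_square]
      _ ≤ ∫ z in Set.Ioc (0 : ℝ) 1 ×ˢ Set.Ioc (0 : ℝ) 1, G z := by
          have hG' : IntegrableOn G (Set.Ioc (0 : ℝ) 1 ×ˢ Set.Ioc (0 : ℝ) 1) := by
            rw [Measure.prod_restrict, ← Measure.volume_eq_prod] at hint
            exact IntegrableOn.mono_set hint (Set.prod_mono hsub hsub)
          refine setIntegral_mono_on ?_ hG' (measurableSet_Ioc.prod measurableSet_Ioc) ?_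
          · have hc : Continuous fun z : ℝ × ℝ => Real.exp (-(3 * r)) * (τ z.1 - τ z.2) ^ 2 := by
              fun_prop
            exact (hc.continuousOn.integrableOn_compact
              (isCompact_Icc.prod isCompact_Icc)).mono_set
              (Set.prod_mono Set.Ioc_subset_Icc_self Set.Ioc_subset_Icc_self)
          · intro z hz
            refine le_trans ?_ (hnn z)
            rw [mul_comm]
            refine mul_le_mul_of_nonneg_left ?_ (sq_nonneg _)
            have e : Real.exp (-(3 * r)) = Real.exp (-(3 * r / 2)) * Real.exp (-(3 * r / 2)) := by
              rw [← Real.exp_add]; congr 1; ring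
            rw [e]
            have b1 := exp_le_gaussWeight hv hz.1.1.le hz.1.2
            have b2 := exp_le_gaussWeight hv hz.2.1.le hz.2.2
            have b3 := exp_le_gaussWeight hv' hz.1.1.le hz.1.2
            have b4 := exp_le_gaussWeight hv' hz.2.1.le hz.2.2
            have := Real.exp_pos (-(3 * r / 2))
            refine le_min ?_ ?_
            · exact mul_le_mul b1 b4 this.le (this.le.trans b1)
            · exact mul_le_mul b3 b2 this.le (this.le.trans b3)
      _ ≤ _ := by
          rw [Measure.prod_restrict, ← Measure.volume_eq_prod]
          rw [Measure.prod_restrict, ← Measure.volume_eq_prod] at hint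
          exact setIntegral_mono_set hint (Filter.Eventually.of_forall hnn0)
            (Set.prod_mono hsub hsub).eventuallyLE
  have hpos := envMoment_pos hr
  calc monoConst r * (p ^ 2 + q ^ 2)
      = Real.exp (-(3 * r)) * (2 * ((p ^ 2 + q ^ 2) / 1000)) /
        (2 * envMoment r * envMoment r) := by
        rw [monoConst]; field_simp
    _ ≤ _ := by
      have hI := le_trans (by positivity) hmain
      gcongr

/-- The same double integral, now bounded from above: `|exp P - exp Q| ≤ |P - Q| max (exp P) (exp
Q)`, with `P - Q` linear in `v - v'` and the weights below the common envelope. -/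
theorem truncExp_lipschitz {r : ℝ} (hr : 1 ≤ r) {v v' : ℝ × ℝ} (hv : v ∈ paramBox r)
    (hv' : v' ∈ paramBox r) {a : ℝ} (ha : a ≤ 0) {f : ℝ → ℝ} (hf : Measurable f)
    (hC : ∀ x, |f x| ≤ 1 + x ^ 2) :
    |truncExp a v f - truncExp a v' f| ≤ lipConst r * (|v.1 - v'.1| + |v.2 - v'.2|) := by
  rw [truncExp_sub hr hv hv' ha hf (C := 1) (k := 1) (by simpa using hC)]
  set D := |v.1 - v'.1| + |v.2 - v'.2| with hD
  have hD0 : 0 ≤ D := by positivity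
  have m1 := le_truncMass hr hv ha
  have m2 := le_truncMass hr hv' ha
  have hpos := envMoment_pos hr
  have key : ∀ z : ℝ × ℝ, |(f z.1 - f z.2) * (gaussWeight v z.1 * gaussWeight v' z.2 -
        gaussWeight v' z.1 * gaussWeight v z.2)| ≤
      4 * D * (((1 + z.1 ^ 2) ^ 2 * weightEnv r z.1) * ((1 + z.2 ^ 2) ^ 2 * weightEnv r z.2)) := by
    intro z
    obtain ⟨P, Q, h1, h2, h3⟩ := weight_prod_sub v v' z.1 z.2
    set s := 1 + z.1 ^ 2 with hs
    set t := 1 + z.2 ^ 2 with ht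
    have hs1 : 1 ≤ s := by nlinarith [sq_nonneg z.1]
    have ht1 : 1 ≤ t := by nlinarith [sq_nonneg z.2]
    have hst : s + t ≤ 2 * (s * t) := by nlinarith
    have b1 : |f z.1 - f z.2| ≤ 2 * (s * t) :=
      (abs_sub _ _).trans ((add_le_add (hC _) (hC _)).trans hst)
    have b2 : |P - Q| ≤ D * (2 * (s * t)) := by
      rw [h3]
      refine (abs_sub _ _).trans ?_
      have c1 := abs_statistic_le (v.1 - v'.1) (v.2 - v'.2) z.1
      have c2 := abs_statistic_le (v.1 - v'.1) (v.2 - v'.2) z.2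
      rw [pow_one] at c1 c2
      calc _ ≤ D * s + D * t := add_le_add c1 c2
        _ ≤ _ := by nlinarith
    have e0 := weightEnv_pos r z.1
    have e1 := weightEnv_pos r z.2
    have b3 : max (Real.exp P) (Real.exp Q) ≤ weightEnv r z.1 * weightEnv r z.2 := by
      rw [← h1, ← h2]
      refine max_le ?_ ?_
      · exact mul_le_mul (gaussWeight_le hr hv _) (gaussWeight_le hr hv' _)
          (gaussWeight_pos _ _).le e0.le
      · exact mul_le_mul (gaussWeight_le hr hv' _) (gaussWeight_le hr hv _)
          (gaussWeight_pos _ _).le e0.le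
    rw [abs_mul, h1, h2]
    calc _ ≤ (2 * (s * t)) * ((D * (2 * (s * t))) * (weightEnv r z.1 * weightEnv r z.2)) := by
          gcongr
          exact (abs_exp_sub_le P Q).trans (by gcongr)
      _ = _ := by ring
  have hint : Integrable (fun z : ℝ × ℝ => 4 * D * (((1 + z.1 ^ 2) ^ 2 * weightEnv r z.1) *
      ((1 + z.2 ^ 2) ^ 2 * weightEnv r z.2)))
      ((volume.restrict (Set.Ioi a)).prod (volume.restrict (Set.Ioi a))) :=
    (((integrable_poly_mul_env 2 hr).integrableOn (s := Set.Ioi a)).mul_prod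
      ((integrable_poly_mul_env 2 hr).integrableOn (s := Set.Ioi a))).const_mul _
  have hI := norm_integral_le_of_norm_le (f := fun z : ℝ × ℝ => (f z.1 - f z.2) *
    (gaussWeight v z.1 * gaussWeight v' z.2 - gaussWeight v' z.1 * gaussWeight v z.2)) hint
    (Filter.Eventually.of_forall key)
  rw [integral_const_mul, integral_prod_mul (fun x : ℝ => (1 + x ^ 2) ^ 2 * weightEnv r x)
    (fun x : ℝ => (1 + x ^ 2) ^ 2 * weightEnv r x), Real.norm_eq_abs] at hI
  have hM := integral_poly_le_envMoment hr (k := 2) (by norm_num) (Set.Ioi a)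
  have hM0 : 0 ≤ ∫ x in Set.Ioi a, (1 + x ^ 2) ^ 2 * weightEnv r x :=
    integral_nonneg fun x => mul_nonneg (by positivity) (weightEnv_pos r x).le
  have m0 := Real.exp_pos (-(3 * r / 2))
  have m3 := m0.trans_le m1
  rw [abs_div, abs_of_pos (a := 2 * truncMass a v * truncMass a v')
    (mul_pos (mul_pos two_pos (m0.trans_le m1)) (m0.trans_le m2))]
  calc _ ≤ 4 * D * (envMoment r * envMoment r) /
        (2 * Real.exp (-(3 * r / 2)) * Real.exp (-(3 * r / 2))) := by
        gcongr
        exact hI.trans (by gcongr)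
    _ = lipConst r * D := by
      have e : Real.exp (3 * r) * (Real.exp (-(3 * r / 2)) * Real.exp (-(3 * r / 2))) = 1 := by
        rw [← Real.exp_add, ← Real.exp_add, ← Real.exp_zero]; congr 1; ring
      rw [lipConst, div_eq_iff (by positivity)]
      linear_combination (-4 * D * envMoment r ^ 2) * e

theorem abs_truncExp_le {r : ℝ} (hr : 1 ≤ r) {v : ℝ × ℝ} (hv : v ∈ paramBox r) {a : ℝ}
    (ha : a ≤ 0) {f : ℝ → ℝ} {k : ℕ} (hk : k ≤ 4) (hC : ∀ x, |f x| ≤ (1 + x ^ 2) ^ k) :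
    |truncExp a v f| ≤ envMoment r * Real.exp (3 * r / 2) := by
  have m1 := le_truncMass hr hv ha
  have m0 := Real.exp_pos (-(3 * r / 2))
  have h := norm_integral_le_of_norm_le (f := fun x => f x * gaussWeight v x)
    ((integrable_poly_mul_env k hr).integrableOn (s := Set.Ioi a))
    (Filter.Eventually.of_forall fun x => by
      rw [norm_mul, Real.norm_eq_abs, Real.norm_of_nonneg (gaussWeight_pos v x).le]
      exact mul_le_mul (hC x) (gaussWeight_le hr hv x) (gaussWeight_pos v x).le (by positivity))
  have h2 := h.trans (integral_poly_le_envMoment hr hk _)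
  have hpos := envMoment_pos hr
  rw [truncExp, abs_div, abs_of_pos (m0.trans_le m1), ← div_inv_eq_mul, ← Real.exp_neg]
  gcongr
  exact h2

/-! ## The law of the rejection sampler -/

/-- The standard Gaussian measure on the line. -/
noncomputable abbrev stdG : Measure ℝ := gaussianReal 0 1

/-- The law of a sequence of independent standard Gaussians. -/
noncomputable abbrev stdGSeq : Measure (ℕ → ℝ) := Measure.infinitePi fun _ : ℕ => stdG

theorem stdG_pos_of_isOpen {A : Set ℝ} (hA : IsOpen A) (hne : A.Nonempty) : 0 < stdG A := by
  rw [pos_iff_ne_zero]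
  intro h
  exact (hA.measure_pos volume hne).ne' (gaussianReal_absolutelyContinuous' 0 one_ne_zero h)

/-- The standard Gaussian draws that are accepted. -/
def acceptSet (a μ σ : ℝ) : Set ℝ := {g | a < μ + σ * g}

theorem measurableSet_acceptSet (a μ σ : ℝ) : MeasurableSet (acceptSet a μ σ) :=
  measurableSet_lt measurable_const (by fun_prop)

theorem acceptSet_pos (a μ : ℝ) {σ : ℝ} (hσ : 0 < σ) : 0 < stdG (acceptSet a μ σ) := by
  refine stdG_pos_of_isOpen (isOpen_lt continuous_const (by fun_prop)) ⟨(a - μ + 1) / σ, ?_⟩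
  simp only [acceptSet, Set.mem_ofPred_eq]
  field_simp
  linarith

theorem truncNormal_mem_iff (a μ σ : ℝ) (w : ℕ → ℝ) (hw : ∃ k, w k ∈ acceptSet a μ σ)
    (E : Set ℝ) : (truncNormal a μ σ w).val ∈ E ↔
      ∃ k, (∀ j < k, w j ∉ acceptSet a μ σ) ∧ w k ∈ acceptSet a μ σ ∧ μ + σ * w k ∈ E := by
  classical
  have hw' : ∃ k, a < μ + σ * w k := hw
  rw [truncNormal_val, dif_pos hw']
  constructor
  · intro h
    exact ⟨Nat.find hw', fun j hj => Nat.find_min hw' hj, Nat.find_spec hw', h⟩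
  · rintro ⟨k, h1, h2, h3⟩
    have : Nat.find hw' = k := (Nat.find_eq_iff hw').2 ⟨h2, h1⟩
    rwa [this]

theorem measurable_truncNormal {Ω : Type*} [MeasurableSpace Ω] {a μ σ : Ω → ℝ} {w : Ω → ℕ → ℝ}
    (ha : Measurable a) (hμ : Measurable μ) (hσ : Measurable σ) (hw : Measurable w) :
    Measurable fun ω => (truncNormal (a ω) (μ ω) (σ ω) (w ω)).val := by
  classical
  have hwk : ∀ k, Measurable fun ω => w ω k := fun k => (measurable_pi_apply k).comp hw
  have hacc : ∀ k, MeasurableSet {ω | a ω < μ ω + σ ω * w ω k} := fun k =>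
    measurableSet_lt ha (hμ.add (hσ.mul (hwk k)))
  have hex : MeasurableSet {ω | ∃ k, a ω < μ ω + σ ω * w ω k} := by
    rw [Set.ofPred_exists]; exact MeasurableSet.iUnion hacc
  -- The alternative that no draw is ever accepted gives `p` a witness for every `ω`, as
  -- `Measurable.find` requires.
  set p : ℕ → Ω → Prop := fun k ω => a ω < μ ω + σ ω * w ω k ∨
    ¬ ∃ k, a ω < μ ω + σ ω * w ω k with hp
  have hpe : ∀ ω, ∃ k, p k ω := fun ω => by
    by_cases h : ∃ k, a ω < μ ω + σ ω * w ω k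
    · exact h.imp fun k hk => Or.inl hk
    · exact ⟨0, Or.inr h⟩
  have hm := Measurable.find (f := fun k ω => if ∃ k, a ω < μ ω + σ ω * w ω k
    then μ ω + σ ω * w ω k else 0) (p := p)
    (fun k => Measurable.ite hex (hμ.add (hσ.mul (hwk k))) measurable_const)
    (fun k => (hacc k).union hex.compl) hpe
  have heq : (fun ω => (truncNormal (a ω) (μ ω) (σ ω) (w ω)).val) = fun ω =>
      if ∃ k, a ω < μ ω + σ ω * w ω k then μ ω + σ ω * w ω (Nat.find (hpe ω)) else 0 := ?_
  · rw [heq]; exact hm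
  funext ω
  rw [truncNormal_val]
  by_cases h : ∃ k, a ω < μ ω + σ ω * w ω k
  · rw [if_pos h, dif_pos h]
    have : Nat.find (hpe ω) = Nat.find h := by
      refine Nat.find_congr' ?_
      intro k
      simp only [hp]
      constructor
      · rintro (h1 | h1)
        · exact h1
        · exact absurd h h1
      · exact Or.inl
    rw [this]
  · rw [if_neg h, dif_neg h]

theorem ae_exists_mem_stdGSeq {A : Set ℝ} (hA : MeasurableSet A) (hpos : 0 < stdG A) :
    ∀ᵐ w ∂stdGSeq, ∃ k, w k ∈ A := by
  have hlt : stdG Aᶜ < 1 := by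
    rw [prob_compl_eq_one_sub hA]
    exact ENNReal.sub_lt_self ENNReal.one_ne_top one_ne_zero hpos.ne'
  rw [ae_iff]
  refine le_antisymm (ge_of_tendsto' (ENNReal.tendsto_pow_atTop_nhds_zero_of_lt_one hlt)
    fun n => ?_) zero_le
  calc stdGSeq {w | ¬ ∃ k, w k ∈ A} ≤ stdGSeq (Set.pi (Finset.range n) fun _ => Aᶜ) := by
        refine measure_mono fun w hw k _ => ?_
        simp only [Set.mem_ofPred_eq, not_exists] at hw
        exact hw k
    _ = stdG Aᶜ ^ n := by
        rw [Measure.infinitePi_pi _ fun _ _ => hA.compl]; simp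

/-- Split by the index of the first accepted draw. The pieces are disjoint cylinders of probability
`P(Aᶜ) ^ k P(A ∩ ⋯)`, and the geometric series turns the factor into `1 / P(A)`. -/
theorem map_truncNormal (a μ : ℝ) {σ : ℝ} (hσ : 0 < σ) :
    stdGSeq.map (fun w => (truncNormal a μ σ w).val) =
      (stdG[|acceptSet a μ σ]).map fun g => μ + σ * g := by
  classical
  set A := acceptSet a μ σ with hAdef
  have hA : MeasurableSet A := measurableSet_acceptSet a μ σ
  have hpos : 0 < stdG A := acceptSet_pos a μ hσ
  ext E hE
  have hf : Measurable fun g : ℝ => μ + σ * g := by fun_prop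
  have hZ : Measurable fun w => (truncNormal a μ σ w).val :=
    measurable_truncNormal measurable_const measurable_const measurable_const measurable_id
  rw [Measure.map_apply hZ hE, Measure.map_apply hf hE, cond_apply hA]
  -- The cylinder for `k`: draws before `k` are rejected, draw `k` is accepted and lands in `E`.
  set t : ℕ → ℕ → Set ℝ := fun k j =>
    if j = k then A ∩ (fun g => μ + σ * g) ⁻¹' E else Aᶜ with ht
  have htm : ∀ k j, MeasurableSet (t k j) := fun k j => by
    simp only [ht]; split_ifs
    · exact hA.inter (hf hE)
    · exact hA.compl
  have hset : (fun w => (truncNormal a μ σ w).val) ⁻¹' E =ᵐ[stdGSeq]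
      ⋃ k, Set.pi (Finset.range (k + 1)) (t k) := by
    filter_upwards [ae_exists_mem_stdGSeq hA hpos] with w hw
    refine propext ?_
    change (truncNormal a μ σ w).val ∈ E ↔ w ∈ ⋃ k, Set.pi (Finset.range (k + 1)) (t k)
    rw [truncNormal_mem_iff a μ σ w hw, Set.mem_iUnion]
    refine exists_congr fun k => ?_
    simp only [ht, Set.mem_pi, Finset.coe_range, Set.mem_Iio]
    constructor
    · rintro ⟨h1, h2, h3⟩ j hj
      split_ifs with h
      · subst h; exact ⟨h2, h3⟩
      · exact h1 j (by omega)
    · intro h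
      have h1 := h k (by omega)
      rw [if_pos rfl] at h1
      refine ⟨fun j hj => ?_, h1.1, h1.2⟩
      have h2 := h j (by omega)
      rw [if_neg (by omega)] at h2
      exact h2
  rw [measure_congr hset, measure_iUnion]
  · have hk : ∀ k, stdGSeq (Set.pi (Finset.range (k + 1)) (t k)) =
        stdG Aᶜ ^ k * stdG (A ∩ (fun g => μ + σ * g) ⁻¹' E) := fun k => by
      rw [Measure.infinitePi_pi _ fun j _ => htm k j, Finset.prod_range_succ]
      congr 1
      · rw [Finset.prod_congr rfl (g := fun _ => stdG Aᶜ)]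
        · simp
        · intro j hj
          simp only [ht]
          rw [if_neg (by have := Finset.mem_range.1 hj; omega)]
      · simp [ht]
    simp_rw [hk]
    rw [ENNReal.tsum_mul_right, ENNReal.tsum_geometric, prob_compl_eq_one_sub hA,
      ENNReal.sub_sub_cancel ENNReal.one_ne_top prob_le_one]
  · intro k l hkl
    rw [Function.onFun, Set.disjoint_left]
    have aux : ∀ k l : ℕ, k < l → ∀ w : ℕ → ℝ, w ∈ Set.pi (Finset.range (k + 1)) (t k) →
        w ∉ Set.pi (Finset.range (l + 1)) (t l) := fun k l h w h1 h2 => by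
      have h3 := h1 k (by simp)
      have h4 := h2 k (by simp; omega)
      simp only [ht, if_true] at h3
      simp only [ht] at h4
      rw [if_neg (by omega)] at h4
      exact h4 h3.1
    intro w h1 h2
    rcases lt_or_gt_of_ne hkl with h | h
    · exact aux k l h w h1 h2
    · exact aux l k h w h2 h1
  · intro k
    exact MeasurableSet.pi (Finset.range (k + 1)).countable_toSet fun j _ => htm k j

theorem gaussianPDFReal_eq_weight {v : ℝ × ℝ} (hv : 0 < v.1) (x : ℝ) :
    gaussianPDFReal (v.2 / v.1) (Real.toNNReal (1 / v.1)) x =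
      (√(2 * Real.pi * (1 / v.1)))⁻¹ * Real.exp (-(v.2 ^ 2 / (2 * v.1))) * gaussWeight v x := by
  rw [gaussianPDFReal, Real.coe_toNNReal _ (by positivity), gaussWeight,
    mul_assoc (√_)⁻¹, ← Real.exp_add]
  congr 2
  field_simp
  ring

/-- The Gaussian density is `c` times the weight, and `c` cancels between the integral and the
acceptance probability, which is the case `h = 1` of `key`. -/
theorem integral_cond_eq_truncExp {v : ℝ × ℝ} (hv : 0 < v.1) (a : ℝ) {h : ℝ → ℝ}
    (hh : Measurable h) :
    ∫ g, h (v.2 / v.1 + √(1 / v.1) * g) ∂(stdG[|acceptSet a (v.2 / v.1) (√(1 / v.1))]) =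
      truncExp a v h := by
  set μ := v.2 / v.1 with hμ
  set σ := √(1 / v.1) with hσ
  have hσ0 : 0 < σ := Real.sqrt_pos.2 (by positivity)
  set A := acceptSet a μ σ with hAdef
  set c := (√(2 * Real.pi * (1 / v.1)))⁻¹ * Real.exp (-(v.2 ^ 2 / (2 * v.1))) with hc
  have hc0 : 0 < c := by positivity
  have hmap : stdG.map (fun g => μ + σ * g) = gaussianReal μ (Real.toNNReal (1 / v.1)) := by
    have h1 : (fun g : ℝ => μ + σ * g) = (fun x => μ + x) ∘ fun g => σ * g := rfl
    rw [h1, ← Measure.map_map (by fun_prop) (by fun_prop), gaussianReal_map_const_mul,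
      gaussianReal_map_const_add]
    congr 1
    · simp
    · ext
      rw [Real.coe_toNNReal _ (by positivity)]
      simp [hσ, Real.sq_sqrt hv.le]
  have hne : Real.toNNReal (1 / v.1) ≠ 0 := by
    rw [Ne, Real.toNNReal_eq_zero, not_le]; positivity
  have key : ∀ h : ℝ → ℝ, Measurable h → ∫ g in A, h (μ + σ * g) ∂stdG =
      c * ∫ x in Set.Ioi a, h x * gaussWeight v x := fun h hh => by
    have hA : A = (fun g => μ + σ * g) ⁻¹' (Set.Ioi a) := rfl
    rw [hA, ← setIntegral_map measurableSet_Ioi hh.aestronglyMeasurable (by fun_prop), hmap,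
      ← integral_indicator measurableSet_Ioi, integral_gaussianReal_eq_integral_smul hne,
      ← integral_indicator measurableSet_Ioi, ← integral_const_mul]
    refine integral_congr_ae (Filter.Eventually.of_forall fun x => ?_)
    simp only [Set.indicator_apply, smul_eq_mul]
    split_ifs
    · rw [gaussianPDFReal_eq_weight hv]; ring
    · simp
  have k1 := key (fun _ => 1) measurable_const
  simp only [one_mul] at k1
  rw [setIntegral_const, smul_eq_mul, mul_one] at k1
  rw [ProbabilityTheory.cond, integral_smul_measure, key h hh, truncExp, truncMass, smul_eq_mul,
    ENNReal.toReal_inv, ← measureReal_def, k1, div_eq_inv_mul, mul_inv]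
  field_simp

theorem integral_truncNormal {v : ℝ × ℝ} (hv : 0 < v.1) (a : ℝ) {h : ℝ → ℝ} (hh : Measurable h) :
    ∫ w, h (truncNormal a (v.2 / v.1) (√(1 / v.1)) w).val ∂stdGSeq = truncExp a v h := by
  have hσ0 : 0 < √(1 / v.1) := Real.sqrt_pos.2 (by positivity)
  have hZ : Measurable fun w => (truncNormal a (v.2 / v.1) (√(1 / v.1)) w).val :=
    measurable_truncNormal measurable_const measurable_const measurable_const measurable_id
  rw [← integral_cond_eq_truncExp hv a hh, ← integral_map hZ.aemeasurable hh.aestronglyMeasurable,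
    map_truncNormal _ _ hσ0, integral_map (by fun_prop) hh.aestronglyMeasurable]

/-- `integral_truncNormal` needs no integrability. If `(1 + z²) ^ k` were not integrable its
integral would be `0` by convention, whereas the other side of that identity is positive. -/
theorem integrable_truncNormal {r : ℝ} (hr : 1 ≤ r) {v : ℝ × ℝ} (hv : v ∈ paramBox r) {a : ℝ}
    (ha : a ≤ 0) {h : ℝ → ℝ} (hh : Measurable h) {C : ℝ} {k : ℕ}
    (hC : ∀ x, |h x| ≤ C * (1 + x ^ 2) ^ k) :
    Integrable (fun w => h (truncNormal a (v.2 / v.1) (√(1 / v.1)) w).val) stdGSeq := by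
  have hv1 : 0 < v.1 := lt_of_lt_of_le (by positivity) hv.1
  have hZ : Measurable fun w => (truncNormal a (v.2 / v.1) (√(1 / v.1)) w).val :=
    measurable_truncNormal measurable_const measurable_const measurable_const measurable_id
  have hC0 : 0 ≤ C := by
    have := (abs_nonneg _).trans (hC 0)
    simpa using this
  have hpos : 0 < ∫ x in Set.Ioi a, (1 + x ^ 2) ^ k * gaussWeight v x := by
    refine lt_of_lt_of_le ((Real.exp_pos _).trans_le (le_truncMass hr hv ha)) ?_
    refine integral_mono (integrable_gaussWeight hr hv).integrableOn
      (integrable_mul_gaussWeight hr hv (f := fun x => (1 + x ^ 2) ^ k) (by fun_prop) (C := 1)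
        (k := k) (fun x => ?_)).integrableOn fun x => ?_
    · rw [abs_of_nonneg (by positivity), one_mul]
    · exact le_mul_of_one_le_left (gaussWeight_pos v x).le
        (one_le_pow₀ (by nlinarith [sq_nonneg x]))
  have h1 : Integrable (fun w =>
      (1 + (truncNormal a (v.2 / v.1) (√(1 / v.1)) w).val ^ 2) ^ k) stdGSeq := by
    by_contra hcon
    have h2 := integral_truncNormal hv1 a (h := fun x => (1 + x ^ 2) ^ k) (by fun_prop)
    rw [integral_undef hcon, truncExp] at h2
    have h3 := (Real.exp_pos _).trans_le (le_truncMass hr hv ha)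
    have := div_pos hpos h3
    linarith
  refine (h1.const_mul C).mono' (hh.comp hZ).aestronglyMeasurable
    (Filter.Eventually.of_forall fun w => ?_)
  exact hC _

/-! ## Analysis of projected SGD -/

/-- The potential is centred at `s + S / c`, not at `s`. If the centre does not lie beyond the face
to which `u` is clamped, clamping moves towards it. Otherwise `|S| ≥ c ρ`, and the clamped square is
at most `S² ≤ S⁴ / (c ρ)²`. For sums `S` of `t` centred terms and `c` of order `t`, this error has
bounded mean. -/
theorem clamp_sq_le {lo hi s ρ c S u : ℝ} (hρ : 0 < ρ) (hc : 0 < c) (h1 : lo + ρ ≤ s)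
    (h2 : s ≤ hi - ρ) :
    (c * (max lo (min hi u) - s) - S) ^ 2 ≤ (c * (u - s) - S) ^ 2 + S ^ 4 / (c * ρ) ^ 2 := by
  have key : ∀ e δ S : ℝ, ρ ≤ e → 0 ≤ δ →
      (c * e - S) ^ 2 ≤ (c * (e + δ) - S) ^ 2 + S ^ 4 / (c * ρ) ^ 2 := fun e δ S he hδ => by
    have h3 : c * ρ ≤ c * e := by gcongr
    have h4 : 0 < c * ρ := by positivity
    rcases le_total S (c * e) with h | h
    · have : 0 ≤ S ^ 4 / (c * ρ) ^ 2 := by positivity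
      have h5 : 0 ≤ c * δ := by positivity
      nlinarith
    · have h5 : S ^ 2 ≤ S ^ 4 / (c * ρ) ^ 2 := by
        rw [le_div_iff₀ (by positivity)]
        have : (c * ρ) ^ 2 ≤ S ^ 2 := by gcongr; linarith
        nlinarith [sq_nonneg S]
      nlinarith [sq_nonneg (c * (e + δ) - S)]
  rcases le_total u lo with h | h
  · rw [min_eq_right (by linarith), max_eq_left h]
    have := key (s - lo) (lo - u) (-S) (by linarith) (by linarith)
    calc _ = (c * (s - lo) - -S) ^ 2 := by ring
      _ ≤ _ := this
      _ = _ := by ring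
  · rcases le_total u hi with h' | h'
    · rw [min_eq_right h', max_eq_right h]
      have : 0 ≤ S ^ 4 / (c * ρ) ^ 2 := by positivity
      linarith
    · rw [min_eq_left h', max_eq_right (by linarith)]
      have := key (hi - s) (u - hi) S (by linarith) (by linarith)
      calc _ ≤ _ := this
        _ = _ := by ring

/-- Expand the square. Monotonicity with constant `2 lam` pays once for the growth of the prefactor
from `lam n` to `lam (n + 1)` and leaves `-2 lam² n |e|²`. Young's inequality for the cross term
with `S` spends half of that. -/
theorem drift_le {lam M n e1 e2 S1 S2 h1 h2 : ℝ} (hlam : 0 < lam) (hn : 0 ≤ n)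
    (hS1 : n = 0 → S1 = 0) (hS2 : n = 0 → S2 = 0)
    (hmono : 2 * lam * (e1 ^ 2 + e2 ^ 2) ≤ e1 * h1 + e2 * h2)
    (hl1 : |lam * e1 - h1| ≤ M * (|e1| + |e2|)) (hl2 : |lam * e2 - h2| ≤ M * (|e1| + |e2|)) :
    (lam * n * e1 - S1 + lam * e1 - h1) ^ 2 + (lam * n * e2 - S2 + lam * e2 - h2) ^ 2 ≤
      (lam * n * e1 - S1) ^ 2 + (lam * n * e2 - S2) ^ 2 - lam ^ 2 * n * (e1 ^ 2 + e2 ^ 2) +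
        4 * M ^ 2 / lam ^ 2 * ((S1 ^ 2 + S2 ^ 2) / n) + 2 * (M * (|e1| + |e2|)) ^ 2 := by
  set D := |e1| + |e2| with hD
  have hD2 : D ^ 2 ≤ 2 * (e1 ^ 2 + e2 ^ 2) := by
    rw [← sq_abs e1, ← sq_abs e2]; nlinarith [sq_nonneg (|e1| - |e2|)]
  have q1 : (lam * e1 - h1) ^ 2 ≤ (M * D) ^ 2 := sq_le_sq' (abs_le.1 hl1).1 (abs_le.1 hl1).2
  have q2 : (lam * e2 - h2) ^ 2 ≤ (M * D) ^ 2 := sq_le_sq' (abs_le.1 hl2).1 (abs_le.1 hl2).2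
  have cross : -(S1 * (lam * e1 - h1) + S2 * (lam * e2 - h2)) ≤
      lam ^ 2 * n * (e1 ^ 2 + e2 ^ 2) / 2 + 2 * M ^ 2 / lam ^ 2 * ((S1 ^ 2 + S2 ^ 2) / n) := by
    rcases hn.eq_or_lt with h | h
    · rw [← h, hS1 h.symm, hS2 h.symm]; simp
    · have c1 : -(S1 * (lam * e1 - h1)) ≤ |S1| * (M * D) := by
        refine (neg_le_abs _).trans ?_
        rw [abs_mul]; gcongr
      have c2 : -(S2 * (lam * e2 - h2)) ≤ |S2| * (M * D) := by
        refine (neg_le_abs _).trans ?_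
        rw [abs_mul]; gcongr
      set s := |S1| + |S2| with hs
      have hs2 : s ^ 2 ≤ 2 * (S1 ^ 2 + S2 ^ 2) := by
        rw [← sq_abs S1, ← sq_abs S2]; nlinarith [sq_nonneg (|S1| - |S2|)]
      -- Young's inequality, with weights such that the part quadratic in `D` costs half of the
      -- available decrease.
      have h0 : 0 ≤ (lam * D * n / 2 - M * s / lam) ^ 2 / n := by positivity
      have h0' : (lam * D * n / 2 - M * s / lam) ^ 2 / n =
          lam ^ 2 * n * D ^ 2 / 4 - s * (M * D) + M ^ 2 / lam ^ 2 * (s ^ 2 / n) := by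
        field_simp; ring
      have h3 : M ^ 2 / lam ^ 2 * (s ^ 2 / n) ≤
          M ^ 2 / lam ^ 2 * (2 * (S1 ^ 2 + S2 ^ 2) / n) := by gcongr
      have h4 : lam ^ 2 * n * D ^ 2 / 4 ≤ lam ^ 2 * n * (2 * (e1 ^ 2 + e2 ^ 2)) / 4 := by gcongr
      have h5 : M ^ 2 / lam ^ 2 * (2 * (S1 ^ 2 + S2 ^ 2) / n) =
        2 * M ^ 2 / lam ^ 2 * ((S1 ^ 2 + S2 ^ 2) / n) := by ring
      nlinarith
  have hm : lam * n * (lam * (e1 ^ 2 + e2 ^ 2) - (e1 * h1 + e2 * h2)) ≤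
      lam * n * (-lam * (e1 ^ 2 + e2 ^ 2)) := by gcongr; linarith
  have e : 4 * M ^ 2 / lam ^ 2 * ((S1 ^ 2 + S2 ^ 2) / n) =
    2 * (2 * M ^ 2 / lam ^ 2 * ((S1 ^ 2 + S2 ^ 2) / n)) := by ring
  rw [e]
  nlinarith

/-! ### One step of the recursion for the potential -/

theorem integral_sub_sq_le {Ω : Type*} [MeasurableSpace Ω] {P : Measure Ω} [IsProbabilityMeasure P]
    {X : Ω → ℝ} (hX : Integrable X P) (hX2 : Integrable (fun ω => X ω ^ 2) P) (D : ℝ) :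
    ∫ ω, (D - X ω) ^ 2 ∂P ≤ (D - ∫ ω, X ω ∂P) ^ 2 + ∫ ω, X ω ^ 2 ∂P := by
  have e : ∀ ω, (D - X ω) ^ 2 = (D ^ 2 - 2 * D * X ω) + X ω ^ 2 := fun ω => by ring
  simp_rw [e]
  have h1 : Integrable (fun ω => D ^ 2 - 2 * D * X ω) P :=
    (integrable_const _).sub (hX.const_mul _)
  rw [integral_add h1 hX2, integral_sub (integrable_const _) (hX.const_mul _), integral_const_mul]
  simp
  nlinarith [sq_nonneg (∫ ω, X ω ∂P)]

/-- The step size parameter. -/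
noncomputable def stepConst (r : ℝ) : ℝ := monoConst r / 2

theorem stepConst_pos {r : ℝ} (hr : 1 ≤ r) : 0 < stepConst r := half_pos (monoConst_pos hr)

/-- The first sufficient statistic. -/
noncomputable def stat1 (x : ℝ) : ℝ := -(x * x) / 2

@[fun_prop] theorem measurable_stat1 : Measurable stat1 := by unfold stat1; fun_prop

/-- The accumulated deviation of the statistic `f` of the data from its expectation. -/
noncomputable def devSum (f : ℝ → ℝ) (m : ℝ) (x : ℕ → ℝ) (t : ℕ) : ℝ :=
  ∑ s ∈ Finset.range t, (f (x s) - m)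

/-- The potential function. -/
noncomputable def sgdPotential (r a : ℝ) (vs : ℝ × ℝ) (x : ℕ → ℝ) (t : ℕ) (v : ℝ × ℝ) : ℝ :=
  (stepConst r * t * (v.1 - vs.1) - devSum stat1 (truncExp a vs stat1) x t) ^ 2 +
  (stepConst r * t * (v.2 - vs.2) - devSum id (truncExp a vs id) x t) ^ 2

/-- The Lipschitz constant of the drift. -/
noncomputable def driftConst (r : ℝ) : ℝ := stepConst r + lipConst r

/-- The contribution of iteration `t + 1` to the bound of the error. -/
noncomputable def stepCost (r a ρ : ℝ) (vs : ℝ × ℝ) (x : ℕ → ℝ) (t : ℕ) : ℝ :=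
  (32 * driftConst r ^ 2 * r ^ 2 + 2 * (envMoment r * Real.exp (3 * r / 2))) +
  4 * driftConst r ^ 2 / stepConst r ^ 2 *
    ((devSum stat1 (truncExp a vs stat1) x t ^ 2 + devSum id (truncExp a vs id) x t ^ 2) / t) +
  (devSum stat1 (truncExp a vs stat1) x (t + 1) ^ 4 +
    devSum id (truncExp a vs id) x (t + 1) ^ 4) / (stepConst r * (t + 1 : ℝ) * ρ) ^ 2

/-- `vs` lies in the box, at distance at least `ρ` from its boundary. -/
def InnerBox (r ρ : ℝ) (vs : ℝ × ℝ) : Prop :=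
  1 / r + ρ ≤ vs.1 ∧ vs.1 ≤ r - ρ ∧ -r + ρ ≤ vs.2 ∧ vs.2 ≤ r - ρ

theorem InnerBox.mem {r ρ : ℝ} {vs : ℝ × ℝ} (h : InnerBox r ρ vs) (hρ : 0 < ρ) :
    vs ∈ paramBox r := by
  obtain ⟨h1, h2, h3, h4⟩ := h
  exact ⟨by linarith, by linarith, abs_le.2 ⟨by linarith, by linarith⟩⟩

theorem abs_sub_le_of_mem_paramBox {r : ℝ} (hr : 1 ≤ r) {v v' : ℝ × ℝ} (hv : v ∈ paramBox r)
    (hv' : v' ∈ paramBox r) : |v.1 - v'.1| ≤ 2 * r ∧ |v.2 - v'.2| ≤ 2 * r := by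
  obtain ⟨h1, h2, h3⟩ := hv
  obtain ⟨h1', h2', h3'⟩ := hv'
  have : 0 < 1 / r := by positivity
  rw [abs_le] at h3 h3'
  refine ⟨abs_le.2 ⟨?_, ?_⟩, abs_le.2 ⟨?_, ?_⟩⟩ <;> linarith

theorem continuous_clampBox (r : ℝ) : Continuous (clampBox r) := by
  unfold clampBox; fun_prop

theorem measurable_sgdNext {Ω : Type*} [MeasurableSpace Ω] (r lam : ℝ) (t : ℕ) {a x : Ω → ℝ}
    {v : Ω → ℝ × ℝ} {w : Ω → ℕ → ℝ} (ha : Measurable a) (hv : Measurable v) (hx : Measurable x)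
    (hw : Measurable w) : Measurable fun ω => sgdNext r lam (a ω) (v ω) (x ω) t (w ω) := by
  have hz := measurable_truncNormal ha (hv.snd.div hv.fst)
    (Real.continuous_sqrt.measurable.comp (measurable_const.div hv.fst)) hw (σ := fun ω =>
      √(1 / (v ω).1)) (μ := fun ω => (v ω).2 / (v ω).1)
  unfold sgdNext
  exact (continuous_clampBox r).measurable.comp
    ((hv.fst.sub ((((hx.mul hx).sub (hz.mul hz)).div_const 2).div_const _)).prodMk
      (hv.snd.sub ((hz.sub hx).div_const _)))

theorem measurable_sgdPotential (r a : ℝ) (vs : ℝ × ℝ) (x : ℕ → ℝ) (t : ℕ) :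
    Measurable (sgdPotential r a vs x t) := by
  unfold sgdPotential; fun_prop

theorem truncExp_stat_mono {r : ℝ} (hr : 1 ≤ r) {v v' : ℝ × ℝ} (hv : v ∈ paramBox r)
    (hv' : v' ∈ paramBox r) {a : ℝ} (ha : a ≤ 0) :
    monoConst r * ((v.1 - v'.1) ^ 2 + (v.2 - v'.2) ^ 2) ≤
      (v.1 - v'.1) * (truncExp a v stat1 - truncExp a v' stat1) +
      (v.2 - v'.2) * (truncExp a v id - truncExp a v' id) := by
  refine (truncExp_strongMono hr hv hv' ha).trans (le_of_eq ?_)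
  have hs : ∀ x, |stat1 x| ≤ 1 * (1 + x ^ 2) ^ 1 := fun x => by
    rw [stat1, abs_div, abs_neg, abs_of_nonneg (mul_self_nonneg x)]
    norm_num; nlinarith
  have hi : ∀ x : ℝ, |id x| ≤ 1 * (1 + x ^ 2) ^ 1 := fun x => by
    simp only [id]; nlinarith [sq_nonneg (|x| - 1), sq_abs x]
  have key : ∀ u : ℝ × ℝ, u ∈ paramBox r → ∀ p q : ℝ,
      truncExp a u (fun x => -p * x ^ 2 / 2 + q * x) =
        p * truncExp a u stat1 + q * truncExp a u id := fun u hu p q => by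
    have i1 := (integrable_mul_gaussWeight hr hu measurable_stat1 hs).integrableOn (s := Set.Ioi a)
    have i2 := (integrable_mul_gaussWeight hr hu measurable_id hi).integrableOn (s := Set.Ioi a)
    have e : ∀ x, (-p * x ^ 2 / 2 + q * x) * gaussWeight u x =
        p * (stat1 x * gaussWeight u x) + q * (id x * gaussWeight u x) := fun x => by
      simp only [stat1, id]; ring
    simp only [truncExp]
    simp_rw [e]
    rw [integral_add (i1.const_mul p) (i2.const_mul q), integral_const_mul, integral_const_mul]
    ring
  rw [key v hv, key v' hv']
  ring

-- Multiplied by `lam (t + 1)`, the unclamped update contains the new data point exactly as the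
-- deviation sum does, so it cancels from the potential. The remaining randomness is the sample `z`,
-- whose mean statistic is `truncExp a v`. Then `drift_le` bounds the mean, the second moment of the
-- statistic bounds the variance, and `clamp_sq_le` bounds the effect of the projection.
set_option maxHeartbeats 600000 in
theorem integral_sgdPotential_le {r ρ a : ℝ} (hr : 1 ≤ r) (hρ : 0 < ρ) (ha : a ≤ 0)
    {vs : ℝ × ℝ} (hvs : InnerBox r ρ vs) (x : ℕ → ℝ) (t : ℕ) {v : ℝ × ℝ} (hv : v ∈ paramBox r) :
    ∫ w, sgdPotential r a vs x (t + 1) (sgdNext r (stepConst r) a v (x t) t w) ∂stdGSeq ≤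
      sgdPotential r a vs x t v -
        stepConst r ^ 2 * t * ((v.1 - vs.1) ^ 2 + (v.2 - vs.2) ^ 2) + stepCost r a ρ vs x t := by
  have hvsm := hvs.mem hρ
  obtain ⟨b1, b2, b3, b4⟩ := hvs
  have hv1 : 0 < v.1 := lt_of_lt_of_le (by positivity) hv.1
  have hlam := stepConst_pos hr
  set lam := stepConst r with hlamdef
  set m1 := truncExp a vs stat1 with hm1
  set m2 := truncExp a vs id with hm2
  set S1 := devSum stat1 m1 x t with hS1
  set S2 := devSum id m2 x t with hS2
  set S1' := devSum stat1 m1 x (t + 1) with hS1'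
  set S2' := devSum id m2 x (t + 1) with hS2'
  have hS1s : S1' = S1 + (stat1 (x t) - m1) := Finset.sum_range_succ _ _
  have hS2s : S2' = S2 + (x t - m2) := Finset.sum_range_succ _ _
  set Z : (ℕ → ℝ) → ℝ := fun w => (truncNormal a (v.2 / v.1) (√(1 / v.1)) w).val with hZ
  have hZm : Measurable Z :=
    measurable_truncNormal measurable_const measurable_const measurable_const measurable_id
  set e1 := v.1 - vs.1 with he1
  set e2 := v.2 - vs.2 with he2
  set c := lam * (t + 1 : ℝ) with hc
  have hc0 : 0 < c := by positivity
  set D1 := lam * t * e1 - S1 + lam * e1 + m1 with hD1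
  set D2 := lam * t * e2 - S2 + lam * e2 + m2 with hD2
  set K := (S1' ^ 4 + S2' ^ 4) / (c * ρ) ^ 2 with hK
  have hs : ∀ x, |stat1 x| ≤ 1 + x ^ 2 := fun x => by
    rw [stat1, abs_div, abs_neg, abs_of_nonneg (mul_self_nonneg x)]
    norm_num; nlinarith
  have hi : ∀ x : ℝ, |id x| ≤ 1 + x ^ 2 := fun x => by
    simp only [id]; nlinarith [sq_nonneg (|x| - 1), sq_abs x]
  have hsq : ∀ f : ℝ → ℝ, (∀ x, |f x| ≤ 1 + x ^ 2) → ∀ x, |f x ^ 2| ≤ 1 * (1 + x ^ 2) ^ 2 :=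
    fun f hf x => by
      rw [abs_pow, one_mul]
      have := hf x
      gcongr
  have i1 := integrable_truncNormal hr hv ha measurable_stat1 (C := 1) (k := 1)
    (by simpa using hs)
  have i2 := integrable_truncNormal hr hv ha measurable_id (C := 1) (k := 1) (by simpa using hi)
  have j1 := integrable_truncNormal hr hv ha (measurable_stat1.pow_const 2) (hsq _ hs)
  have j2 := integrable_truncNormal hr hv ha (measurable_id.pow_const 2) (hsq _ hi)
  have pt : ∀ w, sgdPotential r a vs x (t + 1) (sgdNext r lam a v (x t) t w) ≤
      (D1 - stat1 (Z w)) ^ 2 + (D2 - Z w) ^ 2 + K := fun w => by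
    have k1 := clamp_sq_le (u := v.1 - (x t * x t - Z w * Z w) / 2 / c) (S := S1') hρ hc0 b1 b2
    have k2 := clamp_sq_le (lo := 0 - r) (u := v.2 - (Z w - x t) / c) (S := S2') hρ hc0
      (by linarith) b4
    have e : sgdPotential r a vs x (t + 1) (sgdNext r lam a v (x t) t w) =
      (c * (max (1 / r) (min r (v.1 - (x t * x t - Z w * Z w) / 2 / c)) - vs.1) - S1') ^ 2 +
      (c * (max (0 - r) (min r (v.2 - (Z w - x t) / c)) - vs.2) - S2') ^ 2 := by
      simp only [sgdPotential, sgdNext, clampBox, hc, ← hlamdef]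
      push_cast
      rfl
    -- Here `x t` drops out.
    have f1 : c * (v.1 - (x t * x t - Z w * Z w) / 2 / c - vs.1) - S1' = D1 - stat1 (Z w) := by
      have : c * ((x t * x t - Z w * Z w) / 2 / c) = (x t * x t - Z w * Z w) / 2 := by field_simp
      rw [hS1s, hD1, he1, stat1, stat1]
      linear_combination -this
    have f2 : c * (v.2 - (Z w - x t) / c - vs.2) - S2' = D2 - Z w := by
      have : c * ((Z w - x t) / c) = Z w - x t := by field_simp
      rw [hS2s, hD2, he2]
      linear_combination -this
    rw [f1] at k1
    rw [f2] at k2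
    rw [e, hK, add_div]
    linarith
  have hint : Integrable (fun w => (D1 - stat1 (Z w)) ^ 2 + (D2 - Z w) ^ 2 + K) stdGSeq := by
    have e : (fun w => (D1 - stat1 (Z w)) ^ 2 + (D2 - Z w) ^ 2 + K) = fun w =>
      (D1 ^ 2 - 2 * D1 * stat1 (Z w) + stat1 (Z w) ^ 2) +
        (D2 ^ 2 - 2 * D2 * id (Z w) + id (Z w) ^ 2) + K := by
      funext w; simp only [id]; ring
    rw [e]
    exact ((((integrable_const _).sub (i1.const_mul _)).add j1).add
      (((integrable_const _).sub (i2.const_mul _)).add j2)).add (integrable_const _)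
  have q1 : Integrable (fun w => (D1 - stat1 (Z w)) ^ 2) stdGSeq := by
    have := (((integrable_const (D1 ^ 2)).sub (i1.const_mul (2 * D1))).add j1)
    refine this.congr (Filter.Eventually.of_forall fun w => ?_)
    simp only [Pi.add_apply, Pi.sub_apply, hZ]; ring
  have q2 : Integrable (fun w => (D2 - Z w) ^ 2) stdGSeq := by
    have := (((integrable_const (D2 ^ 2)).sub (i2.const_mul (2 * D2))).add j2)
    refine this.congr (Filter.Eventually.of_forall fun w => ?_)
    simp only [Pi.add_apply, Pi.sub_apply, hZ, id]; ring
  have hlhs : ∫ w, sgdPotential r a vs x (t + 1) (sgdNext r lam a v (x t) t w) ∂stdGSeq ≤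
      ∫ w, (D1 - stat1 (Z w)) ^ 2 ∂stdGSeq + ∫ w, (D2 - Z w) ^ 2 ∂stdGSeq + K := by
    calc _ ≤ ∫ w, ((D1 - stat1 (Z w)) ^ 2 + (D2 - Z w) ^ 2 + K) ∂stdGSeq :=
          integral_mono_of_nonneg (Filter.Eventually.of_forall fun w => by
            unfold sgdPotential; positivity) hint (Filter.Eventually.of_forall pt)
      _ = _ := by
        have q3 : Integrable (fun w => (D1 - stat1 (Z w)) ^ 2 + (D2 - Z w) ^ 2) stdGSeq := q1.add q2
        rw [integral_add q3 (integrable_const _), integral_add q1 q2]; simp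
  have v1 := integral_sub_sq_le i1 j1 D1
  have v2 := integral_sub_sq_le i2 j2 D2
  rw [integral_truncNormal hv1 a measurable_stat1,
    integral_truncNormal hv1 a (measurable_stat1.pow_const 2)] at v1
  rw [integral_truncNormal hv1 a measurable_id,
    integral_truncNormal hv1 a (measurable_id.pow_const 2)] at v2
  have w1 := (le_abs_self _).trans (abs_truncExp_le hr hv ha (k := 2) (by norm_num)
    fun x => (hsq _ hs x).trans_eq (one_mul _))
  have w2 := (le_abs_self _).trans (abs_truncExp_le hr hv ha (k := 2) (by norm_num)
    fun x => (hsq _ hi x).trans_eq (one_mul _))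
  have hmono := truncExp_stat_mono hr hv hvsm ha
  have l1 := truncExp_lipschitz hr hv hvsm ha measurable_stat1 hs
  have l2 := truncExp_lipschitz hr hv hvsm ha measurable_id hi
  set h1 := truncExp a v stat1 - m1 with hh1
  set h2 := truncExp a v id - m2 with hh2
  set E := |e1| + |e2| with hE
  have hE0 : 0 ≤ E := by positivity
  have t1 : |lam * e1 - h1| ≤ driftConst r * E := by
    refine (abs_sub _ _).trans ?_
    rw [abs_mul, abs_of_pos hlam, driftConst, add_mul]
    have : |e1| ≤ E := le_add_of_nonneg_right (abs_nonneg _)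
    gcongr
  have t2 : |lam * e2 - h2| ≤ driftConst r * E := by
    refine (abs_sub _ _).trans ?_
    rw [abs_mul, abs_of_pos hlam, driftConst, add_mul]
    have : |e2| ≤ E := le_add_of_nonneg_left (abs_nonneg _)
    gcongr
  have hd := drift_le (lam := lam) (M := driftConst r) (n := t) (e1 := e1) (e2 := e2) (S1 := S1)
    (S2 := S2) (h1 := h1) (h2 := h2) hlam (Nat.cast_nonneg t)
    (fun h => by have : t = 0 := by exact_mod_cast h
                 simp [hS1, this, devSum])
    (fun h => by have : t = 0 := by exact_mod_cast h
                 simp [hS2, this, devSum])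
    (by rw [hlamdef, stepConst]; linarith) t1 t2
  have hEr : E ≤ 4 * r := by
    have := abs_sub_le_of_mem_paramBox hr hv hvsm
    linarith [this.1, this.2]
  have hE2 : 2 * (driftConst r * E) ^ 2 ≤ 32 * driftConst r ^ 2 * r ^ 2 := by
    calc _ = 2 * (driftConst r ^ 2 * E ^ 2) := by rw [mul_pow]
      _ ≤ 2 * (driftConst r ^ 2 * (4 * r) ^ 2) := by gcongr
      _ = _ := by ring
  have g1 : D1 - truncExp a v stat1 = lam * t * e1 - S1 + lam * e1 - h1 := by
    rw [hD1, hh1]; ring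
  have g2 : D2 - truncExp a v id = lam * t * e2 - S2 + lam * e2 - h2 := by
    rw [hD2, hh2]; ring
  rw [g1] at v1
  rw [g2] at v2
  have hpot : sgdPotential r a vs x t v = (lam * t * e1 - S1) ^ 2 + (lam * t * e2 - S2) ^ 2 := rfl
  have hcost : stepCost r a ρ vs x t =
    (32 * driftConst r ^ 2 * r ^ 2 + 2 * (envMoment r * Real.exp (3 * r / 2))) +
    4 * driftConst r ^ 2 / lam ^ 2 * ((S1 ^ 2 + S2 ^ 2) / t) + K := rfl
  rw [hpot, hcost]
  simp only [id] at v2 w2 hlhs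
  linarith

/-! ## The expected error of projected SGD -/

/-- The law of the random tape used for one batch. -/
noncomputable abbrev batchTape : Measure (ℕ → ℕ → ℝ) := Measure.infinitePi fun _ : ℕ => stdGSeq

theorem sgdIter_congr (r lam a : ℝ) (x : ℕ → ℝ) {w w' : ℕ → ℕ → ℝ} {t : ℕ}
    (h : ∀ s < t, w s = w' s) : sgdIter r lam a x w t = sgdIter r lam a x w' t := by
  induction t with
  | zero => rfl
  | succ t ih =>
    rw [sgdIter, sgdIter, ih fun s hs => h s (by omega), h t (by omega)]

theorem measurable_sgdIter {Ω : Type*} [MeasurableSpace Ω] (r lam : ℝ) {a : Ω → ℝ}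
    {x : ℕ → Ω → ℝ} {w : Ω → ℕ → ℕ → ℝ} (ha : Measurable a) (hx : ∀ k, Measurable (x k))
    (hw : Measurable w) (t : ℕ) :
    Measurable fun ω => sgdIter r lam (a ω) (fun k => x k ω) (w ω) t := by
  induction t with
  | zero => exact measurable_const
  | succ t ih => exact measurable_sgdNext r lam t ha ih (hx t) ((measurable_pi_apply t).comp hw)

/-- Iterate `t` is a function of the rows of the tape before row `t`. -/
theorem indepFun_sgdIter (r lam a : ℝ) (x : ℕ → ℝ) (t : ℕ) :
    IndepFun (fun w => sgdIter r lam a x w t) (fun w => w t) batchTape := by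
  classical
  have hi : iIndepFun (fun (s : ℕ) (w : ℕ → ℕ → ℝ) => w s) batchTape :=
    iIndepFun_infinitePi (X := fun _ u => u) fun _ => measurable_id
  have h := hi.indepFun_finset (Finset.range t) {t} (by simp) fun s => measurable_pi_apply s
  -- Padding with zero rows exhibits the iterate as a function of the first `t` rows.
  set ext : (Finset.range t → ℕ → ℝ) → ℕ → ℕ → ℝ := fun u s =>
    if hs : s ∈ Finset.range t then u ⟨s, hs⟩ else 0 with hext
  have hextm : Measurable ext := measurable_pi_iff.2 fun s => by
    simp only [hext]
    split_ifs with hs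
    · exact measurable_pi_apply _
    · exact measurable_const
  have hψ : Measurable fun u : ({t} : Finset ℕ) → ℕ → ℝ => u ⟨t, Finset.mem_singleton_self t⟩ :=
    measurable_pi_apply (X := fun _ : ({t} : Finset ℕ) => ℕ → ℝ) ⟨t, Finset.mem_singleton_self t⟩
  have h2 := h.comp (φ := fun u => sgdIter r lam a x (ext u) t)
    (measurable_sgdIter r lam measurable_const (fun k => measurable_const) hextm t) hψ
  have e : (fun w => sgdIter r lam a x w t) = (fun u => sgdIter r lam a x (ext u) t) ∘
      fun (w : ℕ → ℕ → ℝ) (i : Finset.range t) => w i := by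
    funext w
    refine sgdIter_congr r lam a x fun s hs => ?_
    simp [hext, hs]
  rw [e]
  exact h2

theorem integral_sgdIter_succ {r lam a : ℝ} (x : ℕ → ℝ) (t : ℕ) {g : ℝ × ℝ → ℝ}
    (hg : Measurable g) {C : ℝ} (hC : ∀ v ∈ paramBox r, |g v| ≤ C) (hr : 1 ≤ r) :
    ∫ w, g (sgdIter r lam a x w (t + 1)) ∂batchTape =
      ∫ w, ∫ u, g (sgdNext r lam a (sgdIter r lam a x w t) (x t) t u) ∂stdGSeq ∂batchTape := by
  have hV : Measurable fun w : ℕ → ℕ → ℝ => sgdIter r lam a x w t :=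
    measurable_sgdIter r lam measurable_const (fun k => measurable_const) measurable_id t
  have hW : Measurable fun w : ℕ → ℕ → ℝ => w t := measurable_pi_apply t
  have hmap := (indepFun_iff_map_prod_eq_prod_map_map hV.aemeasurable hW.aemeasurable).1
    (indepFun_sgdIter r lam a x t)
  have hWt : batchTape.map (fun w : ℕ → ℕ → ℝ => w t) = stdGSeq := Measure.infinitePi_map_eval _ t
  rw [hWt] at hmap
  have hN : Measurable fun p : (ℝ × ℝ) × (ℕ → ℝ) => g (sgdNext r lam a p.1 (x t) t p.2) :=
    hg.comp (measurable_sgdNext r lam t measurable_const measurable_fst measurable_const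
      measurable_snd)
  have : IsProbabilityMeasure (batchTape.map fun w : ℕ → ℕ → ℝ => sgdIter r lam a x w t) :=
    Measure.isProbabilityMeasure_map hV.aemeasurable
  have hint : Integrable (fun p : (ℝ × ℝ) × (ℕ → ℝ) => g (sgdNext r lam a p.1 (x t) t p.2))
      ((batchTape.map fun w : ℕ → ℕ → ℝ => sgdIter r lam a x w t).prod stdGSeq) :=
    Integrable.of_bound hN.aestronglyMeasurable C
      (Filter.Eventually.of_forall fun p => hC _ (clampBox_mem hr _))
  calc _ = ∫ p, g (sgdNext r lam a p.1 (x t) t p.2) ∂(batchTape.map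
        fun w => (sgdIter r lam a x w t, w t)) := by
        rw [integral_map (hV.prodMk hW).aemeasurable hN.aestronglyMeasurable]
        rfl
    _ = ∫ v, ∫ u, g (sgdNext r lam a v (x t) t u) ∂stdGSeq
        ∂(batchTape.map fun w => sgdIter r lam a x w t) := by
        rw [hmap, integral_prod _ hint]
    _ = _ := integral_map hV.aemeasurable hN.stronglyMeasurable.integral_prod_right.aestronglyMeasurable

/-- The squared distance in the plane. -/
def sqDist (v v' : ℝ × ℝ) : ℝ := (v.1 - v'.1) ^ 2 + (v.2 - v'.2) ^ 2

theorem sqDist_nonneg (v v' : ℝ × ℝ) : 0 ≤ sqDist v v' := by unfold sqDist; positivity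

theorem sqDist_le {r : ℝ} (hr : 1 ≤ r) {v v' : ℝ × ℝ} (hv : v ∈ paramBox r)
    (hv' : v' ∈ paramBox r) : sqDist v v' ≤ 8 * r ^ 2 := by
  obtain ⟨h1, h2⟩ := abs_sub_le_of_mem_paramBox hr hv hv'
  have h3 : |v.1 - v'.1| ^ 2 ≤ (2 * r) ^ 2 := by gcongr
  have h4 : |v.2 - v'.2| ^ 2 ≤ (2 * r) ^ 2 := by gcongr
  rw [sq_abs] at h3 h4
  unfold sqDist; linarith

theorem measurable_sqDist (vs : ℝ × ℝ) : Measurable fun v : ℝ × ℝ => sqDist v vs := by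
  unfold sqDist; fun_prop

/-- Divide the recursion by `t + 1` and telescope; `t / (t + 1) ≥ 1 / 2` for `t ≥ 1`. The steps
below `T` control `A 1, …, A (T - 1)` only, so `A T` remains on the right. -/
theorem sum_le_of_recursion {P A q : ℕ → ℝ} {k : ℝ} (hk : 0 < k) (hP0 : P 0 = 0)
    (hP : ∀ t, 0 ≤ P t) (hA : ∀ t, 0 ≤ A t)
    (hrec : ∀ t : ℕ, P (t + 1) ≤ P t - k * t * A t + q t) (T : ℕ) :
    ∑ t ∈ Finset.range T, A (t + 1) ≤
      2 / k * ∑ t ∈ Finset.range T, q t / (t + 1) + A T := by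
  have key : ∀ T : ℕ, P (T + 1) / (T + 1) + k / 2 * ∑ t ∈ Finset.range T, A (t + 1) ≤
      ∑ t ∈ Finset.range (T + 1), q t / (t + 1) := by
    intro T
    induction T with
    | zero =>
      have := hrec 0
      simp [hP0] at this ⊢
      linarith
    | succ T ih =>
      rw [Finset.sum_range_succ, Finset.sum_range_succ _ (T + 1)]
      have h1 := hrec (T + 1)
      have hT : (0 : ℝ) < T + 1 := by positivity
      have h2 : P (T + 1 + 1) / (T + 1 + 1 : ℝ) ≤
          (P (T + 1) - k * ((T + 1 : ℕ) : ℝ) * A (T + 1) + q (T + 1)) / (T + 1 + 1) := by gcongr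
      have h3 : P (T + 1) / (T + 1 + 1 : ℝ) ≤ P (T + 1) / (T + 1) := by
        have := hP (T + 1)
        gcongr
        linarith
      have h4 : k / 2 * A (T + 1) ≤ k * (T + 1) * A (T + 1) / (T + 1 + 1) := by
        rw [le_div_iff₀ (by positivity)]
        have := hA (T + 1)
        have h5 : 0 ≤ k * A (T + 1) := by positivity
        nlinarith [(Nat.cast_nonneg T : (0 : ℝ) ≤ T)]
      push_cast at h2 ⊢
      rw [add_div, sub_div] at h2
      linarith
  cases T with
  | zero => simpa using hA 0
  | succ T =>
    rw [Finset.sum_range_succ _ T]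
    have h1 := key T
    have h2 : 0 ≤ P (T + 1) / (T + 1 : ℝ) := div_nonneg (hP _) (by positivity)
    have h3 : ∑ t ∈ Finset.range T, A (t + 1) =
        2 / k * (k / 2 * ∑ t ∈ Finset.range T, A (t + 1)) := by field_simp
    have h4 : 2 / k * (k / 2 * ∑ t ∈ Finset.range T, A (t + 1)) ≤
        2 / k * ∑ t ∈ Finset.range (T + 1), q t / (t + 1 : ℝ) := by gcongr; linarith
    linarith

/-- The average of the iterates of projected SGD. -/
noncomputable def sgdAvg (r lam a : ℝ) (x : ℕ → ℝ) (w : ℕ → ℕ → ℝ) (T : ℕ) : ℝ × ℝ :=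
  ((∑ i ∈ Finset.range T, (sgdIter r lam a x w (i + 1)).1) / T,
    (∑ i ∈ Finset.range T, (sgdIter r lam a x w (i + 1)).2) / T)

theorem measurable_sgdAvg {Ω : Type*} [MeasurableSpace Ω] (r lam : ℝ) {a : Ω → ℝ}
    {x : ℕ → Ω → ℝ} {w : Ω → ℕ → ℕ → ℝ} (ha : Measurable a) (hx : ∀ k, Measurable (x k))
    (hw : Measurable w) (T : ℕ) :
    Measurable fun ω => sgdAvg r lam (a ω) (fun k => x k ω) (w ω) T := by
  unfold sgdAvg
  exact ((Finset.measurable_sum _ fun i _ =>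
    (measurable_sgdIter r lam ha hx hw (i + 1)).fst).div_const _).prodMk
    ((Finset.measurable_sum _ fun i _ =>
    (measurable_sgdIter r lam ha hx hw (i + 1)).snd).div_const _)

theorem sgdAvg_mem {r : ℝ} (hr : 1 ≤ r) (lam a : ℝ) (x : ℕ → ℝ) (w : ℕ → ℕ → ℝ) {T : ℕ}
    (hT : 0 < T) : sgdAvg r lam a x w T ∈ paramBox r := by
  have hT' : (0 : ℝ) < T := by exact_mod_cast hT
  have h := fun i => sgdIter_mem hr lam a x w (i + 1)
  refine ⟨?_, ?_, abs_le.2 ⟨?_, ?_⟩⟩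
  · rw [sgdAvg, le_div_iff₀ hT']
    have := Finset.card_nsmul_le_sum (Finset.range T) _ (1 / r) fun i _ => (h i).1
    simpa [mul_comm] using this
  · rw [sgdAvg, div_le_iff₀ hT']
    have := Finset.sum_le_card_nsmul (Finset.range T) _ r fun i _ => (h i).2.1
    simpa [mul_comm] using this
  · rw [sgdAvg, le_div_iff₀ hT']
    have := Finset.card_nsmul_le_sum (Finset.range T) _ (-r) fun i _ => (abs_le.1 (h i).2.2).1
    simpa [mul_comm] using this
  · rw [sgdAvg, div_le_iff₀ hT']
    have := Finset.sum_le_card_nsmul (Finset.range T) _ r fun i _ => (abs_le.1 (h i).2.2).2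
    simpa [mul_comm] using this

theorem sqDist_sgdAvg_le (r lam a : ℝ) (x : ℕ → ℝ) (w : ℕ → ℕ → ℝ) {T : ℕ} (hT : 0 < T)
    (vs : ℝ × ℝ) : sqDist (sgdAvg r lam a x w T) vs ≤
      (∑ i ∈ Finset.range T, sqDist (sgdIter r lam a x w (i + 1)) vs) / T := by
  have hT' : (0 : ℝ) < T := by exact_mod_cast hT
  have key : ∀ (f : ℕ → ℝ) (c : ℝ), ((∑ i ∈ Finset.range T, f i) / T - c) ^ 2 ≤
      (∑ i ∈ Finset.range T, (f i - c) ^ 2) / T := fun f c => by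
    have h1 : (∑ i ∈ Finset.range T, f i) / T - c = (∑ i ∈ Finset.range T, (f i - c)) / T := by
      rw [Finset.sum_sub_distrib]; simp; field_simp
    have h2 := sq_sum_le_card_mul_sum_sq (s := Finset.range T) (f := fun i => f i - c)
    rw [Finset.card_range] at h2
    rw [h1, div_pow, div_le_div_iff₀ (by positivity) hT']
    nlinarith
  simp only [sqDist, Finset.sum_add_distrib, add_div]
  exact add_le_add (key _ _) (key _ _)

/-- Averaging is controlled by convexity, the iterates by `sum_le_of_recursion`. The last iterate is
bounded by the size of the box, which gives the term `8 r²`. -/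
theorem integral_sqDist_sgdAvg_le {r ρ a : ℝ} (hr : 1 ≤ r) (hρ : 0 < ρ) (ha : a ≤ 0)
    {vs : ℝ × ℝ} (hvs : InnerBox r ρ vs) (x : ℕ → ℝ) {T : ℕ} (hT : 0 < T) :
    ∫ w, sqDist (sgdAvg r (stepConst r) a x w T) vs ∂batchTape ≤
      (2 / stepConst r ^ 2 * ∑ t ∈ Finset.range T, stepCost r a ρ vs x t / (t + 1) + 8 * r ^ 2)
        / T := by
  have hvsm := hvs.mem hρ
  have hlam := stepConst_pos hr
  set lam := stepConst r with hlamdef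
  have hV : ∀ t, Measurable fun w : ℕ → ℕ → ℝ => sgdIter r lam a x w t := fun t =>
    measurable_sgdIter r lam measurable_const (fun k => measurable_const) measurable_id t
  have hAint : ∀ t, Integrable (fun w => sqDist (sgdIter r lam a x w t) vs) batchTape := fun t =>
    Integrable.of_bound ((measurable_sqDist vs).comp (hV t)).aestronglyMeasurable (8 * r ^ 2)
      (Filter.Eventually.of_forall fun w => by
        rw [Real.norm_of_nonneg (sqDist_nonneg _ _)]
        exact sqDist_le hr (sgdIter_mem hr _ _ _ _ _) hvsm)
  have hpotb : ∀ t, ∃ C, ∀ v ∈ paramBox r, |sgdPotential r a vs x t v| ≤ C := fun t => by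
    refine ⟨(lam * t * (2 * r) + |devSum stat1 (truncExp a vs stat1) x t|) ^ 2 +
      (lam * t * (2 * r) + |devSum id (truncExp a vs id) x t|) ^ 2, fun v hv => ?_⟩
    obtain ⟨h1, h2⟩ := abs_sub_le_of_mem_paramBox hr hv hvsm
    have key : ∀ e S : ℝ, |e| ≤ 2 * r → (lam * t * e - S) ^ 2 ≤ (lam * t * (2 * r) + |S|) ^ 2 :=
      fun e S he => by
        rw [← sq_abs]
        gcongr
        refine (abs_sub _ _).trans ?_
        rw [abs_mul, abs_of_nonneg (by positivity : (0 : ℝ) ≤ lam * t)]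
        gcongr
    rw [abs_of_nonneg (by unfold sgdPotential; positivity)]
    exact add_le_add (key _ _ h1) (key _ _ h2)
  have hpotm : ∀ t, Measurable (sgdPotential r a vs x t) := fun t =>
    measurable_sgdPotential r a vs x t
  have hPint : ∀ t, Integrable (fun w => sgdPotential r a vs x t (sgdIter r lam a x w t))
      batchTape := fun t => by
    obtain ⟨C, hC⟩ := hpotb t
    exact Integrable.of_bound ((hpotm t).comp (hV t)).aestronglyMeasurable C
      (Filter.Eventually.of_forall fun w => hC _ (sgdIter_mem hr _ _ _ _ _))
  set A : ℕ → ℝ := fun t => ∫ w, sqDist (sgdIter r lam a x w t) vs ∂batchTape with hA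
  set P : ℕ → ℝ := fun t => ∫ w, sgdPotential r a vs x t (sgdIter r lam a x w t) ∂batchTape with hP
  have hrec : ∀ t : ℕ, P (t + 1) ≤ P t - lam ^ 2 * t * A t + stepCost r a ρ vs x t := fun t => by
    obtain ⟨C, hC⟩ := hpotb (t + 1)
    have e : P (t + 1) = _ := integral_sgdIter_succ (lam := lam) (a := a) x t (hpotm (t + 1)) hC hr
    have i1 : Integrable (fun w => sgdPotential r a vs x t (sgdIter r lam a x w t) -
        lam ^ 2 * t * sqDist (sgdIter r lam a x w t) vs) batchTape :=
      (hPint t).sub ((hAint t).const_mul _)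
    have e2 : ∫ w, (sgdPotential r a vs x t (sgdIter r lam a x w t) -
        lam ^ 2 * t * sqDist (sgdIter r lam a x w t) vs + stepCost r a ρ vs x t) ∂batchTape =
        P t - lam ^ 2 * t * A t + stepCost r a ρ vs x t := by
      rw [integral_add i1 (integrable_const _), integral_sub (hPint t) ((hAint t).const_mul _),
        integral_const_mul]
      simp [hP, hA]
    rw [e, ← e2]
    refine integral_mono_of_nonneg (Filter.Eventually.of_forall fun w => ?_)
      (i1.add (integrable_const _)) (Filter.Eventually.of_forall fun w => ?_)
    · exact integral_nonneg fun u => by unfold sgdPotential; positivity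
    · exact integral_sgdPotential_le hr hρ ha hvs x t (sgdIter_mem hr _ _ _ _ _)
  have hP0 : P 0 = 0 := by
    have : ∀ w, sgdPotential r a vs x 0 (sgdIter r lam a x w 0) = 0 := fun w => by
      simp [sgdPotential, devSum]
    simp [hP, this]
  have hsum := sum_le_of_recursion (by positivity : 0 < lam ^ 2) hP0
    (fun t => integral_nonneg fun w => by unfold sgdPotential; positivity)
    (fun t => integral_nonneg fun w => sqDist_nonneg _ _) hrec T
  have hAT : A T ≤ 8 * r ^ 2 := by
    have := integral_mono (hAint T) (integrable_const (8 * r ^ 2))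
      fun w => sqDist_le hr (sgdIter_mem hr lam a x w T) hvsm
    simpa using this
  calc _ ≤ ∫ w, (∑ i ∈ Finset.range T, sqDist (sgdIter r lam a x w (i + 1)) vs) / T ∂batchTape :=
        integral_mono_of_nonneg (Filter.Eventually.of_forall fun w => sqDist_nonneg _ _)
          ((integrable_finsetSum _ fun i _ => hAint (i + 1)).div_const _)
          (Filter.Eventually.of_forall fun w => sqDist_sgdAvg_le r lam a x w hT vs)
    _ = (∑ i ∈ Finset.range T, A (i + 1)) / T := by
      rw [integral_div, integral_finsetSum _ fun i _ => hAint (i + 1)]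
    _ ≤ _ := by gcongr; linarith

/-! ## Moments of the truncated standard Gaussian -/

theorem integrable_poly_mul_exp_stdG (k : ℕ) {c : ℝ} (hc : c < 1 / 2) :
    Integrable (fun x : ℝ => (1 + x ^ 2) ^ k * Real.exp (c * x ^ 2)) stdG := by
  have h1 : stdG = volume.withDensity fun x => ENNReal.ofReal (gaussianPDFReal 0 1 x) :=
    gaussianReal_of_var_ne_zero 0 one_ne_zero
  rw [h1, integrable_withDensity_iff (measurable_gaussianPDFReal 0 1).ennreal_ofReal
    (by simp)]
  have h2 := (integrable_poly_mul_exp k (b := 1 / 2 - c) (by linarith)).mul_const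
    ((√(2 * Real.pi * 1))⁻¹)
  refine h2.congr (Filter.Eventually.of_forall fun x => ?_)
  have h3 : (ENNReal.ofReal (gaussianPDFReal 0 1 x)).toReal = gaussianPDFReal 0 1 x :=
    ENNReal.toReal_ofReal (gaussianPDFReal_nonneg _ _ _)
  dsimp only
  rw [h3, gaussianPDFReal]
  have h4 : Real.exp (-(1 / 2 - c) * x ^ 2) =
      Real.exp (c * x ^ 2) * Real.exp (-(x - 0) ^ 2 / (2 * ((1 : NNReal) : ℝ))) := by
    rw [← Real.exp_add]; congr 1; simp; ring
  rw [h4]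
  simp
  ring

theorem half_le_stdG_Ioi {m : ℝ} (hm : 0 ≤ m) : (1 / 2 : ENNReal) ≤ stdG (Set.Ioi (-m)) := by
  have h1 : stdG (Set.Ioi 0) = stdG (Set.Iio 0) := by
    have h2 : stdG.map (fun x => -x) = stdG := by simp [gaussianReal_map_neg]
    conv_lhs => rw [← h2, Measure.map_apply measurable_neg measurableSet_Ioi]
    congr 1; ext x; simp
  have h3 : stdG {0} = 0 := by
    have := nullSingletonClass_gaussianReal (μ := 0) (v := 1) one_ne_zero
    exact measure_singleton 0
  have h4 : (1 : ENNReal) ≤ stdG (Set.Iio 0) + stdG {0} + stdG (Set.Ioi 0) := by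
    rw [← measure_univ (μ := stdG)]
    refine (measure_mono ?_).trans ((measure_union_le (Set.Iio 0 ∪ {0}) (Set.Ioi 0)).trans
      (add_le_add_left (measure_union_le _ _) _))
    intro x _
    rcases lt_trichotomy x 0 with h | h | h <;> simp [h]
  rw [h3, add_zero, ← h1, ← two_mul] at h4
  calc (1 / 2 : ENNReal) ≤ stdG (Set.Ioi 0) := by
        rw [ENNReal.div_le_iff (by norm_num) (by norm_num), mul_comm]; exact h4
    _ ≤ _ := measure_mono (Set.Ioi_subset_Ioi (by linarith))

/-- The standard Gaussian, truncated to `(-m, ∞)`. -/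
noncomputable abbrev truncG (m : ℝ) : Measure ℝ := stdG[|Set.Ioi (-m)]

theorem stdG_Ioi_pos (m : ℝ) : 0 < stdG (Set.Ioi (-m)) :=
  stdG_pos_of_isOpen isOpen_Ioi ⟨-m + 1, by simp⟩

instance isProbabilityMeasure_truncG (m : ℝ) : IsProbabilityMeasure (truncG m) :=
  cond_isProbabilityMeasure (stdG_Ioi_pos m).ne'

/-- This is where a non-negative bias matters: conditioning on an event of probability at least
`1/2` at most doubles the measure, so moment bounds pass from the Gaussian to all truncations at
once. -/
theorem truncG_le {m : ℝ} (hm : 0 ≤ m) : truncG m ≤ (2 : ENNReal) • stdG := by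
  rw [truncG, ProbabilityTheory.cond]
  have h : (stdG (Set.Ioi (-m)))⁻¹ ≤ 2 := by
    rw [ENNReal.inv_le_iff_inv_le]
    simpa using half_le_stdG_Ioi hm
  exact (Measure.le_iff'.2 fun s => by
    simp only [Measure.smul_apply, smul_eq_mul]
    exact mul_le_mul' h (Measure.restrict_apply_le _ _))

theorem integrable_truncG {m : ℝ} (hm : 0 ≤ m) {f : ℝ → ℝ} (hf : Integrable f stdG) :
    Integrable f (truncG m) :=
  (hf.smul_measure (c := 2) (by norm_num)).mono_measure (truncG_le hm)

theorem integral_truncG_le {m : ℝ} (hm : 0 ≤ m) {f : ℝ → ℝ} (hf : Integrable f stdG)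
    (h0 : ∀ x, 0 ≤ f x) : ∫ x, f x ∂(truncG m) ≤ 2 * ∫ x, f x ∂stdG := by
  have := integral_mono_measure (truncG_le hm) (Filter.Eventually.of_forall h0)
    (hf.smul_measure (by norm_num))
  rw [integral_smul_measure] at this
  simpa using this

theorem integrable_poly_stdG (k : ℕ) : Integrable (fun x : ℝ => (1 + x ^ 2) ^ k) stdG := by
  simpa using integrable_poly_mul_exp_stdG k (c := 0) (by norm_num)

/-- The mean of the square of a truncated standard Gaussian. -/
noncomputable def truncSq (m : ℝ) : ℝ := ∫ y, y ^ 2 ∂(truncG m)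

/-- The mean of a truncated standard Gaussian. -/
noncomputable def truncMean (m : ℝ) : ℝ := ∫ y, y ∂(truncG m)

theorem integrable_sq_stdG : Integrable (fun x : ℝ => x ^ 2) stdG := by
  refine (integrable_poly_stdG 1).mono' (by fun_prop) (Filter.Eventually.of_forall fun x => ?_)
  rw [Real.norm_of_nonneg (sq_nonneg x)]; linarith

theorem integrable_id_stdG : Integrable (fun x : ℝ => x) stdG := by
  refine (integrable_poly_stdG 1).mono' (by fun_prop) (Filter.Eventually.of_forall fun x => ?_)
  rw [Real.norm_eq_abs]; nlinarith [sq_nonneg (|x| - 1), sq_abs x]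

theorem integral_sq_stdG : ∫ x, x ^ 2 ∂stdG = 1 := by
  have h := variance_fun_id_gaussianReal (μ := 0) (v := 1)
  rw [variance_eq_integral (by fun_prop)] at h
  simpa [integral_id_gaussianReal] using h

theorem truncSq_le {m : ℝ} (hm : 0 ≤ m) : truncSq m ≤ 2 := by
  have := integral_truncG_le hm integrable_sq_stdG fun x => sq_nonneg x
  rw [integral_sq_stdG] at this
  simpa [truncSq] using this

theorem truncSq_nonneg (m : ℝ) : 0 ≤ truncSq m := integral_nonneg fun x => sq_nonneg x

theorem integral_sub_sq_truncG {m : ℝ} (hm : 0 ≤ m) (c : ℝ) :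
    ∫ y, (y - c) ^ 2 ∂(truncG m) = truncSq m - 2 * c * truncMean m + c ^ 2 := by
  have e : ∀ y : ℝ, (y - c) ^ 2 = (y ^ 2 - 2 * c * y) + c ^ 2 := fun y => by ring
  simp_rw [e]
  have i1 := integrable_truncG hm integrable_sq_stdG
  have i2 := (integrable_truncG hm integrable_id_stdG).const_mul (2 * c)
  have i3 : Integrable (fun y : ℝ => y ^ 2 - 2 * c * y) (truncG m) := i1.sub i2
  rw [integral_add i3 (integrable_const _), integral_sub i1 i2, integral_const_mul]
  simp [truncSq, truncMean]

theorem truncMean_sq_le {m : ℝ} (hm : 0 ≤ m) : truncMean m ^ 2 ≤ truncSq m := by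
  have h := integral_sub_sq_truncG hm (truncMean m)
  have h2 : 0 ≤ ∫ y, (y - truncMean m) ^ 2 ∂(truncG m) := integral_nonneg fun x => sq_nonneg _
  nlinarith

theorem abs_truncMean_le {m : ℝ} (hm : 0 ≤ m) : |truncMean m| ≤ 3 / 2 := by
  refine abs_le_of_sq_le_sq' ?_ (by norm_num) |> abs_le.2
  have := truncMean_sq_le hm
  have := truncSq_le hm
  linarith

theorem gaussianPDFReal_ge {x : ℝ} (h0 : 0 ≤ x) (h1 : x ≤ 1) : 1 / 6 ≤ gaussianPDFReal 0 1 x := by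
  rw [gaussianPDFReal]
  have h2 : √(2 * Real.pi * ((1 : NNReal) : ℝ)) ≤ 3 := by
    rw [Real.sqrt_le_left (by norm_num)]
    have := Real.pi_lt_d2
    simp; linarith
  have h2' : 0 < √(2 * Real.pi * ((1 : NNReal) : ℝ)) := by
    have := Real.pi_pos; simp; positivity
  have h3 : (1 : ℝ) / 2 ≤ Real.exp (-(x - 0) ^ 2 / (2 * ((1 : NNReal) : ℝ))) := by
    have := Real.add_one_le_exp (-(x - 0) ^ 2 / (2 * ((1 : NNReal) : ℝ)))
    simp at this ⊢
    nlinarith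
  have h4 : (3 : ℝ)⁻¹ ≤ (√(2 * Real.pi * ((1 : NNReal) : ℝ)))⁻¹ := by gcongr
  calc (1 : ℝ) / 6 = 3⁻¹ * (1 / 2) := by norm_num
    _ ≤ _ := by gcongr

/-- Only `(0, 1]` is used. The Gaussian density is at least `1/6` there and `∫ (y - c)² ≥ 1/12` for
every `c`, which gives `1/72`; normalization can only increase it. -/
theorem variance_truncG_ge {m : ℝ} (hm : 0 ≤ m) : 1 / 100 ≤ truncSq m - truncMean m ^ 2 := by
  set c := truncMean m with hc
  have h := integral_sub_sq_truncG hm c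
  have h1 : truncSq m - c ^ 2 = ∫ y, (y - c) ^ 2 ∂(truncG m) := by rw [h]; ring
  have hi : Integrable (fun y : ℝ => (y - c) ^ 2) stdG := by
    have e : (fun y : ℝ => (y - c) ^ 2) = fun y => (y ^ 2 - 2 * c * y) + c ^ 2 := by
      funext y; ring
    rw [e]
    exact (integrable_sq_stdG.sub (integrable_id_stdG.const_mul _)).add (integrable_const _)
  have h2 : ∫ y in Set.Ioi (-m), (y - c) ^ 2 ∂stdG ≤ ∫ y, (y - c) ^ 2 ∂(truncG m) := by
    rw [truncG, ProbabilityTheory.cond, integral_smul_measure, smul_eq_mul]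
    refine le_mul_of_one_le_left (integral_nonneg fun x => sq_nonneg _) ?_
    rw [ENNReal.toReal_inv]
    refine (one_le_inv₀ (ENNReal.toReal_pos (stdG_Ioi_pos m).ne' (measure_ne_top _ _))).2 ?_
    exact ENNReal.toReal_le_of_le_ofReal zero_le_one (by simpa using prob_le_one)
  have h3 : ∫ y in Set.Ioc (0 : ℝ) 1, (y - c) ^ 2 ∂stdG ≤ ∫ y in Set.Ioi (-m), (y - c) ^ 2 ∂stdG :=
    setIntegral_mono_set hi.integrableOn (Filter.Eventually.of_forall fun x => sq_nonneg _)
      (LE.le.eventuallyLE fun x hx => lt_of_le_of_lt (by linarith) hx.1)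
  have h4 : ∫ y in Set.Ioc (0 : ℝ) 1, (1 / 6) * (y - c) ^ 2 ≤
      ∫ y in Set.Ioc (0 : ℝ) 1, (y - c) ^ 2 ∂stdG := by
    rw [← integral_indicator measurableSet_Ioc (μ := stdG),
      integral_gaussianReal_eq_integral_smul one_ne_zero, ← integral_indicator measurableSet_Ioc]
    refine integral_mono ?_ ?_ fun y => ?_
    · rw [integrable_indicator_iff measurableSet_Ioc]
      exact (Continuous.integrableOn_Icc (a := 0) (b := 1) (by fun_prop)).mono_set
        Set.Ioc_subset_Icc_self
    · have hcont : Continuous fun y => gaussianPDFReal 0 1 y * (y - c) ^ 2 := by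
        unfold gaussianPDFReal; fun_prop
      have : (fun y => gaussianPDFReal 0 1 y • (Set.Ioc (0 : ℝ) 1).indicator
          (fun y => (y - c) ^ 2) y) = (Set.Ioc (0 : ℝ) 1).indicator
          fun y => gaussianPDFReal 0 1 y * (y - c) ^ 2 := by
        funext y; simp only [Set.indicator_apply, smul_eq_mul]; split_ifs <;> simp
      rw [this, integrable_indicator_iff measurableSet_Ioc]
      exact (hcont.integrableOn_Icc (a := 0) (b := 1)).mono_set Set.Ioc_subset_Icc_self
    · simp only [Set.indicator_apply, smul_eq_mul]
      split_ifs with hy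
      · have := gaussianPDFReal_ge hy.1.le hy.2
        gcongr
      · simp
  have h5 : ∫ y in Set.Ioc (0 : ℝ) 1, (1 / 6) * (y - c) ^ 2 = 1 / 6 * (1 / 3 - c + c ^ 2) := by
    rw [← intervalIntegral.integral_of_le zero_le_one, intervalIntegral.integral_const_mul,
      intervalIntegral.integral_comp_sub_right (fun y => y ^ 2) c, integral_pow]
    norm_num; ring
  rw [h1]
  nlinarith [sq_nonneg (c - 1 / 2)]

/-! ## Concentration -/

theorem exp_le_one_add_add_sq (u : ℝ) : Real.exp u ≤ 1 + u + u ^ 2 * Real.exp |u| := by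
  rcases le_total 0 u with h | h
  · rw [abs_of_nonneg h]
    have h1 := Real.add_one_le_exp (-u)
    have h2 : Real.exp u * Real.exp (-u) = 1 := by rw [← Real.exp_add]; simp
    have h3 : Real.exp u - 1 ≤ u * Real.exp u := by nlinarith [Real.exp_pos u]
    nlinarith [Real.exp_pos u]
  · rw [abs_of_nonpos h]
    have h1 := Real.add_one_le_exp (-u)
    have h2 : Real.exp u * Real.exp (-u) = 1 := by rw [← Real.exp_add]; simp
    have h3 : Real.exp u - 1 ≤ u * Real.exp u := by nlinarith [Real.exp_pos u]
    have h4 := Real.add_one_le_exp u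
    have h5 : 1 ≤ Real.exp (-u) := Real.one_le_exp (by linarith)
    nlinarith [sq_nonneg u]

/-- Chernoff's method with `exp u ≤ 1 + u + u² exp |u|`. For `s ≤ 1/8` the moment generating
function of a centred summand is at most `exp (s² K)`; the second entry of the minimum makes `s² K`
at most half of `s τ`. -/
theorem measure_sum_ge_le_exp {Ω : Type*} [MeasurableSpace Ω] {P : Measure Ω}
    [IsProbabilityMeasure P] {ξ : ℕ → Ω → ℝ} (hind : iIndepFun ξ P) (hm : ∀ k, Measurable (ξ k))
    (hi : ∀ k, Integrable (ξ k) P) (h0 : ∀ k, ∫ ω, ξ k ω ∂P = 0) {K : ℝ} (hK : 0 < K)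
    (hKi : ∀ k, Integrable (fun ω => ξ k ω ^ 2 * Real.exp (|ξ k ω| / 8)) P)
    (hKb : ∀ k, ∫ ω, ξ k ω ^ 2 * Real.exp (|ξ k ω| / 8) ∂P ≤ K) (N : ℕ) {τ : ℝ} (hτ : 0 < τ) :
    P.real {ω | N * τ ≤ ∑ k ∈ Finset.range N, ξ k ω} ≤
      Real.exp (-(min (1 / 8) (τ / (2 * K)) * τ / 2) * N) := by
  set s := min (1 / 8) (τ / (2 * K)) with hs
  have hs0 : 0 < s := lt_min (by norm_num) (by positivity)
  have hs1 : s ≤ 1 / 8 := min_le_left _ _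
  have hs2 : s * K ≤ τ / 2 := by
    have : s ≤ τ / (2 * K) := min_le_right _ _
    calc s * K ≤ τ / (2 * K) * K := by gcongr
      _ = τ / 2 := by field_simp
  have hpt : ∀ k ω, Real.exp (s * ξ k ω) ≤
      (1 + s * ξ k ω) + s ^ 2 * (ξ k ω ^ 2 * Real.exp (|ξ k ω| / 8)) := fun k ω => by
    refine (exp_le_one_add_add_sq (s * ξ k ω)).trans ?_
    rw [mul_pow, mul_assoc, abs_mul, abs_of_pos hs0]
    gcongr
    nlinarith [abs_nonneg (ξ k ω)]
  have hdom : ∀ k, Integrable (fun ω => (1 + s * ξ k ω) +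
      s ^ 2 * (ξ k ω ^ 2 * Real.exp (|ξ k ω| / 8))) P := fun k =>
    ((integrable_const _).add ((hi k).const_mul s)).add ((hKi k).const_mul _)
  have hexp : ∀ k, Integrable (fun ω => Real.exp (s * ξ k ω)) P := fun k =>
    (hdom k).mono' (by have := hm k; fun_prop) (Filter.Eventually.of_forall fun ω => by
      rw [Real.norm_of_nonneg (Real.exp_pos _).le]; exact hpt k ω)
  have hmgf : ∀ k, mgf (ξ k) P s ≤ Real.exp (s ^ 2 * K) := fun k => by
    have h1 : Integrable (fun ω => 1 + s * ξ k ω) P :=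
      (integrable_const _).add ((hi k).const_mul s)
    calc mgf (ξ k) P s ≤ ∫ ω, ((1 + s * ξ k ω) +
          s ^ 2 * (ξ k ω ^ 2 * Real.exp (|ξ k ω| / 8))) ∂P :=
          integral_mono (hexp k) (hdom k) (hpt k)
      _ = 1 + s ^ 2 * ∫ ω, ξ k ω ^ 2 * Real.exp (|ξ k ω| / 8) ∂P := by
          rw [integral_add h1 ((hKi k).const_mul _),
            integral_add (integrable_const _) ((hi k).const_mul s), integral_const_mul,
            integral_const_mul, h0 k]
          simp
      _ ≤ 1 + s ^ 2 * K := by gcongr; exact hKb k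
      _ ≤ _ := by rw [add_comm]; exact Real.add_one_le_exp _
  have hsum : Integrable (fun ω => Real.exp (s * (∑ k ∈ Finset.range N, ξ k) ω)) P :=
    hind.integrable_exp_mul_sum hm (s := Finset.range N) fun k _ => hexp k
  have h1 := measure_ge_le_exp_mul_mgf (μ := P) (X := ∑ k ∈ Finset.range N, ξ k) (N * τ) hs0.le hsum
  rw [hind.mgf_sum hm] at h1
  simp only [Finset.sum_apply] at h1
  refine h1.trans ?_
  have h2 : ∏ k ∈ Finset.range N, mgf (ξ k) P s ≤ Real.exp (s ^ 2 * K) ^ N := by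
    calc _ ≤ ∏ k ∈ Finset.range N, Real.exp (s ^ 2 * K) :=
          Finset.prod_le_prod (fun k _ => mgf_nonneg) fun k _ => hmgf k
      _ = _ := by simp
  calc _ ≤ Real.exp (-s * (N * τ)) * Real.exp (s ^ 2 * K) ^ N := by gcongr
    _ = Real.exp (-s * (N * τ) + N * (s ^ 2 * K)) := by rw [Real.exp_add, Real.exp_nat_mul]
    _ ≤ _ := by
      rw [Real.exp_le_exp]
      have h3 : s * (s * K) ≤ s * (τ / 2) := by gcongr
      have h4 : (0 : ℝ) ≤ N := Nat.cast_nonneg N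
      nlinarith [mul_le_mul_of_nonneg_left h3 h4]

/-- Add one independent summand at a time. In the expansion of the fourth power, terms with a first
power have mean zero. The surviving mixed term is at most `6 M² t`, which fits into the increment of
`3 M² t²`; it needs the second moment, so the bounds are proved together. -/
theorem moment_sum_le {Ω : Type*} [MeasurableSpace Ω] {P : Measure Ω}
    [IsProbabilityMeasure P] {ξ : ℕ → Ω → ℝ} (hind : iIndepFun ξ P) (hm : ∀ k, Measurable (ξ k))
    (h4 : ∀ k, Integrable (fun ω => ξ k ω ^ 4) P) (h0 : ∀ k, ∫ ω, ξ k ω ∂P = 0) {M : ℝ}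
    (hM1 : 1 ≤ M) (hM : ∀ k, ∫ ω, ξ k ω ^ 4 ∂P ≤ M) (t : ℕ) :
    Integrable (fun ω => (∑ k ∈ Finset.range t, ξ k ω) ^ 4) P ∧
    ∫ ω, (∑ k ∈ Finset.range t, ξ k ω) ^ 2 ∂P ≤ M * t ∧
    ∫ ω, (∑ k ∈ Finset.range t, ξ k ω) ^ 4 ∂P ≤ 3 * M ^ 2 * t ^ 2 := by
  have low : ∀ {X : Ω → ℝ}, Measurable X → Integrable (fun ω => X ω ^ 4) P → ∀ j ≤ 4,
      Integrable (fun ω => X ω ^ j) P := fun {X} hX hX4 j hj => by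
    refine ((integrable_const (1 : ℝ)).add hX4).mono' (by fun_prop)
      (Filter.Eventually.of_forall fun ω => ?_)
    rw [Real.norm_eq_abs, abs_pow]
    simp only [Pi.add_apply]
    have e : X ω ^ 4 = |X ω| ^ 4 := by rw [← abs_pow, abs_of_nonneg (by positivity)]
    rw [e]
    rcases le_total |X ω| 1 with h | h
    · have := pow_le_one₀ (n := j) (abs_nonneg _) h
      have : 0 ≤ |X ω| ^ 4 := by positivity
      linarith
    · have := pow_le_pow_right₀ h hj
      linarith
  have hM2 : ∀ k, ∫ ω, ξ k ω ^ 2 ∂P ≤ M := fun k => by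
    have h1 : ∫ ω, ξ k ω ^ 2 ∂P ≤ ∫ ω, (1 / 2 + 1 / 2 * ξ k ω ^ 4) ∂P :=
      integral_mono (low (hm k) (h4 k) 2 (by norm_num))
        ((integrable_const _).add ((h4 k).const_mul _)) fun ω => by
          dsimp only; nlinarith [sq_nonneg (ξ k ω ^ 2 - 1)]
    rw [integral_add (integrable_const _) ((h4 k).const_mul _), integral_const_mul] at h1
    simp at h1
    linarith [hM k]
  induction t with
  | zero => simp
  | succ t ih =>
    obtain ⟨i4, b2, b4⟩ := ih
    set S : Ω → ℝ := fun ω => ∑ k ∈ Finset.range t, ξ k ω with hS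
    have hSm : Measurable S := Finset.measurable_sum _ fun k _ => hm k
    have hSξ : IndepFun S (ξ t) P := by
      have := hind.indepFun_finsetSum_of_notMem hm (s := Finset.range t) (i := t) (by simp)
      convert this using 1
      funext ω; simp [hS]
    have iS := fun j hj => low hSm i4 j hj
    have iξ := fun j hj => low (hm t) (h4 t) j hj
    have hmul : ∀ i j, i ≤ 4 → j ≤ 4 → Integrable (fun ω => S ω ^ i * ξ t ω ^ j) P ∧
        ∫ ω, S ω ^ i * ξ t ω ^ j ∂P = (∫ ω, S ω ^ i ∂P) * ∫ ω, ξ t ω ^ j ∂P := fun i j hi hj => by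
      have hI : IndepFun (fun ω => S ω ^ i) (fun ω => ξ t ω ^ j) P :=
        hSξ.comp (φ := fun x => x ^ i) (ψ := fun x => x ^ j) (by fun_prop) (by fun_prop)
      exact ⟨hI.integrable_mul (iS i hi) (iξ j hj),
        hI.integral_fun_mul_eq_mul_integral (iS i hi).aestronglyMeasurable
          (iξ j hj).aestronglyMeasurable⟩
    have hS0 : ∫ ω, S ω ^ 1 ∂P = 0 := by
      simp only [pow_one, hS]
      rw [integral_finsetSum _ fun k _ => by simpa using low (hm k) (h4 k) 1 (by norm_num)]
      simp [h0]
    have hξ0 : ∫ ω, ξ t ω ^ 1 ∂P = 0 := by simpa using h0 t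
    simp only [Finset.sum_range_succ]
    change Integrable (fun ω => (S ω + ξ t ω) ^ 4) P ∧ ∫ ω, (S ω + ξ t ω) ^ 2 ∂P ≤ _ ∧
      ∫ ω, (S ω + ξ t ω) ^ 4 ∂P ≤ _
    have e4 : ∀ ω, (S ω + ξ t ω) ^ 4 = S ω ^ 4 + (4 * (S ω ^ 3 * ξ t ω ^ 1) +
      (6 * (S ω ^ 2 * ξ t ω ^ 2) + (4 * (S ω ^ 1 * ξ t ω ^ 3) + ξ t ω ^ 4))) := fun ω => by ring
    have e2 : ∀ ω, (S ω + ξ t ω) ^ 2 = S ω ^ 2 + (2 * (S ω ^ 1 * ξ t ω ^ 1) + ξ t ω ^ 2) :=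
      fun ω => by ring
    have m31 := hmul 3 1 (by norm_num) (by norm_num)
    have m22 := hmul 2 2 (by norm_num) (by norm_num)
    have m13 := hmul 1 3 (by norm_num) (by norm_num)
    have m11 := hmul 1 1 (by norm_num) (by norm_num)
    have j1 : Integrable (fun ω => 4 * (S ω ^ 1 * ξ t ω ^ 3) + ξ t ω ^ 4) P :=
      (m13.1.const_mul 4).add (h4 t)
    have j2 : Integrable (fun ω => 6 * (S ω ^ 2 * ξ t ω ^ 2) +
      (4 * (S ω ^ 1 * ξ t ω ^ 3) + ξ t ω ^ 4)) P := (m22.1.const_mul 6).add j1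
    have j3 : Integrable (fun ω => 4 * (S ω ^ 3 * ξ t ω ^ 1) + (6 * (S ω ^ 2 * ξ t ω ^ 2) +
      (4 * (S ω ^ 1 * ξ t ω ^ 3) + ξ t ω ^ 4))) P := (m31.1.const_mul 4).add j2
    have j4 : Integrable (fun ω => 2 * (S ω ^ 1 * ξ t ω ^ 1) + ξ t ω ^ 2) P :=
      (m11.1.const_mul 2).add (iξ 2 (by norm_num))
    have b2' : 0 ≤ ∫ ω, S ω ^ 2 ∂P := integral_nonneg fun ω => sq_nonneg _
    have c2' : 0 ≤ ∫ ω, ξ t ω ^ 2 ∂P := integral_nonneg fun ω => sq_nonneg _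
    refine ⟨?_, ?_, ?_⟩
    · simp_rw [e4]; exact (iS 4 le_rfl).add j3
    · simp_rw [e2]
      rw [integral_add (iS 2 (by norm_num)) j4, integral_add (m11.1.const_mul 2)
        (iξ 2 (by norm_num)), integral_const_mul, m11.2, hξ0]
      push_cast
      linarith [hM2 t]
    · simp_rw [e4]
      rw [integral_add (iS 4 le_rfl) j3, integral_add (m31.1.const_mul 4) j2,
        integral_add (m22.1.const_mul 6) j1, integral_add (m13.1.const_mul 4) (h4 t),
        integral_const_mul, integral_const_mul, integral_const_mul, m31.2, m22.2, m13.2, hξ0, hS0]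
      have h5 : (∫ ω, S ω ^ 2 ∂P) * ∫ ω, ξ t ω ^ 2 ∂P ≤ (M * t) * M :=
        mul_le_mul b2 (hM2 t) c2' (by positivity)
      have h6 := hM t
      have h7 : M ≤ M ^ 2 := by nlinarith
      push_cast
      nlinarith

/-! ## The data in one coordinate -/

theorem hoeffding_le {Ω ι : Type*} [MeasurableSpace Ω] {P : Measure Ω} [IsProbabilityMeasure P]
    {X : ι → Ω → ℝ} (hind : iIndepFun X P) (hm : ∀ i, Measurable (X i))
    (h01 : ∀ i ω, X i ω ∈ Set.Icc (0 : ℝ) 1) (s : Finset ι) {p : ℝ}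
    (hp : ∀ i ∈ s, ∫ ω, X i ω ∂P ≤ p) {u : ℝ} (hu : 0 ≤ u) :
    P.real {ω | s.card * p + u ≤ ∑ i ∈ s, X i ω} ≤ Real.exp (-2 * u ^ 2 / s.card) := by
  have hsub : ∀ i ∈ s, HasSubgaussianMGF (fun ω => X i ω - ∫ ω, X i ω ∂P)
      ((‖(1 : ℝ) - 0‖₊ / 2) ^ 2) P := fun i _ =>
    hasSubgaussianMGF_of_mem_Icc (hm i).aemeasurable (Filter.Eventually.of_forall (h01 i))
  have hind' : iIndepFun (fun i ω => X i ω - ∫ ω, X i ω ∂P) P :=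
    hind.comp (fun i x => x - ∫ ω, X i ω ∂P) fun i => by fun_prop
  have h := HasSubgaussianMGF.measure_sum_ge_le_of_iIndepFun hind' hsub hu
  refine le_trans (measureReal_mono fun ω hω => ?_) (h.trans (le_of_eq ?_))
  · simp only [Set.mem_ofPred_eq] at hω ⊢
    rw [Finset.sum_sub_distrib]
    have : ∑ i ∈ s, ∫ ω, X i ω ∂P ≤ s.card * p := by
      simpa using Finset.sum_le_card_nsmul s _ p hp
    linarith
  · congr 1
    simp
    ring_nf

/-- The law of a sequence of independent truncated Gaussians. -/
noncomputable abbrev dataSeq (m : ℝ) : Measure (ℕ → ℝ) := Measure.infinitePi fun _ : ℕ => truncG m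

/-- A centered statistic of at most quadratic growth. -/
structure IsCentered (m : ℝ) (g : ℝ → ℝ) : Prop where
  meas : Measurable g
  growth : ∀ y, |g y| ≤ y ^ 2 + 2
  mean : ∫ y, g y ∂(truncG m) = 0

theorem isCentered_sq {m : ℝ} (hm : 0 ≤ m) : IsCentered m fun y => y ^ 2 - truncSq m where
  meas := by fun_prop
  growth y := by
    have h1 := truncSq_le hm
    have h2 := truncSq_nonneg m
    rw [abs_le]; constructor <;> nlinarith [sq_nonneg y]
  mean := by
    rw [integral_sub (integrable_truncG hm integrable_sq_stdG) (integrable_const _)]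
    simp [truncSq]

theorem isCentered_id {m : ℝ} (hm : 0 ≤ m) : IsCentered m fun y => y - truncMean m where
  meas := by fun_prop
  growth y := by
    have h1 := abs_truncMean_le hm
    refine (abs_sub _ _).trans ?_
    nlinarith [sq_nonneg (|y| - 1 / 2), sq_abs y]
  mean := by
    rw [integral_sub (integrable_truncG hm integrable_id_stdG) (integrable_const _)]
    simp [truncMean]

/-- The constant of the exponential moments. -/
noncomputable def chernoffMoment : ℝ :=
  2 * ∫ y, 4 * Real.exp (1 / 4) * ((1 + y ^ 2) ^ 2 * Real.exp (1 / 8 * y ^ 2)) ∂stdG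

/-- The constant of the fourth moments. -/
noncomputable def fourthMoment : ℝ := 2 * ∫ y, 16 * (1 + y ^ 2) ^ 4 ∂stdG

theorem one_le_fourthMoment : 1 ≤ fourthMoment := by
  have h : ∫ _y : ℝ, (1 : ℝ) ∂stdG ≤ ∫ y, 16 * (1 + y ^ 2) ^ 4 ∂stdG :=
    integral_mono (integrable_const _) ((integrable_poly_stdG 4).const_mul _) fun y => by
      have : (1 : ℝ) ≤ (1 + y ^ 2) ^ 4 := one_le_pow₀ (by nlinarith [sq_nonneg y])
      dsimp only; linarith
  simp at h
  unfold fourthMoment; linarith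

theorem one_le_chernoffMoment : 1 ≤ chernoffMoment := by
  have h : ∫ _y : ℝ, (1 : ℝ) ∂stdG ≤
      ∫ y, 4 * Real.exp (1 / 4) * ((1 + y ^ 2) ^ 2 * Real.exp (1 / 8 * y ^ 2)) ∂stdG :=
    integral_mono (integrable_const _) ((integrable_poly_mul_exp_stdG 2 (by norm_num)).const_mul _)
      fun y => by
      have h1 : (1 : ℝ) ≤ (1 + y ^ 2) ^ 2 := one_le_pow₀ (by nlinarith [sq_nonneg y])
      have h2 : 1 ≤ Real.exp (1 / 8 * y ^ 2) := Real.one_le_exp (by positivity)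
      have h3 : (1 : ℝ) ≤ Real.exp (1 / 4) := Real.one_le_exp (by norm_num)
      dsimp only
      nlinarith [one_le_mul_of_one_le_of_one_le h1 h2]
  simp at h
  unfold chernoffMoment
  norm_num at h ⊢
  linarith

section IsCentered

variable {m : ℝ} {g : ℝ → ℝ}

/-- Quadratic growth and the tilt `1/8` give `exp (y² / 8)`, below the threshold `exp (y² / 2)` of
Gaussian integrability. -/
theorem IsCentered.chernoff_bound (hg : IsCentered m g) (y : ℝ) :
    g y ^ 2 * Real.exp (|g y| / 8) ≤
      4 * Real.exp (1 / 4) * ((1 + y ^ 2) ^ 2 * Real.exp (1 / 8 * y ^ 2)) := by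
  have h := hg.growth y
  have h1 : g y ^ 2 ≤ (2 * (1 + y ^ 2)) ^ 2 := by
    rw [← sq_abs]; gcongr; nlinarith [sq_nonneg y]
  have h2 : Real.exp (|g y| / 8) ≤ Real.exp (1 / 4 + 1 / 8 * y ^ 2) := by
    rw [Real.exp_le_exp]; linarith
  calc _ ≤ (2 * (1 + y ^ 2)) ^ 2 * Real.exp (1 / 4 + 1 / 8 * y ^ 2) := by gcongr
    _ = _ := by rw [Real.exp_add]; ring

theorem IsCentered.fourth_bound (hg : IsCentered m g) (y : ℝ) :
    g y ^ 4 ≤ 16 * (1 + y ^ 2) ^ 4 := by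
  have h := hg.growth y
  have h1 : |g y| ^ 4 ≤ (2 * (1 + y ^ 2)) ^ 4 := by
    gcongr; nlinarith [sq_nonneg y]
  have e : |g y| ^ 4 = g y ^ 4 := by rw [← abs_pow, abs_of_nonneg (by positivity)]
  rw [← e]
  exact h1.trans_eq (by ring)

theorem integrable_chernoff : Integrable (fun y : ℝ =>
    4 * Real.exp (1 / 4) * ((1 + y ^ 2) ^ 2 * Real.exp (1 / 8 * y ^ 2))) stdG :=
  (integrable_poly_mul_exp_stdG 2 (by norm_num)).const_mul _

theorem IsCentered.integrable (hg : IsCentered m g) (hm : 0 ≤ m) : Integrable g (truncG m) := by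
  refine (integrable_truncG hm ((integrable_poly_stdG 1).const_mul 2)).mono'
    hg.meas.aestronglyMeasurable (Filter.Eventually.of_forall fun y => ?_)
  have := hg.growth y
  rw [Real.norm_eq_abs]; nlinarith [sq_nonneg y]

theorem map_eval_dataSeq (m : ℝ) (k : ℕ) : (dataSeq m).map (fun Y => Y k) = truncG m :=
  Measure.infinitePi_map_eval _ k

theorem integral_eval_dataSeq (k : ℕ) {f : ℝ → ℝ} (hf : Measurable f) :
    ∫ Y, f (Y k) ∂(dataSeq m) = ∫ y, f y ∂(truncG m) := by
  rw [← map_eval_dataSeq m k, integral_map (measurable_pi_apply k).aemeasurable hf.aestronglyMeasurable]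

theorem integrable_eval_dataSeq (k : ℕ) {f : ℝ → ℝ} (hf : Integrable f (truncG m)) :
    Integrable (fun Y => f (Y k)) (dataSeq m) := by
  rw [← map_eval_dataSeq m k] at hf
  exact hf.comp_measurable (measurable_pi_apply k)

theorem iIndepFun_dataSeq (g : ℝ → ℝ) (hg : Measurable g) (k₀ : ℕ) :
    iIndepFun (fun (k : ℕ) (Y : ℕ → ℝ) => g (Y (k₀ + k))) (dataSeq m) := by
  have h : iIndepFun (fun (k : ℕ) (Y : ℕ → ℝ) => g (Y k)) (dataSeq m) :=
    iIndepFun_infinitePi (X := fun _ => g) fun _ => hg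
  exact h.precomp (g := fun k => k₀ + k) fun _ _ h => by simpa using h

theorem IsCentered.chernoff (hg : IsCentered m g) (hm : 0 ≤ m) (N : ℕ) {τ : ℝ} (hτ : 0 < τ) :
    (dataSeq m).real {Y | N * τ ≤ |∑ k ∈ Finset.range N, g (Y k)|} ≤
      2 * Real.exp (-(min (1 / 8) (τ / (2 * chernoffMoment)) * τ / 2) * N) := by
  have one : ∀ g : ℝ → ℝ, IsCentered m g →
      (dataSeq m).real {Y | N * τ ≤ ∑ k ∈ Finset.range N, g (Y k)} ≤
      Real.exp (-(min (1 / 8) (τ / (2 * chernoffMoment)) * τ / 2) * N) := fun g hg => by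
    have hK := one_le_chernoffMoment
    have hi : Integrable (fun y => g y ^ 2 * Real.exp (|g y| / 8)) (truncG m) :=
      (integrable_truncG hm integrable_chernoff).mono'
        (by have := hg.meas; fun_prop) (Filter.Eventually.of_forall fun y => by
          rw [Real.norm_of_nonneg (by positivity)]; exact hg.chernoff_bound y)
    have hmeas : Measurable fun y => g y ^ 2 * Real.exp (|g y| / 8) := by
      have := hg.meas; fun_prop
    refine measure_sum_ge_le_exp (ξ := fun (k : ℕ) (Y : ℕ → ℝ) => g (Y k)) (by simpa using iIndepFun_dataSeq g hg.meas 0)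
      (fun k => hg.meas.comp (measurable_pi_apply k))
      (fun k => integrable_eval_dataSeq k (hg.integrable hm))
      (fun k => (integral_eval_dataSeq k hg.meas).trans hg.mean) (by linarith)
      (fun k => integrable_eval_dataSeq k hi) (fun k => ?_) N hτ
    rw [integral_eval_dataSeq k (f := fun y => g y ^ 2 * Real.exp (|g y| / 8)) hmeas]
    calc _ ≤ ∫ y, 4 * Real.exp (1 / 4) * ((1 + y ^ 2) ^ 2 * Real.exp (1 / 8 * y ^ 2)) ∂(truncG m) :=
          integral_mono hi (integrable_truncG hm integrable_chernoff) hg.chernoff_bound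
      _ ≤ _ := integral_truncG_le hm integrable_chernoff fun y => by positivity
  have hneg : IsCentered m fun y => -g y :=
    ⟨hg.meas.neg, fun y => by rw [abs_neg]; exact hg.growth y, by rw [integral_neg, hg.mean, neg_zero]⟩
  have h1 := one g hg
  have h2 := one _ hneg
  refine le_trans (measureReal_mono (s₂ := {Y | N * τ ≤ ∑ k ∈ Finset.range N, g (Y k)} ∪
    {Y | N * τ ≤ ∑ k ∈ Finset.range N, -g (Y k)}) fun Y hY => ?_)
    ((measureReal_union_le _ _).trans (by linarith))
  simp only [Set.mem_ofPred_eq, Finset.sum_neg_distrib, Set.mem_union] at hY ⊢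
  exact le_abs.1 hY

theorem IsCentered.moments (hg : IsCentered m g) (hm : 0 ≤ m) (k₀ t : ℕ) :
    Integrable (fun Y => (∑ k ∈ Finset.range t, g (Y (k₀ + k))) ^ 4) (dataSeq m) ∧
    ∫ Y, (∑ k ∈ Finset.range t, g (Y (k₀ + k))) ^ 2 ∂(dataSeq m) ≤ fourthMoment * t ∧
    ∫ Y, (∑ k ∈ Finset.range t, g (Y (k₀ + k))) ^ 4 ∂(dataSeq m) ≤
      3 * fourthMoment ^ 2 * t ^ 2 := by
  have hb := (integrable_poly_stdG 4).const_mul 16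
  have hi : Integrable (fun y => g y ^ 4) (truncG m) :=
    (integrable_truncG hm hb).mono'
      (by have := hg.meas; fun_prop) (Filter.Eventually.of_forall fun y => by
        rw [Real.norm_of_nonneg (by positivity)]; exact hg.fourth_bound y)
  have hmeas : Measurable fun y => g y ^ 4 := by have := hg.meas; fun_prop
  refine moment_sum_le (iIndepFun_dataSeq g hg.meas k₀)
    (fun k => hg.meas.comp (measurable_pi_apply _)) (fun k => integrable_eval_dataSeq _ hi)
    (fun k => (integral_eval_dataSeq _ hg.meas).trans hg.mean) one_le_fourthMoment (fun k => ?_) t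
  rw [integral_eval_dataSeq _ (f := fun y => g y ^ 4) hmeas]
  exact (integral_mono hi (integrable_truncG hm hb) hg.fourth_bound).trans
    (integral_truncG_le hm hb fun y => by positivity)

end IsCentered

/-- The contribution of iteration `t + 1` to the cost of a batch of data. -/
noncomputable def dataCost (m : ℝ) (y : ℕ → ℝ) (t : ℕ) : ℝ :=
  1 + (devSum (fun y => y ^ 2) (truncSq m) y t ^ 2 + devSum id (truncMean m) y t ^ 2) / t +
    (devSum (fun y => y ^ 2) (truncSq m) y (t + 1) ^ 4 +
      devSum id (truncMean m) y (t + 1) ^ 4) / (t + 1 : ℝ) ^ 2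

/-- The cost of a batch of data. -/
noncomputable def batchCost (m : ℝ) (y : ℕ → ℝ) (T : ℕ) : ℝ :=
  ∑ t ∈ Finset.range T, dataCost m y t / (t + 1)

theorem dataCost_nonneg (m : ℝ) (y : ℕ → ℝ) (t : ℕ) : 0 ≤ dataCost m y t := by
  unfold dataCost; positivity

theorem batchCost_nonneg (m : ℝ) (y : ℕ → ℝ) (T : ℕ) : 0 ≤ batchCost m y T :=
  Finset.sum_nonneg fun t _ => div_nonneg (dataCost_nonneg m y t) (by positivity)

theorem devSum_congr (f : ℝ → ℝ) (m : ℝ) {y y' : ℕ → ℝ} {T : ℕ} (h : ∀ t < T, y t = y' t) :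
    devSum f m y T = devSum f m y' T :=
  Finset.sum_congr rfl fun s hs => by rw [h s (Finset.mem_range.1 hs)]

theorem batchCost_congr (m : ℝ) {y y' : ℕ → ℝ} {T : ℕ} (h : ∀ t < T, y t = y' t) :
    batchCost m y T = batchCost m y' T := by
  refine Finset.sum_congr rfl fun t ht => ?_
  have ht' := Finset.mem_range.1 ht
  rw [dataCost, dataCost, devSum_congr _ _ fun s (hs : s < t) => h s (by omega),
    devSum_congr id _ fun s (hs : s < t) => h s (by omega),
    devSum_congr _ _ fun s (hs : s < t + 1) => h s (by omega),
    devSum_congr id _ fun s (hs : s < t + 1) => h s (by omega)]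

theorem measurable_devSum {f : ℝ → ℝ} (hf : Measurable f) (m : ℝ) (t : ℕ) :
    Measurable fun y : ℕ → ℝ => devSum f m y t :=
  Finset.measurable_sum _ fun k _ => (hf.comp (measurable_pi_apply k)).sub_const m

theorem measurable_batchCost (m : ℝ) (T : ℕ) : Measurable fun y : ℕ → ℝ => batchCost m y T := by
  have h1 := fun t => measurable_devSum (f := fun y => y ^ 2) (by fun_prop) (truncSq m) t
  have h2 := fun t => measurable_devSum (f := id) measurable_id (truncMean m) t
  unfold batchCost dataCost
  exact Finset.measurable_sum _ fun t _ => ((((((h1 t).pow_const 2).add ((h2 t).pow_const 2)).div_const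
    _).const_add 1).add ((((h1 (t + 1)).pow_const 4).add ((h2 (t + 1)).pow_const 4)).div_const
    _)).div_const _

/-- The constant of the expected cost of a batch. -/
noncomputable def costConst : ℝ := 1 + 2 * fourthMoment + 6 * fourthMoment ^ 2

/-- Second moments of order `t` and fourth moments of order `t²` make the expected price of each
step bounded, so the weights `1 / (t + 1)` produce a harmonic sum. -/
theorem integral_batchCost_le {m : ℝ} (hm : 0 ≤ m) (k₀ T : ℕ) :
    Integrable (fun Y => batchCost m (fun k => Y (k₀ + k)) T) (dataSeq m) ∧
    ∫ Y, batchCost m (fun k => Y (k₀ + k)) T ∂(dataSeq m) ≤ costConst * (1 + Real.log T) := by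
  have a := fun t => (isCentered_sq hm).moments hm k₀ t
  have b := fun t => (isCentered_id hm).moments hm k₀ t
  have two : ∀ {f : (ℕ → ℝ) → ℝ}, Measurable f → Integrable (fun Y => f Y ^ 4) (dataSeq m) →
      Integrable (fun Y => f Y ^ 2) (dataSeq m) := fun {f} hf h =>
    ((integrable_const (1 : ℝ)).add h).mono' (by fun_prop) (Filter.Eventually.of_forall fun Y => by
      rw [Real.norm_of_nonneg (sq_nonneg _)]
      simp only [Pi.add_apply]
      nlinarith [sq_nonneg (f Y ^ 2 - 1 / 2)])
  have hshift : Measurable fun (Y : ℕ → ℝ) (k : ℕ) => Y (k₀ + k) :=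
    measurable_pi_iff.2 fun k => measurable_pi_apply _
  have a2 := fun t => two ((measurable_devSum (f := fun y => y ^ 2) (by fun_prop)
    (truncSq m) t).comp hshift) (a t).1
  have b2 := fun t => two ((measurable_devSum (f := id) measurable_id
    (truncMean m) t).comp hshift) (b t).1
  have key : ∀ t : ℕ, Integrable (fun Y => dataCost m (fun k => Y (k₀ + k)) t) (dataSeq m) ∧
      ∫ Y, dataCost m (fun k => Y (k₀ + k)) t ∂(dataSeq m) ≤ costConst := fun t => by
    have i1 := ((a2 t).add (b2 t)).div_const (t : ℝ)
    have i2 := ((a (t + 1)).1.add (b (t + 1)).1).div_const ((t + 1 : ℝ) ^ 2)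
    have i3 := (integrable_const (1 : ℝ)).add i1
    refine ⟨i3.add i2, ?_⟩
    have e : ∫ Y, dataCost m (fun k => Y (k₀ + k)) t ∂(dataSeq m) = 1 +
        (∫ Y, (∑ k ∈ Finset.range t, (Y (k₀ + k) ^ 2 - truncSq m)) ^ 2 ∂(dataSeq m) +
        ∫ Y, (∑ k ∈ Finset.range t, (Y (k₀ + k) - truncMean m)) ^ 2 ∂(dataSeq m)) / t +
        (∫ Y, (∑ k ∈ Finset.range (t + 1), (Y (k₀ + k) ^ 2 - truncSq m)) ^ 4 ∂(dataSeq m) +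
        ∫ Y, (∑ k ∈ Finset.range (t + 1), (Y (k₀ + k) - truncMean m)) ^ 4 ∂(dataSeq m))
          / (t + 1 : ℝ) ^ 2 := by
      refine (integral_add i3 i2).trans ?_
      congr 1
      · refine (integral_add (integrable_const (1 : ℝ)) i1).trans ?_
        congr 1
        · simp
        · exact (integral_div _ _).trans (congrArg (· / (t : ℝ)) (integral_add (a2 t) (b2 t)))
      · exact (integral_div _ _).trans (congrArg (· / ((t + 1 : ℝ) ^ 2))
          (integral_add (a (t + 1)).1 (b (t + 1)).1))
    rw [e, costConst]
    have hM := one_le_fourthMoment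
    have c1 := (a t).2.1
    have c2 := (b t).2.1
    have c3 := (a (t + 1)).2.2
    have c4 := (b (t + 1)).2.2
    push_cast at c3 c4
    have d1 : (∫ Y, (∑ k ∈ Finset.range t, (Y (k₀ + k) ^ 2 - truncSq m)) ^ 2 ∂(dataSeq m) +
        ∫ Y, (∑ k ∈ Finset.range t, (Y (k₀ + k) - truncMean m)) ^ 2 ∂(dataSeq m)) / t ≤
        2 * fourthMoment := by
      refine div_le_of_le_mul₀ (Nat.cast_nonneg t) (by linarith) ?_
      linarith
    have d2 : (∫ Y, (∑ k ∈ Finset.range (t + 1), (Y (k₀ + k) ^ 2 - truncSq m)) ^ 4 ∂(dataSeq m) +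
        ∫ Y, (∑ k ∈ Finset.range (t + 1), (Y (k₀ + k) - truncMean m)) ^ 4 ∂(dataSeq m))
          / (t + 1 : ℝ) ^ 2 ≤ 6 * fourthMoment ^ 2 := by
      refine div_le_of_le_mul₀ (by positivity) (by positivity) ?_
      linarith
    linarith
  refine ⟨integrable_finsetSum _ fun t _ => (key t).1.div_const _, ?_⟩
  have e : ∫ Y, batchCost m (fun k => Y (k₀ + k)) T ∂(dataSeq m) =
      ∑ t ∈ Finset.range T, (∫ Y, dataCost m (fun k => Y (k₀ + k)) t ∂(dataSeq m)) / (t + 1) := by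
    refine (integral_finsetSum _ fun t _ => (key t).1.div_const _).trans ?_
    exact Finset.sum_congr rfl fun t _ => integral_div _ _
  rw [e]
  have hC : 0 ≤ costConst := by
    have := one_le_fourthMoment
    unfold costConst; positivity
  calc _ ≤ ∑ t ∈ Finset.range T, costConst / (t + 1 : ℝ) :=
        Finset.sum_le_sum fun t _ => by gcongr; exact (key t).2
    _ = costConst * (harmonic T : ℝ) := by
      rw [harmonic, Rat.cast_sum, Finset.mul_sum]
      refine Finset.sum_congr rfl fun t _ => ?_
      push_cast; rw [div_eq_mul_inv]
    _ ≤ _ := by gcongr; exact harmonic_le_one_add_log T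

/-- A batch of data is bad if its cost is large. -/
@[irreducible] def badBatch (m : ℝ) (T : ℕ) : Set (ℕ → ℝ) :=
  {y | 32 * (costConst * (1 + Real.log T)) ≤ batchCost m y T}

theorem mem_badBatch {m : ℝ} {T : ℕ} {y : ℕ → ℝ} :
    y ∈ badBatch m T ↔ 32 * (costConst * (1 + Real.log T)) ≤ batchCost m y T := by
  unfold badBatch; rfl

theorem measurableSet_badBatch (m : ℝ) (T : ℕ) : MeasurableSet (badBatch m T) := by
  unfold badBatch
  exact measurableSet_le measurable_const (measurable_batchCost m T)

/-! ### Bad batches: Markov's inequality for one, Hoeffding's inequality for their number -/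

theorem measureReal_le_of_integral_le {Ω : Type*} [MeasurableSpace Ω] {P : Measure Ω}
    {f : Ω → ℝ} (h0 : ∀ ω, 0 ≤ f ω) (hi : Integrable f P) {c K : ℝ} (hc : 0 < c) (hK : 0 < K)
    (h : ∫ ω, f ω ∂P ≤ c) : P.real {ω | K * c ≤ f ω} ≤ 1 / K := by
  have h1 := mul_meas_ge_le_integral_of_nonneg (Filter.Eventually.of_forall h0) hi (K * c)
  have h2 : P.real {ω | K * c ≤ f ω} * K * c ≤ c := by linarith
  rw [le_div_iff₀ hK]
  exact (mul_le_iff_le_one_left hc).1 h2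

theorem measure_badBatch_le {m : ℝ} (hm : 0 ≤ m) (k₀ T : ℕ) :
    (dataSeq m).real {Y | (fun k => Y (k₀ + k)) ∈ badBatch m T} ≤ 1 / 32 := by
  have h1 := integral_batchCost_le hm k₀ T
  have h0 : ∀ Y : ℕ → ℝ, 0 ≤ batchCost m (fun k => Y (k₀ + k)) T :=
    fun Y => batchCost_nonneg m (fun k => Y (k₀ + k)) T
  have hpos : 0 < costConst * (1 + Real.log T) := by
    have := one_le_fourthMoment
    have h3 : 0 ≤ Real.log T := Real.log_natCast_nonneg T
    unfold costConst; positivity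
  simp only [mem_badBatch]
  exact measureReal_le_of_integral_le h0 h1.1 hpos (by norm_num) h1.2

/-- Reindex along the injection `(j, t) ↦ j T + t` and curry. -/
theorem iIndepFun_blocks (m : ℝ) {T : ℕ} (hT : 0 < T) :
    iIndepFun (fun (j : ℕ) (Y : ℕ → ℝ) (t : Fin T) => Y (j * T + t)) (dataSeq m) := by
  have hinj : Function.Injective fun p : ℕ × Fin T => p.1 * T + p.2 := by
    rintro ⟨j, t⟩ ⟨j', t'⟩ h
    simp only at h
    have h1 : (j * T + t) / T = j := by
      rw [mul_comm, Nat.mul_add_div hT, Nat.div_eq_of_lt t.2, add_zero]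
    have h2 : (j' * T + t') / T = j' := by
      rw [mul_comm, Nat.mul_add_div hT, Nat.div_eq_of_lt t'.2, add_zero]
    have h3 : j = j' := by rw [← h1, ← h2, h]
    subst h3
    simp only [Nat.add_left_cancel_iff] at h
    rw [Fin.ext h]
  have h1 := Measure.map_infinitePi_infinitePi_of_inj (P := fun _ : ℕ => truncG m) hinj
  have h2 := Measure.infinitePi_map_curry (ι := ℕ) (κ := Fin T) fun _ _ => truncG m
  rw [← h1, Measure.map_map (by fun_prop) (by fun_prop)] at h2
  have hm : ∀ j : ℕ, Measurable fun (Y : ℕ → ℝ) (t : Fin T) => Y (j * T + t) := fun j =>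
    measurable_pi_iff.2 fun t => measurable_pi_apply _
  rw [iIndepFun_iff_map_fun_eq_infinitePi_map hm]
  have h3 : ∀ j : ℕ, (dataSeq m).map (fun (Y : ℕ → ℝ) (t : Fin T) => Y (j * T + t)) =
      Measure.infinitePi fun _ : Fin T => truncG m := fun j =>
    Measure.map_infinitePi_infinitePi_of_inj (P := fun _ : ℕ => truncG m)
      (f := fun t : Fin T => j * T + t) fun t t' h => Fin.ext (by simpa using h)
  simp_rw [h3]
  exact h2

-- A batch is bad with probability at most `1/32`; an excess of another `1/32` of the batches costs
-- the exponent `2 (1/32)² B = B / 512`.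
open Classical in
theorem measure_badBatches_le {m : ℝ} (hm : 0 ≤ m) {T : ℕ} (hT : 0 < T) (B : ℕ) :
    (dataSeq m).real {Y | (B : ℝ) / 16 ≤ ∑ j ∈ Finset.range B,
      if (fun k => Y (j * T + k)) ∈ badBatch m T then (1 : ℝ) else 0} ≤ Real.exp (-B / 512) := by
  -- The cost of a batch sees its first `T` points only, so badness is a function of the finite
  -- block and independence of blocks applies.
  set ext : (Fin T → ℝ) → ℕ → ℝ := fun u k => if h : k < T then u ⟨k, h⟩ else 0 with hext
  have hextm : Measurable ext := measurable_pi_iff.2 fun k => by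
    simp only [hext]; split_ifs
    · exact measurable_pi_apply _
    · exact measurable_const
  set F : (Fin T → ℝ) → ℝ := fun u => if ext u ∈ badBatch m T then 1 else 0 with hF
  have hFm : Measurable F := Measurable.ite (hextm (measurableSet_badBatch m T)) measurable_const
    measurable_const
  have hFe : ∀ (j : ℕ) (Y : ℕ → ℝ), (if (fun k => Y (j * T + k)) ∈ badBatch m T then (1 : ℝ)
      else 0) = F fun t : Fin T => Y (j * T + t) := fun j Y => by
    have : ((fun k => Y (j * T + k)) ∈ badBatch m T) ↔
        ext (fun t : Fin T => Y (j * T + t)) ∈ badBatch m T := by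
      simp only [mem_badBatch]
      rw [batchCost_congr m (y := fun k => Y (j * T + k))
        (y' := ext fun t : Fin T => Y (j * T + t)) fun t ht => by simp [hext, ht]]
    simp only [hF, this]
  have hind : iIndepFun (fun (j : ℕ) (Y : ℕ → ℝ) => if (fun k => Y (j * T + k)) ∈ badBatch m T
      then (1 : ℝ) else 0) (dataSeq m) := by
    simp_rw [hFe]
    exact (iIndepFun_blocks m hT).comp (fun _ => F) fun _ => hFm
  have hblock : ∀ j : ℕ, Measurable fun (Y : ℕ → ℝ) (t : Fin T) => Y (j * T + t) := fun j =>
    measurable_pi_iff.2 fun t => measurable_pi_apply _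
  have hmeas : ∀ j : ℕ, Measurable fun Y : ℕ → ℝ => if (fun k => Y (j * T + k)) ∈ badBatch m T
      then (1 : ℝ) else 0 := fun j => by
    simp_rw [hFe]; exact hFm.comp (hblock j)
  have hset : ∀ j : ℕ, MeasurableSet {Y : ℕ → ℝ | (fun k => Y (j * T + k)) ∈ badBatch m T} :=
    fun j => (measurable_pi_iff.2 fun k => measurable_pi_apply (j * T + k))
      (measurableSet_badBatch m T)
  have h := hoeffding_le hind hmeas (fun j Y => by
    split_ifs <;> simp) (Finset.range B) (p := 1 / 32) (fun j _ => by
    have e : ∫ Y, (if (fun k => Y (j * T + k)) ∈ badBatch m T then (1 : ℝ) else 0) ∂(dataSeq m) =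
        (dataSeq m).real {Y | (fun k => Y (j * T + k)) ∈ badBatch m T} := by
      rw [← integral_indicator_one (hset j)]
      refine integral_congr_ae (Filter.Eventually.of_forall fun Y => ?_)
      simp only [Set.indicator, Set.mem_ofPred_eq, Pi.one_apply]
    rw [e]
    exact measure_badBatch_le hm (j * T) T) (u := B / 32) (by positivity)
  rw [Finset.card_range] at h
  refine le_trans (measureReal_mono fun Y hY => ?_) (h.trans ?_)
  · simp only [Set.mem_ofPred_eq] at hY ⊢
    linarith
  · rw [Real.exp_le_exp]
    rcases Nat.eq_zero_or_pos B with h0 | h0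
    · simp [h0]
    · have : (0 : ℝ) < B := by exact_mod_cast h0
      rw [div_le_div_iff₀ this (by norm_num)]
      nlinarith

/-! ## Projected SGD on normalized data -/

/-- The mean of the first `N` data points. -/
noncomputable def empMean (Y : ℕ → ℝ) (N : ℕ) : ℝ := (∑ k ∈ Finset.range N, Y k) / N

/-- The variance of the first `N` data points. -/
noncomputable def empVar (Y : ℕ → ℝ) (N : ℕ) : ℝ :=
  (∑ k ∈ Finset.range N, (Y k - empMean Y N) ^ 2) / N

/-- The truncation point `-m` after normalization. -/
noncomputable def normLow (m : ℝ) (Y : ℕ → ℝ) (N : ℕ) : ℝ := -(m + empMean Y N) / √(empVar Y N)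

/-- The normalized data. -/
noncomputable def normData (Y : ℕ → ℝ) (N : ℕ) (k : ℕ) : ℝ := (Y k - empMean Y N) / √(empVar Y N)

/-- The parameter of the standard Gaussian after normalization. -/
noncomputable def centerParam (Y : ℕ → ℝ) (N : ℕ) : ℝ × ℝ :=
  (empVar Y N, -empMean Y N * √(empVar Y N))

/-- The data are truncated to `[-m, ∞)` and their first two moments are close to their
expectations. -/
def GoodMoments (m : ℝ) (Y : ℕ → ℝ) (N : ℕ) : Prop :=
  |∑ k ∈ Finset.range N, (Y k ^ 2 - truncSq m)| < N * (1 / 1600) ∧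
  |∑ k ∈ Finset.range N, (Y k - truncMean m)| < N * (1 / 1600) ∧ ∀ k < N, -m ≤ Y k

/-! ### Empirical moments, and deviations of the normalized data -/

theorem empVar_eq (Y : ℕ → ℝ) {N : ℕ} (hN : 0 < N) :
    empVar Y N = (∑ k ∈ Finset.range N, Y k ^ 2) / N - empMean Y N ^ 2 := by
  have hN' : (N : ℝ) ≠ 0 := by positivity
  have h1 : ∑ k ∈ Finset.range N, Y k = N * empMean Y N := by unfold empMean; field_simp
  have h2 : ∑ k ∈ Finset.range N, (Y k - empMean Y N) ^ 2 =
      ∑ k ∈ Finset.range N, Y k ^ 2 - N * empMean Y N ^ 2 := by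
    have : ∀ k, (Y k - empMean Y N) ^ 2 = Y k ^ 2 - 2 * empMean Y N * Y k + empMean Y N ^ 2 :=
      fun k => by ring
    simp_rw [this, Finset.sum_add_distrib, Finset.sum_sub_distrib, ← Finset.mul_sum, h1]
    simp; ring
  rw [empVar, h2]
  field_simp

/-- The true variance is at least `1/100` and the mean at most `3/2`. Errors of `1/1600` in both
moments change the variance by less than `3/1000`, which leaves `1/200`. -/
theorem GoodMoments.bounds {m : ℝ} (hm : 0 ≤ m) {Y : ℕ → ℝ} {N : ℕ} (hN : 0 < N)
    (h : GoodMoments m Y N) : 1 / 200 ≤ empVar Y N ∧ empVar Y N ≤ 3 ∧ |empMean Y N| ≤ 2 ∧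
      0 ≤ m + empMean Y N := by
  have hN' : (0 : ℝ) < N := by exact_mod_cast hN
  obtain ⟨h1, h2, hlow⟩ := h
  rw [Finset.sum_sub_distrib] at h1 h2
  simp only [Finset.sum_const, Finset.card_range, nsmul_eq_mul] at h1 h2
  have e1 : |(∑ k ∈ Finset.range N, Y k ^ 2) / N - truncSq m| < 1 / 1600 := by
    have : (∑ k ∈ Finset.range N, Y k ^ 2) / N - truncSq m =
      (∑ k ∈ Finset.range N, Y k ^ 2 - N * truncSq m) / N := by field_simp
    rw [this, abs_div, abs_of_pos hN', div_lt_iff₀ hN']; linarith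
  have e2 : |empMean Y N - truncMean m| < 1 / 1600 := by
    have : empMean Y N - truncMean m =
      (∑ k ∈ Finset.range N, Y k - N * truncMean m) / N := by unfold empMean; field_simp
    rw [this, abs_div, abs_of_pos hN', div_lt_iff₀ hN']; linarith
  have h3 := abs_le.1 (abs_truncMean_le hm)
  have h4 := truncSq_le hm
  have h5 := variance_truncG_ge hm
  have h6 : -m ≤ empMean Y N := by
    rw [empMean, le_div_iff₀ hN']
    have := Finset.card_nsmul_le_sum (Finset.range N) Y (-m) fun k hk =>
      hlow k (Finset.mem_range.1 hk)
    simp only [Finset.card_range, nsmul_eq_mul] at this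
    linarith
  rw [empVar_eq Y hN]
  rw [abs_lt] at e1 e2
  refine ⟨?_, ?_, abs_le.2 ⟨by linarith, by linarith⟩, ?_⟩
  · nlinarith
  · nlinarith [sq_nonneg (empMean Y N)]
  · linarith

/-- This fixes `r = 400`: the lower bound `1/200` for the empirical variance is `1/400 + 1/400`, the
edge of the box plus the margin that `clamp_sq_le` needs. -/
theorem GoodMoments.innerBox {m : ℝ} (hm : 0 ≤ m) {Y : ℕ → ℝ} {N : ℕ} (hN : 0 < N)
    (h : GoodMoments m Y N) : InnerBox 400 (1 / 400) (centerParam Y N) := by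
  obtain ⟨h1, h2, h3, -⟩ := h.bounds hm hN
  have hs : √(empVar Y N) ≤ 2 := Real.sqrt_le_iff.2 ⟨by norm_num, by linarith⟩
  have h4 : |-empMean Y N * √(empVar Y N)| ≤ 2 * 2 := by
    rw [abs_mul, abs_neg, abs_of_nonneg (Real.sqrt_nonneg _)]
    gcongr
  have h5 := abs_le.1 h4
  refine ⟨?_, ?_, ?_, ?_⟩ <;> simp only [centerParam] <;> linarith

theorem normLow_nonpos {m : ℝ} (hm : 0 ≤ m) {Y : ℕ → ℝ} {N : ℕ} (hN : 0 < N)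
    (h : GoodMoments m Y N) : normLow m Y N ≤ 0 := by
  obtain ⟨h1, h2, h3, h4⟩ := h.bounds hm hN
  exact div_nonpos_of_nonpos_of_nonneg (by linarith) (Real.sqrt_nonneg _)

/-- The normalization `(y - mean) / sd` carries the truncated standard Gaussian to the truncated
Gaussian with this parameter. The target of SGD thus depends on the data, but explicitly. -/
theorem truncExp_centerParam (m : ℝ) {Y : ℕ → ℝ} {N : ℕ} (hV : 0 < empVar Y N) {f : ℝ → ℝ}
    (hf : Measurable f) : truncExp (normLow m Y N) (centerParam Y N) f =
      ∫ y, f ((y - empMean Y N) / √(empVar Y N)) ∂(truncG m) := by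
  have hs : 0 < √(empVar Y N) := Real.sqrt_pos.2 hV
  have hss : √(empVar Y N) * √(empVar Y N) = empVar Y N := Real.mul_self_sqrt hV.le
  rw [← integral_cond_eq_truncExp (v := centerParam Y N) hV _ hf]
  have e1 : (centerParam Y N).2 / (centerParam Y N).1 = -empMean Y N / √(empVar Y N) := by
    simp only [centerParam]
    rw [div_eq_div_iff hV.ne' hs.ne', mul_assoc, hss]
  have e2 : √(1 / (centerParam Y N).1) = 1 / √(empVar Y N) := by
    simp only [centerParam]
    rw [Real.sqrt_div zero_le_one, Real.sqrt_one]
  rw [e1, e2]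
  have e3 : acceptSet (normLow m Y N) (-empMean Y N / √(empVar Y N)) (1 / √(empVar Y N)) =
      Set.Ioi (-m) := by
    ext g
    have : -empMean Y N / √(empVar Y N) + 1 / √(empVar Y N) * g =
      (g - empMean Y N) / √(empVar Y N) := by field_simp; ring
    simp only [acceptSet, normLow, Set.mem_ofPred_eq, Set.mem_Ioi]
    rw [this, div_lt_div_iff_of_pos_right hs]
    constructor <;> intro h <;> linarith
  rw [e3]
  refine integral_congr_ae (Filter.Eventually.of_forall fun g => ?_)
  dsimp only
  congr 1
  field_simp; ring

theorem integral_sub_truncG {m : ℝ} (hm : 0 ≤ m) (c s : ℝ) :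
    ∫ y, (y - c) / s ∂(truncG m) = (truncMean m - c) / s := by
  rw [integral_div, integral_sub (integrable_truncG hm integrable_id_stdG) (integrable_const _)]
  simp [truncMean]

theorem devSum_id_normData {m : ℝ} (hm : 0 ≤ m) {Y : ℕ → ℝ} {N : ℕ} (hV : 0 < empVar Y N)
    (k₀ t : ℕ) :
    devSum id (truncExp (normLow m Y N) (centerParam Y N) id) (fun k => normData Y N (k₀ + k)) t =
      1 / √(empVar Y N) * devSum id (truncMean m) (fun k => Y (k₀ + k)) t := by
  rw [truncExp_centerParam m hV measurable_id]
  simp only [id]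
  rw [integral_sub_truncG hm, devSum, devSum, Finset.mul_sum]
  refine Finset.sum_congr rfl fun k _ => ?_
  simp only [normData, id]
  ring

/-- Both the data and the target are transformed by the same affine map, so constants cancel and the
deviation is linear in the raw deviations. The normalization enters through two bounded coefficients
only; this separates its dependence on all data from the independence of the raw points. -/
theorem devSum_stat1_normData {m : ℝ} (hm : 0 ≤ m) {Y : ℕ → ℝ} {N : ℕ} (hV : 0 < empVar Y N)
    (k₀ t : ℕ) :
    devSum stat1 (truncExp (normLow m Y N) (centerParam Y N) stat1)
        (fun k => normData Y N (k₀ + k)) t =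
      -(1 / (2 * empVar Y N)) * devSum (fun y => y ^ 2) (truncSq m) (fun k => Y (k₀ + k)) t +
      empMean Y N / empVar Y N * devSum id (truncMean m) (fun k => Y (k₀ + k)) t := by
  rw [truncExp_centerParam m hV measurable_stat1]
  have e : ∀ y, stat1 ((y - empMean Y N) / √(empVar Y N)) =
      -(1 / (2 * empVar Y N)) * (y - empMean Y N) ^ 2 := fun y => by
    rw [stat1, div_mul_div_comm, Real.mul_self_sqrt hV.le]
    field_simp
  simp_rw [e]
  rw [integral_const_mul, integral_sub_sq_truncG hm, devSum, devSum, devSum, Finset.mul_sum,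
    Finset.mul_sum, ← Finset.sum_add_distrib]
  refine Finset.sum_congr rfl fun k _ => ?_
  simp only [normData, id, e]
  field_simp
  ring

theorem lin_comb_pow_le {A p q u X Z : ℝ} (hp : |p| ≤ A) (hq : |q| ≤ A) (hu : |u| ≤ A) :
    (p * X + q * Z) ^ 2 + (u * Z) ^ 2 ≤ 3 * A ^ 2 * (X ^ 2 + Z ^ 2) ∧
    (p * X + q * Z) ^ 4 + (u * Z) ^ 4 ≤ 9 * A ^ 4 * (X ^ 4 + Z ^ 4) := by
  have sq : ∀ {p : ℝ}, |p| ≤ A → p ^ 2 ≤ A ^ 2 := fun h => sq_le_sq' (abs_le.1 h).1 (abs_le.1 h).2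
  have h1 : (p * X + q * Z) ^ 2 ≤ 2 * A ^ 2 * (X ^ 2 + Z ^ 2) := by
    nlinarith [sq_nonneg (p * X - q * Z), mul_le_mul_of_nonneg_right (sq hp) (sq_nonneg X),
      mul_le_mul_of_nonneg_right (sq hq) (sq_nonneg Z)]
  have h2 : (u * Z) ^ 2 ≤ A ^ 2 * Z ^ 2 := by
    rw [mul_pow]; exact mul_le_mul_of_nonneg_right (sq hu) (sq_nonneg Z)
  refine ⟨by nlinarith [mul_nonneg (sq_nonneg A) (sq_nonneg X)], ?_⟩
  have h3 : (p * X + q * Z) ^ 4 ≤ (2 * A ^ 2 * (X ^ 2 + Z ^ 2)) ^ 2 := by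
    have e : (p * X + q * Z) ^ 4 = ((p * X + q * Z) ^ 2) ^ 2 := by ring
    rw [e]; gcongr
  have h4 : (u * Z) ^ 4 ≤ (A ^ 2 * Z ^ 2) ^ 2 := by
    have e : (u * Z) ^ 4 = ((u * Z) ^ 2) ^ 2 := by ring
    rw [e]; gcongr
  have h5 : 0 ≤ A ^ 4 * (X ^ 2 - Z ^ 2) ^ 2 := by positivity
  have h6 : 0 ≤ A ^ 4 * X ^ 4 := by positivity
  nlinarith

/-- Comparison of the costs of the normalized and of the original data. -/
noncomputable def sgdConst : ℝ :=
  (32 * driftConst 400 ^ 2 * 400 ^ 2 + 2 * (envMoment 400 * Real.exp (3 * 400 / 2))) +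
  4 * driftConst 400 ^ 2 / stepConst 400 ^ 2 * (3 * 1000 ^ 2) +
  9 * 1000 ^ 4 / (stepConst 400 * (1 / 400)) ^ 2

/-- With variance at least `1/200` and mean at most `2`, all coefficients of the linear combinations
are below `1000`, so powers of normalized deviations are bounded by powers of raw ones. -/
theorem stepCost_le {m : ℝ} (hm : 0 ≤ m) {Y : ℕ → ℝ} {N : ℕ} (hN : 0 < N)
    (h : GoodMoments m Y N) (k₀ t : ℕ) :
    stepCost 400 (normLow m Y N) (1 / 400) (centerParam Y N) (fun k => normData Y N (k₀ + k)) t ≤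
      sgdConst * dataCost m (fun k => Y (k₀ + k)) t := by
  obtain ⟨h1, h2, h3, -⟩ := h.bounds hm hN
  have hV : 0 < empVar Y N := by linarith
  have hl := stepConst_pos (r := 400) (by norm_num)
  have hE : 0 ≤ envMoment 400 * Real.exp (3 * 400 / 2) :=
    mul_nonneg (envMoment_pos (by norm_num)).le (Real.exp_pos _).le
  have hp : |-(1 / (2 * empVar Y N))| ≤ 1000 := by
    rw [abs_neg, abs_of_pos (by positivity), div_le_iff₀ (by positivity)]; linarith
  have hq : |empMean Y N / empVar Y N| ≤ 1000 := by
    rw [abs_div, abs_of_pos hV, div_le_iff₀ hV]; linarith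
  have hu : |1 / √(empVar Y N)| ≤ 1000 := by
    have hs : 1 / 1000 ≤ √(empVar Y N) := Real.le_sqrt_of_sq_le (by norm_num; linarith)
    rw [abs_of_pos (by positivity), div_le_iff₀ (by linarith)]; linarith
  have key := fun t => lin_comb_pow_le
    (X := devSum (fun y => y ^ 2) (truncSq m) (fun k => Y (k₀ + k)) t)
    (Z := devSum id (truncMean m) (fun k => Y (k₀ + k)) t) hp hq hu
  rw [stepCost, devSum_id_normData hm hV, devSum_stat1_normData hm hV, devSum_id_normData hm hV,
    devSum_stat1_normData hm hV, dataCost]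
  have k1 := (key t).1
  have k2 := (key (t + 1)).2
  generalize devSum (fun y => y ^ 2) (truncSq m) (fun k => Y (k₀ + k)) t = X at *
  generalize devSum (fun y => y ^ 2) (truncSq m) (fun k => Y (k₀ + k)) (t + 1) = X' at *
  generalize devSum id (truncMean m) (fun k => Y (k₀ + k)) t = Z at *
  generalize devSum id (truncMean m) (fun k => Y (k₀ + k)) (t + 1) = Z' at *
  have a1 : 4 * driftConst 400 ^ 2 / stepConst 400 ^ 2 *
      (((-(1 / (2 * empVar Y N)) * X + empMean Y N / empVar Y N * Z) ^ 2 +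
        (1 / √(empVar Y N) * Z) ^ 2) / t) ≤
      4 * driftConst 400 ^ 2 / stepConst 400 ^ 2 * (3 * 1000 ^ 2) * ((X ^ 2 + Z ^ 2) / t) := by
    calc _ ≤ 4 * driftConst 400 ^ 2 / stepConst 400 ^ 2 *
          ((3 * 1000 ^ 2 * (X ^ 2 + Z ^ 2)) / t) := by gcongr
      _ = _ := by ring
  have a2 : ((-(1 / (2 * empVar Y N)) * X' + empMean Y N / empVar Y N * Z') ^ 4 +
        (1 / √(empVar Y N) * Z') ^ 4) / (stepConst 400 * (t + 1) * (1 / 400)) ^ 2 ≤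
      9 * 1000 ^ 4 / (stepConst 400 * (1 / 400)) ^ 2 * ((X' ^ 4 + Z' ^ 4) / (t + 1) ^ 2) := by
    rw [div_mul_div_comm, ← mul_pow, mul_right_comm (stepConst 400)]
    gcongr
  have b1 : 0 ≤ (X ^ 2 + Z ^ 2) / (t : ℝ) := by positivity
  have b2 : 0 ≤ (X' ^ 4 + Z' ^ 4) / (t + 1 : ℝ) ^ 2 := by positivity
  have c1 : 0 ≤ 32 * driftConst 400 ^ 2 * 400 ^ 2 + 2 * (envMoment 400 * Real.exp (3 * 400 / 2)) := by
    positivity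
  have c2 : 0 ≤ 4 * driftConst 400 ^ 2 / stepConst 400 ^ 2 * (3 * 1000 ^ 2) := by positivity
  have c3 : 0 ≤ 9 * 1000 ^ 4 / (stepConst 400 * (1 / 400)) ^ 2 := by positivity
  rw [sgdConst]
  generalize (X ^ 2 + Z ^ 2) / (t : ℝ) = U at *
  generalize (X' ^ 4 + Z' ^ 4) / (t + 1 : ℝ) ^ 2 = U' at *
  generalize 32 * driftConst 400 ^ 2 * 400 ^ 2 + 2 * (envMoment 400 * Real.exp (3 * 400 / 2)) = C1 at *
  generalize 4 * driftConst 400 ^ 2 / stepConst 400 ^ 2 * (3 * 1000 ^ 2) = C2 at *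
  generalize 9 * 1000 ^ 4 / (stepConst 400 * (1 / 400)) ^ 2 = C3 at *
  nlinarith [mul_nonneg c1 b1, mul_nonneg c1 b2, mul_nonneg c2 b2, mul_nonneg c3 b1]

theorem sgdConst_nonneg : 0 ≤ sgdConst := by
  have hE : 0 ≤ envMoment 400 * Real.exp (3 * 400 / 2) :=
    mul_nonneg (envMoment_pos (by norm_num)).le (Real.exp_pos _).le
  unfold sgdConst
  positivity

/-- The constant of the mean squared error of SGD on a good batch. -/
noncomputable def rateConst : ℝ :=
  2 / stepConst 400 ^ 2 * (sgdConst * (32 * costConst)) + 8 * 400 ^ 2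

theorem costConst_pos : 0 < costConst := by
  have := one_le_fourthMoment
  unfold costConst; positivity

theorem rateConst_pos : 0 < rateConst := by
  have h1 := sgdConst_nonneg
  have h2 := costConst_pos
  have h3 := stepConst_pos (r := 400) (by norm_num)
  unfold rateConst
  positivity

/-- The result of projected SGD on the data `Y k₀, Y (k₀ + 1), …`. -/
noncomputable def batchResult (m : ℝ) (Y : ℕ → ℝ) (N k₀ T : ℕ) (w : ℕ → ℕ → ℝ) : ℝ × ℝ :=
  sgdAvg 400 (stepConst 400) (normLow m Y N) (fun k => normData Y N (k₀ + k)) w T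

theorem integral_batchResult_le {m : ℝ} (hm : 0 ≤ m) {Y : ℕ → ℝ} {N : ℕ} (hN : 0 < N)
    (h : GoodMoments m Y N) (k₀ : ℕ) {T : ℕ} (hT : 0 < T)
    (hb : (fun k => Y (k₀ + k)) ∉ badBatch m T) :
    ∫ w, sqDist (batchResult m Y N k₀ T w) (centerParam Y N) ∂batchTape ≤
      rateConst * (1 + Real.log T) / T := by
  refine (integral_sqDist_sgdAvg_le (by norm_num) (ρ := 1 / 400) (by norm_num)
    (normLow_nonpos hm hN h) (h.innerBox hm hN) _ hT).trans ?_
  have hl := stepConst_pos (r := 400) (by norm_num)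
  have h1 := sgdConst_nonneg
  rw [mem_badBatch, not_le] at hb
  have h2 : ∑ t ∈ Finset.range T, stepCost 400 (normLow m Y N) (1 / 400) (centerParam Y N)
      (fun k => normData Y N (k₀ + k)) t / (t + 1) ≤
      sgdConst * (32 * (costConst * (1 + Real.log T))) := by
    calc _ ≤ ∑ t ∈ Finset.range T, sgdConst * (dataCost m (fun k => Y (k₀ + k)) t / (t + 1)) :=
          Finset.sum_le_sum fun t _ => by
            rw [← mul_div_assoc]
            have := stepCost_le hm hN h k₀ t
            gcongr
      _ = sgdConst * batchCost m (fun k => Y (k₀ + k)) T := by rw [batchCost, Finset.mul_sum]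
      _ ≤ _ := by gcongr
  have h3 : (0 : ℝ) ≤ Real.log T := Real.log_natCast_nonneg T
  gcongr
  rw [rateConst]
  have h4 : 2 / stepConst 400 ^ 2 * ∑ t ∈ Finset.range T,
      stepCost 400 (normLow m Y N) (1 / 400) (centerParam Y N)
      (fun k => normData Y N (k₀ + k)) t / (t + 1) ≤ 2 / stepConst 400 ^ 2 *
      (sgdConst * (32 * (costConst * (1 + Real.log T)))) := by gcongr
  nlinarith

/-! ### The batches of one coordinate -/

/-- The law of the tape of one coordinate. -/
noncomputable abbrev coordTape : Measure (ℕ → ℕ → ℕ → ℝ) :=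
  Measure.infinitePi fun _ : ℕ => batchTape

theorem measurable_batchResult {Ω : Type*} [MeasurableSpace Ω] (m : ℝ) {Y : Ω → ℕ → ℝ}
    {w : Ω → ℕ → ℕ → ℝ} (hY : Measurable Y) (hw : Measurable w) (N k₀ T : ℕ) :
    Measurable fun ω => batchResult m (Y ω) N k₀ T (w ω) := by
  have hk : ∀ k, Measurable fun ω => Y ω k := fun k => (measurable_pi_apply k).comp hY
  have hmean : Measurable fun ω => empMean (Y ω) N := by
    unfold empMean; fun_prop
  have hvar : Measurable fun ω => √(empVar (Y ω) N) := by
    unfold empVar; fun_prop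
  exact measurable_sgdAvg 400 (stepConst 400) ((hmean.const_add m).neg.div hvar)
    (fun k => ((hk (k₀ + k)).sub hmean).div hvar) hw T

theorem measurable_centerParam (N : ℕ) : Measurable fun Y : ℕ → ℝ => centerParam Y N := by
  have hmean : Measurable fun Y : ℕ → ℝ => empMean Y N := by
    unfold empMean; fun_prop
  have hvar : Measurable fun Y : ℕ → ℝ => empVar Y N := by
    unfold empVar; fun_prop
  unfold centerParam
  fun_prop

theorem measurable_sqDist_prod {Ω : Type*} [MeasurableSpace Ω] {u v : Ω → ℝ × ℝ}
    (hu : Measurable u) (hv : Measurable v) : Measurable fun ω => sqDist (u ω) (v ω) := by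
  unfold sqDist; fun_prop

open Classical in
/-- The number of batches whose result is not within `ρ` of its target. -/
noncomputable def farBatches (m ρ : ℝ) (N B T : ℕ) (Y : ℕ → ℝ) (w : ℕ → ℕ → ℕ → ℝ) : ℝ :=
  ∑ j ∈ Finset.range B,
    if ρ ^ 2 ≤ sqDist (batchResult m Y N (j * T) T (w j)) (centerParam Y N) then 1 else 0

theorem measurable_farBatches (m ρ : ℝ) (N B T : ℕ) :
    Measurable fun p : (ℕ → ℝ) × (ℕ → ℕ → ℕ → ℝ) => farBatches m ρ N B T p.1 p.2 := by
  unfold farBatches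
  refine Finset.measurable_sum _ fun j _ => Measurable.ite (measurableSet_le measurable_const ?_)
    measurable_const measurable_const
  exact measurable_sqDist_prod (measurable_batchResult m measurable_fst
    ((measurable_pi_apply j).comp measurable_snd) N _ T)
    ((measurable_centerParam N).comp measurable_fst)

open Classical in
/-- The tape of a coordinate is good with high probability, for fixed good data. -/
theorem measure_farBatches_le {m : ℝ} (hm : 0 ≤ m) {Y : ℕ → ℝ} {N : ℕ} (hN : 0 < N)
    (h : GoodMoments m Y N) {T B : ℕ} (hT : 0 < T) {ρ : ℝ} (hρ : 0 < ρ)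
    (hTρ : 16 * (rateConst * (1 + Real.log T) / T) ≤ ρ ^ 2)
    (hb : (∑ j ∈ Finset.range B,
      if (fun k => Y (j * T + k)) ∈ badBatch m T then (1 : ℝ) else 0) < B / 16) :
    coordTape.real {w | (B : ℝ) / 4 ≤ farBatches m ρ N B T Y w} ≤ Real.exp (-B / 32) := by
  -- Count only the failures on batches that are not bad: for these Markov's inequality and `hTρ`
  -- give probability at most `1/16`.
  set F : ℕ → (ℕ → ℕ → ℝ) → ℝ := fun j w =>
    if (fun k => Y (j * T + k)) ∉ badBatch m T ∧
      ρ ^ 2 ≤ sqDist (batchResult m Y N (j * T) T w) (centerParam Y N) then 1 else 0 with hF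
  have hset : ∀ j, MeasurableSet {w : ℕ → ℕ → ℝ |
      ρ ^ 2 ≤ sqDist (batchResult m Y N (j * T) T w) (centerParam Y N)} := fun j =>
    measurableSet_le measurable_const (measurable_sqDist_prod
      (measurable_batchResult m measurable_const measurable_id N _ T) measurable_const)
  have hFm : ∀ j, Measurable (F j) := fun j =>
    Measurable.ite ((MeasurableSet.const _).inter (hset j)) measurable_const measurable_const
  have hFi : ∀ j, ∫ w, F j w ∂batchTape ≤ 1 / 16 := fun j => by
    by_cases hj : (fun k => Y (j * T + k)) ∈ badBatch m T
    · have : ∀ w, F j w = 0 := fun w => by simp [hF, hj]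
      simp [this]
    · have e : ∫ w, F j w ∂batchTape = batchTape.real {w : ℕ → ℕ → ℝ |
          ρ ^ 2 ≤ sqDist (batchResult m Y N (j * T) T w) (centerParam Y N)} := by
        rw [← integral_indicator_one (hset j)]
        refine integral_congr_ae (Filter.Eventually.of_forall fun Y => ?_)
        simp [Set.indicator, hF, hj]
      rw [e]
      have hmem : ∀ w, batchResult m Y N (j * T) T w ∈ paramBox 400 := fun w =>
        sgdAvg_mem (by norm_num) _ _ _ _ hT
      have h0 : ∀ w, 0 ≤ sqDist (batchResult m Y N (j * T) T w) (centerParam Y N) := fun w => by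
        unfold sqDist; positivity
      have hint : Integrable (fun w => sqDist (batchResult m Y N (j * T) T w) (centerParam Y N))
          batchTape := by
        refine Integrable.of_bound (measurable_sqDist_prod
          (measurable_batchResult m measurable_const measurable_id N _ T)
          measurable_const).aestronglyMeasurable (2 * (2 * 400) ^ 2)
          (Filter.Eventually.of_forall fun w => ?_)
        obtain ⟨a1, a2⟩ := abs_sub_le_of_mem_paramBox (by norm_num) (hmem w)
          ((h.innerBox hm hN).mem (by norm_num))
        rw [Real.norm_of_nonneg (h0 w), sqDist]
        have b1 := sq_le_sq' (abs_le.1 a1).1 (abs_le.1 a1).2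
        have b2 := sq_le_sq' (abs_le.1 a2).1 (abs_le.1 a2).2
        linarith
      have h5 := measureReal_le_of_integral_le h0 hint (c := ρ ^ 2 / 16) (K := 16) (by positivity)
        (by norm_num) ((integral_batchResult_le hm hN h _ hT hj).trans (by linarith))
      have e2 : 16 * (ρ ^ 2 / 16) = ρ ^ 2 := by ring
      rw [e2] at h5
      exact h5
  have hind : iIndepFun (fun (j : ℕ) (w : ℕ → ℕ → ℕ → ℝ) => F j (w j)) coordTape :=
    iIndepFun_infinitePi (P := fun _ : ℕ => batchTape) (X := F) hFm
  -- Fractions: `1/16` from Markov, `1/8` for the fluctuation and `1/16` of bad batches make `1/4`;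
  -- the exponent is `2 (1/8)² B = B / 32`.
  have hH := hoeffding_le hind (fun j => (hFm j).comp (measurable_pi_apply j)) (fun j w => by
    simp only [hF]; split_ifs <;> simp) (Finset.range B) (p := 1 / 16) (fun j _ => by
    have e : coordTape.map (fun w => w j) = batchTape := Measure.infinitePi_map_eval _ j
    have : ∫ w, F j (w j) ∂coordTape = ∫ w, F j w ∂batchTape := by
      rw [← e, integral_map (measurable_pi_apply j).aemeasurable (hFm j).aestronglyMeasurable]
    rw [this]; exact hFi j) (u := B / 8) (by positivity)
  rw [Finset.card_range] at hH
  refine le_trans (measureReal_mono fun w hw => ?_) (hH.trans ?_)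
  · simp only [Set.mem_ofPred_eq] at hw ⊢
    have : farBatches m ρ N B T Y w ≤ ∑ j ∈ Finset.range B,
        (if (fun k => Y (j * T + k)) ∈ badBatch m T then (1 : ℝ) else 0) +
        ∑ j ∈ Finset.range B, F j (w j) := by
      rw [farBatches, ← Finset.sum_add_distrib]
      refine Finset.sum_le_sum fun j _ => ?_
      simp only [hF]
      by_cases h1 : (fun k => Y (j * T + k)) ∈ badBatch m T <;>
      by_cases h2 : ρ ^ 2 ≤ sqDist (batchResult m Y N (j * T) T (w j)) (centerParam Y N) <;>
      simp [h1, h2]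
    linarith
  · rw [Real.exp_le_exp]
    rcases Nat.eq_zero_or_pos B with h0 | h0
    · simp [h0]
    · have : (0 : ℝ) < B := by exact_mod_cast h0
      rw [div_le_div_iff₀ this (by norm_num)]
      nlinarith

/-- Fubini: sections over `F` are bounded by `1`, the others by `c`. `F` need not be measurable,
hence the measurable hull. -/
theorem measure_prod_le_add {α β : Type*} [MeasurableSpace α] [MeasurableSpace β] {P : Measure α}
    {Q : Measure β} [IsProbabilityMeasure P] [IsProbabilityMeasure Q] {s : Set (α × β)}
    (hs : MeasurableSet s) {F : Set α} {c : ENNReal}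
    (h : ∀ x ∉ F, Q (Prod.mk x ⁻¹' s) ≤ c) : (P.prod Q) s ≤ P F + c := by
  rw [Measure.prod_apply hs]
  calc _ ≤ ∫⁻ x, (toMeasurable P F).indicator 1 x + c ∂P := lintegral_mono fun x => by
        by_cases hx : x ∈ toMeasurable P F
        · rw [Set.indicator_of_mem hx]
          exact prob_le_one.trans le_self_add
        · exact (h x fun hF => hx (subset_toMeasurable P F hF)).trans le_add_self
    _ = _ := by
      rw [lintegral_add_right _ measurable_const, lintegral_indicator_one (measurableSet_toMeasurable _ _),
        measure_toMeasurable]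
      simp

/-! ### The failure event of one coordinate -/

theorem ae_lt_dataSeq (m : ℝ) : ∀ᵐ Y ∂(dataSeq m), ∀ k, -m < Y k := by
  rw [ae_all_iff]
  intro k
  have h : ∀ᵐ y ∂(truncG m), -m < y := ae_cond_mem measurableSet_Ioi
  rw [← map_eval_dataSeq m k] at h
  exact ae_of_ae_map (measurable_pi_apply k).aemeasurable h

/-- The rate of the Chernoff bounds for the first two moments. -/
noncomputable def momentRate : ℝ :=
  min (1 / 8) (1 / 1600 / (2 * chernoffMoment)) * (1 / 1600) / 2

theorem momentRate_pos : 0 < momentRate := by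
  have := one_le_chernoffMoment
  unfold momentRate
  have : 0 < min (1 / 8 : ℝ) (1 / 1600 / (2 * chernoffMoment)) := lt_min (by norm_num) (by positivity)
  positivity

theorem measure_not_goodMoments_le {m : ℝ} (hm : 0 ≤ m) (N : ℕ) :
    dataSeq m {Y | ¬ GoodMoments m Y N} ≤ ENNReal.ofReal (4 * Real.exp (-momentRate * N)) := by
  have h1 := (isCentered_sq hm).chernoff hm N (τ := 1 / 1600) (by norm_num)
  have h2 := (isCentered_id hm).chernoff hm N (τ := 1 / 1600) (by norm_num)
  rw [← momentRate] at h1 h2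
  have h3 : dataSeq m {Y | ¬ ∀ k, -m < Y k} = 0 := ae_lt_dataSeq m
  have h4 : {Y | ¬ GoodMoments m Y N} ⊆
      ({Y | N * (1 / 1600) ≤ |∑ k ∈ Finset.range N, (Y k ^ 2 - truncSq m)|} ∪
      {Y | N * (1 / 1600) ≤ |∑ k ∈ Finset.range N, (Y k - truncMean m)|}) ∪
      {Y | ¬ ∀ k, -m < Y k} := fun Y hY => by
    by_contra hc
    simp only [Set.mem_union, Set.mem_ofPred_eq, not_or, not_le, not_not] at hc
    exact hY ⟨hc.1.1, hc.1.2, fun k _ => (hc.2 k).le⟩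
  calc _ ≤ dataSeq m _ := measure_mono h4
    _ ≤ _ := measure_union_le _ _
    _ ≤ _ := add_le_add_left (measure_union_le _ _) _
    _ ≤ ENNReal.ofReal (2 * Real.exp (-momentRate * N)) +
        ENNReal.ofReal (2 * Real.exp (-momentRate * N)) + 0 := by
      rw [h3, ← ofReal_measureReal, ← ofReal_measureReal]
      gcongr
    _ = _ := by
      rw [add_zero, ← ENNReal.ofReal_add (by positivity) (by positivity)]
      congr 1; ring

theorem measurableSet_goodMoments (m : ℝ) (N : ℕ) :
    MeasurableSet {Y : ℕ → ℝ | GoodMoments m Y N} := by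
  have h1 : Measurable fun Y : ℕ → ℝ => |∑ k ∈ Finset.range N, (Y k ^ 2 - truncSq m)| := by fun_prop
  have h2 : Measurable fun Y : ℕ → ℝ => |∑ k ∈ Finset.range N, (Y k - truncMean m)| := by fun_prop
  refine (measurableSet_lt h1 measurable_const).inter
    ((measurableSet_lt h2 measurable_const).inter ?_)
  have : {Y : ℕ → ℝ | ∀ k < N, -m ≤ Y k} = ⋂ k, ⋂ (_ : k < N), {Y | -m ≤ Y k} := by
    ext; simp
  change MeasurableSet {Y : ℕ → ℝ | ∀ k < N, -m ≤ Y k}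
  rw [this]
  exact MeasurableSet.iInter fun k => MeasurableSet.iInter fun _ =>
    measurableSet_le measurable_const (measurable_pi_apply k)

/-- The bad event of one coordinate. -/
def badCoord (m ρ : ℝ) (N B : ℕ) : Set ((ℕ → ℝ) × (ℕ → ℕ → ℕ → ℝ)) :=
  {p | ¬ GoodMoments m p.1 N ∨ (B : ℝ) / 4 ≤ farBatches m ρ N B (N / B) p.1 p.2}

theorem measurableSet_badCoord (m ρ : ℝ) (N B : ℕ) : MeasurableSet (badCoord m ρ N B) :=
  (measurable_fst (measurableSet_goodMoments m N)).compl.union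
    (measurableSet_le measurable_const (measurable_farBatches m ρ N B _))

/-- The bound of the failure probability of one coordinate. -/
noncomputable def coordFailure (N B : ℕ) : ℝ :=
  4 * Real.exp (-momentRate * N) + 2 * Real.exp (-B / 512)

theorem measure_badCoord_le {m : ℝ} (hm : 0 ≤ m) {N B : ℕ} (hN : 0 < N) (hT : 0 < N / B) {ρ : ℝ}
    (hρ : 0 < ρ) (hTρ : 16 * (rateConst * (1 + Real.log (N / B : ℕ)) / (N / B : ℕ)) ≤ ρ ^ 2) :
    ((dataSeq m).prod coordTape) (badCoord m ρ N B) ≤ ENNReal.ofReal (coordFailure N B) := by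
  classical
  set T := N / B
  have h := measure_prod_le_add (P := dataSeq m) (Q := coordTape) (measurableSet_badCoord m ρ N B)
    (F := {Y | ¬ GoodMoments m Y N} ∪ {Y | (B : ℝ) / 16 ≤ ∑ j ∈ Finset.range B,
      if (fun k => Y (j * T + k)) ∈ badBatch m T then (1 : ℝ) else 0})
    (c := ENNReal.ofReal (Real.exp (-B / 512))) fun Y hY => by
      simp only [Set.mem_union, Set.mem_ofPred_eq, not_or, not_not, not_le] at hY
      have h1 := measure_farBatches_le hm hN hY.1 hT hρ hTρ hY.2
      have h2 : Prod.mk Y ⁻¹' badCoord m ρ N B =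
          {w | (B : ℝ) / 4 ≤ farBatches m ρ N B T Y w} := by
        ext w
        simp only [badCoord, Set.mem_preimage, Set.mem_ofPred_eq, hY.1, not_true_eq_false, false_or]
        rfl
      rw [h2, ← ofReal_measureReal]
      refine ENNReal.ofReal_le_ofReal (h1.trans ?_)
      rw [Real.exp_le_exp, neg_div, neg_div, neg_le_neg_iff]
      gcongr
      norm_num
  refine h.trans ?_
  calc _ ≤ (ENNReal.ofReal (4 * Real.exp (-momentRate * N)) + ENNReal.ofReal (Real.exp (-B / 512))) +
        ENNReal.ofReal (Real.exp (-B / 512)) := by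
        gcongr
        refine (measure_union_le _ _).trans ?_
        gcongr
        · exact measure_not_goodMoments_le hm N
        · rw [← ofReal_measureReal]
          exact ENNReal.ofReal_le_ofReal (measure_badBatches_le hm hT B)
    _ = _ := by
      rw [← ENNReal.ofReal_add (by positivity) (by positivity),
        ← ENNReal.ofReal_add (by positivity) (by positivity), coordFailure]
      congr 1; ring

theorem sgdIter_congr_data (r lam a : ℝ) {x x' : ℕ → ℝ} (w : ℕ → ℕ → ℝ) {T : ℕ}
    (h : ∀ k < T, x k = x' k) : ∀ t ≤ T, sgdIter r lam a x w t = sgdIter r lam a x' w t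
  | 0, _ => rfl
  | t + 1, ht => by
    rw [sgdIter, sgdIter, sgdIter_congr_data r lam a w h t (by omega), h t (by omega)]

theorem sgdAvg_congr_data (r lam a : ℝ) {x x' : ℕ → ℝ} (w : ℕ → ℕ → ℝ) {T : ℕ}
    (h : ∀ k < T, x k = x' k) : sgdAvg r lam a x w T = sgdAvg r lam a x' w T := by
  unfold sgdAvg
  have e : ∀ i ∈ Finset.range T, sgdIter r lam a x w (i + 1) = sgdIter r lam a x' w (i + 1) :=
    fun i hi => sgdIter_congr_data r lam a w h _ (Finset.mem_range.1 hi)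
  rw [Finset.sum_congr rfl fun i hi => congrArg Prod.fst (e i hi),
    Finset.sum_congr rfl fun i hi => congrArg Prod.snd (e i hi)]

/-! ### Dependence on the first `N` data points only, to pass from infinite sequences to lists -/

section congr

variable {Y Y' : ℕ → ℝ} {N : ℕ}

theorem empMean_congr (h : ∀ k < N, Y k = Y' k) : empMean Y N = empMean Y' N := by
  unfold empMean
  rw [Finset.sum_congr rfl fun k hk => h k (Finset.mem_range.1 hk)]

theorem empVar_congr (h : ∀ k < N, Y k = Y' k) : empVar Y N = empVar Y' N := by
  unfold empVar
  rw [empMean_congr h, Finset.sum_congr rfl fun k hk => by rw [h k (Finset.mem_range.1 hk)]]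

theorem GoodMoments.congr {m : ℝ} (h : ∀ k < N, Y k = Y' k) (hg : GoodMoments m Y N) :
    GoodMoments m Y' N := by
  obtain ⟨h1, h2, h3⟩ := hg
  refine ⟨?_, ?_, fun k hk => by rw [← h k hk]; exact h3 k hk⟩
  · rwa [Finset.sum_congr rfl fun k hk => by rw [h k (Finset.mem_range.1 hk)]] at h1
  · rwa [Finset.sum_congr rfl fun k hk => by rw [h k (Finset.mem_range.1 hk)]] at h2

theorem index_lt {B j k : ℕ} (hj : j < B) (hk : k < N / B) : j * (N / B) + k < N := by
  have h1 : (j + 1) * (N / B) ≤ B * (N / B) := Nat.mul_le_mul_right _ hj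
  have h2 : B * (N / B) ≤ N := Nat.mul_div_le N B
  nlinarith

theorem farBatches_congr (m ρ : ℝ) (B : ℕ) (w : ℕ → ℕ → ℕ → ℝ) (h : ∀ k < N, Y k = Y' k) :
    farBatches m ρ N B (N / B) Y w = farBatches m ρ N B (N / B) Y' w := by
  unfold farBatches
  refine Finset.sum_congr rfl fun j hj => ?_
  have hj' := Finset.mem_range.1 hj
  have e1 : centerParam Y N = centerParam Y' N := by
    unfold centerParam; rw [empMean_congr h, empVar_congr h]
  have e2 : batchResult m Y N (j * (N / B)) (N / B) (w j) =
      batchResult m Y' N (j * (N / B)) (N / B) (w j) := by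
    unfold batchResult normLow
    rw [empMean_congr h, empVar_congr h]
    refine sgdAvg_congr_data _ _ _ _ fun k hk => ?_
    unfold normData
    rw [empMean_congr h, empVar_congr h, h _ (index_lt hj' hk)]
  rw [e1, e2]

theorem badCoord_congr (m ρ : ℝ) (B : ℕ) (w : ℕ → ℕ → ℕ → ℝ) (h : ∀ k < N, Y k = Y' k)
    (hb : (Y, w) ∈ badCoord m ρ N B) : (Y', w) ∈ badCoord m ρ N B := by
  rcases hb with hb | hb
  · exact Or.inl fun hc => hb (hc.congr fun k hk => (h k hk).symm)
  · right
    have := farBatches_congr m ρ B w h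
    simp only at hb ⊢
    rwa [this] at hb

end congr

/-! ### Selection of a batch -/

/-- The plane as the complex plane. -/
def toComplex (p : ℝ × ℝ) : ℂ := ⟨p.1, p.2⟩

theorem distSum_eq (vs : List (ℝ × ℝ)) (p : ℝ × ℝ) :
    distSum vs p = (vs.map fun q => dist (toComplex p) (toComplex q)).sum := by
  unfold distSum
  congr 1
  refine List.map_congr_left fun q _ => ?_
  rw [Complex.dist_eq_re_im, ← sq, ← sq]; rfl

theorem dist_toComplex_lt {p q : ℝ × ℝ} {ρ : ℝ} (hρ : 0 < ρ) (h : sqDist p q < ρ ^ 2) :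
    dist (toComplex p) (toComplex q) < ρ := by
  rw [Complex.dist_eq_re_im, Real.sqrt_lt' hρ]; exact h

open Classical in
/-- If less than a quarter of the points is not close to `q`, then a point that minimizes the sum of
the distances to all points is close to `q`. -/
theorem dist_le_of_distSum_le {B : ℕ} (hB : 0 < B) (f : ℕ → ℝ × ℝ) {q p : ℝ × ℝ} {ρ : ℝ}
    (hρ : 0 < ρ)
    (hfar : (∑ j ∈ Finset.range B, if ρ ^ 2 ≤ sqDist (f j) q then (1 : ℝ) else 0) < B / 4)
    (hp : ∀ j < B, distSum ((List.range B).map f) p ≤ distSum ((List.range B).map f) (f j)) :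
    dist (toComplex p) (toComplex q) ≤ 5 * ρ := by
  have hB' : (0 : ℝ) < B := by exact_mod_cast hB
  have hsum : ∀ u, distSum ((List.range B).map f) u =
      ∑ j ∈ Finset.range B, dist (toComplex u) (toComplex (f j)) := fun u => by
    rw [distSum_eq, List.map_map]; exact (Multiset.sum_coe _).symm
  simp_rw [hsum] at hp
  obtain ⟨j₀, hj₀, hg⟩ : ∃ j < B, sqDist (f j) q < ρ ^ 2 := by
    by_contra! hc
    have : (∑ j ∈ Finset.range B, if ρ ^ 2 ≤ sqDist (f j) q then (1 : ℝ) else 0) = B := by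
      rw [Finset.sum_congr rfl fun j hj => if_pos (hc j (Finset.mem_range.1 hj))]
      simp
    linarith
  have h0 := dist_toComplex_lt hρ hg
  have h1 := hp j₀ hj₀
  set D := dist (toComplex p) (toComplex q) with hD
  by_contra! hc
  -- Compared with the near point `f j₀`, the minimizer `p` loses at least `D - 3 ρ` at a near point
  -- and gains at most `D + ρ` at a far one. With less than `B / 4` far points the total loss is at
  -- least `B (D - 5 ρ) / 2`, positive if `D > 5 ρ`.
  have key : ∀ j, (D - 3 * ρ) - (2 * D - 2 * ρ) *
      (if ρ ^ 2 ≤ sqDist (f j) q then (1 : ℝ) else 0) ≤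
      dist (toComplex p) (toComplex (f j)) - dist (toComplex (f j₀)) (toComplex (f j)) := fun j => by
    split_ifs with h
    · have := dist_triangle (toComplex (f j₀)) (toComplex q) (toComplex (f j))
      have h3 := dist_triangle (toComplex (f j₀)) (toComplex q) (toComplex p)
      have h4 := dist_triangle (toComplex (f j₀)) (toComplex p) (toComplex (f j))
      rw [dist_comm (toComplex q) (toComplex p)] at h3
      linarith
    · have h2 := dist_toComplex_lt hρ (not_le.1 h)
      have h3 := dist_triangle (toComplex p) (toComplex (f j)) (toComplex q)
      have h4 := dist_triangle (toComplex (f j₀)) (toComplex q) (toComplex (f j))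
      rw [dist_comm (toComplex q)] at h4
      linarith
  have h2 := Finset.sum_le_sum fun j (_ : j ∈ Finset.range B) => key j
  simp only [Finset.sum_sub_distrib, ← Finset.mul_sum, Finset.sum_const, Finset.card_range,
    nsmul_eq_mul] at h2
  have h3 : (2 * D - 2 * ρ) * (∑ j ∈ Finset.range B, if ρ ^ 2 ≤ sqDist (f j) q then (1 : ℝ) else 0)
      ≤ (2 * D - 2 * ρ) * (B / 4) := by
    refine mul_le_mul_of_nonneg_left hfar.le (by linarith)
  nlinarith [mul_pos hB' (sub_pos.2 hc)]

/-! ### The estimate of one coordinate on good data -/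

/-- In units of `σ` and `σ²`, the errors are linear in the error of `v` divided by `v.1 ≥ 1/400`,
hence relative errors. The true factor is below `2000`; the constant is generous. -/
theorem denormalize_close {b σ V μ : ℝ} (hσ : 0 < σ) (hV1 : 1 / 200 ≤ V) (hV2 : V ≤ 3)
    (hμ : |μ| ≤ 2) {v : ℝ × ℝ} (hv : v ∈ paramBox 400) {δ : ℝ}
    (h1 : |v.1 - V| ≤ δ) (h2 : |v.2 - -μ * √V| ≤ δ) :
    |(denormalize (b + σ * μ) (σ ^ 2 * V) v).1 - b| ≤ 2 * 10 ^ 6 * δ * σ ∧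
    |(denormalize (b + σ * μ) (σ ^ 2 * V) v).2 - σ ^ 2| ≤ 2 * 10 ^ 6 * δ * σ ^ 2 := by
  obtain ⟨c1, c2, -⟩ := hv
  have hV : 0 < V := by linarith
  have hv1 : 0 < v.1 := by linarith
  have hδ : 0 ≤ δ := (abs_nonneg _).trans h1
  set s := √V with hs
  have hs0 : 0 < s := Real.sqrt_pos.2 hV
  have hs2 : s ≤ 2 := Real.sqrt_le_iff.2 ⟨by norm_num, by linarith⟩
  have hss : s ^ 2 = V := Real.sq_sqrt hV.le
  have e0 : √(σ ^ 2 * V) = σ * s := by rw [Real.sqrt_mul (sq_nonneg σ), Real.sqrt_sq hσ.le]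
  have e1 : (denormalize (b + σ * μ) (σ ^ 2 * V) v).1 - b =
      (s * (v.2 - -μ * s) + μ * (v.1 - V)) / v.1 * σ := by
    simp only [denormalize, e0]
    rw [div_div_div_cancel_right₀ (by positivity), ← hss]
    field_simp
    ring
  have e2 : (denormalize (b + σ * μ) (σ ^ 2 * V) v).2 - σ ^ 2 = -(v.1 - V) / v.1 * σ ^ 2 := by
    simp only [denormalize]
    field_simp
    ring
  rw [e1, e2]
  constructor
  · rw [abs_mul, abs_of_pos hσ]
    gcongr
    rw [abs_div, abs_of_pos hv1, div_le_iff₀ hv1]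
    have a1 : |s * (v.2 - -μ * s)| ≤ 2 * δ := by
      rw [abs_mul, abs_of_pos hs0]; gcongr
    have a2 : |μ * (v.1 - V)| ≤ 2 * δ := by rw [abs_mul]; gcongr
    calc _ ≤ 2 * δ + 2 * δ := (abs_add_le _ _).trans (add_le_add a1 a2)
      _ ≤ 2 * 10 ^ 6 * δ * (1 / 400) := by nlinarith
      _ ≤ _ := by gcongr
  · rw [abs_mul, abs_of_nonneg (sq_nonneg σ)]
    gcongr
    rw [abs_div, abs_of_pos hv1, div_le_iff₀ hv1, abs_neg]
    calc _ ≤ δ := h1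
      _ ≤ 2 * 10 ^ 6 * δ * (1 / 400) := by nlinarith
      _ ≤ _ := by gcongr

theorem listMean_ofFn (b σ : ℝ) (Y : ℕ → ℝ) {N : ℕ} (hN : 0 < N) :
    listMean (List.ofFn fun k : Fin N => b + σ * Y k) = b + σ * empMean Y N := by
  have hN' : (N : ℝ) ≠ 0 := by positivity
  rw [listMean, List.map_id', List.sum_ofFn, List.length_ofFn, empMean,
    Fin.sum_univ_eq_sum_range fun k => b + σ * Y k, Finset.sum_add_distrib, ← Finset.mul_sum]
  simp
  field_simp

theorem listVar_ofFn (b σ : ℝ) (Y : ℕ → ℝ) {N : ℕ} (hN : 0 < N) :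
    listVar (List.ofFn fun k : Fin N => b + σ * Y k) = σ ^ 2 * empVar Y N := by
  rw [listVar, listMean_ofFn b σ Y hN, List.map_ofFn, List.sum_ofFn, List.length_ofFn, empVar]
  simp only [Function.comp_apply]
  rw [Fin.sum_univ_eq_sum_range fun k =>
    (b + σ * Y k - (b + σ * empMean Y N)) * (b + σ * Y k - (b + σ * empMean Y N)),
    ← mul_div_assoc, Finset.mul_sum]
  congr 1
  exact Finset.sum_congr rfl fun k _ => by ring

theorem listNormalized_ofFn (b : ℝ) {σ : ℝ} (hσ : 0 < σ) (Y : ℕ → ℝ) {N : ℕ} (hN : 0 < N) :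
    listNormalized (List.ofFn fun k : Fin N => b + σ * Y k) =
      List.ofFn fun k : Fin N => normData Y N k := by
  rw [listNormalized, listMean_ofFn b σ Y hN, listVar_ofFn b σ Y hN, List.map_ofFn]
  congr 1
  funext k
  simp only [Function.comp_apply, normData]
  rw [Real.sqrt_mul (sq_nonneg σ), Real.sqrt_sq hσ.le]
  -- If the empirical variance vanishes, both sides are `0` by the convention for division.
  rcases (Real.sqrt_nonneg (empVar Y N)).eq_or_lt with h | h
  · rw [← h]; simp
  · field_simp; ring

theorem batchResults_ofFn {m σ : ℝ} (hσ : 0 < σ) (Y : ℕ → ℝ) {N B : ℕ} (hN : 0 < N)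
    (w : ℕ → ℕ → ℕ → ℝ) :
    batchResults 400 (stepConst 400) B (List.ofFn fun k : Fin N => m * σ + σ * Y k) w =
      (List.range B).map fun j => batchResult m Y N (j * (N / B)) (N / B) (w j) := by
  rw [batchResults, listMean_ofFn _ σ Y hN, listVar_ofFn _ σ Y hN, listNormalized_ofFn _ hσ Y hN,
    List.length_ofFn]
  refine List.map_congr_left fun j hj => ?_
  have hj' := List.mem_range.1 hj
  set T := N / B
  have hlen : (((List.ofFn fun k : Fin N => normData Y N k).drop (j * T)).take T).length = T := by
    rw [List.length_take, List.length_drop, List.length_ofFn, min_eq_left]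
    rcases Nat.eq_zero_or_pos T with h | h
    · omega
    · have : j * T + (T - 1) < N := index_lt hj' (by omega)
      omega
  rw [projSGD_val _ _ _ (fun k => normData Y N (j * T + k)) _ _ fun i hi => by
    simp [List.getElem_take, List.getElem_drop, List.getElem_ofFn], hlen]
  have e : 0 - (m * σ + σ * empMean Y N) / √(σ ^ 2 * empVar Y N) = normLow m Y N := by
    rw [Real.sqrt_mul (sq_nonneg σ), Real.sqrt_sq hσ.le, normLow]
    rcases (Real.sqrt_nonneg (empVar Y N)).eq_or_lt with h | h
    · rw [← h]; simp
    · field_simp; ring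
  rw [e]; rfl

/-- On good data and tape, the estimates of a coordinate are close to the truth. -/
theorem normBiasEst_close {m σ ρ : ℝ} (hm : 0 ≤ m) (hσ : 0 < σ) (hρ : 0 < ρ) {Y : ℕ → ℝ} {N B : ℕ}
    (hT : 0 < N / B) {w : ℕ → ℕ → ℕ → ℝ} (h : (Y, w) ∉ badCoord m ρ N B) :
    let e := (normBiasEst 400 (stepConst 400) B (List.ofFn fun k : Fin N => m * σ + σ * Y k) w).val
    |e.1 - m * σ| ≤ 10 ^ 7 * ρ * σ ∧ |e.2 - σ ^ 2| ≤ 10 ^ 7 * ρ * σ ^ 2 := by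
  have hB : 0 < B := Nat.pos_of_ne_zero fun h => by simp [h] at hT
  have hN : 0 < N := Nat.pos_of_ne_zero fun h => by simp [h] at hT
  simp only [badCoord, Set.mem_ofPred_eq, not_or, not_not, not_le] at h
  obtain ⟨hg, hfar⟩ := h
  obtain ⟨hV1, hV2, hμ, -⟩ := hg.bounds hm hN
  intro e
  set f := fun j => batchResult m Y N (j * (N / B)) (N / B) (w j) with hf
  have he : e = denormalize (m * σ + σ * empMean Y N) (σ ^ 2 * empVar Y N)
      (selectPoint ((List.range B).map f)).val := by
    simp only [e]
    rw [normBiasEst_val, listMean_ofFn _ σ Y hN, listVar_ofFn _ σ Y hN, batchResults_ofFn hσ Y hN]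
  have hne : (List.range B).map f ≠ [] := by simp; omega
  obtain ⟨s1, s2⟩ := selectPoint_spec hne
  set v := (selectPoint ((List.range B).map f)).val
  have hd := dist_le_of_distSum_le hB f (q := centerParam Y N) (p := v) hρ hfar fun j hj =>
    s2 _ (List.mem_map_of_mem (List.mem_range.2 hj))
  have hbox : v ∈ paramBox 400 := by
    obtain ⟨j, -, hj⟩ := List.mem_map.1 s1
    rw [← hj]
    exact sgdAvg_mem (by norm_num) _ _ _ _ hT
  have d1 : |v.1 - empVar Y N| ≤ 5 * ρ := by
    have := (Complex.abs_re_le_norm (toComplex v - toComplex (centerParam Y N))).trans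
      ((dist_eq_norm _ _).symm.le.trans hd)
    exact this
  have d2 : |v.2 - -empMean Y N * √(empVar Y N)| ≤ 5 * ρ := by
    have := (Complex.abs_im_le_norm (toComplex v - toComplex (centerParam Y N))).trans
      ((dist_eq_norm _ _).symm.le.trans hd)
    exact this
  obtain ⟨r1, r2⟩ := denormalize_close (b := m * σ) hσ hV1 hV2 hμ hbox d1 d2
  rw [he]
  exact ⟨r1.trans_eq (by ring), r2.trans_eq (by ring)⟩

/-! ## The law of one coordinate -/

/-- The law of `max 0 (m σ + σ g)` for a standard Gaussian `g`. -/
noncomputable def reluLaw (m σ : ℝ) : Measure ℝ := stdG.map fun g => max 0 (m * σ + σ * g)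

instance (m σ : ℝ) : IsProbabilityMeasure (reluLaw m σ) :=
  Measure.isProbabilityMeasure_map (by fun_prop)

/-- The law of the event that a coordinate is positive. -/
noncomputable def signLaw (m : ℝ) : Measure Bool := stdG.map fun g => decide (-m < g)

theorem measurable_decide_lt (m : ℝ) : Measurable fun g : ℝ => decide (-m < g) :=
  measurable_to_bool <| by
    have : (fun g : ℝ => decide (-m < g)) ⁻¹' {true} = Set.Ioi (-m) := by ext; simp
    rw [this]; exact measurableSet_Ioi

instance (m : ℝ) : IsProbabilityMeasure (signLaw m) :=
  Measure.isProbabilityMeasure_map (measurable_decide_lt m).aemeasurable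

/-- A sample from its sign and a truncated Gaussian. -/
def signCase (m σ : ℝ) (e : Bool) (y : ℝ) : ℝ := if e then m * σ + σ * y else 0

theorem measurable_signCase (m σ : ℝ) : Measurable fun p : Bool × ℝ => signCase m σ p.1 p.2 :=
  measurable_from_prod_countable_right fun e => by unfold signCase; cases e <;> simp; fun_prop

/-- A sample can be drawn by deciding its sign and, independently, a truncated Gaussian that is
ignored when the sign is negative. In this representation the positive samples are i.i.d. given the
signs. -/
theorem map_signCase {m σ : ℝ} (hσ : 0 < σ) :
    ((signLaw m).prod (truncG m)).map (fun p => signCase m σ p.1 p.2) = reluLaw m σ := by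
  classical
  ext S hS
  have hA : MeasurableSet (Set.Ioi (-m)) := measurableSet_Ioi
  rw [Measure.map_apply (measurable_signCase m σ) hS,
    Measure.prod_apply (measurable_signCase m σ hS), signLaw,
    lintegral_map (measurable_of_countable _) (measurable_decide_lt m),
    reluLaw, Measure.map_apply (by fun_prop) hS, ← measure_inter_add_sdiff _ hA]
  have h1 : (fun g => max 0 (m * σ + σ * g)) ⁻¹' S ∩ Set.Ioi (-m) =
      Set.Ioi (-m) ∩ {y | m * σ + σ * y ∈ S} := by
    ext g
    simp only [Set.mem_inter_iff, Set.mem_preimage, Set.mem_Ioi, Set.mem_ofPred_eq]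
    rw [and_comm]
    refine and_congr_right fun hg => ?_
    rw [max_eq_right (by nlinarith)]
  have h2 : (fun g => max 0 (m * σ + σ * g)) ⁻¹' S \ Set.Ioi (-m) =
      (Set.Ioi (-m))ᶜ ∩ {_y | (0 : ℝ) ∈ S} := by
    ext g
    simp only [Set.mem_sdiff, Set.mem_preimage, Set.mem_Ioi, Set.mem_ofPred_eq, Set.mem_inter_iff,
      Set.mem_compl_iff]
    rw [and_comm]
    refine and_congr_right fun hg => ?_
    rw [max_eq_left (by nlinarith)]
  have e : ∀ g, truncG m (Prod.mk (decide (-m < g)) ⁻¹' ((fun p => signCase m σ p.1 p.2) ⁻¹' S)) =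
      (Set.Ioi (-m)).indicator (fun _ => truncG m {y | m * σ + σ * y ∈ S}) g +
      (Set.Ioi (-m))ᶜ.indicator (fun _ => if (0 : ℝ) ∈ S then 1 else 0) g := fun g => by
    by_cases hg : -m < g
    · rw [Set.indicator_of_mem (show g ∈ Set.Ioi (-m) from hg), Set.indicator_of_notMem (by simpa),
        add_zero]
      congr 1
      ext y; simp [signCase, hg]
    · rw [Set.indicator_of_notMem (show g ∉ Set.Ioi (-m) from hg), Set.indicator_of_mem (by simpa using hg),
        zero_add]
      have : Prod.mk (decide (-m < g)) ⁻¹' ((fun p => signCase m σ p.1 p.2) ⁻¹' S) =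
          {_y | (0 : ℝ) ∈ S} := by ext y; simp [signCase, hg]
      rw [this]
      split_ifs with h0 <;> simp [h0]
  simp_rw [e]
  rw [lintegral_add_left (measurable_const.indicator hA), lintegral_indicator_const hA,
    lintegral_indicator_const hA.compl, h1, h2]
  congr 1
  · rw [truncG, cond_mul_eq_inter hA]
  · split_ifs with h0 <;> simp [h0]

theorem measure_signLaw_false_le {m : ℝ} (hm : 0 ≤ m) : (signLaw m).real {false} ≤ 1 / 2 := by
  have h1 : (signLaw m).real {false} = stdG.real (Set.Ioi (-m))ᶜ := by
    rw [measureReal_def, signLaw, Measure.map_apply (measurable_decide_lt m)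
      (measurableSet_singleton _), ← measureReal_def]
    congr 1; ext g; simp
  have h2 : (1 / 2 : ℝ) ≤ stdG.real (Set.Ioi (-m)) := by
    have := ENNReal.toReal_mono (measure_ne_top _ _) (half_le_stdG_Ioi hm)
    simpa [measureReal_def] using this
  rw [h1, probReal_compl_eq_one_sub measurableSet_Ioi]
  linarith

/-! ## The positive samples -/

/-- The indices of the positive samples. -/
def posIndices {n : ℕ} (e : Fin n → Bool) : List (Fin n) := (List.finRange n).filter fun k => e k

theorem nodup_posIndices {n : ℕ} (e : Fin n → Bool) : (posIndices e).Nodup :=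
  (List.nodup_finRange n).filter _

/-- The `k`-th positive sample, or an arbitrary unused index. -/
def posIndex {n : ℕ} (e : Fin n → Bool) (k : ℕ) : ℕ :=
  if h : k < (posIndices e).length then ((posIndices e)[k] : ℕ) else n + k

theorem posIndex_injective {n : ℕ} (e : Fin n → Bool) : Function.Injective (posIndex e) := by
  intro k l h
  unfold posIndex at h
  split_ifs at h with h1 h2 h2
  · exact (nodup_posIndices e).getElem_inj_iff.1 (Fin.ext h)
  · have := ((posIndices e)[k]).2; omega
  · have := ((posIndices e)[l]).2; omega
  · omega

theorem length_posIndices {n : ℕ} (e : Fin n → Bool) :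
    ((posIndices e).length : ℝ) = n - ∑ k, if e k = false then (1 : ℝ) else 0 := by
  have h1 : ((posIndices e).length : ℝ) = ∑ k, if e k then (1 : ℝ) else 0 := by
    rw [Finset.sum_boole, ← List.toFinset_card_of_nodup (nodup_posIndices e)]
    congr 2
    ext k; simp [posIndices]
  rw [h1]
  have h2 : ∑ k, ((if e k then (1 : ℝ) else 0) + if e k = false then (1 : ℝ) else 0) = n := by
    have : ∀ k, ((if e k then (1 : ℝ) else 0) + if e k = false then (1 : ℝ) else 0) = 1 := fun k => by
      cases e k <;> simp
    simp [this]
  rw [Finset.sum_add_distrib] at h2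
  linarith

/-- Each sample is zero with probability at most `1/2`. More than two thirds of zeros is an excess
of `n / 6`, with exponent `2 (1/6)² n = n / 18`. -/
theorem measure_few_positive_le {m : ℝ} (hm : 0 ≤ m) {n : ℕ} (hn : 0 < n) :
    (Measure.pi fun _ : Fin n => signLaw m) {e | 3 * (posIndices e).length < n} ≤
      ENNReal.ofReal (Real.exp (-n / 18)) := by
  have hn' : (0 : ℝ) < n := by exact_mod_cast hn
  have hX : Measurable fun e : Bool => if e = false then (1 : ℝ) else 0 := measurable_of_countable _
  have hind : iIndepFun (fun (k : Fin n) (e : Fin n → Bool) => if e k = false then (1 : ℝ) else 0)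
      (Measure.pi fun _ : Fin n => signLaw m) :=
    iIndepFun_pi (X := fun (_ : Fin n) (e : Bool) => if e = false then (1 : ℝ) else 0)
      fun _ => hX.aemeasurable
  have h := hoeffding_le hind (fun k => hX.comp (measurable_pi_apply k)) (fun k e => by
    split_ifs <;> simp) Finset.univ (p := 1 / 2) (fun k _ => by
    have e1 : (Measure.pi fun _ : Fin n => signLaw m).map (fun e => e k) = signLaw m :=
      (measurePreserving_eval _ k).map_eq
    have e2 : ∫ e, (if e k = false then (1 : ℝ) else 0) ∂(Measure.pi fun _ : Fin n => signLaw m) =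
        ∫ e, (if e = false then (1 : ℝ) else 0) ∂(signLaw m) := by
      conv_rhs => rw [← e1]
      rw [integral_map (measurable_pi_apply k).aemeasurable hX.aestronglyMeasurable]
    have e3 : ∫ e, (if e = false then (1 : ℝ) else 0) ∂(signLaw m) = (signLaw m).real {false} := by
      rw [← integral_indicator_one (measurableSet_singleton _)]
      refine integral_congr_ae (Filter.Eventually.of_forall fun e => ?_)
      cases e <;> simp
    rw [e2, e3]
    exact measure_signLaw_false_le hm) (u := n / 6) (by positivity)
  rw [Finset.card_univ, Fintype.card_fin] at h
  rw [← ofReal_measureReal]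
  refine ENNReal.ofReal_le_ofReal (le_trans (measureReal_mono fun e he => ?_) (h.trans ?_))
  · simp only [Set.mem_ofPred_eq] at he ⊢
    have h1 := length_posIndices e
    have h2 : (3 * (posIndices e).length : ℝ) < n := by exact_mod_cast he
    linarith
  · rw [Real.exp_le_exp]
    field_simp
    norm_num

/-- The signs of the samples. -/
noncomputable def signs {n : ℕ} (x : Fin n → ℝ) (k : Fin n) : Bool := decide (0 < x k)

/-- The standardized positive samples. -/
noncomputable def posData (m σ : ℝ) {n : ℕ} (e : Fin n → Bool) (x : Fin n → ℝ) (k : ℕ) : ℝ :=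
  if h : k < (posIndices e).length then (x (posIndices e)[k] - m * σ) / σ else 0

theorem filter_pos_eq {m σ : ℝ} (hσ : 0 < σ) {n : ℕ} (x : Fin n → ℝ) :
    (List.ofFn x).filter (fun y => decide (0 < y)) =
      List.ofFn fun k : Fin (posIndices (signs x)).length =>
        m * σ + σ * posData m σ (signs x) x k := by
  rw [List.ofFn_eq_map, List.filter_map]
  have : (List.finRange n).filter ((fun y => decide (0 < y)) ∘ x) = posIndices (signs x) := rfl
  rw [this]
  refine List.ext_getElem (by simp) fun k h1 h2 => ?_
  simp only [List.length_map] at h1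
  simp only [List.getElem_map, List.getElem_ofFn, posData, h1, dif_pos]
  field_simp; ring

/-- The bad event of one coordinate in terms of the samples. -/
def badSamples (m σ ρ : ℝ) (n B : ℕ) : Set ((Fin n → ℝ) × (ℕ → ℕ → ℕ → ℝ)) :=
  {p | 3 * (posIndices (signs p.1)).length < n ∨
    (posData m σ (signs p.1) p.1, p.2) ∈ badCoord m ρ (posIndices (signs p.1)).length B}

/-! ### Conditioning on the signs -/

theorem measurable_signs {n : ℕ} : Measurable (signs : (Fin n → ℝ) → Fin n → Bool) :=
  measurable_pi_iff.2 fun k => measurable_to_bool <| by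
    have : (fun x : Fin n → ℝ => signs x k) ⁻¹' {true} = {x | 0 < x k} := by ext; simp [signs]
    rw [this]; exact measurableSet_lt measurable_const (measurable_pi_apply k)

theorem measurable_posData (m σ : ℝ) {n : ℕ} (e : Fin n → Bool) :
    Measurable (posData m σ e) :=
  measurable_pi_iff.2 fun k => by
    unfold posData
    split_ifs
    · fun_prop
    · fun_prop

theorem measurableSet_badSamples (m σ ρ : ℝ) (n B : ℕ) :
    MeasurableSet (badSamples m σ ρ n B) := by
  have h : badSamples m σ ρ n B = ⋃ e : Fin n → Bool, {p | signs p.1 = e} ∩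
      {p | 3 * (posIndices e).length < n ∨
        (posData m σ e p.1, p.2) ∈ badCoord m ρ (posIndices e).length B} := by
    ext p; simp [badSamples]
  rw [h]
  refine MeasurableSet.iUnion fun e => MeasurableSet.inter
    ((measurable_signs.comp measurable_fst) (measurableSet_singleton e)) ?_
  exact (MeasurableSet.const _).union
    ((((measurable_posData m σ e).comp measurable_fst).prodMk measurable_snd)
      (measurableSet_badCoord m ρ _ B))

/-- The samples from their signs and a sequence of truncated Gaussians. -/
def signSamples (m σ : ℝ) {n : ℕ} (e : Fin n → Bool) (Y : ℕ → ℝ) (k : Fin n) : ℝ :=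
  signCase m σ (e k) (Y k)

theorem measurePreserving_signSamples {m σ : ℝ} (hσ : 0 < σ) (n : ℕ) :
    MeasurePreserving (fun p : (Fin n → Bool) × (ℕ → ℝ) => signSamples m σ p.1 p.2)
      ((Measure.pi fun _ : Fin n => signLaw m).prod (dataSeq m))
      (Measure.pi fun _ : Fin n => reluLaw m σ) := by
  have h1 : MeasurePreserving (fun (Y : ℕ → ℝ) (k : Fin n) => Y k) (dataSeq m)
      (Measure.pi fun _ : Fin n => truncG m) := by
    refine ⟨by fun_prop, ?_⟩
    rw [← Measure.infinitePi_eq_pi]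
    exact Measure.map_infinitePi_infinitePi_of_inj (P := fun _ : ℕ => truncG m)
      (f := fun k : Fin n => (k : ℕ)) Fin.val_injective
  have h2 := (MeasurePreserving.id (Measure.pi fun _ : Fin n => signLaw m)).prod h1
  have h3 := (measurePreserving_arrowProdEquivProdArrow Bool ℝ (Fin n) (fun _ => signLaw m)
    fun _ => truncG m).symm
  have h4 : MeasurePreserving (fun (p : Fin n → Bool × ℝ) k => signCase m σ (p k).1 (p k).2)
      (Measure.pi fun _ : Fin n => (signLaw m).prod (truncG m))
      (Measure.pi fun _ : Fin n => reluLaw m σ) := by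
    have hm := measurable_signCase m σ
    refine ⟨measurable_pi_iff.2 fun k => hm.comp (measurable_pi_apply k), ?_⟩
    have := Measure.pi_map_pi (μ := fun _ : Fin n => (signLaw m).prod (truncG m))
      (f := fun _ p => signCase m σ p.1 p.2) fun _ => hm.aemeasurable
    rw [this]
    simp_rw [map_signCase hσ]
  exact h4.comp (h3.comp h2)

/-- For fixed signs, the positive samples are read off the sequence along an injection, so they are
again a sequence of independent truncated Gaussians. The unused indices `n + k` serve to make the
injection total. -/
theorem measurePreserving_posIndex (m : ℝ) {n : ℕ} (e : Fin n → Bool) :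
    MeasurePreserving (fun (Y : ℕ → ℝ) k => Y (posIndex e k)) (dataSeq m) (dataSeq m) :=
  ⟨by fun_prop, Measure.map_infinitePi_infinitePi_of_inj (P := fun _ : ℕ => truncG m)
    (posIndex_injective e)⟩

theorem signs_signSamples {m σ : ℝ} (hσ : 0 < σ) {n : ℕ} (e : Fin n → Bool) {Y : ℕ → ℝ}
    (hY : ∀ k, -m < Y k) : signs (signSamples m σ e Y) = e := by
  funext k
  unfold signs signSamples signCase
  cases e k
  · simp
  · have := hY k
    simp only [if_true, decide_eq_true_eq]
    nlinarith

theorem posData_signSamples {m σ : ℝ} (hσ : 0 < σ) {n : ℕ} (e : Fin n → Bool) (Y : ℕ → ℝ) {k : ℕ}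
    (hk : k < (posIndices e).length) :
    posData m σ e (signSamples m σ e Y) k = Y (posIndex e k) := by
  have h1 : e (posIndices e)[k] = true := (List.mem_filter.1 (List.getElem_mem hk)).2
  simp only [posData, hk, dif_pos, signSamples, signCase, posIndex, h1, if_true]
  field_simp; ring

/-- The batch length depends on the random number of positive samples; monotonicity of the rate
replaces it by the deterministic lower bound `T₀`. -/
theorem one_add_log_div_le {T₀ T : ℕ} (h₀ : 0 < T₀) (h : T₀ ≤ T) :
    (1 + Real.log T) / T ≤ (1 + Real.log T₀) / T₀ := by
  have h1 : (0 : ℝ) < T₀ := by exact_mod_cast h₀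
  have h2 : (T₀ : ℝ) ≤ T := by exact_mod_cast h
  have h3 : (0 : ℝ) < T := h1.trans_le h2
  have h4 : Real.log T = Real.log T₀ + Real.log (T / T₀) := by
    rw [Real.log_div h3.ne' h1.ne']; ring
  have h5 := Real.log_le_sub_one_of_pos (div_pos h3 h1)
  have h6 : (0 : ℝ) ≤ Real.log T₀ := Real.log_natCast_nonneg T₀
  have h7 : 1 ≤ (T : ℝ) / T₀ := (one_le_div h1).2 h2
  rw [div_le_div_iff₀ h3 h1]
  have h8 : 1 + Real.log T ≤ (T / T₀ : ℝ) * (1 + Real.log T₀) := by nlinarith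
  calc (1 + Real.log T) * T₀ ≤ (T / T₀ : ℝ) * (1 + Real.log T₀) * T₀ := by gcongr
    _ = _ := by field_simp

/-- Pull back to signs and truncated values and apply Fubini over the signs. With at least `n / 3`
positive samples, `3 T₀ B ≤ n` gives batches of length at least `T₀`, and `measure_badCoord_le`
applies to the reindexed sequence. -/
theorem measure_badSamples_le {m σ ρ : ℝ} (hm : 0 ≤ m) (hσ : 0 < σ) (hρ : 0 < ρ) {n B T₀ : ℕ}
    (hB : 0 < B) (hT₀ : 0 < T₀) (hn : 3 * (T₀ * B) ≤ n)
    (hTρ : 16 * (rateConst * ((1 + Real.log T₀) / T₀)) ≤ ρ ^ 2) :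
    ((Measure.pi fun _ : Fin n => reluLaw m σ).prod coordTape) (badSamples m σ ρ n B) ≤
      ENNReal.ofReal (Real.exp (-n / 18) + 4 * Real.exp (-momentRate * (n / 3)) +
        2 * Real.exp (-B / 512)) := by
  have hn0 : 0 < n := lt_of_lt_of_le (by positivity) hn
  have hmp := ((measurePreserving_signSamples hσ n).prod (MeasurePreserving.id coordTape)).comp
    (measurePreserving_prodAssoc (Measure.pi fun _ : Fin n => signLaw m) (dataSeq m)
      coordTape).symm
  have hbm := measurableSet_badSamples m σ ρ n B
  rw [← hmp.measure_preimage hbm.nullMeasurableSet]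
  have h := measure_prod_le_add (hmp.measurable hbm)
    (F := {e | 3 * (posIndices e).length < n})
    (c := ENNReal.ofReal (4 * Real.exp (-momentRate * (n / 3)) + 2 * Real.exp (-B / 512)))
    (P := Measure.pi fun _ : Fin n => signLaw m) (Q := (dataSeq m).prod coordTape) fun e he => by
      simp only [Set.mem_ofPred_eq, not_lt] at he
      set N := (posIndices e).length with hN
      have hTN : T₀ ≤ N / B := by
        rw [Nat.le_div_iff_mul_le hB]; omega
      have hT : 0 < N / B := hT₀.trans_le hTN
      have hN0 : 0 < N := Nat.pos_of_ne_zero fun h => by simp [h] at hT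
      have hN1 : (n : ℝ) / 3 ≤ N := by
        have : (n : ℝ) ≤ 3 * N := by exact_mod_cast he
        linarith
      have hrate : 16 * (rateConst * (1 + Real.log (N / B : ℕ)) / (N / B : ℕ)) ≤ ρ ^ 2 := by
        refine le_trans ?_ hTρ
        rw [mul_div_assoc]
        have := rateConst_pos
        have := one_add_log_div_le hT₀ hTN
        gcongr
      have hmp2 := (measurePreserving_posIndex m e).prod (MeasurePreserving.id coordTape)
      have hnull : ((dataSeq m).prod coordTape) {p | ¬ ∀ k, -m < p.1 k} = 0 :=
        Measure.quasiMeasurePreserving_fst.ae (ae_lt_dataSeq m)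
      refine (measure_mono (t := {p | ¬ ∀ k, -m < p.1 k} ∪
        Prod.map (fun (Y : ℕ → ℝ) k => Y (posIndex e k)) id ⁻¹' badCoord m ρ N B) ?_).trans ?_
      · rintro ⟨Y, w⟩ hp
        by_cases hY : ∀ k, -m < Y k
        · right
          have hs := signs_signSamples hσ e hY
          have hp' : (signSamples m σ e Y, w) ∈ badSamples m σ ρ n B := hp
          simp only [badSamples, Set.mem_ofPred_eq, hs] at hp'
          rcases hp' with hp' | hp'
          · omega
          · exact badCoord_congr m ρ B w (fun k hk => posData_signSamples hσ e Y hk) hp'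
        · exact Or.inl hY
      · refine (measure_union_le _ _).trans ?_
        rw [hnull, zero_add, hmp2.measure_preimage (measurableSet_badCoord m ρ N B).nullMeasurableSet]
        refine (measure_badCoord_le hm hN0 hT hρ hrate).trans (ENNReal.ofReal_le_ofReal ?_)
        rw [coordFailure]
        have := momentRate_pos
        exact add_le_add_left (mul_le_mul_of_nonneg_left (Real.exp_le_exp.2 (by nlinarith))
          (by norm_num)) _
  refine h.trans ((add_le_add_left (measure_few_positive_le hm hn0) _).trans ?_)
  rw [← ENNReal.ofReal_add (by positivity) (by positivity)]
  refine ENNReal.ofReal_le_ofReal (by linarith)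

/-- Outside of the bad event, the estimates of a coordinate are close to the truth. -/
theorem coordEst_close {m σ ρ : ℝ} (hm : 0 ≤ m) (hσ : 0 < σ) (hρ : 0 < ρ) {n B T₀ : ℕ}
    (hB : 0 < B) (hT₀ : 0 < T₀) (hn : 3 * (T₀ * B) ≤ n) {x : Fin n → ℝ} {w : ℕ → ℕ → ℕ → ℝ}
    (h : (x, w) ∉ badSamples m σ ρ n B) :
    |(coordEst 400 (stepConst 400) B x w).1 - m * σ| ≤ 10 ^ 7 * ρ * σ ∧
    |(coordEst 400 (stepConst 400) B x w).2 - σ ^ 2| ≤ 10 ^ 7 * ρ * σ ^ 2 := by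
  simp only [badSamples, Set.mem_ofPred_eq, not_or, not_lt] at h
  have hT : 0 < (posIndices (signs x)).length / B := by
    refine hT₀.trans_le ?_
    rw [Nat.le_div_iff_mul_le hB]; omega
  obtain ⟨h1, h2⟩ := normBiasEst_close hm hσ hρ hT h.2
  unfold coordEst
  rw [filter_pos_eq hσ]
  refine ⟨le_trans ?_ h1, h2⟩
  have h3 := abs_max_sub_max_le_abs (normBiasEst 400 (stepConst 400) B
    (List.ofFn fun k : Fin (posIndices (signs x)).length =>
      m * σ + σ * posData m σ (signs x) x k) w).val.1 (m * σ) 0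
  rwa [max_eq_left (show (0 : ℝ) ≤ m * σ by positivity), max_comm] at h3

/-! ## Total variation distance of Gaussians -/

theorem tvDistance_le_of_forall {α : Type*} [MeasurableSpace α] {P Q : Measure α} {ε : ℝ}
    (h : ∀ A, MeasurableSet A → |P.real A - Q.real A| ≤ ε) : tvDistance P Q ≤ ε :=
  haveI : Nonempty {A : Set α // MeasurableSet A} := ⟨⟨∅, MeasurableSet.empty⟩⟩
  ciSup_le fun A => h A.1 A.2

/-- The total variation distance is bounded in terms of the second moment of the density. -/
theorem abs_real_sub_le_of_withDensity {α : Type*} [MeasurableSpace α] {P Q : Measure α}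
    [IsProbabilityMeasure Q] [IsProbabilityMeasure P] {F : α → ℝ} (h0 : ∀ x, 0 ≤ F x)
    (hi : Integrable F Q) (hi2 : Integrable (fun x => F x ^ 2) Q)
    (hP : P = Q.withDensity fun x => ENNReal.ofReal (F x)) {ε : ℝ} (hε : 0 < ε)
    (h2 : ∫ x, F x ^ 2 ∂Q ≤ 1 + ε ^ 2) {A : Set α} (hA : MeasurableSet A) :
    |P.real A - Q.real A| ≤ ε := by
  have hreal : ∀ {A : Set α}, MeasurableSet A → P.real A = ∫ x in A, F x ∂Q := fun {A} hA => by
    rw [measureReal_def, hP, withDensity_apply _ hA, integral_eq_lintegral_of_nonneg_ae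
      (Filter.Eventually.of_forall h0) hi.aestronglyMeasurable.restrict]
  have h1 : ∫ x, F x ∂Q = 1 := by
    have := hreal MeasurableSet.univ
    rw [setIntegral_univ] at this
    rw [← this]; simp
  have hd : Integrable (fun x => F x - 1) Q := hi.sub (integrable_const _)
  have e1 : P.real A - Q.real A = ∫ x in A, (F x - 1) ∂Q := by
    rw [hreal hA, integral_sub hi.integrableOn (integrable_const _)]
    simp
  have hd2 : Integrable (fun x => (F x ^ 2 - 2 * F x) + 1) Q :=
    (hi2.sub (hi.const_mul 2)).add (integrable_const _)
  have e2 : ∫ x, ((F x ^ 2 - 2 * F x) + 1) ∂Q ≤ ε ^ 2 := by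
    have i1 : Integrable (fun x => F x ^ 2 - 2 * F x) Q := hi2.sub (hi.const_mul 2)
    rw [integral_add i1 (integrable_const _), integral_sub hi2 (hi.const_mul 2),
      integral_const_mul, h1]
    simp; linarith
  rw [e1]
  calc |∫ x in A, (F x - 1) ∂Q| ≤ ∫ x in A, |F x - 1| ∂Q := abs_integral_le_integral_abs
    _ ≤ ∫ x, |F x - 1| ∂Q := setIntegral_le_integral hd.abs
        (Filter.Eventually.of_forall fun x => abs_nonneg _)
    -- The arithmetic-geometric mean inequality in place of Cauchy–Schwarz; the integral of `(F -
    -- 1)²` is `∫ F² - 1 ≤ ε²`.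
    _ ≤ ∫ x, (ε / 2 + 1 / (2 * ε) * ((F x ^ 2 - 2 * F x) + 1)) ∂Q := by
        refine integral_mono hd.abs ((integrable_const _).add (hd2.const_mul _)) fun x => ?_
        have e : F x ^ 2 - 2 * F x + 1 = |F x - 1| ^ 2 := by rw [sq_abs]; ring
        dsimp only
        rw [e]
        have : ε / 2 + 1 / (2 * ε) * |F x - 1| ^ 2 - |F x - 1| = (ε - |F x - 1|) ^ 2 / (2 * ε) := by
          field_simp; ring
        have h3 : 0 ≤ (ε - |F x - 1|) ^ 2 / (2 * ε) := by positivity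
        linarith
    _ = ε / 2 + 1 / (2 * ε) * ∫ x, ((F x ^ 2 - 2 * F x) + 1) ∂Q := by
        rw [integral_add (integrable_const _) (hd2.const_mul _), integral_const_mul]
        simp
    _ ≤ ε / 2 + 1 / (2 * ε) * ε ^ 2 := by gcongr
    _ = ε := by field_simp; ring

theorem pi_eq_withDensity {ι α : Type*} [Fintype ι] [MeasurableSpace α] {P Q : ι → Measure α}
    [∀ i, IsProbabilityMeasure (P i)] [∀ i, IsProbabilityMeasure (Q i)] {f : ι → α → ℝ}
    (h0 : ∀ i x, 0 ≤ f i x) (hi : ∀ i, Integrable (f i) (Q i))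
    (hP : ∀ i, P i = (Q i).withDensity fun x => ENNReal.ofReal (f i x)) :
    Measure.pi P = (Measure.pi Q).withDensity fun x => ENNReal.ofReal (∏ i, f i (x i)) := by
  refine Measure.pi_eq fun s hs => ?_
  have hint : Integrable (fun x : ι → α => ∏ i, (s i).indicator (f i) (x i)) (Measure.pi Q) :=
    Integrable.fintype_prod_dep fun i => (hi i).indicator (hs i)
  rw [withDensity_apply _ (MeasurableSet.univ_pi hs), ← lintegral_indicator (MeasurableSet.univ_pi hs)]
  have e : ∀ x : ι → α, (Set.univ.pi s).indicator (fun x => ENNReal.ofReal (∏ i, f i (x i))) x =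
      ENNReal.ofReal (∏ i, (s i).indicator (f i) (x i)) := fun x => by
    by_cases hx : x ∈ Set.univ.pi s
    · rw [Set.indicator_of_mem hx]
      congr 1
      exact Finset.prod_congr rfl fun i _ => (Set.indicator_of_mem (hx i trivial) _).symm
    · rw [Set.indicator_of_notMem hx]
      obtain ⟨i, hi⟩ : ∃ i, x i ∉ s i := by simpa [Set.mem_pi] using hx
      rw [Finset.prod_eq_zero (Finset.mem_univ i) (Set.indicator_of_notMem hi _), ENNReal.ofReal_zero]
  simp_rw [e]
  rw [← ofReal_integral_eq_lintegral_ofReal hint (Filter.Eventually.of_forall fun x =>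
    Finset.prod_nonneg fun i _ => Set.indicator_nonneg (fun y _ => h0 i y) _),
    integral_fintype_prod_eq_prod, ENNReal.ofReal_prod_of_nonneg fun i _ =>
      integral_nonneg fun x => Set.indicator_nonneg (fun y _ => h0 i y) _]
  refine Finset.prod_congr rfl fun i _ => ?_
  rw [integral_indicator (hs i), hP i, withDensity_apply _ (hs i),
    ofReal_integral_eq_lintegral_ofReal (hi i).integrableOn (Filter.Eventually.of_forall (h0 i))]

/-- The density of `N(m, s)` with respect to `N(0, 1)`. -/
noncomputable def gaussDensity (m : ℝ) (s : NNReal) (x : ℝ) : ℝ :=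
  (√(s : ℝ))⁻¹ * Real.exp (x ^ 2 / 2 - (x - m) ^ 2 / (2 * s))

/-! ### The chi-square divergence of Gaussians from the standard Gaussian -/

theorem gaussDensity_nonneg (m : ℝ) (s : NNReal) (x : ℝ) : 0 ≤ gaussDensity m s x := by
  unfold gaussDensity; positivity

theorem measurable_gaussDensity (m : ℝ) (s : NNReal) : Measurable (gaussDensity m s) := by
  unfold gaussDensity; fun_prop

theorem gaussianReal_eq_withDensity_stdG (m : ℝ) {s : NNReal} (hs : s ≠ 0) :
    gaussianReal m s = stdG.withDensity fun x => ENNReal.ofReal (gaussDensity m s x) := by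
  rw [stdG, gaussianReal_of_var_ne_zero m hs, gaussianReal_of_var_ne_zero 0 one_ne_zero,
    ← withDensity_mul _ (measurable_gaussianPDF 0 1) (measurable_gaussDensity m s).ennreal_ofReal]
  congr 1
  funext x
  rw [Pi.mul_apply, gaussianPDF, gaussianPDF, ← ENNReal.ofReal_mul (gaussianPDFReal_nonneg _ _ _)]
  congr 1
  rw [gaussianPDFReal, gaussianPDFReal, gaussDensity, Real.sqrt_mul (by positivity),
    mul_mul_mul_comm, ← Real.exp_add]
  congr 1
  · rw [mul_inv]; simp
  · congr 1; simp; ring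

theorem integrable_gaussDensity (m : ℝ) {s : NNReal} (hs : s ≠ 0) :
    Integrable (gaussDensity m s) stdG := by
  refine ⟨(measurable_gaussDensity m s).aestronglyMeasurable, ?_⟩
  rw [hasFiniteIntegral_iff_ofReal (Filter.Eventually.of_forall (gaussDensity_nonneg m s))]
  have := congrArg (fun μ => μ Set.univ) (gaussianReal_eq_withDensity_stdG m hs)
  simp only [measure_univ, withDensity_apply _ MeasurableSet.univ, Measure.restrict_univ] at this
  rw [← this]; exact ENNReal.one_lt_top

/-- Completing the square. The coefficient `(2 - s) / (2 s)` shows why `s < 2` is needed for a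
finite second moment. -/
theorem gaussDensity_sq (m : ℝ) {s : NNReal} (hs : 0 < s) (hs2 : (s : ℝ) < 2) (x : ℝ) :
    gaussianPDFReal 0 1 x * gaussDensity m s x ^ 2 =
      (√(2 * Real.pi))⁻¹ * (s : ℝ)⁻¹ * Real.exp (m ^ 2 / (2 - s)) *
        Real.exp (-((2 - s) / (2 * s)) * (x - 2 * m / (2 - s)) ^ 2) := by
  have hs' : (0 : ℝ) < s := hs
  have h2 : (0 : ℝ) < 2 - s := by linarith
  rw [gaussianPDFReal, gaussDensity, mul_pow, inv_pow, Real.sq_sqrt hs'.le, ← Real.exp_nat_mul,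
    mul_mul_mul_comm, ← Real.exp_add, mul_assoc (_ * _) (Real.exp _), ← Real.exp_add]
  congr 1
  · simp
  · congr 1
    simp
    field_simp
    ring

theorem integrable_gaussDensity_sq (m : ℝ) {s : NNReal} (hs : 0 < s) (hs2 : (s : ℝ) < 2) :
    Integrable (fun x => gaussDensity m s x ^ 2) stdG := by
  have hs' : (0 : ℝ) < s := hs
  have h1 : stdG = volume.withDensity fun x => ENNReal.ofReal (gaussianPDFReal 0 1 x) :=
    gaussianReal_of_var_ne_zero 0 one_ne_zero
  rw [h1, integrable_withDensity_iff (measurable_gaussianPDFReal 0 1).ennreal_ofReal (by simp)]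
  have h2 := ((integrable_exp_neg_mul_sq (b := (2 - s) / (2 * s))
    (by have : (0 : ℝ) < 2 - s := by linarith
        positivity)).comp_sub_right (2 * m / (2 - s))).const_mul
    ((√(2 * Real.pi))⁻¹ * (s : ℝ)⁻¹ * Real.exp (m ^ 2 / (2 - s)))
  refine h2.congr (Filter.Eventually.of_forall fun x => ?_)
  dsimp only
  rw [ENNReal.toReal_ofReal (gaussianPDFReal_nonneg _ _ _), mul_comm (gaussDensity m s x ^ 2),
    gaussDensity_sq m hs hs2]

theorem integral_gaussDensity_sq (m : ℝ) {s : NNReal} (hs : 0 < s) (hs2 : (s : ℝ) < 2) :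
    ∫ x, gaussDensity m s x ^ 2 ∂stdG = (√(s * (2 - s)))⁻¹ * Real.exp (m ^ 2 / (2 - s)) := by
  have hs' : (0 : ℝ) < s := hs
  have h2 : (0 : ℝ) < 2 - s := by linarith
  rw [stdG, integral_gaussianReal_eq_integral_smul one_ne_zero]
  simp_rw [smul_eq_mul, gaussDensity_sq m hs hs2]
  rw [integral_const_mul, integral_sub_right_eq_self (μ := volume)
    (fun x => Real.exp (-((2 - s) / (2 * s)) * x ^ 2)), integral_gaussian]
  have e : (√(2 * Real.pi))⁻¹ * (s : ℝ)⁻¹ * √(Real.pi / ((2 - s) / (2 * s))) =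
      (√(s * (2 - s)))⁻¹ := by
    refine eq_inv_of_mul_eq_one_left ?_
    rw [mul_assoc, ← Real.sqrt_mul (by positivity)]
    have : Real.pi / ((2 - s) / (2 * s)) * (s * (2 - s)) = (2 * Real.pi) * (s : ℝ) ^ 2 := by
      field_simp
    rw [this, Real.sqrt_mul (show 0 ≤ 2 * Real.pi by positivity) ((s : ℝ) ^ 2), Real.sqrt_sq hs'.le]
    field_simp
  rw [← e]; ring

/-- For `s = 1 + e` the prefactor is `(1 - e²) ^ (-1/2)`, at most `exp (e²)` since `e² ≤ 1/4`. In
the exponent, `m² / (1 - e) ≤ 2 m²`. The exponential form makes the bound multiply over coordinates.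
-/
theorem integral_gaussDensity_sq_le (m : ℝ) {e : ℝ} (he : |e| ≤ 1 / 2) {s : NNReal}
    (hs : (s : ℝ) = 1 + e) :
    ∫ x, gaussDensity m s x ^ 2 ∂stdG ≤ Real.exp (e ^ 2 + 2 * m ^ 2) := by
  obtain ⟨h1, h2⟩ := abs_le.1 he
  have hs0 : 0 < s := by rw [← NNReal.coe_pos, hs]; linarith
  rw [integral_gaussDensity_sq m hs0 (by rw [hs]; linarith), hs, Real.exp_add]
  have e2 : e ^ 2 ≤ 1 / 4 := by nlinarith
  gcongr
  · rw [inv_le_comm₀ (Real.sqrt_pos.2 (by nlinarith)) (Real.exp_pos _), ← Real.exp_neg]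
    refine Real.le_sqrt_of_sq_le ?_
    rw [← Real.exp_nat_mul]
    have h3 : 1 + 2 * e ^ 2 ≤ Real.exp (2 * e ^ 2) := by
      have := Real.add_one_le_exp (2 * e ^ 2); linarith
    have h4 : ((2 : ℕ) : ℝ) * -e ^ 2 = -(2 * e ^ 2) := by push_cast; ring
    rw [h4, Real.exp_neg]
    calc _ ≤ (1 + 2 * e ^ 2)⁻¹ := by gcongr
      _ ≤ _ := by
        rw [inv_le_iff_one_le_mul₀ (by positivity)]
        nlinarith [sq_nonneg e]
  · rw [div_le_iff₀ (by linarith)]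
    nlinarith [sq_nonneg m]

theorem exp_half_le {u : ℝ} (h1 : u ≤ 1) (h0 : 0 ≤ u := by positivity) :
    Real.exp (u / 2) ≤ 1 + u := by
  have h3 : 0 < 1 - u / 2 := by linarith
  have h2 : Real.exp (u / 2) ≤ 1 / (1 - u / 2) := by
    have := Real.add_one_le_exp (-(u / 2))
    rw [Real.exp_neg] at this
    rw [le_div_comm₀ (Real.exp_pos _) h3, one_div]; linarith
  refine h2.trans ?_
  rw [div_le_iff₀ h3]
  nlinarith

/-- Total variation distance of two products of Gaussians. -/
theorem abs_pi_gaussianReal_sub_le {ι : Type*} [Fintype ι] {m e : ι → ℝ} {s : ι → NNReal}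
    (hs : ∀ i, (s i : ℝ) = 1 + e i) {ε : ℝ} (hε : 0 < ε) (hε1 : ε ≤ 1 / 2)
    (h : ∑ i, e i ^ 2 + 2 * ∑ i, m i ^ 2 ≤ ε ^ 2 / 2) {A : Set (ι → ℝ)} (hA : MeasurableSet A) :
    |(Measure.pi fun i => gaussianReal (m i) (s i)).real A -
      (Measure.pi fun _ : ι => stdG).real A| ≤ ε := by
  have hm0 : 0 ≤ ∑ i, m i ^ 2 := Finset.sum_nonneg fun i _ => sq_nonneg _
  have he : ∀ i, |e i| ≤ 1 / 2 := fun i => by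
    have h1 : e i ^ 2 ≤ ∑ i, e i ^ 2 :=
      Finset.single_le_sum (f := fun i => e i ^ 2) (fun i _ => sq_nonneg _) (Finset.mem_univ i)
    refine abs_le_of_sq_le_sq (by nlinarith) (by norm_num)
  have hs0 : ∀ i, 0 < s i := fun i => by
    rw [← NNReal.coe_pos, hs]; linarith [(abs_le.1 (he i)).1]
  have hs2 : ∀ i, (s i : ℝ) < 2 := fun i => by
    rw [hs]; linarith [(abs_le.1 (he i)).2]
  have hP := pi_eq_withDensity (P := fun i => gaussianReal (m i) (s i)) (Q := fun _ : ι => stdG)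
    (f := fun i => gaussDensity (m i) (s i)) (fun i => gaussDensity_nonneg _ _)
    (fun i => integrable_gaussDensity _ (hs0 i).ne')
    fun i => gaussianReal_eq_withDensity_stdG _ (hs0 i).ne'
  have hi : Integrable (fun x : ι → ℝ => ∏ i, gaussDensity (m i) (s i) (x i))
      (Measure.pi fun _ : ι => stdG) :=
    Integrable.fintype_prod_dep fun i => integrable_gaussDensity _ (hs0 i).ne'
  have hi2 : Integrable (fun x : ι → ℝ => (∏ i, gaussDensity (m i) (s i) (x i)) ^ 2)
      (Measure.pi fun _ : ι => stdG) := by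
    simp_rw [← Finset.prod_pow]
    exact Integrable.fintype_prod_dep (f := fun i x => gaussDensity (m i) (s i) x ^ 2)
      fun i => integrable_gaussDensity_sq _ (hs0 i) (hs2 i)
  refine abs_real_sub_le_of_withDensity (fun x => Finset.prod_nonneg fun i _ =>
    gaussDensity_nonneg _ _ _) hi hi2 hP hε ?_ hA
  simp_rw [← Finset.prod_pow]
  rw [integral_fintype_prod_eq_prod fun i x => gaussDensity (m i) (s i) x ^ 2]
  calc _ ≤ ∏ i, Real.exp (e i ^ 2 + 2 * m i ^ 2) :=
        Finset.prod_le_prod (fun i _ => integral_nonneg fun x => sq_nonneg _)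
          fun i _ => integral_gaussDensity_sq_le _ (he i) (hs i)
    _ = Real.exp (∑ i, e i ^ 2 + 2 * ∑ i, m i ^ 2) := by
        rw [← Real.exp_sum, Finset.sum_add_distrib, Finset.mul_sum]
    _ ≤ Real.exp (ε ^ 2 / 2) := Real.exp_le_exp.2 h
    _ ≤ 1 + ε ^ 2 := exp_half_le (by nlinarith)

/-! ## Gaussians with a covariance matrix -/

section Law

variable {d d' k : ℕ}

/-- The characteristic function factors over the coordinates of `z`, and the exponents add up to
`|Aᵀ c|²`, which sees only `A Aᵀ`. -/
theorem integral_exp_dual (A : Matrix (Fin k) (Fin d) ℝ) (c : Fin k → ℝ) :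
    ∫ z, Complex.exp (((c ⬝ᵥ A *ᵥ z : ℝ) : ℂ) * Complex.I) ∂(Measure.pi fun _ : Fin d => stdG) =
      Complex.exp (-((c ⬝ᵥ (A * Aᵀ) *ᵥ c : ℝ) : ℂ) / 2) := by
  have e : ∀ z : Fin d → ℝ, Complex.exp (((c ⬝ᵥ A *ᵥ z : ℝ) : ℂ) * Complex.I) =
      ∏ j, Complex.exp ((((c ᵥ* A) j : ℝ) : ℂ) * ((z j : ℝ) : ℂ) * Complex.I) := fun z => by
    rw [Matrix.dotProduct_mulVec, dotProduct, ← Complex.exp_sum]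
    congr 1
    push_cast
    rw [Finset.sum_mul]
  have e1 : ∀ t : ℝ, ∫ x, Complex.exp ((t : ℂ) * (x : ℂ) * Complex.I) ∂stdG =
      Complex.exp (-((t ^ 2 : ℝ) : ℂ) / 2) := fun t => by
    rw [← charFun_apply_real, charFun_gaussianReal]
    congr 1
    push_cast
    ring
  simp_rw [e]
  rw [integral_fintype_prod_eq_prod fun j x => Complex.exp ((((c ᵥ* A) j : ℝ) : ℂ) *
    ((x : ℝ) : ℂ) * Complex.I)]
  simp_rw [e1]
  rw [← Complex.exp_sum]
  congr 1
  have e2 : c ⬝ᵥ (A * Aᵀ) *ᵥ c = ∑ j, (c ᵥ* A) j ^ 2 := by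
    rw [← Matrix.mulVec_mulVec, Matrix.dotProduct_mulVec, Matrix.mulVec_transpose, dotProduct]
    exact Finset.sum_congr rfl fun j _ => (sq _).symm
  rw [e2, ← Finset.sum_div, Finset.sum_neg_distrib]
  push_cast
  rfl

theorem measurable_mulVec (A : Matrix (Fin k) (Fin d) ℝ) :
    Measurable fun z : Fin d → ℝ => A *ᵥ z :=
  (Continuous.matrix_mulVec continuous_const continuous_id).measurable

theorem charFunDual_map_mulVec (A : Matrix (Fin k) (Fin d) ℝ) (L : StrongDual ℝ (Fin k → ℝ)) :
    charFunDual ((Measure.pi fun _ : Fin d => stdG).map (fun z => A *ᵥ z)) L =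
      Complex.exp (-(((fun i => L (Pi.single i 1)) ⬝ᵥ (A * Aᵀ) *ᵥ
        (fun i => L (Pi.single i 1)) : ℝ) : ℂ) / 2) := by
  have hL : ∀ y : Fin k → ℝ, L y = (fun i => L (Pi.single i 1)) ⬝ᵥ y := fun y => by
    conv_lhs => rw [← Finset.univ_sum_single y]
    rw [map_sum, dotProduct]
    refine Finset.sum_congr rfl fun i _ => ?_
    have : (Pi.single i (y i) : Fin k → ℝ) = y i • Pi.single i 1 := by
      rw [← Pi.single_smul]; simp
    rw [this, map_smul, smul_eq_mul, mul_comm]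
  rw [charFunDual_apply, integral_map (measurable_mulVec A).aemeasurable (by
    have := L.continuous; fun_prop), ← integral_exp_dual]
  refine integral_congr_ae (Filter.Eventually.of_forall fun z => ?_)
  dsimp only
  rw [hL]

/-- The law of `A z` depends only on `A Aᵀ`. -/
theorem map_mulVec_eq {A : Matrix (Fin k) (Fin d) ℝ} {A' : Matrix (Fin k) (Fin d') ℝ}
    (h : A * Aᵀ = A' * A'ᵀ) :
    (Measure.pi fun _ : Fin d => stdG).map (fun z => A *ᵥ z) =
      (Measure.pi fun _ : Fin d' => stdG).map (fun z => A' *ᵥ z) := by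
  have := Measure.isProbabilityMeasure_map (μ := Measure.pi fun _ : Fin d => stdG)
    (measurable_mulVec A).aemeasurable
  have := Measure.isProbabilityMeasure_map (μ := Measure.pi fun _ : Fin d' => stdG)
    (measurable_mulVec A').aemeasurable
  refine Measure.ext_of_charFunDual ?_
  funext L
  rw [charFunDual_map_mulVec, charFunDual_map_mulVec, h]

theorem measurable_relu_affine (A : Matrix (Fin d) (Fin d) ℝ) (b : Fin d → ℝ) :
    Measurable fun (z : Fin d → ℝ) (i : Fin d) => max 0 ((A *ᵥ z) i + b i) :=
  measurable_pi_iff.2 fun i => by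
    have : Continuous fun z : Fin d → ℝ => A *ᵥ z :=
      Continuous.matrix_mulVec continuous_const continuous_id
    have := (measurable_pi_apply i).comp this.measurable
    exact measurable_const.max (this.add_const _)

theorem measurable_relu_add (b : Fin d → ℝ) :
    Measurable fun (y : Fin d → ℝ) (i : Fin d) => max 0 (y i + b i) := by fun_prop

theorem reluDist_eq_map (A : Matrix (Fin d) (Fin d) ℝ) (b : Fin d → ℝ) :
    reluDist A b = ((Measure.pi fun _ : Fin d => stdG).map fun z => A *ᵥ z).map
      fun y i => max 0 (y i + b i) := by
  rw [Measure.map_map (measurable_relu_add b) (measurable_mulVec A)]; rfl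

/-- `D(A, b)` depends only on `A Aᵀ` and `b`. -/
theorem reluDist_congr {A A' : Matrix (Fin d) (Fin d) ℝ} (h : A * Aᵀ = A' * A'ᵀ)
    (b : Fin d → ℝ) : reluDist A b = reluDist A' b := by
  rw [reluDist_eq_map, reluDist_eq_map, map_mulVec_eq h]

/-- `D(M S, M m + b)` for a diagonal matrix `S` is an image of a product measure. -/
theorem reluDist_mul_diagonal (M : Matrix (Fin d) (Fin d) ℝ) (s : Fin d → NNReal)
    (m b : Fin d → ℝ) :
    reluDist (M * Matrix.diagonal fun i => √(s i : ℝ)) (M *ᵥ m + b) =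
      (Measure.pi fun i => gaussianReal (m i) (s i)).map
        fun y i => max 0 ((M *ᵥ y) i + b i) := by
  have h1 : ∀ i, stdG.map (fun x => √(s i : ℝ) * x + m i) = gaussianReal (m i) (s i) := fun i => by
    have h2 : (fun x => √(s i : ℝ) * x + m i) = (fun x => x + m i) ∘ fun x => √(s i : ℝ) * x := rfl
    rw [h2, ← Measure.map_map (by fun_prop) (by fun_prop), stdG, gaussianReal_map_const_mul,
      gaussianReal_map_add_const]
    congr 1
    · simp
    · ext; simp [Real.sq_sqrt]
  have h2 := Measure.pi_map_pi (μ := fun _ : Fin d => stdG)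
    (f := fun i x => √(s i : ℝ) * x + m i) fun i => by fun_prop
  simp_rw [h1] at h2
  rw [← h2, Measure.map_map (measurable_relu_affine M b) (by fun_prop), reluDist]
  congr 1
  funext z i
  simp only [Function.comp_apply]
  have h3 : (fun i => √(s i : ℝ) * z i + m i) =
      (Matrix.diagonal fun i => √(s i : ℝ)) *ᵥ z + m := by
    funext i; simp [Matrix.mulVec_diagonal]
  rw [h3, Matrix.mulVec_add, Matrix.mulVec_mulVec]
  simp only [Pi.add_apply]
  ring_nf

end Law

/-! ### From entrywise errors of the covariance to total variation distance -/

section MatrixNorm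

open scoped Matrix.Norms.L2Operator

variable {d : ℕ}

/-- The squared Frobenius norm. -/
def frobSq (X : Matrix (Fin d) (Fin d) ℝ) : ℝ := ∑ i, ∑ j, X i j ^ 2

theorem sum_mulVec_sq_le (A : Matrix (Fin d) (Fin d) ℝ) (v : Fin d → ℝ) :
    ∑ i, (A *ᵥ v) i ^ 2 ≤ ‖A‖ ^ 2 * ∑ i, v i ^ 2 := by
  have h := Matrix.l2_opNorm_mulVec A (WithLp.toLp 2 v)
  have h2 := pow_le_pow_left₀ (norm_nonneg _) h 2
  rw [mul_pow, EuclideanSpace.norm_sq_eq, EuclideanSpace.norm_sq_eq] at h2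
  simpa using h2

theorem frobSq_transpose (X : Matrix (Fin d) (Fin d) ℝ) : frobSq Xᵀ = frobSq X :=
  Finset.sum_comm

theorem frobSq_mul_le (A X : Matrix (Fin d) (Fin d) ℝ) :
    frobSq (A * X) ≤ ‖A‖ ^ 2 * frobSq X := by
  rw [← frobSq_transpose, ← frobSq_transpose X, frobSq, frobSq, Finset.mul_sum]
  refine Finset.sum_le_sum fun j _ => ?_
  exact sum_mulVec_sq_le A fun i => X i j

theorem frobSq_conj_le (V X : Matrix (Fin d) (Fin d) ℝ) :
    frobSq (V * X * Vᵀ) ≤ (‖V‖ ^ 2) ^ 2 * frobSq X := by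
  have h1 : frobSq (V * X * Vᵀ) ≤ ‖V‖ ^ 2 * frobSq (V * X) := by
    rw [← frobSq_transpose, Matrix.transpose_mul, Matrix.transpose_transpose]
    refine (frobSq_mul_le _ _).trans_eq ?_
    rw [frobSq_transpose]
  have h2 := frobSq_mul_le V X
  nlinarith [sq_nonneg ‖V‖]

theorem frobSq_eq_trace (X : Matrix (Fin d) (Fin d) ℝ) : frobSq X = (X * Xᵀ).trace := by
  simp only [frobSq, Matrix.trace, Matrix.diag, Matrix.mul_apply, Matrix.transpose_apply]
  exact Finset.sum_congr rfl fun i _ => Finset.sum_congr rfl fun j _ => sq _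

theorem norm_inv_mul_transpose (W : Matrix (Fin d) (Fin d) ℝ) :
    ‖(W * Wᵀ)⁻¹‖ = ‖W⁻¹‖ ^ 2 := by
  rw [Matrix.mul_inv_rev, ← Matrix.transpose_nonsing_inv, ← Matrix.conjTranspose_eq_transpose_of_trivial,
    Matrix.l2_opNorm_conjTranspose_mul_self, sq]

theorem diag_le_norm (A : Matrix (Fin d) (Fin d) ℝ) (i : Fin d) : A i i ≤ ‖A‖ := by
  have h := sum_mulVec_sq_le A (Pi.single i 1)
  have h1 : A i i ^ 2 ≤ ∑ k, (A *ᵥ Pi.single i 1) k ^ 2 := by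
    refine le_trans (le_of_eq ?_) (Finset.single_le_sum (f := fun k => (A *ᵥ Pi.single i 1) k ^ 2)
      (fun k _ => sq_nonneg _) (Finset.mem_univ i))
    simp
  have h2 : ∑ k, (Pi.single i (1 : ℝ) : Fin d → ℝ) k ^ 2 = 1 := by
    rw [Finset.sum_eq_single i] <;> simp +contextual
  rw [h2, mul_one] at h
  exact le_of_sq_le_sq (h1.trans h) (norm_nonneg _)

theorem condNumber_eq (W : Matrix (Fin d) (Fin d) ℝ) :
    condNumber (W * Wᵀ) = ‖W * Wᵀ‖ * ‖W⁻¹‖ ^ 2 := by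
  rw [← norm_inv_mul_transpose]; rfl

theorem one_le_condNumber (hd : 0 < d) {W : Matrix (Fin d) (Fin d) ℝ} (hW : IsUnit W.det) :
    1 ≤ condNumber (W * Wᵀ) := by
  have := Fin.pos_iff_nonempty.1 hd
  have h : IsUnit (W * Wᵀ).det := by
    rw [Matrix.det_mul, Matrix.det_transpose]; exact hW.mul hW
  have h1 : (1 : ℝ) = ‖(1 : Matrix (Fin d) (Fin d) ℝ)‖ := by
    rw [CStarRing.norm_one]
  rw [h1, ← Matrix.mul_nonsing_inv _ h]
  exact norm_mul_le _ _

theorem sum_diag_le (W : Matrix (Fin d) (Fin d) ℝ) : ∑ i, (W * Wᵀ) i i ≤ d * ‖W * Wᵀ‖ := by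
  simpa using Finset.sum_le_card_nsmul Finset.univ _ _ fun i _ => diag_le_norm (W * Wᵀ) i

/-- Estimates of the bias and of the entries of the covariance matrix give an estimate of the
distribution in total variation distance. -/
theorem posSemidef_and_tvDistance_le {W S : Matrix (Fin d) (Fin d) ℝ} (hd : 0 < d)
    (hW : IsUnit W.det) {b c : Fin d → ℝ} {η ε : ℝ} (hη : 0 ≤ η) (hε : 0 < ε) (hε1 : ε ≤ 1 / 2)
    (hηε : condNumber (W * Wᵀ) * d * η ≤ ε / 3) (hS : Sᵀ = S)
    (hΔ : ∀ i j, |S i j - (W * Wᵀ) i j| ≤ η * (√((W * Wᵀ) i i) * √((W * Wᵀ) j j)))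
    (hc : ∀ i, |c i - b i| ≤ η * √((W * Wᵀ) i i)) :
    S.PosSemidef ∧ tvDistance (reluDist (matrixSqrt S) c) (reluDist W b) ≤ ε := by
  set Sg := W * Wᵀ with hSg
  set V := W⁻¹ with hV
  set κ := condNumber Sg with hκ
  have hκ1 : 1 ≤ κ := one_le_condNumber hd hW
  have hd1 : (1 : ℝ) ≤ d := by exact_mod_cast hd
  have hWV : W * V = 1 := Matrix.mul_nonsing_inv _ hW
  have hVW : V * W = 1 := Matrix.nonsing_inv_mul _ hW
  have hWVt : Wᵀ * Vᵀ = 1 := by rw [← Matrix.transpose_mul, hVW, Matrix.transpose_one]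
  have hVWt : Vᵀ * Wᵀ = 1 := by rw [← Matrix.transpose_mul, hWV, Matrix.transpose_one]
  have hdiag : ∀ i, 0 ≤ Sg i i := fun i => by
    rw [hSg, Matrix.mul_apply]
    exact Finset.sum_nonneg fun j _ => mul_self_nonneg _
  have hSgT : Sgᵀ = Sg := by rw [hSg, Matrix.transpose_mul, Matrix.transpose_transpose]
  -- the relative error of the covariance matrix
  set E := V * (S - Sg) * Vᵀ with hE
  have hEs : Eᴴ = E := by
    rw [Matrix.conjTranspose_eq_transpose_of_trivial, hE, Matrix.transpose_mul, Matrix.transpose_mul,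
      Matrix.transpose_transpose, Matrix.transpose_sub, hS, hSgT, Matrix.mul_assoc]
  have hEh : E.IsHermitian := hEs
  set U : Matrix (Fin d) (Fin d) ℝ := (hEh.eigenvectorUnitary : Matrix (Fin d) (Fin d) ℝ) with hU
  set e := hEh.eigenvalues with he
  have hUU : U * Uᵀ = 1 := by
    have := Matrix.mem_unitaryGroup_iff.1 hEh.eigenvectorUnitary.2
    rwa [Matrix.star_eq_conjTranspose, Matrix.conjTranspose_eq_transpose_of_trivial] at this
  have hUU' : Uᵀ * U = 1 := mul_eq_one_comm.1 hUU
  have hspec : E = U * Matrix.diagonal e * Uᵀ := by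
    conv_lhs => rw [hEh.spectral_theorem]
    rw [Unitary.conjStarAlgAut_apply, Matrix.star_eq_conjTranspose,
      Matrix.conjTranspose_eq_transpose_of_trivial]
    rfl
  have hsum_e : ∑ i, e i ^ 2 = frobSq E := by
    rw [frobSq_eq_trace]
    have : E * Eᵀ = U * (Matrix.diagonal fun i => e i ^ 2) * Uᵀ := by
      rw [hspec, Matrix.transpose_mul, Matrix.transpose_mul, Matrix.transpose_transpose,
        Matrix.diagonal_transpose]
      calc _ = U * Matrix.diagonal e * (Uᵀ * U) * Matrix.diagonal e * Uᵀ := by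
            simp only [Matrix.mul_assoc]
        _ = U * (Matrix.diagonal e * Matrix.diagonal e) * Uᵀ := by
            rw [hUU', Matrix.mul_one]; simp only [Matrix.mul_assoc]
        _ = _ := by rw [Matrix.diagonal_mul_diagonal]; simp_rw [← sq]
    rw [this, Matrix.trace_mul_comm, ← Matrix.mul_assoc, hUU', Matrix.one_mul, Matrix.trace_diagonal]
  have htr := sum_diag_le W
  have hκe : κ = ‖Sg‖ * ‖V‖ ^ 2 := condNumber_eq W
  have htr0 : 0 ≤ ∑ i, Sg i i := Finset.sum_nonneg fun i _ => hdiag i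
  -- The trace is at most `d ‖Sg‖`, and `‖V‖²` is the norm of the inverse of `Sg`: the only place
  -- where the condition number arises.
  have hVS : ‖V‖ ^ 2 * ∑ i, Sg i i ≤ κ * d := by
    rw [hκe]; nlinarith [sq_nonneg ‖V‖]
  have hVS0 : 0 ≤ ‖V‖ ^ 2 * ∑ i, Sg i i := by positivity
  have hbound_e : ∑ i, e i ^ 2 ≤ (κ * d * η) ^ 2 := by
    rw [hsum_e]
    have h1 : frobSq (S - Sg) ≤ η ^ 2 * (∑ i, Sg i i) ^ 2 := by
      calc frobSq (S - Sg) ≤ ∑ i, ∑ j, η ^ 2 * (Sg i i * Sg j j) := by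
            refine Finset.sum_le_sum fun i _ => Finset.sum_le_sum fun j _ => ?_
            have := sq_le_sq' (abs_le.1 (hΔ i j)).1 (abs_le.1 (hΔ i j)).2
            rwa [mul_pow, mul_pow, Real.sq_sqrt (hdiag i), Real.sq_sqrt (hdiag j)] at this
        _ = _ := by
            rw [sq (∑ i, Sg i i), Finset.sum_mul_sum]
            simp_rw [Finset.mul_sum]
    calc frobSq E ≤ (‖V‖ ^ 2) ^ 2 * (η ^ 2 * (∑ i, Sg i i) ^ 2) :=
          (frobSq_conj_le _ _).trans (by gcongr)
      _ = (‖V‖ ^ 2 * ∑ i, Sg i i) ^ 2 * η ^ 2 := by ring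
      _ ≤ (κ * d) ^ 2 * η ^ 2 := by gcongr
      _ = _ := by ring
  -- the relative error of the bias
  set m := Uᵀ *ᵥ (V *ᵥ (c - b)) with hm
  have hbound_m : ∑ i, m i ^ 2 ≤ (κ * d * η) ^ 2 := by
    have h1 : ∑ i, m i ^ 2 = ∑ i, (V *ᵥ (c - b)) i ^ 2 := by
      have h2 : ∀ v : Fin d → ℝ, ∑ i, v i ^ 2 = v ⬝ᵥ v := fun v =>
        Finset.sum_congr rfl fun i _ => sq _
      rw [h2, h2, hm, Matrix.dotProduct_mulVec, Matrix.vecMul_transpose, Matrix.mulVec_mulVec, hUU,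
        Matrix.one_mulVec]
    have h3 : ∑ i, (c - b) i ^ 2 ≤ η ^ 2 * ∑ i, Sg i i := by
      rw [Finset.mul_sum]
      refine Finset.sum_le_sum fun i _ => ?_
      have := sq_le_sq' (abs_le.1 (hc i)).1 (abs_le.1 (hc i)).2
      rwa [mul_pow, Real.sq_sqrt (hdiag i)] at this
    calc _ ≤ ‖V‖ ^ 2 * (η ^ 2 * ∑ i, Sg i i) := by
          rw [h1]; exact (sum_mulVec_sq_le _ _).trans (by gcongr)
      _ = (‖V‖ ^ 2 * ∑ i, Sg i i) * η ^ 2 := by ring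
      _ ≤ (κ * d) * η ^ 2 := by gcongr
      _ ≤ (κ * d) * (κ * d) * η ^ 2 := by
          have : 1 ≤ κ * d := one_le_mul_of_one_le_of_one_le hκ1 hd1
          exact mul_le_mul_of_nonneg_right (le_mul_of_one_le_left (by linarith) this)
            (sq_nonneg η)
      _ = _ := by ring
  have hκη : 0 ≤ κ * d * η := by positivity
  -- Variances contribute this once and means twice: `3 ε² / 9 ≤ ε² / 2`, as
  -- `abs_pi_gaussianReal_sub_le` demands.
  have hsq : (κ * d * η) ^ 2 ≤ ε ^ 2 / 9 := by
    calc _ ≤ (ε / 3) ^ 2 := by gcongr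
      _ = _ := by ring
  have he1 : ∀ i, 0 ≤ 1 + e i := fun i => by
    have h1 : e i ^ 2 ≤ ∑ i, e i ^ 2 :=
      Finset.single_le_sum (f := fun i => e i ^ 2) (fun i _ => sq_nonneg _) (Finset.mem_univ i)
    have : |e i| ≤ 1 := abs_le_of_sq_le_sq (by nlinarith) (by norm_num)
    linarith [(abs_le.1 this).1]
  set s : Fin d → NNReal := fun i => ⟨1 + e i, he1 i⟩ with hs
  -- `U` is orthogonal, so `M Mᵀ` is still the true covariance, while `M diag(1 + e) Mᵀ = S`. Both
  -- laws thus become images, under the same map built from `M` and `b`, of product Gaussians, and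
  -- it remains to compare those.
  set M := W * U with hM
  set R := M * Matrix.diagonal fun i => √(s i : ℝ) with hR
  have hRR : R * Rᵀ = S := by
    have h1 : (Matrix.diagonal fun i => √(s i : ℝ)) * (Matrix.diagonal fun i => √(s i : ℝ)) =
        1 + Matrix.diagonal e := by
      rw [Matrix.diagonal_mul_diagonal, ← Matrix.diagonal_one, Matrix.diagonal_add]
      congr 1
      funext i
      exact Real.mul_self_sqrt (he1 i)
    rw [hR, Matrix.transpose_mul, Matrix.diagonal_transpose]
    calc _ = M * ((Matrix.diagonal fun i => √(s i : ℝ)) * (Matrix.diagonal fun i => √(s i : ℝ))) *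
          Mᵀ := by simp only [Matrix.mul_assoc]
      _ = W * (U * Uᵀ + U * Matrix.diagonal e * Uᵀ) * Wᵀ := by
          rw [h1, hM, Matrix.transpose_mul]
          simp only [Matrix.mul_add, Matrix.add_mul, Matrix.mul_one, Matrix.mul_assoc]
      _ = W * Wᵀ + (W * V) * (S - Sg) * (Vᵀ * Wᵀ) := by
          rw [hUU, ← hspec, hE]
          simp only [Matrix.mul_add, Matrix.add_mul, Matrix.mul_one, Matrix.mul_assoc]
      _ = S := by rw [hWV, hVWt, ← hSg]; simp
  have hpsd : S.PosSemidef := by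
    rw [← hRR, ← Matrix.conjTranspose_eq_transpose_of_trivial]
    exact Matrix.posSemidef_self_mul_conjTranspose R
  refine ⟨hpsd, ?_⟩
  have hsqrt : matrixSqrt S * (matrixSqrt S)ᵀ = R * Rᵀ := by
    open scoped MatrixOrder in
    have h1 : (0 : Matrix (Fin d) (Fin d) ℝ) ≤ S := Matrix.nonneg_iff_posSemidef.2 hpsd
    have h2 : (matrixSqrt S).PosSemidef := Matrix.nonneg_iff_posSemidef.1 (CFC.sqrt_nonneg S)
    rw [← Matrix.conjTranspose_eq_transpose_of_trivial, h2.1.eq, hRR]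
    exact CFC.sqrt_mul_sqrt_self S h1
  have hcb : M *ᵥ m + b = c := by
    rw [hm, hM, Matrix.mulVec_mulVec, Matrix.mulVec_mulVec]
    have : W * U * (Uᵀ * V) = 1 := by
      calc _ = W * (U * Uᵀ) * V := by simp only [Matrix.mul_assoc]
        _ = 1 := by rw [hUU, Matrix.mul_one, hWV]
    rw [← Matrix.mul_assoc] at this
    rw [this, Matrix.one_mulVec, sub_add_cancel]
  have hP : reluDist (matrixSqrt S) c = (Measure.pi fun i => gaussianReal (m i) (s i)).map
      fun y i => max 0 ((M *ᵥ y) i + b i) := by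
    rw [reluDist_congr hsqrt c, ← reluDist_mul_diagonal M s m b, hcb]
  have hQ : reluDist W b = (Measure.pi fun _ : Fin d => stdG).map
      fun y i => max 0 ((M *ᵥ y) i + b i) := by
    have : W * Wᵀ = M * Mᵀ := by
      rw [hM, Matrix.transpose_mul]
      calc _ = W * (U * Uᵀ) * Wᵀ := by rw [hUU, Matrix.mul_one]
        _ = _ := by simp only [Matrix.mul_assoc]
    rw [reluDist_congr this b]; rfl
  rw [hP, hQ]
  refine tvDistance_le_of_forall fun A hA => ?_
  have hmeas := measurable_relu_affine M b
  rw [measureReal_def, measureReal_def, Measure.map_apply hmeas hA, Measure.map_apply hmeas hA]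
  exact abs_pi_gaussianReal_sub_le (e := e) (fun i => rfl) hε hε1 (by nlinarith) (hmeas hA)

end MatrixNorm

/-! ## The angle between two coordinates -/

theorem stdG_le_volume : stdG ≤ volume := by
  rw [stdG, gaussianReal_of_var_ne_zero 0 one_ne_zero]
  refine (withDensity_mono (Filter.Eventually.of_forall fun x => ?_)).trans_eq withDensity_one
  rw [gaussianPDF, gaussianPDFReal, Pi.one_apply, ← ENNReal.ofReal_one]
  refine ENNReal.ofReal_le_ofReal ?_
  have h1 : (1 : ℝ) ≤ √(2 * Real.pi * (1 : NNReal)) :=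
    Real.one_le_sqrt.2 (by have := Real.pi_gt_three; simp; linarith)
  have h2 : Real.exp (-(x - 0) ^ 2 / (2 * ((1 : NNReal) : ℝ))) ≤ 1 := by
    rw [Real.exp_le_one_iff]
    have := sq_nonneg x
    simp
    linarith
  calc _ ≤ (1 : ℝ) * 1 := by
        gcongr
        exact inv_le_one_of_one_le₀ h1
    _ = 1 := one_mul 1

theorem measurableSet_pos_and {α : Type*} [MeasurableSpace α] {f g : α → ℝ} (hf : Measurable f)
    (hg : Measurable g) : MeasurableSet {x | 0 < f x ∧ 0 < g x} :=
  (measurableSet_lt measurable_const hf).inter (measurableSet_lt measurable_const hg)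

/-- Polar coordinates: the density is rotation invariant and `S` is a cone up to null sets, so
radius and angle separate. The radial integral is left unevaluated; the case of the whole plane
determines it. -/
theorem stdG_prod_real_eq {S : Set (ℝ × ℝ)} (hS : MeasurableSet S) {T : Set ℝ}
    (h : ∀ r > 0, ∀ t ∈ Set.Ioo (-Real.pi) Real.pi, (r * Real.cos t, r * Real.sin t) ∈ S ↔ t ∈ T) :
    (stdG.prod stdG).real S =
      (∫ r in Set.Ioi (0 : ℝ), r * (gaussianPDFReal 0 1 0 * gaussianPDFReal 0 1 r)) *
        ∫ t in Set.Ioo (-Real.pi) Real.pi, T.indicator 1 t := by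
  have h1 : stdG = volume.withDensity (gaussianPDF 0 1) :=
    gaussianReal_of_var_ne_zero 0 one_ne_zero
  rw [← integral_indicator_one hS, h1,
    prod_withDensity (measurable_gaussianPDF 0 1) (measurable_gaussianPDF 0 1),
    integral_withDensity_eq_integral_toReal_smul
      (f := fun z : ℝ × ℝ => gaussianPDF 0 1 z.1 * gaussianPDF 0 1 z.2)
      (((measurable_gaussianPDF 0 1).comp measurable_fst).mul
        ((measurable_gaussianPDF 0 1).comp measurable_snd))
      (Filter.Eventually.of_forall fun x => ENNReal.mul_lt_top ENNReal.ofReal_lt_top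
        ENNReal.ofReal_lt_top), ← Measure.volume_eq_prod, ← integral_comp_polarCoord_symm,
    polarCoord_target, Measure.volume_eq_prod, ← setIntegral_prod_mul]
  refine setIntegral_congr_fun (measurableSet_Ioi.prod measurableSet_Ioo) fun p hp => ?_
  obtain ⟨hp1, hp2⟩ := hp
  have hmem := h p.1 hp1 p.2 hp2
  have hpdf : gaussianPDFReal 0 1 (p.1 * Real.cos p.2) * gaussianPDFReal 0 1 (p.1 * Real.sin p.2) =
      gaussianPDFReal 0 1 0 * gaussianPDFReal 0 1 p.1 := by
    simp only [gaussianPDFReal]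
    rw [mul_mul_mul_comm, ← Real.exp_add, mul_mul_mul_comm, ← Real.exp_add]
    congr 2
    have := Real.sin_sq_add_cos_sq p.2
    simp only [sub_zero]
    rw [← add_div, ← add_div]
    congr 1
    nlinarith
  simp only [polarCoord_symm_apply, ENNReal.toReal_mul, toReal_gaussianPDF, smul_eq_mul]
  rw [hpdf]
  have hind : S.indicator (1 : ℝ × ℝ → ℝ) (p.1 * Real.cos p.2, p.1 * Real.sin p.2) =
      T.indicator 1 p.2 := by
    by_cases ht : p.2 ∈ T
    · rw [Set.indicator_of_mem ht, Set.indicator_of_mem (hmem.2 ht)]; rfl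
    · rw [Set.indicator_of_notMem ht, Set.indicator_of_notMem fun hc => ht (hmem.1 hc)]
  rw [hind]
  ring

/-- The probability of a wedge under the standard Gaussian of the plane. -/
theorem stdG_prod_wedge {θ : ℝ} (h0 : 0 ≤ θ) (hpi : θ ≤ Real.pi) :
    (stdG.prod stdG).real {p | 0 < p.1 ∧ 0 < Real.cos θ * p.1 + Real.sin θ * p.2} =
      (Real.pi - θ) / (2 * Real.pi) := by
  have hπ := Real.pi_pos
  have hS : MeasurableSet {p : ℝ × ℝ | 0 < p.1 ∧ 0 < Real.cos θ * p.1 + Real.sin θ * p.2} :=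
    measurableSet_pos_and measurable_fst
      ((measurable_fst.const_mul _).add (measurable_snd.const_mul _))
  -- The whole plane normalizes: the radial integral times `2 π` is `1`.
  have h1 := stdG_prod_real_eq MeasurableSet.univ (T := Set.univ) fun r hr t ht => by simp
  have h2 := stdG_prod_real_eq hS (T := Set.Ioo (θ - Real.pi / 2) (Real.pi / 2))
    fun r hr t ht => by
      simp only [Set.mem_ofPred_eq, Set.mem_Ioo]
      have e : Real.cos θ * (r * Real.cos t) + Real.sin θ * (r * Real.sin t) =
          r * Real.cos (t - θ) := by rw [Real.cos_sub]; ring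
      rw [e, mul_pos_iff_of_pos_left hr, mul_pos_iff_of_pos_left hr]
      constructor
      · rintro ⟨c1, c2⟩
        have t2 : t < Real.pi / 2 := by
          by_contra! hc
          exact absurd (Real.cos_nonpos_of_pi_div_two_le_of_le hc (by linarith [ht.2])) (not_le.2 c1)
        refine ⟨?_, t2⟩
        by_contra! hc
        have := Real.cos_nonpos_of_pi_div_two_le_of_le (x := θ - t) (by linarith) (by
          have t1 : -(Real.pi / 2) < t := by
            by_contra! hc
            have := Real.cos_nonpos_of_pi_div_two_le_of_le (x := -t) (by linarith)
              (by linarith [ht.1])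
            rw [Real.cos_neg] at this
            linarith
          linarith)
        rw [← Real.cos_neg, neg_sub] at this
        linarith
      · rintro ⟨t1, t2⟩
        exact ⟨Real.cos_pos_of_mem_Ioo ⟨by linarith, t2⟩,
          Real.cos_pos_of_mem_Ioo ⟨by linarith, by linarith⟩⟩
  have e1 : ∫ t in Set.Ioo (-Real.pi) Real.pi, (Set.univ : Set ℝ).indicator (1 : ℝ → ℝ) t =
      2 * Real.pi := by
    simp [hπ.le, two_mul]
  have e2 : ∫ t in Set.Ioo (-Real.pi) Real.pi,
      (Set.Ioo (θ - Real.pi / 2) (Real.pi / 2)).indicator (1 : ℝ → ℝ) t = Real.pi - θ := by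
    rw [integral_indicator_one measurableSet_Ioo, measureReal_restrict_apply measurableSet_Ioo,
      Set.inter_eq_left.2 (Set.Ioo_subset_Ioo (by linarith) (by linarith)), measureReal_def,
      Real.volume_Ioo, ENNReal.toReal_ofReal (by linarith)]
    ring
  rw [e1, probReal_univ] at h1
  rw [h2, e2, eq_div_iff (by positivity)]
  linear_combination -(Real.pi - θ) * h1

/-! ### One- and two-dimensional marginals of `W z` -/

section Marginals

variable {d : ℕ}

/-- The standard deviation of coordinate `i` of `W z`. -/
noncomputable def rowSd (W : Matrix (Fin d) (Fin d) ℝ) (i : Fin d) : ℝ := √((W * Wᵀ) i i)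

theorem rowSq_nonneg (W : Matrix (Fin d) (Fin d) ℝ) (i : Fin d) : 0 ≤ (W * Wᵀ) i i := by
  rw [Matrix.mul_apply]
  exact Finset.sum_nonneg fun j _ => mul_self_nonneg _

theorem rowSd_pos {W : Matrix (Fin d) (Fin d) ℝ} (hW : IsUnit W.det) (i : Fin d) :
    0 < rowSd W i := by
  refine Real.sqrt_pos.2 ((rowSq_nonneg W i).lt_of_ne fun h => ?_)
  rw [Matrix.mul_apply] at h
  have h0 : ∀ j, W i j = 0 := fun j => by
    have := (Finset.sum_eq_zero_iff_of_nonneg fun j _ => mul_self_nonneg (W i j)).1 h.symm j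
      (Finset.mem_univ j)
    exact mul_self_eq_zero.1 this
  rw [Matrix.det_eq_zero_of_row_eq_zero i h0] at hW
  exact not_isUnit_zero hW

/-- The row as a `1 × d` matrix and its length as a `1 × 1` matrix have the same product with their
transposes, so `map_mulVec_eq` applies. -/
theorem map_row (W : Matrix (Fin d) (Fin d) ℝ) (i : Fin d) :
    (Measure.pi fun _ : Fin d => stdG).map (fun z => (W *ᵥ z) i) =
      stdG.map fun g => rowSd W i * g := by
  set A : Matrix (Fin 1) (Fin d) ℝ := Matrix.of fun _ => W i with hA
  set A' : Matrix (Fin 1) (Fin 1) ℝ := Matrix.of fun _ _ => rowSd W i with hA'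
  have h : A * Aᵀ = A' * A'ᵀ := by
    ext a b
    simp only [hA, hA', Matrix.mul_apply, Matrix.transpose_apply, Matrix.of_apply,
      Finset.univ_unique, Finset.sum_const, Finset.card_singleton, one_smul]
    rw [rowSd, Real.mul_self_sqrt (rowSq_nonneg W i), Matrix.mul_apply]
    rfl
  have h2 := congrArg (Measure.map fun y : Fin 1 → ℝ => y 0) (map_mulVec_eq h)
  rw [Measure.map_map (by fun_prop) (measurable_mulVec A),
    Measure.map_map (by fun_prop) (measurable_mulVec A')] at h2
  have h3 : (Measure.pi fun _ : Fin 1 => stdG).map (fun z => z 0) = stdG :=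
    (measurePreserving_eval (fun _ : Fin 1 => stdG) 0).map_eq
  have h4 : stdG.map (fun g => rowSd W i * g) = (Measure.pi fun _ : Fin 1 => stdG).map
      ((fun g => rowSd W i * g) ∘ fun z => z 0) := by
    rw [← Measure.map_map (by fun_prop) (by fun_prop), h3]
  rw [h4]
  refine Eq.trans ?_ (h2.trans ?_)
  · congr 1
  · congr 1
    funext z
    simp [Matrix.mulVec, dotProduct, hA']

/-- The angle between two rows. -/
noncomputable def rowAngle (W : Matrix (Fin d) (Fin d) ℝ) (i j : Fin d) : ℝ :=
  Real.arccos ((W * Wᵀ) i j / (rowSd W i * rowSd W j))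

theorem cos_rowAngle {W : Matrix (Fin d) (Fin d) ℝ} (hW : IsUnit W.det) (i j : Fin d) :
    rowSd W i * rowSd W j * Real.cos (rowAngle W i j) = (W * Wᵀ) i j := by
  have hi := rowSd_pos hW i
  have hj := rowSd_pos hW j
  have hsq : ((W * Wᵀ) i j) ^ 2 ≤ (rowSd W i * rowSd W j) ^ 2 := by
    rw [mul_pow, rowSd, rowSd, Real.sq_sqrt (rowSq_nonneg W i), Real.sq_sqrt (rowSq_nonneg W j)]
    simp only [Matrix.mul_apply, Matrix.transpose_apply]
    simpa [sq] using Finset.sum_mul_sq_le_sq_mul_sq Finset.univ (W i) (W j)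
  have habs := abs_le_of_sq_le_sq hsq (by positivity)
  obtain ⟨h1, h2⟩ := abs_le.1 habs
  have hpos : 0 < rowSd W i * rowSd W j := by positivity
  rw [rowAngle, Real.cos_arccos]
  · field_simp
  · rw [le_div_iff₀ hpos]; linarith
  · rw [div_le_iff₀ hpos]; linarith

/-- The probability that two coordinates of `W z` are positive. -/
theorem measure_rows_pos {W : Matrix (Fin d) (Fin d) ℝ} (hW : IsUnit W.det) (i j : Fin d) :
    (Measure.pi fun _ : Fin d => stdG).real {z | 0 < (W *ᵥ z) i ∧ 0 < (W *ᵥ z) j} =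
      (Real.pi - rowAngle W i j) / (2 * Real.pi) := by
  have hi := rowSd_pos hW i
  have hj := rowSd_pos hW j
  set θ := rowAngle W i j with hθ
  rw [← stdG_prod_wedge (θ := θ) (Real.arccos_nonneg _) (Real.arccos_le_pi _)]
  set A : Matrix (Fin 2) (Fin d) ℝ := Matrix.of ![W i, W j] with hA
  -- A triangular root of the covariance of the two coordinates; it reduces the event to the wedge
  -- of angle `θ` in the plane.
  set A' : Matrix (Fin 2) (Fin 2) ℝ := !![rowSd W i, 0; rowSd W j * Real.cos θ,
    rowSd W j * Real.sin θ] with hA'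
  have hc := cos_rowAngle hW i j
  have hd : ∀ i, ∑ k, W i k * W i k = rowSd W i * rowSd W i := fun i => by
    rw [rowSd, Real.mul_self_sqrt (rowSq_nonneg W i), Matrix.mul_apply]; rfl
  have hij : ∑ k, W i k * W j k = rowSd W i * (rowSd W j * Real.cos θ) := by
    rw [← mul_assoc, hc, Matrix.mul_apply]; rfl
  have hji : ∑ k, W j k * W i k = rowSd W i * (rowSd W j * Real.cos θ) := by
    rw [← hij]; exact Finset.sum_congr rfl fun k _ => mul_comm _ _
  have h : A * Aᵀ = A' * A'ᵀ := by
    have hsc := Real.sin_sq_add_cos_sq θ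
    ext a b
    fin_cases a <;> fin_cases b <;>
      simp [hA, hA', Matrix.mul_apply, Fin.sum_univ_two, hd, hij, hji]
    · ring
    · linear_combination -(rowSd W j) ^ 2 * hsc
  have hS : MeasurableSet {y : Fin 2 → ℝ | 0 < y 0 ∧ 0 < y 1} :=
    measurableSet_pos_and (measurable_pi_apply 0) (measurable_pi_apply 1)
  have h2 := congrArg (fun μ : Measure (Fin 2 → ℝ) => μ.real {y | 0 < y 0 ∧ 0 < y 1})
    (map_mulVec_eq h)
  beta_reduce at h2
  rw [map_measureReal_apply (measurable_mulVec A) hS,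
    map_measureReal_apply (measurable_mulVec A') hS] at h2
  have h3 := measurePreserving_finTwoArrow stdG
  have hS' : MeasurableSet {p : ℝ × ℝ | 0 < p.1 ∧ 0 < Real.cos θ * p.1 + Real.sin θ * p.2} :=
    measurableSet_pos_and measurable_fst
      ((measurable_fst.const_mul _).add (measurable_snd.const_mul _))
  rw [← h3.map_eq, map_measureReal_apply (MeasurableEquiv.measurable _) hS']
  refine Eq.trans ?_ (h2.trans ?_)
  · congr 1
  · congr 1
    ext g
    have e1 : (A' *ᵥ g) 0 = rowSd W i * g 0 := by
      simp [hA', Matrix.mulVec, dotProduct, Fin.sum_univ_two]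
    have e2 : (A' *ᵥ g) 1 = rowSd W j * (Real.cos θ * g 0 + Real.sin θ * g 1) := by
      simp [hA', Matrix.mulVec, dotProduct, Fin.sum_univ_two]
      ring
    change (0 < (A' *ᵥ g) 0 ∧ 0 < (A' *ᵥ g) 1) ↔
      0 < g 0 ∧ 0 < Real.cos θ * g 0 + Real.sin θ * g 1
    rw [e1, e2, mul_pos_iff_of_pos_left hi, mul_pos_iff_of_pos_left hj]

end Marginals

/-! ## The angle estimate -/

theorem measure_count_ge_le {E : Type*} [MeasurableSpace E] (μ : Measure E) [IsProbabilityMeasure μ]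
    {A : Set E} (hA : MeasurableSet A) {q η : ℝ} (hq : μ.real A ≤ q) (hη : 0 ≤ η) (n : ℕ) :
    (Measure.pi fun _ : Fin n => μ).real
      {x | n * (q + η) ≤ ∑ m, A.indicator (1 : E → ℝ) (x m)} ≤ Real.exp (-2 * n * η ^ 2) := by
  have hm1 : Measurable (A.indicator (1 : E → ℝ)) := measurable_one.indicator hA
  have hind : iIndepFun (fun (m : Fin n) (x : Fin n → E) => A.indicator (1 : E → ℝ) (x m))
      (Measure.pi fun _ : Fin n => μ) :=
    iIndepFun_pi (X := fun _ => A.indicator (1 : E → ℝ)) fun _ => hm1.aemeasurable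
  have h := hoeffding_le hind (fun m => hm1.comp (measurable_pi_apply m))
    (fun m x => ⟨Set.indicator_nonneg (fun _ _ => zero_le_one) _,
      Set.indicator_le_self' (fun _ _ => zero_le_one) _⟩) Finset.univ (p := q) (fun m _ => by
        have e := (measurePreserving_eval (fun _ : Fin n => μ) m).map_eq
        rw [← integral_map (f := A.indicator (1 : E → ℝ)) (φ := fun x : Fin n → E => x m)
          (measurable_pi_apply m).aemeasurable hm1.aestronglyMeasurable]
        rw [show (fun x : Fin n → E => x m) = Function.eval m from rfl, e,
          integral_indicator_one hA]
        exact hq) (u := n * η) (by positivity)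
  rw [Finset.card_univ, Fintype.card_fin] at h
  convert h using 2
  · ext x; simp only [Set.mem_ofPred_eq, mul_add]
  · rcases Nat.eq_zero_or_pos n with rfl | hn
    · simp
    · have : (n : ℝ) ≠ 0 := by positivity
      field_simp

/-! ### Stability of the joint count under errors of the thresholds -/

section Angle

variable {d : ℕ}

theorem measure_strip_le {W : Matrix (Fin d) (Fin d) ℝ} (hW : IsUnit W.det) (i : Fin d) {a c : ℝ}
    (hac : a ≤ c) :
    (Measure.pi fun _ : Fin d => stdG).real
      {z | rowSd W i * a < (W *ᵥ z) i ∧ (W *ᵥ z) i ≤ rowSd W i * c} ≤ c - a := by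
  have hi := rowSd_pos hW i
  have hm : Measurable fun z : Fin d → ℝ => (W *ᵥ z) i :=
    (measurable_pi_apply i).comp (measurable_mulVec W)
  have hS : MeasurableSet (Set.Ioc (rowSd W i * a) (rowSd W i * c)) := measurableSet_Ioc
  have e : {z | rowSd W i * a < (W *ᵥ z) i ∧ (W *ᵥ z) i ≤ rowSd W i * c} =
      (fun z : Fin d → ℝ => (W *ᵥ z) i) ⁻¹' Set.Ioc (rowSd W i * a) (rowSd W i * c) := rfl
  rw [e, ← map_measureReal_apply hm hS, map_row,
    map_measureReal_apply (measurable_const_mul (rowSd W i)) hS]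
  have e2 : (fun g => rowSd W i * g) ⁻¹' Set.Ioc (rowSd W i * a) (rowSd W i * c) =
      Set.Ioc a c := by
    ext g
    simp only [Set.mem_preimage, Set.mem_Ioc, mul_lt_mul_iff_right₀ hi, mul_le_mul_iff_right₀ hi]
  rw [e2]
  have := ENNReal.toReal_mono (by simp) (stdG_le_volume (Set.Ioc a c))
  rwa [Real.volume_Ioc, ENNReal.toReal_ofReal (by linarith)] at this

/-- The points of which two given coordinates exceed the thresholds `s` and `t`. -/
def quadrant (i j : Fin d) (s t : ℝ) : Set (Fin d → ℝ) := {y | s < y i ∧ t < y j}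

theorem measurableSet_quadrant (i j : Fin d) (s t : ℝ) : MeasurableSet (quadrant i j s t) :=
  (measurableSet_lt measurable_const (measurable_pi_apply i)).inter
    (measurableSet_lt measurable_const (measurable_pi_apply j))

instance (W : Matrix (Fin d) (Fin d) ℝ) (b : Fin d → ℝ) : IsProbabilityMeasure (reluDist W b) :=
  Measure.isProbabilityMeasure_map (measurable_relu_affine W b).aemeasurable

variable {W : Matrix (Fin d) (Fin d) ℝ} (hW : IsUnit W.det) {b : Fin d → ℝ} {η : ℝ} (hη : 0 ≤ η)
include hW hη

/-- Lowering the thresholds by `η` standard deviations adds at most two strips, each of probability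
at most `η`. The maximum with `0` excludes the samples that the rectification has set to `0`. -/
theorem reluDist_quadrant_le (i j : Fin d) :
    (reluDist W b).real (quadrant i j (max 0 (b i - η * rowSd W i)) (max 0 (b j - η * rowSd W j))) ≤
      (Real.pi - rowAngle W i j) / (2 * Real.pi) + 2 * η := by
  have hi := measure_strip_le hW i (show -η ≤ 0 by linarith)
  have hj := measure_strip_le hW j (show -η ≤ 0 by linarith)
  rw [← measure_rows_pos hW i j, reluDist,
    map_measureReal_apply (measurable_relu_affine W b) (measurableSet_quadrant i j _ _)]
  refine (measureReal_mono (s₂ := {z | 0 < (W *ᵥ z) i ∧ 0 < (W *ᵥ z) j} ∪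
    ({z | rowSd W i * -η < (W *ᵥ z) i ∧ (W *ᵥ z) i ≤ rowSd W i * 0} ∪
      {z | rowSd W j * -η < (W *ᵥ z) j ∧ (W *ᵥ z) j ≤ rowSd W j * 0}))
    fun z hz => ?_).trans ?_
  · obtain ⟨h1, h2⟩ := hz
    have key : ∀ i, max 0 (b i - η * rowSd W i) < max 0 ((W *ᵥ z) i + b i) →
        rowSd W i * -η < (W *ᵥ z) i := fun i h => by
      have h3 := (le_max_left _ _).trans_lt h
      have h4 := (le_max_right _ _).trans_lt h
      rcases le_total 0 ((W *ᵥ z) i + b i) with h5 | h5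
      · rw [max_eq_right h5] at h4; linarith
      · rw [max_eq_left h5] at h3; exact absurd h3 (lt_irrefl _)
    have k1 := key i h1
    have k2 := key j h2
    simp only [Set.mem_union, Set.mem_ofPred_eq, mul_zero]
    by_cases c1 : 0 < (W *ᵥ z) i
    · by_cases c2 : 0 < (W *ᵥ z) j
      · exact Or.inl ⟨c1, c2⟩
      · exact Or.inr (Or.inr ⟨k2, not_lt.1 c2⟩)
    · exact Or.inr (Or.inl ⟨k1, not_lt.1 c1⟩)
  · refine (measureReal_union_le _ _).trans ?_
    have := measureReal_union_le (μ := Measure.pi fun _ : Fin d => stdG)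
      {z | rowSd W i * -η < (W *ᵥ z) i ∧ (W *ᵥ z) i ≤ rowSd W i * 0}
      {z | rowSd W j * -η < (W *ᵥ z) j ∧ (W *ᵥ z) j ≤ rowSd W j * 0}
    unfold stdG at *
    linarith

theorem le_reluDist_quadrant (i j : Fin d) :
    (Real.pi - rowAngle W i j) / (2 * Real.pi) ≤
      (reluDist W b).real (quadrant i j (b i + η * rowSd W i) (b j + η * rowSd W j)) + 2 * η := by
  have hi := measure_strip_le hW i hη
  have hj := measure_strip_le hW j hη
  rw [← measure_rows_pos hW i j, reluDist,
    map_measureReal_apply (measurable_relu_affine W b) (measurableSet_quadrant i j _ _)]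
  refine (measureReal_mono (s₂ := ((fun z i => max 0 ((W *ᵥ z) i + b i)) ⁻¹'
      quadrant i j (b i + η * rowSd W i) (b j + η * rowSd W j)) ∪
    ({z | rowSd W i * 0 < (W *ᵥ z) i ∧ (W *ᵥ z) i ≤ rowSd W i * η} ∪
      {z | rowSd W j * 0 < (W *ᵥ z) j ∧ (W *ᵥ z) j ≤ rowSd W j * η}))
    fun z hz => ?_).trans ?_
  · obtain ⟨h1, h2⟩ := hz
    have key : ∀ i, 0 < (W *ᵥ z) i → ¬ (W *ᵥ z) i ≤ rowSd W i * η →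
        b i + η * rowSd W i < max 0 ((W *ᵥ z) i + b i) := fun i _ h => by
      rw [not_le] at h
      exact lt_max_of_lt_right (by linarith)
    simp only [Set.mem_union, Set.mem_ofPred_eq, mul_zero, Set.mem_preimage, quadrant]
    by_cases c1 : (W *ᵥ z) i ≤ rowSd W i * η
    · exact Or.inr (Or.inl ⟨h1, c1⟩)
    · by_cases c2 : (W *ᵥ z) j ≤ rowSd W j * η
      · exact Or.inr (Or.inr ⟨h2, c2⟩)
      · exact Or.inl ⟨key i h1 c1, key j h2 c2⟩
  · refine (measureReal_union_le _ _).trans ?_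
    have := measureReal_union_le (μ := Measure.pi fun _ : Fin d => stdG)
      {z | rowSd W i * 0 < (W *ᵥ z) i ∧ (W *ᵥ z) i ≤ rowSd W i * η}
      {z | rowSd W j * 0 < (W *ᵥ z) j ∧ (W *ᵥ z) j ≤ rowSd W j * η}
    unfold stdG at *
    linarith

omit hW hη

/-- The event that the empirical frequency of joint positivity is off, for some thresholds close to
the true ones. -/
def badPair (W : Matrix (Fin d) (Fin d) ℝ) (b : Fin d → ℝ) (η : ℝ) (n : ℕ) (i j : Fin d) :
    Set (Fin n → Fin d → ℝ) :=
  {x | n * ((Real.pi - rowAngle W i j) / (2 * Real.pi) + 2 * η + η) ≤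
    ∑ m, (quadrant i j (max 0 (b i - η * rowSd W i))
      (max 0 (b j - η * rowSd W j))).indicator (1 : (Fin d → ℝ) → ℝ) (x m)} ∪
  {x | n * (1 - (Real.pi - rowAngle W i j) / (2 * Real.pi) + 2 * η + η) ≤
    ∑ m, (quadrant i j (b i + η * rowSd W i)
      (b j + η * rowSd W j))ᶜ.indicator (1 : (Fin d → ℝ) → ℝ) (x m)}

theorem measure_badPair_le (hW : IsUnit W.det) (hη : 0 ≤ η) (n : ℕ)
    (i j : Fin d) :
    (Measure.pi fun _ : Fin n => reluDist W b).real (badPair W b η n i j) ≤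
      2 * Real.exp (-2 * n * η ^ 2) := by
  have h1 := measure_count_ge_le (reluDist W b) (measurableSet_quadrant i j _ _)
    (reluDist_quadrant_le (b := b) hW hη i j) hη n
  have h2 := measure_count_ge_le (reluDist W b) (measurableSet_quadrant i j
      (b i + η * rowSd W i) (b j + η * rowSd W j)).compl
    (q := 1 - (Real.pi - rowAngle W i j) / (2 * Real.pi) + 2 * η) (by
      rw [probReal_compl_eq_one_sub (measurableSet_quadrant i j _ _)]
      have := le_reluDist_quadrant (b := b) hW hη i j
      linarith) hη n
  refine (measureReal_union_le _ _).trans ?_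
  linarith

/-- The thresholds `c` may depend on the samples: the count is monotone in them, so it lies between
the counts for the two fixed quadrants of `badPair`. The error is `2 η` from the strips and `η` from
sampling. -/
theorem jointCount_close {n : ℕ} (hn : 0 < n) {x : Fin n → Fin d → ℝ} {i j : Fin d}
    (hx : x ∉ badPair W b η n i j) {c : Fin d → ℝ} (hc0 : ∀ i, 0 ≤ c i)
    (hc : ∀ i, |c i - b i| ≤ η * rowSd W i) :
    |jointCount x c i j / n - (Real.pi - rowAngle W i j) / (2 * Real.pi)| ≤ 3 * η := by
  have hn' : (0 : ℝ) < n := by exact_mod_cast hn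
  simp only [badPair, Set.mem_union, Set.mem_ofPred_eq, not_or, not_le] at hx
  obtain ⟨hx1, hx2⟩ := hx
  set p := (Real.pi - rowAngle W i j) / (2 * Real.pi)
  have hci := abs_le.1 (hc i)
  have hcj := abs_le.1 (hc j)
  have u1 : jointCount x c i j ≤ ∑ m, (quadrant i j (max 0 (b i - η * rowSd W i))
      (max 0 (b j - η * rowSd W j))).indicator (1 : (Fin d → ℝ) → ℝ) (x m) := by
    refine Finset.sum_le_sum fun m _ => ?_
    split_ifs with h
    · rw [Set.indicator_of_mem]
      · rfl
      · exact ⟨(max_le (hc0 i) (by linarith)).trans_lt h.1,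
          (max_le (hc0 j) (by linarith)).trans_lt h.2⟩
    · exact Set.indicator_nonneg (fun _ _ => zero_le_one) _
  have u2 : n - jointCount x c i j ≤ ∑ m, (quadrant i j (b i + η * rowSd W i)
      (b j + η * rowSd W j))ᶜ.indicator (1 : (Fin d → ℝ) → ℝ) (x m) := by
    have e : (n : ℝ) = ∑ _m : Fin n, (1 : ℝ) := by simp
    rw [jointCount, e, ← Finset.sum_sub_distrib]
    refine Finset.sum_le_sum fun m _ => ?_
    split_ifs with h
    · rw [sub_self]; exact Set.indicator_nonneg (fun _ _ => zero_le_one) _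
    · rw [Set.indicator_of_mem, sub_zero]
      · rfl
      · exact fun hq => h ⟨lt_of_le_of_lt (by linarith) hq.1, lt_of_le_of_lt (by linarith) hq.2⟩
  rw [abs_le]
  constructor
  · rw [le_sub_iff_add_le, le_div_iff₀ hn']
    nlinarith
  · rw [sub_le_iff_le_add, div_le_iff₀ hn']
    nlinarith

/-- The angle is off by at most `2 π · 3 η ≤ 24 η`, as `π ≤ 4`, and the cosine is 1-Lipschitz. The
product of the standard deviations has relative error `η`, whence `25 η`. -/
theorem covEst_close (hW : IsUnit W.det) (hη1 : η ≤ 1) {n : ℕ} (hn : 0 < n)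
    {x : Fin n → Fin d → ℝ} {i j : Fin d}
    (hx : x ∉ badPair W b η n i j) {c : Fin d → ℝ} (hc0 : ∀ i, 0 ≤ c i)
    (hc : ∀ i, |c i - b i| ≤ η * rowSd W i) {s : Fin d → ℝ}
    (hs : ∀ i, |s i - rowSd W i ^ 2| ≤ η * rowSd W i ^ 2) :
    |covEst x s c i j - (W * Wᵀ) i j| ≤ 25 * η * (rowSd W i * rowSd W j) := by
  have hi := rowSd_pos hW i
  have hj := rowSd_pos hW j
  have hη : 0 ≤ η := by
    have := (abs_nonneg _).trans (hc i)
    by_contra! h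
    nlinarith
  have hcount := jointCount_close hn hx hc0 hc
  have hπ := Real.pi_pos
  set p := (Real.pi - rowAngle W i j) / (2 * Real.pi) with hp
  have hθ : |(Real.pi - 2 * Real.pi / n * jointCount x c i j) - rowAngle W i j| ≤ 24 * η := by
    have e : (Real.pi - 2 * Real.pi / n * jointCount x c i j) - rowAngle W i j =
        -(2 * Real.pi) * (jointCount x c i j / n - p) := by
      rw [hp]; field_simp; ring
    rw [e, abs_mul, abs_neg, abs_of_pos (by positivity)]
    have := Real.pi_le_four
    nlinarith [abs_nonneg (jointCount x c i j / n - p)]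
  have hcos := (Real.abs_cos_sub_cos_le (Real.pi - 2 * Real.pi / n * jointCount x c i j)
    (rowAngle W i j)).trans hθ
  have hroot : |√(s i * s j) - rowSd W i * rowSd W j| ≤ η * (rowSd W i * rowSd W j) := by
    obtain ⟨a1, a2⟩ := abs_le.1 (hs i)
    obtain ⟨b1, b2⟩ := abs_le.1 (hs j)
    have hi2 : (0 : ℝ) < rowSd W i ^ 2 := by positivity
    have hj2 : (0 : ℝ) < rowSd W j ^ 2 := by positivity
    have l1 : (1 - η) * rowSd W i ^ 2 ≤ s i := by linarith
    have l2 : (1 - η) * rowSd W j ^ 2 ≤ s j := by linarith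
    have k1 : s i ≤ (1 + η) * rowSd W i ^ 2 := by linarith
    have k2 : s j ≤ (1 + η) * rowSd W j ^ 2 := by linarith
    have n1 : 0 ≤ (1 - η) * rowSd W i ^ 2 := mul_nonneg (by linarith) hi2.le
    have n2 : 0 ≤ (1 - η) * rowSd W j ^ 2 := mul_nonneg (by linarith) hj2.le
    rw [abs_le]
    constructor
    · have := Real.le_sqrt_of_sq_le (x := (1 - η) * (rowSd W i * rowSd W j)) (y := s i * s j)
        (by calc _ = ((1 - η) * rowSd W i ^ 2) * ((1 - η) * rowSd W j ^ 2) := by ring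
              _ ≤ s i * s j := mul_le_mul l1 l2 n2 (n1.trans l1))
      linarith
    · have := (Real.sqrt_le_iff (x := s i * s j) (y := (1 + η) * (rowSd W i * rowSd W j))).2
        ⟨by positivity, by
          calc s i * s j ≤ ((1 + η) * rowSd W i ^ 2) * ((1 + η) * rowSd W j ^ 2) :=
                mul_le_mul k1 k2 (n2.trans l2) (by positivity)
            _ = _ := by ring⟩
      linarith
  have hc1 := Real.abs_cos_le_one (Real.pi - 2 * Real.pi / n * jointCount x c i j)
  rw [covEst, ← cos_rowAngle hW i j]
  set C := Real.cos (Real.pi - 2 * Real.pi / n * jointCount x c i j)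
  set P := rowSd W i * rowSd W j with hP
  have hPpos : 0 < P := by positivity
  have e : √(s i * s j) * C - P * Real.cos (rowAngle W i j) =
      (√(s i * s j) - P) * C + P * (C - Real.cos (rowAngle W i j)) := by ring
  rw [e]
  refine (abs_add_le _ _).trans ?_
  rw [abs_mul, abs_mul, abs_of_pos hPpos]
  have t1 : |√(s i * s j) - P| * |C| ≤ η * P * 1 :=
    mul_le_mul hroot hc1 (abs_nonneg _) (by positivity)
  have t2 : P * |C - Real.cos (rowAngle W i j)| ≤ P * (24 * η) := by gcongr
  linarith

end Angle

/-! ## The number of draws of the rejection sampler -/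

open Classical in
theorem trials_eq_succ_iff (c : ℝ) (w : ℕ → ℝ) (k : ℕ) :
    trials c w = k + 1 ↔ c < w k ∧ ∀ j < k, ¬ c < w j := by
  unfold trials
  split_ifs with h
  · rw [Nat.add_right_cancel_iff, Nat.find_eq_iff]
  · refine ⟨fun h0 => absurd h0 (by simp), fun h1 => absurd ⟨k, h1.1⟩ h⟩

theorem measurable_trials (c : ℝ) : Measurable (trials c) := by
  have hk : ∀ k, MeasurableSet {w : ℕ → ℝ | c < w k} := fun k =>
    measurableSet_lt measurable_const (measurable_pi_apply k)
  have hs : ∀ k, MeasurableSet (trials c ⁻¹' {k + 1}) := fun k => by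
    have e : trials c ⁻¹' {k + 1} = {w | c < w k} ∩ ⋂ j ∈ Set.Iio k, {w : ℕ → ℝ | c < w j}ᶜ := by
      ext w
      simp only [Set.mem_preimage, Set.mem_singleton_iff, trials_eq_succ_iff, Set.mem_inter_iff,
        Set.mem_ofPred_eq, Set.mem_iInter, Set.mem_Iio, Set.mem_compl_iff]
    rw [e]
    exact (hk k).inter (MeasurableSet.biInter (Set.to_countable _) fun j _ => (hk j).compl)
  refine measurable_to_countable' fun n => ?_
  cases n with
  | zero =>
    have e : trials c ⁻¹' {0} = (⋃ k, trials c ⁻¹' {k + 1})ᶜ := by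
      ext w
      simp only [Set.mem_preimage, Set.mem_singleton_iff, Set.mem_compl_iff, Set.mem_iUnion,
        not_exists]
      refine ⟨fun h k => by omega, fun h => ?_⟩
      by_contra h0
      exact h (trials c w - 1) (by omega)
    rw [e]
    exact (MeasurableSet.iUnion hs).compl
  | succ k => exact hs k

/-- The number of draws has an exponential moment. -/
theorem exists_integrable_exp_trials (c : ℝ) :
    ∃ s > 0, Integrable (fun w => Real.exp (s * (trials c w : ℝ))) stdGSeq := by
  have hIoi : 0 < stdG (Set.Ioi c) := stdG_pos_of_isOpen isOpen_Ioi ⟨c + 1, by simp⟩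
  have hIic : MeasurableSet (Set.Iic c) := measurableSet_Iic
  set q : ℝ := stdG.real (Set.Iic c) with hq
  have hq0 : 0 ≤ q := measureReal_nonneg
  have hq1 : q < 1 := by
    have h1 := probReal_compl_eq_one_sub (μ := stdG) (measurableSet_Ioi (a := c))
    rw [Set.compl_Ioi] at h1
    have h2 : 0 < stdG.real (Set.Ioi c) := ENNReal.toReal_pos hIoi.ne' (measure_ne_top _ _)
    rw [hq, h1]; linarith
  -- Then `q < 1 - s ≤ exp (-s)`, so the geometric series with ratio `exp s * q` converges.
  set s := (1 - q) / 2 with hs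
  have hs0 : 0 < s := by rw [hs]; linarith
  have hratio : Real.exp s * q < 1 := by
    have h1 := Real.one_sub_le_exp_neg s
    have h2 : q < Real.exp (-s) := by linarith
    calc Real.exp s * q < Real.exp s * Real.exp (-s) := by gcongr
      _ = 1 := by rw [← Real.exp_add]; simp
  have hm : Measurable fun w : ℕ → ℝ => Real.exp (s * (trials c w : ℝ)) :=
    Real.measurable_exp.comp (((measurable_from_top (f := fun n : ℕ => (n : ℝ))).comp
      (measurable_trials c)).const_mul s)
  refine ⟨s, hs0, hm.aestronglyMeasurable, ?_⟩
  set E : ℕ → Set (ℕ → ℝ) := fun k => Set.pi (Finset.range k) fun _ => Set.Iic c with hE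
  have hEm : ∀ k, MeasurableSet (E k) := fun k =>
    MeasurableSet.pi (Finset.range k).countable_toSet fun _ _ => hIic
  have hEμ : ∀ k, stdGSeq (E k) = ENNReal.ofReal (q ^ k) := fun k => by
    rw [hE]
    simp only
    rw [Measure.infinitePi_pi _ fun _ _ => hIic, Finset.prod_const, Finset.card_range,
      ENNReal.ofReal_pow hq0, hq, ofReal_measureReal]
  have hpt : ∀ w : ℕ → ℝ, ‖Real.exp (s * (trials c w : ℝ))‖ₑ ≤
      1 + ∑' k, (E k).indicator (fun _ => ENNReal.ofReal (Real.exp s ^ (k + 1))) w := fun w => by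
    rw [Real.enorm_of_nonneg (Real.exp_pos _).le]
    rcases h : trials c w with _ | k
    · simp
    · have h' := (trials_eq_succ_iff c w k).1 h
      refine le_trans ?_ (le_add_of_nonneg_left zero_le)
      refine le_trans ?_ (ENNReal.le_tsum k)
      rw [Set.indicator_of_mem]
      · rw [← Real.exp_nat_mul, mul_comm]
      · intro j hj
        exact not_lt.1 (h'.2 j (by simpa using hj))
  refine lt_of_le_of_lt (lintegral_mono hpt) ?_
  rw [lintegral_add_left measurable_const, lintegral_tsum fun k =>
    (measurable_const.indicator (hEm k)).aemeasurable]
  simp_rw [lintegral_indicator_const (hEm _), hEμ]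
  refine ENNReal.add_lt_top.2 ⟨by simp, ?_⟩
  have e : ∀ k : ℕ, ENNReal.ofReal (Real.exp s ^ (k + 1)) * ENNReal.ofReal (q ^ k) =
      ENNReal.ofReal (Real.exp s * (Real.exp s * q) ^ k) := fun k => by
    rw [← ENNReal.ofReal_mul (by positivity), mul_pow, pow_succ]
    congr 1; ring
  simp_rw [e]
  have hsum : Summable fun k : ℕ => Real.exp s * (Real.exp s * q) ^ k :=
    (summable_geometric_of_lt_one (by positivity) hratio).mul_left _
  rw [← ENNReal.ofReal_tsum_of_nonneg (fun k => by positivity) hsum]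
  exact ENNReal.ofReal_lt_top

/-- With overwhelming probability, the total number of draws is linear in the number of samples. -/
theorem exists_measure_trials_le (c : ℝ) :
    ∃ K > 0, ∀ (ι : Type) (S : Finset ι) (N : ℝ), (S.card : ℝ) ≤ N →
      (Measure.infinitePi fun _ : ι => stdGSeq).real
        {w | K * N ≤ ∑ p ∈ S, (trials c (w p) : ℝ)} ≤ Real.exp (-N) := by
  obtain ⟨s, hs, hint⟩ := exists_integrable_exp_trials c
  set M : ℝ := ∫ w, Real.exp (s * (trials c w : ℝ)) ∂stdGSeq with hM
  have hM1 : 1 ≤ M := by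
    have h : ∫ _w : ℕ → ℝ, (1 : ℝ) ∂stdGSeq ≤ M :=
      integral_mono (integrable_const _) hint fun w => Real.one_le_exp (by positivity)
    simpa using h
  have hlog := Real.log_nonneg hM1
  -- Markov's inequality for `exp (s · total)` gives `exp (-s K N) M ^ N`, which this `K` turns into
  -- `exp (-N)`.
  refine ⟨(1 + Real.log M) / s, by positivity, fun ι S N hN => ?_⟩
  have hmt : Measurable fun w : ℕ → ℝ => (trials c w : ℝ) :=
    (measurable_from_top (f := fun n : ℕ => (n : ℝ))).comp (measurable_trials c)
  set P := Measure.infinitePi fun _ : ι => stdGSeq with hP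
  have hind : iIndepFun (fun (p : ι) (w : ι → ℕ → ℝ) => (trials c (w p) : ℝ)) P :=
    iIndepFun_infinitePi (P := fun _ : ι => stdGSeq) (X := fun _ w => (trials c w : ℝ))
      fun _ => hmt
  have hmp : ∀ p : ι, P.map (fun w => w p) = stdGSeq := fun p => Measure.infinitePi_map_eval _ p
  have hmX : ∀ p : ι, Measurable fun w : ι → ℕ → ℝ => (trials c (w p) : ℝ) := fun p =>
    hmt.comp (measurable_pi_apply p)
  have hi : ∀ p : ι, Integrable (fun w : ι → ℕ → ℝ => Real.exp (s * (trials c (w p) : ℝ))) P :=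
    fun p => by
      have h := hint
      rw [← hmp p] at h
      exact h.comp_measurable (measurable_pi_apply p)
  have hmgf : ∀ p : ι, mgf (fun w : ι → ℕ → ℝ => (trials c (w p) : ℝ)) P s = M := fun p => by
    rw [mgf, hM, ← hmp p, integral_map (measurable_pi_apply p).aemeasurable]
    exact (Real.measurable_exp.comp (hmt.const_mul s)).aestronglyMeasurable
  have h := measure_ge_le_exp_mul_mgf (μ := P)
    (X := ∑ p ∈ S, fun w : ι → ℕ → ℝ => (trials c (w p) : ℝ)) ((1 + Real.log M) / s * N) hs.le
    (hind.integrable_exp_mul_sum hmX fun p _ => hi p)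
  rw [hind.mgf_sum hmX] at h
  simp only [hmgf, Finset.prod_const, Finset.sum_apply] at h
  refine h.trans ?_
  have h2 : M ^ S.card ≤ Real.exp (Real.log M * N) := by
    rw [← Real.exp_log (show 0 < M by linarith), ← Real.exp_nat_mul, Real.log_exp, mul_comm]
    gcongr
  refine (mul_le_mul_of_nonneg_left h2 (Real.exp_pos _).le).trans_eq ?_
  rw [← Real.exp_add]
  congr 1
  field_simp
  ring

/-- In the box the mean `v.2 / v.1` is at least `-r²` and the standard deviation at least `1 / r`,
so a draw above `r³` yields a positive proposal. -/
theorem paramBox_pos_of_lt {r : ℝ} (hr : 1 ≤ r) {v : ℝ × ℝ} (hv : v ∈ paramBox r) {g : ℝ}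
    (hg : r ^ 3 < g) : 0 < v.2 / v.1 + √(1 / v.1) * g := by
  obtain ⟨h1, h2, h3⟩ := hv
  have h0 : 0 < v.1 := lt_of_lt_of_le (by positivity) h1
  have hroot : 1 / r ≤ √(1 / v.1) := by
    refine Real.le_sqrt_of_sq_le ?_
    calc (1 / r) ^ 2 ≤ 1 / r := by
          rw [sq]
          exact mul_le_of_le_one_left (by positivity) ((div_le_one (by linarith)).2 hr)
      _ ≤ 1 / v.1 := one_div_le_one_div_of_le h0 h2
  have hg0 : 0 < g := lt_trans (by positivity) hg
  have ha : -(r ^ 2) ≤ v.2 / v.1 := by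
    rw [le_div_iff₀ h0]
    have h4 := (abs_le.1 h3).1
    have h5 : 1 ≤ r * v.1 := by rwa [div_le_iff₀' (by linarith)] at h1
    nlinarith
  have hb : r ^ 2 < √(1 / v.1) * g := by
    calc r ^ 2 = 1 / r * r ^ 3 := by field_simp
      _ < 1 / r * g := by gcongr
      _ ≤ _ := by gcongr
  linarith

/-! ## The laws of parts of the random tape -/

section Tape

variable {d : ℕ}

/-- The law of the random tape. -/
noncomputable abbrev fullTape (d : ℕ) : Measure (Fin d × ℕ × ℕ × ℕ → ℝ) :=
  Measure.infinitePi fun _ : Fin d × ℕ × ℕ × ℕ => stdG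

theorem measurePreserving_sequences :
    MeasurePreserving (fun (w : Fin d × ℕ × ℕ × ℕ → ℝ) (p : Fin d × ℕ × ℕ) (a : ℕ) =>
      w (p.1, p.2.1, p.2.2, a)) (fullTape d) (Measure.infinitePi fun _ => stdGSeq) := by
  have hinj : Function.Injective fun p : (Fin d × ℕ × ℕ) × ℕ =>
      (p.1.1, p.1.2.1, p.1.2.2, p.2) := by
    rintro ⟨⟨i, j, t⟩, a⟩ ⟨⟨i', j', t'⟩, a'⟩ h
    simpa [and_assoc] using h
  refine ⟨by fun_prop, ?_⟩
  have h1 := Measure.map_infinitePi_infinitePi_of_inj (P := fun _ : Fin d × ℕ × ℕ × ℕ => stdG) hinj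
  have h2 := Measure.infinitePi_map_curry (ι := Fin d × ℕ × ℕ) (κ := ℕ) fun _ _ => stdG
  rw [← h1, Measure.map_map (by fun_prop) (by fun_prop)] at h2
  exact h2

theorem measurePreserving_coordTape (i : Fin d) :
    MeasurePreserving (fun (w : Fin d × ℕ × ℕ × ℕ → ℝ) (j t a : ℕ) => w (i, j, t, a))
      (fullTape d) coordTape := by
  refine ⟨by fun_prop, ?_⟩
  have hinj : Function.Injective fun p : ℕ × ℕ => (i, p.1, p.2) := by
    rintro ⟨j, t⟩ ⟨j', t'⟩ h
    simpa using h
  have h1 := Measure.map_infinitePi_infinitePi_of_inj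
    (P := fun _ : Fin d × ℕ × ℕ => stdGSeq) hinj
  have h2 := Measure.infinitePi_map_curry (ι := ℕ) (κ := ℕ) fun _ _ => stdGSeq
  rw [← h1, ← (measurePreserving_sequences (d := d)).map_eq,
    Measure.map_map (by fun_prop) (by fun_prop), Measure.map_map (by fun_prop) (by fun_prop)] at h2
  exact h2

theorem ae_forall_exists_lt (c : ℝ) :
    ∀ᵐ w ∂fullTape d, ∀ i j t, ∃ k, c < w (i, j, t, k) := by
  have hpos : 0 < stdG (Set.Ioi c) := stdG_pos_of_isOpen isOpen_Ioi ⟨c + 1, by simp⟩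
  have h1 : ∀ p : Fin d × ℕ × ℕ, ∀ᵐ w ∂(Measure.infinitePi fun _ : Fin d × ℕ × ℕ => stdGSeq),
      ∃ k, c < w p k := fun p => by
    have h := ae_exists_mem_stdGSeq measurableSet_Ioi hpos
    rw [← Measure.infinitePi_map_eval (fun _ : Fin d × ℕ × ℕ => stdGSeq) p] at h
    exact ae_of_ae_map (measurable_pi_apply p).aemeasurable h
  have h2 := measurePreserving_sequences.quasiMeasurePreserving.ae (ae_all_iff.2 h1)
  filter_upwards [h2] with w hw i j t using hw (i, j, t)

end Tape

/-! ## The bad event of a run -/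

section Run

variable {d : ℕ} {W : Matrix (Fin d) (Fin d) ℝ} {b : Fin d → ℝ}

theorem measurePreserving_coordinate (hW : IsUnit W.det) (b : Fin d → ℝ) (i : Fin d) :
    MeasurePreserving (fun y : Fin d → ℝ => y i) (reluDist W b)
      (reluLaw (b i / rowSd W i) (rowSd W i)) := by
  refine ⟨measurable_pi_apply i, ?_⟩
  have hi := rowSd_pos hW i
  have hm : Measurable fun z : Fin d → ℝ => (W *ᵥ z) i :=
    (measurable_pi_apply i).comp (measurable_mulVec W)
  have hf : Measurable fun u : ℝ => max 0 (u + b i) := by fun_prop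
  have h := congrArg (Measure.map fun u : ℝ => max 0 (u + b i)) (map_row W i)
  rw [Measure.map_map hf hm, Measure.map_map hf (measurable_const_mul _)] at h
  rw [reluDist, Measure.map_map (measurable_pi_apply i) (measurable_relu_affine W b)]
  refine h.trans ?_
  rw [reluLaw]
  congr 1
  funext g
  simp only [Function.comp_apply]
  rw [div_mul_cancel₀ _ hi.ne', add_comm]

/-- The data and the random tape of coordinate `i`. -/
def coordinateData (n : ℕ) (i : Fin d)
    (ω : (Fin n → Fin d → ℝ) × (Fin d × ℕ × ℕ × ℕ → ℝ)) : (Fin n → ℝ) × (ℕ → ℕ → ℕ → ℝ) :=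
  (fun m => ω.1 m i, fun j t a => ω.2 (i, j, t, a))

theorem measurePreserving_coordinateData (hW : IsUnit W.det) (b : Fin d → ℝ) (n : ℕ) (i : Fin d) :
    MeasurePreserving (coordinateData n i) (samplesAndTape n W b)
      ((Measure.pi fun _ : Fin n => reluLaw (b i / rowSd W i) (rowSd W i)).prod coordTape) := by
  have h1 := measurePreserving_pi (fun _ : Fin n => reluDist W b)
    (fun _ : Fin n => reluLaw (b i / rowSd W i) (rowSd W i))
    (f := fun _ y => y i) fun _ => measurePreserving_coordinate hW b i
  exact h1.prod (measurePreserving_coordTape i)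

/-- The total number of draws of rejection samplers that accept precisely the values above `c`. -/
noncomputable def totalTrials (c : ℝ) (n B : ℕ) (w : Fin d × ℕ × ℕ × ℕ → ℝ) : ℝ :=
  ∑ p ∈ (Finset.univ : Finset (Fin d)) ×ˢ Finset.range B ×ˢ Finset.range (n / B),
    (trials c (fun a => w (p.1, p.2.1, p.2.2, a)) : ℝ)

theorem card_iterations_le (n B : ℕ) :
    (((Finset.univ : Finset (Fin d)) ×ˢ Finset.range B ×ˢ Finset.range (n / B)).card : ℝ) ≤
      d * n := by
  rw [Finset.card_product, Finset.card_product]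
  simp only [Finset.card_univ, Fintype.card_fin, Finset.card_range]
  exact_mod_cast Nat.mul_le_mul_left d (Nat.mul_div_le n B)

/-- The event that the run fails. -/
def badRun (W : Matrix (Fin d) (Fin d) ℝ) (b : Fin d → ℝ) (η ρ c K : ℝ) (n B : ℕ) :
    Set ((Fin n → Fin d → ℝ) × (Fin d × ℕ × ℕ × ℕ → ℝ)) :=
  ((⋃ i, coordinateData n i ⁻¹' badSamples (b i / rowSd W i) (rowSd W i) ρ n B) ∪
    ⋃ p : Fin d × Fin d, Prod.fst ⁻¹' badPair W b η n p.1 p.2) ∪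
  (Prod.snd ⁻¹' {w | K * (d * n) ≤ totalTrials c n B w} ∪
    Prod.snd ⁻¹' {w | ¬ ∀ i j t, ∃ k, c < w (i, j, t, k)})

theorem measure_badRun_le (hW : IsUnit W.det) (hb : ∀ i, 0 ≤ b i) {η ρ c K : ℝ} (hη : 0 ≤ η)
    (hρ : 0 < ρ) {n B T₀ : ℕ} (hB : 0 < B) (hT₀ : 0 < T₀) (hn : 3 * (T₀ * B) ≤ n)
    (hTρ : 16 * (rateConst * ((1 + Real.log T₀) / T₀)) ≤ ρ ^ 2)
    (hK : ∀ (ι : Type) (S : Finset ι) (N : ℝ), (S.card : ℝ) ≤ N →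
      (Measure.infinitePi fun _ : ι => stdGSeq).real
        {w | K * N ≤ ∑ p ∈ S, (trials c (w p) : ℝ)} ≤ Real.exp (-N)) :
    samplesAndTape n W b (badRun W b η ρ c K n B) ≤ ENNReal.ofReal
      (d * (Real.exp (-n / 18) + 4 * Real.exp (-momentRate * (n / 3)) + 2 * Real.exp (-B / 512)) +
        d * d * (2 * Real.exp (-2 * n * η ^ 2)) + Real.exp (-(d * n))) := by
  have hfst : MeasurePreserving Prod.fst (samplesAndTape n W b)
      (Measure.pi fun _ : Fin n => reluDist W b) := measurePreserving_fst
  have hsnd : MeasurePreserving Prod.snd (samplesAndTape n W b) (fullTape d) :=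
    measurePreserving_snd
  set q₁ := Real.exp (-n / 18) + 4 * Real.exp (-momentRate * (n / 3)) + 2 * Real.exp (-B / 512)
  set q₂ := 2 * Real.exp (-2 * n * η ^ 2)
  have hq₁ : 0 ≤ q₁ := by positivity
  have hq₂ : 0 ≤ q₂ := by positivity
  have h1 : samplesAndTape n W b (⋃ i, coordinateData n i ⁻¹'
      badSamples (b i / rowSd W i) (rowSd W i) ρ n B) ≤ ENNReal.ofReal (d * q₁) := by
    refine (measure_iUnion_fintype_le _ _).trans ?_
    calc _ ≤ ∑ _i : Fin d, ENNReal.ofReal q₁ := by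
          refine Finset.sum_le_sum fun i _ => ?_
          have hi := rowSd_pos hW i
          have hmp := measurePreserving_coordinateData hW b n i
          rw [hmp.measure_preimage (measurableSet_badSamples _ _ _ _ _).nullMeasurableSet]
          exact measure_badSamples_le (div_nonneg (hb i) hi.le) hi hρ hB hT₀ hn hTρ
      _ = _ := by
          rw [Finset.sum_const, Finset.card_univ, Fintype.card_fin, nsmul_eq_mul,
            ENNReal.ofReal_mul (by positivity), ENNReal.ofReal_natCast]
  have h2 : samplesAndTape n W b (⋃ p : Fin d × Fin d, Prod.fst ⁻¹' badPair W b η n p.1 p.2) ≤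
      ENNReal.ofReal (d * d * q₂) := by
    refine (measure_iUnion_fintype_le _ _).trans ?_
    calc _ ≤ ∑ _p : Fin d × Fin d, ENNReal.ofReal q₂ := by
          refine Finset.sum_le_sum fun p _ => ?_
          -- This inequality holds for arbitrary sets, so measurability of the event need not be
          -- shown.
          refine (Measure.le_map_apply hfst.measurable.aemeasurable _).trans ?_
          rw [hfst.map_eq, ← ofReal_measureReal]
          exact ENNReal.ofReal_le_ofReal (measure_badPair_le hW hη n p.1 p.2)
      _ = _ := by
          rw [Finset.sum_const, Finset.card_univ, Fintype.card_prod, Fintype.card_fin,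
            nsmul_eq_mul, ← Nat.cast_mul, ENNReal.ofReal_mul (Nat.cast_nonneg _),
            ENNReal.ofReal_natCast]
  have h3 : samplesAndTape n W b (Prod.snd ⁻¹' {w | K * (d * n) ≤ totalTrials c n B w}) ≤
      ENNReal.ofReal (Real.exp (-(d * n))) := by
    refine (Measure.le_map_apply hsnd.measurable.aemeasurable _).trans ?_
    rw [hsnd.map_eq]
    have hseq := measurePreserving_sequences (d := d)
    refine le_trans (Measure.le_map_apply hseq.measurable.aemeasurable {w | K * (d * n) ≤
      ∑ p ∈ (Finset.univ : Finset (Fin d)) ×ˢ Finset.range B ×ˢ Finset.range (n / B),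
        (trials c (w p) : ℝ)}) ?_
    rw [hseq.map_eq, ← ofReal_measureReal]
    exact ENNReal.ofReal_le_ofReal (hK _ _ _ (card_iterations_le n B))
  have h4 : samplesAndTape n W b (Prod.snd ⁻¹' {w | ¬ ∀ i j t, ∃ k, c < w (i, j, t, k)}) = 0 :=
    hsnd.quasiMeasurePreserving.ae (ae_forall_exists_lt c)
  refine (measure_union_le _ _).trans ?_
  refine (add_le_add (measure_union_le _ _) (measure_union_le _ _)).trans ?_
  rw [h4, add_zero, ENNReal.ofReal_add (by positivity) (by positivity),
    ENNReal.ofReal_add (by positivity) (by positivity)]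
  exact add_le_add (add_le_add h1 h2) h3

theorem learnReLU_accurate (hd : 0 < d) (hW : IsUnit W.det) (hb : ∀ i, 0 ≤ b i) {η ρ ε c K : ℝ}
    (hη1 : η ≤ 1) (hρ : 0 < ρ) (hρη : 10 ^ 7 * ρ = η) (hε : 0 < ε) (hε1 : ε ≤ 1 / 2)
    (hηε : condNumber (W * Wᵀ) * d * (25 * η) ≤ ε / 3) {n B T₀ : ℕ} (hB : 0 < B) (hT₀ : 0 < T₀)
    (hn : 3 * (T₀ * B) ≤ n) {ω : (Fin n → Fin d → ℝ) × (Fin d × ℕ × ℕ × ℕ → ℝ)}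
    (hω : ω ∉ badRun W b η ρ c K n B) :
    let run := learnReLU 400 (stepConst 400) B ω.1 (fun i j s a => ω.2 (i, j, s, a))
    run.val.1.PosSemidef ∧
      tvDistance (reluDist (matrixSqrt run.val.1) run.val.2) (reluDist W b) ≤ ε := by
  intro run
  simp only [badRun, Set.mem_union, Set.mem_iUnion, Set.mem_preimage, not_or, not_exists] at hω
  obtain ⟨⟨hs, hp⟩, -⟩ := hω
  have hn0 : 0 < n := lt_of_lt_of_le (by positivity) hn
  have hη0 : 0 ≤ η := by rw [← hρη]; positivity
  set w : Fin d → ℕ → ℕ → ℕ → ℝ := fun i j s a => ω.2 (i, j, s, a) with hw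
  set v := varOut 400 (stepConst 400) B ω.1 w with hv
  set β := biasOut 400 (stepConst 400) B ω.1 w with hβ
  have hpos := rowSd_pos hW
  have hclose : ∀ i, |β i - b i| ≤ η * rowSd W i ∧
      |v i - rowSd W i ^ 2| ≤ η * rowSd W i ^ 2 := fun i => by
    have h := coordEst_close (div_nonneg (hb i) (hpos i).le) (hpos i) hρ hB hT₀ hn (hs i)
    rwa [div_mul_cancel₀ _ (hpos i).ne', hρη] at h
  have hβ0 : ∀ i, 0 ≤ β i := fun i => by
    rw [hβ, biasOut, coordEst]; exact le_max_left _ _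
  have hcov : ∀ i j, |covEst ω.1 v β i j - (W * Wᵀ) i j| ≤ 25 * η * (rowSd W i * rowSd W j) :=
    fun i j => covEst_close hW hη1 hn0 (hp (i, j)) hβ0 (fun i => (hclose i).1)
      fun i => (hclose i).2
  have hsymm : ∀ i j, (W * Wᵀ) i j = (W * Wᵀ) j i := fun i j => by
    rw [Matrix.mul_apply, Matrix.mul_apply]
    exact Finset.sum_congr rfl fun k _ => mul_comm _ _
  have hfst : ∀ i j, run.val.1 i j = if i = j then v i else if i < j then covEst ω.1 v β i j
      else covEst ω.1 v β j i := learnReLU_fst _ _ _ _ _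
  have hsnd : run.val.2 = β := learnReLU_snd _ _ _ _ _
  rw [hsnd]
  refine posSemidef_and_tvDistance_le hd hW (η := 25 * η) (by positivity) hε hε1 hηε ?_ ?_ ?_
  · ext i j
    rw [Matrix.transpose_apply, hfst, hfst]
    rcases lt_trichotomy i j with h | rfl | h
    · rw [if_neg h.ne', if_neg h.not_gt, if_neg h.ne, if_pos h]
    · rfl
    · rw [if_neg h.ne, if_pos h, if_neg h.ne', if_neg h.not_gt]
  · intro i j
    rw [hfst]
    change _ ≤ 25 * η * (rowSd W i * rowSd W j)
    split_ifs with h1 h2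
    · subst h1
      have e : (W * Wᵀ) i i = rowSd W i ^ 2 := by rw [rowSd, Real.sq_sqrt (rowSq_nonneg W i)]
      rw [e]
      refine (hclose i).2.trans ?_
      have := hpos i
      nlinarith [mul_nonneg hη0 (mul_pos this this).le]
    · exact hcov i j
    · rw [hsymm, mul_comm (rowSd W i)]; exact hcov j i
  · intro i
    change _ ≤ 25 * η * rowSd W i
    refine (hclose i).1.trans ?_
    have := hpos i
    nlinarith [mul_nonneg hη0 this.le]

theorem learnReLU_time_le {r lam c K : ℝ} (hr : 1 ≤ r)
    (hc : ∀ v ∈ paramBox r, ∀ g, c < g → 0 < v.2 / v.1 + √(1 / v.1) * g) {η ρ : ℝ} {n B : ℕ}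
    {ω : (Fin n → Fin d → ℝ) × (Fin d × ℕ × ℕ × ℕ → ℝ)} (hω : ω ∉ badRun W b η ρ c K n B) :
    ∃ t : ℕ, (learnReLU r lam B ω.1 (fun i j s a => ω.2 (i, j, s, a))).time = t ∧
      (t : ℝ) ≤ d * (16 * n + 8 * B ^ 2 + 6 * B + 25) + d * d * (7 * n + 13) +
        24 * (d * n) + 5 * (K * (d * n)) := by
  simp only [badRun, Set.mem_union, Set.mem_preimage, not_or, Set.mem_ofPred_eq, not_not,
    not_le] at hω
  obtain ⟨-, htr, hhalt⟩ := hω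
  have h := learnReLU_time lam B ω.1 (fun i j s a => ω.2 (i, j, s, a)) hr c hc hhalt
  obtain ⟨t, ht, hle⟩ := ENat.le_natCast_iff.1 h
  refine ⟨t, ht, ?_⟩
  have hle' : (t : ℝ) ≤ ((d * (16 * n + 8 * B ^ 2 + 6 * B + 25) + d * d * (7 * n + 13) +
        ∑ i : Fin d, ∑ j ∈ Finset.range B, ∑ t ∈ Finset.range (n / B),
          (24 + 5 * trials c (fun a => ω.2 (i, j, t, a))) : ℕ) : ℝ) := by exact_mod_cast hle
  refine hle'.trans ?_
  have hsum : (∑ i : Fin d, ∑ j ∈ Finset.range B, ∑ t ∈ Finset.range (n / B),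
      (24 + 5 * (trials c (fun a => ω.2 (i, j, t, a)) : ℝ))) =
      24 * (((Finset.univ : Finset (Fin d)) ×ˢ Finset.range B ×ˢ
        Finset.range (n / B)).card : ℝ) + 5 * totalTrials c n B ω.2 := by
    rw [totalTrials, Finset.mul_sum, ← nsmul_eq_mul', ← Finset.sum_const, ← Finset.sum_add_distrib,
      Finset.sum_product]
    refine Finset.sum_congr rfl fun i _ => ?_
    rw [Finset.sum_product]
  have hcard := card_iterations_le (d := d) n B
  push_cast
  rw [hsum]
  linarith

end Run

/-! ## The choice of the constants -/

/-- Take `T = ⌈s² x² (1 + log x)⌉`. Then `1 + log T ≤ 5 s (1 + log x)`, so `(1 + log T) / T ≤ 5 / (s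
x²)`: of the two factors `s`, one pays for the logarithm of `T` and the other absorbs the constant
`80 R / ρ²`. -/
theorem exists_batch_length {R ρ x s : ℝ} (hρ : 0 < ρ) (hx : 2 ≤ x) (hs : 1 ≤ s)
    (hRs : 80 * R ≤ ρ ^ 2 * s) (hR : 0 < R) :
    ∃ T : ℕ, 0 < T ∧ (T : ℝ) ≤ (s ^ 2 + 1) * (x ^ 2 * (1 + Real.log x)) ∧
      16 * (R * ((1 + Real.log T) / T)) ≤ (ρ / x) ^ 2 := by
  have hlog : 0 ≤ Real.log x := Real.log_nonneg (by linarith)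
  set L := 1 + Real.log x with hL
  have hL1 : 1 ≤ L := by linarith
  have hxL : 1 ≤ x ^ 2 * L := one_le_mul_of_one_le_of_one_le (by nlinarith) hL1
  set t := s ^ 2 * (x ^ 2 * L) with ht
  have hs2 : (1 : ℝ) ≤ s ^ 2 := one_le_pow₀ hs
  have ht1 : 1 ≤ t := one_le_mul_of_one_le_of_one_le hs2 hxL
  have hT1 : t ≤ ⌈t⌉₊ := Nat.le_ceil t
  have hT2 : (⌈t⌉₊ : ℝ) < t + 1 := Nat.ceil_lt_add_one (by linarith)
  have hT0 : (0 : ℝ) < ⌈t⌉₊ := by linarith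
  refine ⟨⌈t⌉₊, by exact_mod_cast hT0, by linarith, ?_⟩
  have hl1 : Real.log ⌈t⌉₊ ≤ Real.log 2 + Real.log t := by
    rw [← Real.log_mul (by norm_num) (by linarith)]
    exact Real.log_le_log hT0 (by linarith)
  have hl2 : Real.log t = 2 * Real.log s + (2 * Real.log x + Real.log L) := by
    rw [ht, Real.log_mul (by positivity) (by positivity), Real.log_mul (by positivity)
      (by positivity), Real.log_pow, Real.log_pow]
    push_cast; ring
  have hl3 := Real.log_le_sub_one_of_pos (show 0 < s by linarith)
  have hl4 := Real.log_le_sub_one_of_pos (show 0 < L by linarith)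
  have hl5 := Real.log_le_sub_one_of_pos (show (0 : ℝ) < 2 by norm_num)
  have hnum : 1 + Real.log ⌈t⌉₊ ≤ 5 * (s * L) := by nlinarith
  have hfrac : (1 + Real.log ⌈t⌉₊) / ⌈t⌉₊ ≤ 5 / (s * x ^ 2) := by
    rw [div_le_div_iff₀ hT0 (by positivity)]
    calc _ ≤ 5 * (s * L) * (s * x ^ 2) := by gcongr
      _ = 5 * t := by rw [ht]; ring
      _ ≤ _ := by gcongr
  calc _ ≤ 16 * (R * (5 / (s * x ^ 2))) := by gcongr
    _ = 80 * R / (s * x ^ 2) := by ring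
    _ ≤ ρ ^ 2 * s / (s * x ^ 2) := by gcongr
    _ = _ := by field_simp

/-- With `y = δ / (2 d)` every exponential is at most `y ^ 5`. The total `10 d² y⁵ = 10 (d y)² y³`
leaves room for the pairs of coordinates and the numerical factors. -/
theorem failure_le {d : ℕ} (hd : 0 < d) {δ : ℝ} (hδ : 0 < δ) (hδ1 : δ < 1) {e₁ e₂ e₃ e₄ e₅ : ℝ}
    (h₁ : e₁ ≤ -(5 * Real.log (2 * d / δ))) (h₂ : e₂ ≤ -(5 * Real.log (2 * d / δ)))
    (h₃ : e₃ ≤ -(5 * Real.log (2 * d / δ))) (h₄ : e₄ ≤ -(5 * Real.log (2 * d / δ)))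
    (h₅ : e₅ ≤ -(5 * Real.log (2 * d / δ))) :
    d * (Real.exp e₁ + 4 * Real.exp e₂ + 2 * Real.exp e₃) + d * d * (2 * Real.exp e₄) +
      Real.exp e₅ ≤ δ := by
  have hd1 : (1 : ℝ) ≤ d := by exact_mod_cast hd
  have hd0 : (0 : ℝ) < d := by linarith
  set y := δ / (2 * d) with hy
  have hy0 : 0 < y := by positivity
  have hexp : Real.exp (-(5 * Real.log (2 * d / δ))) = y ^ 5 := by
    rw [← mul_neg, ← Real.log_inv, inv_div, show (5 : ℝ) = ((5 : ℕ) : ℝ) by norm_num,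
      Real.exp_nat_mul, Real.exp_log hy0]
  have hdy : d * y = δ / 2 := by rw [hy]; field_simp
  have k : ∀ e, e ≤ -(5 * Real.log (2 * d / δ)) → Real.exp e ≤ y ^ 5 := fun e he => by
    rw [← hexp]; exact Real.exp_le_exp.2 he
  have k1 := k _ h₁
  have k2 := k _ h₂
  have k3 := k _ h₃
  have k4 := k _ h₄
  have k5 := k _ h₅
  have hyδ : y ≤ δ / 2 := by nlinarith
  have hy3 : y ^ 3 ≤ δ / 8 := by
    calc y ^ 3 ≤ (δ / 2) ^ 3 := by gcongr
      _ = δ * (δ * δ) / 8 := by ring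
      _ ≤ δ * 1 / 8 := by gcongr; nlinarith
      _ = _ := by ring
  calc _ ≤ d * (y ^ 5 + 4 * y ^ 5 + 2 * y ^ 5) + d * d * (2 * y ^ 5) + y ^ 5 := by gcongr
    _ ≤ 10 * (d * d * y ^ 5) := by
      have h5 : 0 < y ^ 5 := by positivity
      have : (d : ℝ) ≤ d * d := by nlinarith
      nlinarith
    _ = 10 * ((d * y) ^ 2 * y ^ 3) := by ring
    _ ≤ 10 * ((1 / 2) ^ 2 * (δ / 8)) := by
      gcongr
      rw [hdy]; linarith
    _ ≤ δ := by linarith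

theorem time_bound {d n B K C c X ℓ : ℝ} (hd : 1 ≤ d) (hX : 1 ≤ X) (hℓ : 1 / 2 ≤ ℓ) (hn0 : 0 ≤ n)
    (hn : n ≤ (C + 1) * X) (hB0 : 0 ≤ B) (hB : B ≤ (c + 2) * ℓ) (hK : 0 < K) (hc : 0 < c)
    (hC : 0 < C) :
    d * (16 * n + 8 * B ^ 2 + 6 * B + 25) + d * d * (7 * n + 13) + 24 * (d * n) +
      5 * (K * (d * n)) ≤
    ((47 + 5 * K) * (C + 1) + 38 + 20 * (c + 2) ^ 2) * (d ^ 2 * X + d * ℓ ^ 2) := by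
  have hd0 : 0 < d := by linarith
  have hdd : d ≤ d ^ 2 := by nlinarith
  have h1 : d * n ≤ d ^ 2 * ((C + 1) * X) := by gcongr
  have h2 : d ^ 2 * n ≤ d ^ 2 * ((C + 1) * X) := by gcongr
  have h3 : d * B ^ 2 ≤ d * ((c + 2) * ℓ) ^ 2 := by gcongr
  have h4 : d * B ≤ d * ((c + 2) * ℓ) := by gcongr
  have h5 : d * ((c + 2) * ℓ) ≤ d * ((c + 2) * ℓ) ^ 2 := by
    have : 1 ≤ (c + 2) * ℓ := by nlinarith
    gcongr
    nlinarith
  have h6 : d ≤ d ^ 2 * X := by nlinarith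
  have h7 : d ^ 2 ≤ d ^ 2 * X := by nlinarith [sq_nonneg d]
  have h8 : K * (d * n) ≤ K * (d ^ 2 * ((C + 1) * X)) := by gcongr
  have h9 : 0 ≤ ((47 + 5 * K) * (C + 1) + 38) * (d * ℓ ^ 2) := by positivity
  have h10 : 0 ≤ (c + 2) ^ 2 * (d ^ 2 * X) := by positivity
  have h11 : 0 ≤ d * ((c + 2) * ℓ) ^ 2 := by positivity
  calc _ = 40 * (d * n) + 8 * (d * B ^ 2) + 6 * (d * B) + 25 * d + 7 * (d ^ 2 * n) + 13 * d ^ 2 +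
        5 * (K * (d * n)) := by ring
    _ ≤ 40 * (d ^ 2 * ((C + 1) * X)) + 14 * (d * ((c + 2) * ℓ) ^ 2) + 38 * (d ^ 2 * X) +
        7 * (d ^ 2 * ((C + 1) * X)) + 5 * (K * (d ^ 2 * ((C + 1) * X))) := by linarith
    _ ≤ _ := by linarith

theorem space_bound {d n B C c X ℓ : ℝ} (hd : 1 ≤ d) (hX : d ≤ X) (hℓX : ℓ ≤ X)
    (hn : n ≤ (C + 1) * X) (hB : B ≤ (c + 2) * ℓ) (hc : 0 < c) (hC : 0 < C) :
    n * d + 2 * (d * d) + 2 * d + 2 * n + 5 * B + 112 ≤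
      (3 * (C + 1) + 116 + 5 * (c + 2)) * (d * X) := by
  have h1 : n * d ≤ (C + 1) * X * d := by gcongr
  have hX0 : 0 < X := by linarith
  have h2 : X ≤ d * X := by nlinarith
  have h3 : d * d ≤ d * X := by gcongr
  have h4 : (1 : ℝ) ≤ d * X := by nlinarith
  have h5 : (C + 1) * X ≤ (C + 1) * (d * X) := by gcongr
  have h6 : (c + 2) * ℓ ≤ (c + 2) * (d * X) := by gcongr; linarith
  have h7 : d ≤ d * X := by nlinarith
  linarith

theorem isUnit_det_of_rank_eq {d : ℕ} {W : Matrix (Fin d) (Fin d) ℝ} (h : W.rank = d) :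
    IsUnit W.det := by
  rw [← Matrix.isUnit_iff_isUnit_det, ← Matrix.linearIndependent_rows_iff_isUnit,
    linearIndependent_iff_card_eq_finrank_span, Fintype.card_fin]
  exact h.symm.trans W.rank_eq_finrank_span_row

theorem learnReLU_good {d : ℕ} {W : Matrix (Fin d) (Fin d) ℝ} {b : Fin d → ℝ} (hd : 0 < d)
    (hW : IsUnit W.det) (hb : ∀ i, 0 ≤ b i) {η ρ ε c K : ℝ} (hη1 : η ≤ 1) (hρ : 0 < ρ)
    (hρη : 10 ^ 7 * ρ = η) (hε : 0 < ε) (hε1 : ε ≤ 1 / 2)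
    (hηε : condNumber (W * Wᵀ) * d * (25 * η) ≤ ε / 3) {n B T₀ : ℕ} (hB : 0 < B) (hT₀ : 0 < T₀)
    (hn : 3 * (T₀ * B) ≤ n)
    (hc : ∀ v ∈ paramBox 400, ∀ g, c < g → 0 < v.2 / v.1 + √(1 / v.1) * g) {tb sb : ℝ}
    (htb : d * (16 * n + 8 * B ^ 2 + 6 * B + 25) + d * d * (7 * n + 13) + 24 * (d * n) +
      5 * (K * (d * n)) ≤ tb)
    (hsb : (n : ℝ) * d + 2 * (d * d) + 2 * d + 2 * n + 5 * B + 112 ≤ sb)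
    {ω : (Fin n → Fin d → ℝ) × (Fin d × ℕ × ℕ × ℕ → ℝ)} (hω : ω ∉ badRun W b η ρ c K n B) :
    ∃ t : ℕ,
      let run := learnReLU 400 (stepConst 400) B ω.1 (fun i j s a => ω.2 (i, j, s, a))
      run.val.1.PosSemidef ∧
      tvDistance (reluDist (matrixSqrt run.val.1) run.val.2) (reluDist W b) ≤ ε ∧
      run.time = t ∧ (t : ℝ) ≤ tb ∧ (run.space : ℝ) ≤ sb := by
  obtain ⟨t, ht, htle⟩ := learnReLU_time_le (lam := stepConst 400)
    (show (1 : ℝ) ≤ 400 by norm_num) hc hω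
  obtain ⟨hpsd, htv⟩ := learnReLU_accurate hd hW hb hη1 hρ hρη hε hε1 hηε hB hT₀ hn hω
  have h := learnReLU_space 400 (stepConst 400) B ω.1 fun i j s a => ω.2 (i, j, s, a)
  exact ⟨t, hpsd, htv, ht, htle.trans htb, le_trans (by exact_mod_cast h) hsb⟩

theorem corollary1 :
    ∃ (r lam cB C C' : ℝ) (k : ℕ), 0 < r ∧ 0 < lam ∧ 0 < cB ∧ 0 < C ∧ 0 < C' ∧
      ∀ (d : ℕ) (W : Matrix (Fin d) (Fin d) ℝ) (b : Fin d → ℝ) (ε δ κ L : ℝ) (B n : ℕ),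
        0 < d → W.rank = d → (∀ i, 0 ≤ b i) → 0 < ε → ε ≤ 1 / 2 → 0 < δ → δ < 1 →
        κ = condNumber (W * Wᵀ) →
        L = 1 + Real.log (κ * d / ε) →
        B = ⌈cB * Real.log (2 * d / δ)⌉₊ →
        n = ⌈C * (κ ^ 2 * d ^ 2 / ε ^ 2 * Real.log (2 * d / δ) * L ^ k)⌉₊ →
        samplesAndTape n W b
            {ω | ¬ ∃ t : ℕ,
              let run := learnReLU r lam B ω.1 (fun i j s a => ω.2 (i, j, s, a))
              run.val.1.PosSemidef ∧
              tvDistance (reluDist (matrixSqrt run.val.1) run.val.2) (reluDist W b) ≤ ε ∧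
              run.time = t ∧
              (t : ℝ) ≤ C' * (κ ^ 2 * d ^ 4 / ε ^ 2 * Real.log (2 * d / δ) * L ^ k
                + d * Real.log (2 * d / δ) ^ 2) ∧
              (run.space : ℝ) ≤ C' * (κ ^ 2 * d ^ 3 / ε ^ 2 * Real.log (2 * d / δ) * L ^ k)}
          ≤ ENNReal.ofReal δ := by
  obtain ⟨c, hc⟩ : ∃ c : ℝ, ∀ v ∈ paramBox 400, ∀ g, c < g → 0 < v.2 / v.1 + √(1 / v.1) * g :=
    ⟨400 ^ 3, fun v hv g hg => paramBox_pos_of_lt (by norm_num) hv hg⟩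
  obtain ⟨K, hK0, hK⟩ := exists_measure_trials_le c
  have hR := rateConst_pos
  have hM := momentRate_pos
  -- `10 ^ 7` is the loss from selection and denormalization; `75 = 25 · 3` combines the loss of the
  -- covariance estimate with the bound `ε / 3` required for the total variation distance.
  set ρ₀ : ℝ := 1 / (75 * 10 ^ 7) with hρ₀
  have hρ₀pos : 0 < ρ₀ := by positivity
  set s : ℝ := 1 + 80 * rateConst / ρ₀ ^ 2 with hs
  have hs1 : 1 ≤ s := by rw [hs]; linarith [show 0 ≤ 80 * rateConst / ρ₀ ^ 2 by positivity]
  have hRs : 80 * rateConst ≤ ρ₀ ^ 2 * s := by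
    have : ρ₀ ^ 2 * s = ρ₀ ^ 2 + 80 * rateConst := by rw [hs]; field_simp
    rw [this]; linarith [sq_nonneg ρ₀]
  -- The first term serves the exponents `n / 18` and `2 n η²` (which needs `5 · 5625 / 2`), the
  -- second the rate `momentRate / 3`, each to reach `5 ℓ`. The third ensures `3 T B ≤ n`.
  set C : ℝ := 15000 + 15 / momentRate + 3 * (s ^ 2 + 1) * (2560 + 2) with hC
  have hC0 : 0 < C := by positivity
  have hC1 : 15000 ≤ C := by
    rw [hC]; linarith [show 0 ≤ 15 / momentRate + 3 * (s ^ 2 + 1) * (2560 + 2) by positivity]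
  have hC2 : 15 / momentRate ≤ C := by
    rw [hC]; linarith [show 0 ≤ 3 * (s ^ 2 + 1) * (2560 + 2) by positivity]
  have hC3 : 3 * (s ^ 2 + 1) * (2560 + 2) ≤ C := by
    rw [hC]; linarith [show 0 ≤ 15 / momentRate by positivity]
  set Ct : ℝ := (47 + 5 * K) * (C + 1) + 38 + 20 * (2560 + 2) ^ 2 with hCt
  set Cs : ℝ := 3 * (C + 1) + 116 + 5 * (2560 + 2) with hCs
  -- `2560 = 5 · 512`, so that `exp (-B / 512)` is at most the fifth power of `δ / (2 d)`. A single
  -- logarithmic factor, `k = 1`, suffices: it comes from the batch length.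
  refine ⟨400, stepConst 400, 2560, C, Ct + Cs, 1, by norm_num, stepConst_pos (by norm_num),
    by norm_num, hC0, by positivity, ?_⟩
  intro d W b ε δ κ L B n hd hrank hb hε hε1 hδ hδ1 hκ hL hB hn
  have hW := isUnit_det_of_rank_eq hrank
  have hκ1 : 1 ≤ κ := hκ ▸ one_le_condNumber hd hW
  have hd1 : (1 : ℝ) ≤ d := by exact_mod_cast hd
  set ℓ := Real.log (2 * d / δ) with hℓ
  set x := κ * d / ε with hx
  have hxd : 2 * (d : ℝ) ≤ x := by
    rw [hx, le_div_iff₀ hε]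
    nlinarith
  have hx2 : 2 ≤ x := by linarith
  have hL1 : 1 ≤ L := by rw [hL]; linarith [Real.log_nonneg (show 1 ≤ x by linarith)]
  have hℓ1 : 1 / 2 ≤ ℓ := by
    have h1 : Real.log 2 ≤ ℓ := Real.log_le_log (by norm_num) (by
      rw [le_div_iff₀ hδ]; nlinarith)
    linarith [Real.log_two_gt_d9]
  set X := x ^ 2 * ℓ * L with hX
  have eX : κ ^ 2 * d ^ 2 / ε ^ 2 * ℓ * L ^ 1 = X := by rw [hX, hx]; ring
  have eXt : κ ^ 2 * d ^ 4 / ε ^ 2 * ℓ * L ^ 1 = d ^ 2 * X := by rw [hX, hx]; ring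
  have eXs : κ ^ 2 * d ^ 3 / ε ^ 2 * ℓ * L ^ 1 = d * X := by rw [hX, hx]; ring
  rw [eX] at hn
  rw [eXt, eXs]
  have hx4 : 4 * (d : ℝ) ≤ x ^ 2 := by
    calc 4 * (d : ℝ) ≤ 2 * (2 * d) := by linarith
      _ ≤ x * x := by gcongr
      _ = x ^ 2 := by ring
  have hxℓX : x ^ 2 * ℓ ≤ X := le_mul_of_one_le_right (by positivity) hL1
  have hdX : (d : ℝ) ≤ X := by
    refine le_trans ?_ hxℓX
    calc (d : ℝ) ≤ 4 * d * (1 / 2) := by linarith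
      _ ≤ x ^ 2 * ℓ := by gcongr
  have hℓX : ℓ ≤ X := (le_mul_of_one_le_left (by linarith) (by linarith)).trans hxℓX
  have hX1 : 1 ≤ X := by linarith
  have hnX : C * X ≤ n := hn ▸ Nat.le_ceil _
  have hnX' : n ≤ (C + 1) * X := by
    have := Nat.ceil_lt_add_one (show 0 ≤ C * X by positivity)
    rw [← hn] at this
    linarith
  have hBℓ : 2560 * ℓ ≤ B := hB ▸ Nat.le_ceil _
  have hBℓ' : B ≤ (2560 + 2) * ℓ := by
    have := Nat.ceil_lt_add_one (show 0 ≤ 2560 * ℓ by positivity)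
    rw [← hB] at this
    linarith
  have hB0 : 0 < B := by
    have : (0 : ℝ) < B := by linarith
    exact_mod_cast this
  obtain ⟨T, hT0, hTle, hTρ⟩ := exists_batch_length hρ₀pos hx2 hs1 hRs hR
  rw [← hL] at hTle
  have hTn : 3 * (T * B) ≤ n := by
    have : (3 : ℝ) * (T * B) ≤ n := by
      calc (3 : ℝ) * (T * B) ≤ 3 * ((s ^ 2 + 1) * (x ^ 2 * L) * ((2560 + 2) * ℓ)) := by gcongr
        _ = 3 * (s ^ 2 + 1) * (2560 + 2) * X := by rw [hX]; ring
        _ ≤ C * X := by gcongr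
        _ ≤ n := hnX
    exact_mod_cast this
  -- Since `x = κ d / ε`, this makes `κ d · 25 η` equal to `ε / 3`.
  set η := 1 / (75 * x) with hη
  have hη0 : 0 < η := by positivity
  have hη1 : η ≤ 1 := by
    rw [hη, div_le_one (by positivity)]; linarith
  have hρη : 10 ^ 7 * (ρ₀ / x) = η := by rw [hρ₀, hη]; field_simp
  have hηε : condNumber (W * Wᵀ) * d * (25 * η) ≤ ε / 3 := by
    rw [← hκ, hη, hx]
    refine le_of_eq ?_
    have : κ ≠ 0 := by positivity
    field_simp
    norm_num
  have hρ : 0 < ρ₀ / x := by positivity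
  have htb := (time_bound hd1 hX1 hℓ1 (Nat.cast_nonneg n) hnX' (Nat.cast_nonneg B)
    hBℓ' hK0 (by norm_num) hC0).trans (show _ ≤ (Ct + Cs) * (d ^ 2 * X + d * ℓ ^ 2) by
      rw [← hCt]
      exact mul_le_mul_of_nonneg_right (le_add_of_nonneg_right (by positivity)) (by positivity))
  have hsb := (space_bound hd1 hdX hℓX hnX' hBℓ' (by norm_num) hC0).trans
    (show _ ≤ (Ct + Cs) * (d * X) by
      rw [← hCs]
      exact mul_le_mul_of_nonneg_right (le_add_of_nonneg_left (by positivity)) (by positivity))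
  refine (measure_mono (t := badRun W b η (ρ₀ / x) c K n B) fun ω hω => ?_).trans
    ((measure_badRun_le hW hb hη0.le hρ hB0 hT0 hTn hTρ hK).trans
      (ENNReal.ofReal_le_ofReal (failure_le hd hδ hδ1 ?_ ?_ ?_ ?_ ?_)))
  · by_contra hgood
    exact hω (learnReLU_good hd hW hb hη1 hρ hρη hε hε1 hηε hB0 hT0 hTn hc htb hsb hgood)
  · have : 15000 * ℓ ≤ C * X := by gcongr
    linarith
  · have h1 : 15 / momentRate * ℓ ≤ C * X := by gcongr
    have h2 : momentRate * (15 / momentRate * ℓ) ≤ momentRate * n := by gcongr; linarith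
    have h3 : momentRate * (15 / momentRate * ℓ) = 15 * ℓ := by field_simp
    linarith
  · linarith
  · have h1 : C * (x ^ 2 * ℓ) ≤ n := le_trans (by gcongr) hnX
    have h2 : C * (x ^ 2 * ℓ) * η ^ 2 ≤ n * η ^ 2 := by gcongr
    have h3 : C * (x ^ 2 * ℓ) * η ^ 2 = C * ℓ / 5625 := by rw [hη]; field_simp; norm_num
    have h4 : 15000 * ℓ ≤ C * ℓ := by gcongr
    linarith
  · have : 15000 * ℓ ≤ C * X := by gcongr
    have h2 : (n : ℝ) ≤ d * n := le_mul_of_one_le_left (Nat.cast_nonneg n) hd1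
    linarith
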